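/- Let $k$ be a field and let $(H,\Delta,\varepsilon,\Phi,S,\alpha,\beta,R)$ be a finite-dimensional quasi-triangular (QT) quasi-Hopf algebra over $k$. Thus $\Delta:H\to H\otimes H$ and $\varepsilon:H\to k$ are algebra maps with $(\mathrm{id}\otimes\varepsilon)\Delta(h)=h\otimes 1$ and $(\varepsilon\otimes\mathrm{id})\Delta(h)=1\otimes h$; $\Phi=X^1\otimes X^2\otimes X^3$ (with inverse $x^1\otimes x^2\otimes x^3$; other letters $Y^i$, $y^i$ denote further copies) is invertible in $H^{\otimes 3}$ with $(\mathrm{id}\otimes\Delta)\Delta(h)=\Phi\,(\Delta\otimes\mathrm{id})\Delta(h)\,\Phi^{-1}$, $(1\otimes\Phi)(\mathrm{id}\otimes\Delta\otimes\mathrm{id})(\Phi)(\Phi\otimes1)=(\mathrm{id}\otimes\mathrm{id}\otimes\Delta)(\Phi)(\Delta\otimes\mathrm{id}\otimes\mathrm{id})(\Phi)$ and $(\mathrm{id}\otimes\varepsilon\otimes\mathrm{id})(\Phi)=1$; $S$ is an anti-endomorphism of the algebra $H$ with $S(h_1)\alpha h_2=\varepsilon(h)\alpha$, $h_1\beta S(h_2)=\varepsilon(h)\beta$,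 $X^1\beta S(X^2)\alpha X^3=1$, $S(x^1)\alpha x^2\beta S(x^3)=1$, normalised by $\varepsilon(\alpha)=\varepsilon(\beta)=1$; and $R=R^1\otimes R^2\in H\otimes H$ ($r$ denotes a second copy) satisfies $(\Delta\otimes\mathrm{id})(R)=\Phi_{312}R_{13}\Phi^{-1}_{132}R_{23}\Phi$, $(\mathrm{id}\otimes\Delta)(R)=\Phi^{-1}_{231}R_{13}\Phi_{213}R_{12}\Phi^{-1}$, $\Delta^{\rm op}(h)R=R\Delta(h)$, $(\varepsilon\otimes\mathrm{id})(R)=(\mathrm{id}\otimes\varepsilon)(R)=1$; here $\Phi_{\sigma(1)\sigma(2)\sigma(3)}$ has the $i$-th component of $\Phi$ in the $\sigma(i)$-th slot. Put $\gamma=S(A^2)\alpha A^3\otimes S(A^1)\alpha A^4$ with $A^1\otimes\cdots\otimes A^4=(\Phi\otimes1)(\Delta\otimes\mathrm{id}\otimes\mathrm{id})(\Phi^{-1})$, and $\delta=B^1\beta S(B^4)\otimes B^2\beta S(B^3)$ with $B^1\otimes\cdots\otimes B^4=(\Delta\otimes\mathrm{id}\otimes\mathrm{id})(\Phi)(\Phi^{-1}\otimes1)$.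 Drinfeld's twist and its inverse are $$f=f^1\otimes f^2=(S\otimes S)(\Delta^{\rm op}(x^1))\,\gamma\,\Delta(x^2\beta S(x^3)),\qquad f^{-1}=g^1\otimes g^2=\Delta(S(x^1)\alpha x^2)\,\delta\,(S\otimes S)(\Delta^{\rm op}(x^3)).$$ Put $p^1\otimes p^2=x^1\otimes x^2\beta S(x^3)$, $q^1\otimes q^2=X^1\otimes S^{-1}(\alpha X^3)X^2$, $\tilde p^1\otimes\tilde p^2=X^2S^{-1}(X^1\beta)\otimes X^3$ and $R^{-1}=\overline R^1\otimes\overline R^2$. On $H^*$ write $(h\rightharpoonup\chi)(h')=\chi(h'h)$ and $(\chi\leftharpoonup h)(h')=\chi(hh')$; products and coproducts $\chi\psi$, $\chi_1\otimes\chi_2$ are dual to $\Delta$ and to the multiplication of $H$. The category ${}_H\mathcal M$ of left $H$-modules is braided: $H$ acts on tensor products through $\Delta$ and on $k$ through $\varepsilon$, the associativity constraint is the action of $\Phi$, and $c(u\otimes v)=R^2\cdot v\otimes R^1\cdot u$. A finite-dimensional module $V$ has the left dual $V^*$ with $(h\cdot v^*)(v)=v^*(S(h)\cdot v)$, $\mathrm{ev}(v^*\otimes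 v)=v^*(\alpha\cdot v)$, $\mathrm{coev}(1)=\sum_i\beta\cdot v_i\otimes v^i$. (a) The enveloping algebra braided group $\underline H$ is the space $H$ with the action $h\triangleright h'=h_1h'S(h_2)$, the multiplication $h\bullet h'=X^1hS(x^1X^2)\alpha x^2X^3_1h'S(x^3X^3_2)$, the unit $\beta$, the counit $\varepsilon$, $$\underline\Delta(h)=x^1X^1h_1g^1S(x^2R^2y^3X^3_2)\otimes x^3R^1\triangleright\bigl(y^1X^2h_2g^2S(y^2X^3_1)\bigr),\qquad \underline S(h)=X^1R^2p^2S\bigl(q^1(X^2R^1p^1\triangleright h)S(q^2)X^3\bigr).$$ (b) $(\underline H)^*$ is its categorical left dual: the module $\underline H^*$ with multiplication $\underline\Delta^*\circ\phi^*$, comultiplication $(\phi^*)^{-1}\circ\bullet^*$, unit $\varepsilon^*$, counit $\beta^*$ and antipode $\underline S^*$. Here ${}^*$ on morphisms is the categorical transpose, and $\phi^*:\underline H^*\otimes\underline H^*\to(\underline H\otimes\underline H)^*$ is the canonical isomorphism $N^*\otimes M^*\to(M\otimes N)^*$ built from $\mathrm{coev}_{M\otimes N}$, the associativity constraints, $\mathrm{ev}_M$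 and $\mathrm{ev}_N$, for $M=N=\underline H$. (c) The function algebra braided group $\underline{H^*}$ is the space $H^*$ with the action $h\blacktriangleright\chi=h_2\rightharpoonup\chi\leftharpoonup S(h_1)$, the unit $\varepsilon$, the counit $\chi\mapsto\chi(\alpha)$ and $$\chi\,\underline\cdot\,\psi=[x^3_1Y^2r^1y^1X^2\rightharpoonup\chi\leftharpoonup S(x^1X^1)f^2R^1]\,[x^3_2Y^3y^3X^3_2\rightharpoonup\psi\leftharpoonup S(x^2Y^1r^2y^2X^3_1)f^1R^2],$$ $$\underline\Delta(\chi)=\chi_1\leftharpoonup S(x^1)\otimes x^3_2X^3\rightharpoonup\chi_2\leftharpoonup x^2X^1\beta S(x^3_1X^2),\qquad \underline S(\chi)=q^1_2\overline R^1_2\tilde p^2\rightharpoonup\chi\circ S\leftharpoonup q^2\overline R^2S(q^1_1\overline R^1_1\tilde p^1).$$ Then the inverses used above exist ($S$ and $\phi^*$ are bijective, $R$ is invertible, and the two displayed elements $f$ and $g^1\otimes g^2$ are inverse to each other), $(\underline H)^*$ and $\underline{H^*}$ are Hopf algebras in the braided category ${}_H\mathcal M$, and the map $$\lambda:(\underline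 H)^*\to\underline{H^*},\qquad \lambda(\chi)=S^{-1}(g^1)\rightharpoonup\chi\circ S\leftharpoonup g^2,$$ is an isomorphism of braided Hopf algebras: it is bijective, $H$-linear, and compatible with the multiplications, units, comultiplications, counits and antipodes. -/

import Mathlib

open scoped TensorProduct

namespace QuasiHopf

noncomputable section

/-! ### Multilinear bookkeeping

Elements such as `Φ = X¹ ⊗ X² ⊗ X³` are fed into multilinear expressions through the linear maps
`mulMap` and `mulMap₃`; `Sweedler` legs are put into chosen slots of a tensor power and multiplied
there componentwise. -/

section Tensor

variable {k : Type*} [Field k]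

/-- `a ⊗ b ↦ f a * g b`. -/
def mulMap {M N A : Type*} [AddCommGroup M] [Module k M] [AddCommGroup N] [Module k N]
    [Ring A] [Algebra k A] (f : M →ₗ[k] A) (g : N →ₗ[k] A) : M ⊗[k] N →ₗ[k] A :=
  LinearMap.mul' k A ∘ₗ TensorProduct.map f g

/-- `a ⊗ (b ⊗ c) ↦ f a * (g b * h c)`. -/
def mulMap₃ {M N P A : Type*} [AddCommGroup M] [Module k M] [AddCommGroup N] [Module k N]
    [AddCommGroup P] [Module k P] [Ring A] [Algebra k A]
    (f : M →ₗ[k] A) (g : N →ₗ[k] A) (h : P →ₗ[k] A) : M ⊗[k] (N ⊗[k] P) →ₗ[k] A :=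
  mulMap f (mulMap g h)

@[simp]
theorem mulMap_tmul {M N A : Type*} [AddCommGroup M] [Module k M] [AddCommGroup N] [Module k N]
    [Ring A] [Algebra k A] (f : M →ₗ[k] A) (g : N →ₗ[k] A) (a : M) (b : N) :
    mulMap f g (a ⊗ₜ[k] b) = f a * g b := by
  simp [mulMap]

@[simp]
theorem mulMap₃_tmul {M N P A : Type*} [AddCommGroup M] [Module k M] [AddCommGroup N] [Module k N]
    [AddCommGroup P] [Module k P] [Ring A] [Algebra k A]
    (f : M →ₗ[k] A) (g : N →ₗ[k] A) (h : P →ₗ[k] A) (a : M) (b : N) (c : P) :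
    mulMap₃ f g h (a ⊗ₜ[k] (b ⊗ₜ[k] c)) = f a * (g b * h c) := by
  simp [mulMap₃]

variable (k) (H : Type*) [Ring H] [Algebra k H]

/-- `a ↦ a ⊗ 1 ⊗ 1`. -/
def leg₁ : H →ₗ[k] H ⊗[k] (H ⊗[k] H) := (TensorProduct.mk k H (H ⊗[k] H)).flip (1 ⊗ₜ 1)

/-- `a ↦ 1 ⊗ a ⊗ 1`. -/
def leg₂ : H →ₗ[k] H ⊗[k] (H ⊗[k] H) :=
  TensorProduct.mk k H (H ⊗[k] H) 1 ∘ₗ (TensorProduct.mk k H H).flip 1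

/-- `a ↦ 1 ⊗ 1 ⊗ a`. -/
def leg₃ : H →ₗ[k] H ⊗[k] (H ⊗[k] H) :=
  TensorProduct.mk k H (H ⊗[k] H) 1 ∘ₗ TensorProduct.mk k H H 1

/-- The fourfold tensor power of `H`, bracketed as `(H ⊗ H) ⊗ (H ⊗ H)`. -/
abbrev H4 : Type _ := (H ⊗[k] H) ⊗[k] (H ⊗[k] H)

/-- `a ↦ (a ⊗ 1) ⊗ (1 ⊗ 1)`. -/
def slot₁ : H →ₗ[k] H4 k H :=
  (TensorProduct.mk k (H ⊗[k] H) (H ⊗[k] H)).flip (1 ⊗ₜ 1) ∘ₗ (TensorProduct.mk k H H).flip 1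

/-- `a ↦ (1 ⊗ a) ⊗ (1 ⊗ 1)`. -/
def slot₂ : H →ₗ[k] H4 k H :=
  (TensorProduct.mk k (H ⊗[k] H) (H ⊗[k] H)).flip (1 ⊗ₜ 1) ∘ₗ TensorProduct.mk k H H 1

/-- `a ↦ (1 ⊗ 1) ⊗ (a ⊗ 1)`. -/
def slot₃ : H →ₗ[k] H4 k H :=
  TensorProduct.mk k (H ⊗[k] H) (H ⊗[k] H) (1 ⊗ₜ 1) ∘ₗ (TensorProduct.mk k H H).flip 1

/-- `a ↦ (1 ⊗ 1) ⊗ (1 ⊗ a)`. -/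
def slot₄ : H →ₗ[k] H4 k H :=
  TensorProduct.mk k (H ⊗[k] H) (H ⊗[k] H) (1 ⊗ₜ 1) ∘ₗ TensorProduct.mk k H H 1

/-- Left multiplications `a ↦ (x ↦ a * x)`. -/
def lm : H →ₗ[k] Module.End k H := LinearMap.mul k H

/-- Right multiplications `a ↦ (x ↦ x * a)`. -/
def rm : H →ₗ[k] Module.End k H := (LinearMap.mul k H).flip

variable {k H}

open Classical in
/-- The inverse of a bijective linear map (and `0` if the map is not bijective). -/
def linInv {M N : Type*} [AddCommMonoid M] [Module k M] [AddCommMonoid N] [Module k N]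
    (f : M →ₗ[k] N) : N →ₗ[k] M :=
  if hf : Function.Bijective f then (LinearEquiv.ofBijective f hf).symm.toLinearMap else 0

end Tensor

end

end QuasiHopf

open QuasiHopf in
/-- A quasi-Hopf algebra `(H, Δ, ε, Φ, S, α, β)` over the field `k`, with `α` and `β` normalised by
`ε(α) = ε(β) = 1`. The reassociator is `Φ = X¹ ⊗ X² ⊗ X³`, its inverse `Φ⁻¹ = x¹ ⊗ x² ⊗ x³`.
The antipode is not required to be bijective. -/
structure QuasiHopfAlgebra (k H : Type*) [Field k] [Ring H] [Algebra k H] where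
  Δ : H →ₐ[k] H ⊗[k] H
  ε : H →ₐ[k] k
  Φ : (H ⊗[k] (H ⊗[k] H))ˣ
  S : H →ₗ[k] H
  α : H
  β : H
  /-- `(id ⊗ Δ)(Δ(h)) = Φ (Δ ⊗ id)(Δ(h)) Φ⁻¹`. -/
  coassoc : ∀ h, Algebra.TensorProduct.map (AlgHom.id k H) Δ (Δ h) =
    ↑Φ * Algebra.TensorProduct.assoc k k k H H H
      (Algebra.TensorProduct.map Δ (AlgHom.id k H) (Δ h)) * ↑Φ⁻¹
  /-- `(id ⊗ ε)(Δ(h)) = h ⊗ 1`. -/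
  counit_right : ∀ h, Algebra.TensorProduct.map (AlgHom.id k H) ε (Δ h) = h ⊗ₜ[k] 1
  /-- `(ε ⊗ id)(Δ(h)) = 1 ⊗ h`. -/
  counit_left : ∀ h, Algebra.TensorProduct.map ε (AlgHom.id k H) (Δ h) = 1 ⊗ₜ[k] h
  /-- `(1 ⊗ Φ)(id ⊗ Δ ⊗ id)(Φ)(Φ ⊗ 1) = (id ⊗ id ⊗ Δ)(Φ)(Δ ⊗ id ⊗ id)(Φ)`. -/
  cocycle :
    mulMap₃ (slot₂ k H) (slot₃ k H) (slot₄ k H) (Φ : H ⊗[k] (H ⊗[k] H)) *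
        mulMap₃ (slot₁ k H) (mulMap (slot₂ k H) (slot₃ k H) ∘ₗ Δ.toLinearMap) (slot₄ k H)
          (Φ : H ⊗[k] (H ⊗[k] H)) *
        mulMap₃ (slot₁ k H) (slot₂ k H) (slot₃ k H) (Φ : H ⊗[k] (H ⊗[k] H)) =
      mulMap₃ (slot₁ k H) (slot₂ k H) (mulMap (slot₃ k H) (slot₄ k H) ∘ₗ Δ.toLinearMap)
          (Φ : H ⊗[k] (H ⊗[k] H)) *
        mulMap₃ (mulMap (slot₁ k H) (slot₂ k H) ∘ₗ Δ.toLinearMap) (slot₃ k H) (slot₄ k H)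
          (Φ : H ⊗[k] (H ⊗[k] H))
  /-- `(id ⊗ ε ⊗ id)(Φ) = 1 ⊗ 1 ⊗ 1`. -/
  cocycle_counit : Algebra.TensorProduct.map (AlgHom.id k H)
    (Algebra.TensorProduct.map ε (AlgHom.id k H)) (Φ : H ⊗[k] (H ⊗[k] H)) = 1
  S_one : S 1 = 1
  S_mul : ∀ a b, S (a * b) = S b * S a
  /-- `S(h₁) α h₂ = ε(h) α`. -/
  antipode_left : ∀ h,
    mulMap (LinearMap.mulRight k α ∘ₗ S) LinearMap.id (Δ h) = ε h • α
  /-- `h₁ β S(h₂) = ε(h) β`. -/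
  antipode_right : ∀ h, mulMap (LinearMap.mulRight k β) S (Δ h) = ε h • β
  /-- `X¹ β S(X²) α X³ = 1`. -/
  zigzag : mulMap₃ (LinearMap.mulRight k β) (LinearMap.mulRight k α ∘ₗ S) LinearMap.id
    (Φ : H ⊗[k] (H ⊗[k] H)) = 1
  /-- `S(x¹) α x² β S(x³) = 1`. -/
  zigzag_inv : mulMap₃ (LinearMap.mulRight k α ∘ₗ S) (LinearMap.mulRight k β) S
    (↑Φ⁻¹ : H ⊗[k] (H ⊗[k] H)) = 1
  counit_α : ε α = 1
  counit_β : ε β = 1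

open QuasiHopf in
/-- A quasi-triangular quasi-Hopf algebra. For a permutation `σ` of `{1, 2, 3}`, `Φ_{σ(1)σ(2)σ(3)}`
is `Φ` with its `i`-th component put into the `σ(i)`-th tensor slot. -/
structure QTQuasiHopfAlgebra (k H : Type*) [Field k] [Ring H] [Algebra k H] extends
    QuasiHopfAlgebra k H where
  R : H ⊗[k] H
  /-- `(Δ ⊗ id)(R) = Φ₃₁₂ R₁₃ Φ⁻¹₁₃₂ R₂₃ Φ`. -/
  hexagon_left : mulMap (mulMap (leg₁ k H) (leg₂ k H) ∘ₗ Δ.toLinearMap) (leg₃ k H) R =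
    mulMap₃ (leg₃ k H) (leg₁ k H) (leg₂ k H) (Φ : H ⊗[k] (H ⊗[k] H)) *
      mulMap (leg₁ k H) (leg₃ k H) R *
      mulMap₃ (leg₁ k H) (leg₃ k H) (leg₂ k H) (↑Φ⁻¹ : H ⊗[k] (H ⊗[k] H)) *
      mulMap (leg₂ k H) (leg₃ k H) R * ↑Φ
  /-- `(id ⊗ Δ)(R) = Φ⁻¹₂₃₁ R₁₃ Φ₂₁₃ R₁₂ Φ⁻¹`. -/
  hexagon_right : mulMap (leg₁ k H) (mulMap (leg₂ k H) (leg₃ k H) ∘ₗ Δ.toLinearMap) R =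
    mulMap₃ (leg₂ k H) (leg₃ k H) (leg₁ k H) (↑Φ⁻¹ : H ⊗[k] (H ⊗[k] H)) *
      mulMap (leg₁ k H) (leg₃ k H) R *
      mulMap₃ (leg₂ k H) (leg₁ k H) (leg₃ k H) (Φ : H ⊗[k] (H ⊗[k] H)) *
      mulMap (leg₁ k H) (leg₂ k H) R * ↑Φ⁻¹
  /-- `Δᵒᵖ(h) R = R Δ(h)`. -/
  almost_cocomm : ∀ h, TensorProduct.comm k H H (Δ h) * R = R * Δ h
  /-- `(ε ⊗ id)(R) = 1`. -/
  counit_R_left : Algebra.TensorProduct.map ε (AlgHom.id k H) R = 1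
  /-- `(id ⊗ ε)(R) = 1`. -/
  counit_R_right : Algebra.TensorProduct.map (AlgHom.id k H) ε R = 1

noncomputable section

namespace QuasiHopfAlgebra

open QuasiHopf

variable {k H : Type*} [Field k] [Ring H] [Algebra k H] (Q : QuasiHopfAlgebra k H)

/-! ### Distinguished elements -/

/-- The reassociator as a plain element. -/
def X : H ⊗[k] (H ⊗[k] H) := ↑Q.Φ

/-- The inverse of the reassociator as a plain element. -/
def x : H ⊗[k] (H ⊗[k] H) := ↑Q.Φ⁻¹

/-- `S⁻¹`. -/
def Sinv : H →ₗ[k] H := linInv Q.S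

/-- `h ↦ s(h₁) t(h₂)`: puts `h₁` and `h₂` into the slots `s` and `t`. -/
def Δ₂ {A : Type*} [Ring A] [Algebra k A] (s t : H →ₗ[k] A) : H →ₗ[k] A :=
  mulMap s t ∘ₗ Q.Δ.toLinearMap

/-- `a ⊗ b ↦ S(a) α b`. -/
def SαI : H ⊗[k] H →ₗ[k] H := mulMap (LinearMap.mulRight k Q.α ∘ₗ Q.S) LinearMap.id

/-- `a ⊗ b ↦ a β S(b)`. -/
def IβS : H ⊗[k] H →ₗ[k] H := mulMap (LinearMap.mulRight k Q.β) Q.S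

/-- `h ↦ (S ⊗ S)(Δᵒᵖ(h)) = S(h₂) ⊗ S(h₁)`. -/
def SSΔop : H →ₗ[k] H ⊗[k] H :=
  TensorProduct.map Q.S Q.S ∘ₗ (TensorProduct.comm k H H).toLinearMap ∘ₗ Q.Δ.toLinearMap

/-- `γ = S(A²) α A³ ⊗ S(A¹) α A⁴` with `A¹ ⊗ A² ⊗ A³ ⊗ A⁴ = (Φ ⊗ 1)(Δ ⊗ id ⊗ id)(Φ⁻¹)`;
the components are collected in the order `(A² ⊗ A³) ⊗ (A¹ ⊗ A⁴)`. -/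
def γ : H ⊗[k] H :=
  TensorProduct.map Q.SαI Q.SαI
    (mulMap₃ (slot₃ k H) (slot₁ k H) (slot₂ k H) Q.X *
      mulMap₃ (Q.Δ₂ (slot₃ k H) (slot₁ k H)) (slot₂ k H) (slot₄ k H) Q.x)

/-- `δ = B¹ β S(B⁴) ⊗ B² β S(B³)` with `B¹ ⊗ B² ⊗ B³ ⊗ B⁴ = (Δ ⊗ id ⊗ id)(Φ)(Φ⁻¹ ⊗ 1)`;
the components are collected in the order `(B¹ ⊗ B⁴) ⊗ (B² ⊗ B³)`. -/
def δ : H ⊗[k] H :=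
  TensorProduct.map Q.IβS Q.IβS
    (mulMap₃ (Q.Δ₂ (slot₁ k H) (slot₃ k H)) (slot₄ k H) (slot₂ k H) Q.X *
      mulMap₃ (slot₁ k H) (slot₃ k H) (slot₄ k H) Q.x)

/-- Drinfeld's twist `f = (S ⊗ S)(Δᵒᵖ(x¹)) γ Δ(x² β S(x³)) = f¹ ⊗ f²`. -/
def f : H ⊗[k] H :=
  mulMap (LinearMap.mulRight k Q.γ ∘ₗ Q.SSΔop) (Q.Δ.toLinearMap ∘ₗ Q.IβS) Q.x

/-- The inverse of Drinfeld's twist,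
`f⁻¹ = Δ(S(x¹) α x²) δ (S ⊗ S)(Δᵒᵖ(x³)) = g¹ ⊗ g²`. -/
def g : H ⊗[k] H :=
  mulMap (LinearMap.mulRight k Q.δ ∘ₗ Q.Δ.toLinearMap ∘ₗ Q.SαI) Q.SSΔop
    ((TensorProduct.assoc k H H H).symm Q.x)

/-- `p_R = p¹ ⊗ p² = x¹ ⊗ x² β S(x³)`. -/
def pR : H ⊗[k] H := TensorProduct.map LinearMap.id Q.IβS Q.x

/-- `q_R = q¹ ⊗ q² = X¹ ⊗ S⁻¹(α X³) X²`. -/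
def qR : H ⊗[k] H :=
  TensorProduct.map LinearMap.id
    (mulMap (Q.Sinv ∘ₗ LinearMap.mulLeft k Q.α) LinearMap.id ∘ₗ
      (TensorProduct.comm k H H).toLinearMap) Q.X

/-- `p_L = p̃¹ ⊗ p̃² = X² S⁻¹(X¹ β) ⊗ X³`. -/
def pL : H ⊗[k] H :=
  TensorProduct.map
    (mulMap LinearMap.id (Q.Sinv ∘ₗ LinearMap.mulRight k Q.β) ∘ₗ
      (TensorProduct.comm k H H).toLinearMap) LinearMap.id
    ((TensorProduct.assoc k H H H).symm Q.X)

/-! ### Left `H`-modules and their monoidal structure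

A left `H`-module is a `k`-space `M` with an algebra map `H →ₐ[k] Module.End k M`. -/

section Modules

variable {M N P : Type*} [AddCommGroup M] [Module k M] [AddCommGroup N] [Module k N]
  [AddCommGroup P] [Module k P]

/-- The action of `A ⊗ B` on `M ⊗ N` for an `A`-module `M` and a `B`-module `N`. -/
def extAct {A B : Type*} [Ring A] [Algebra k A] [Ring B] [Algebra k B]
    (ρ : A →ₐ[k] Module.End k M) (σ : B →ₐ[k] Module.End k N) :
    A ⊗[k] B →ₐ[k] Module.End k (M ⊗[k] N) :=
  (Module.endTensorEndAlgHom (R := k) (S := k) (A := k) (M := M) (N := N)).comp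
    (Algebra.TensorProduct.map ρ σ)

/-- The `H`-module `M ⊗ N`: `h · (m ⊗ n) = h₁ · m ⊗ h₂ · n`. -/
def tensAct (ρ : H →ₐ[k] Module.End k M) (σ : H →ₐ[k] Module.End k N) :
    H →ₐ[k] Module.End k (M ⊗[k] N) :=
  (extAct ρ σ).comp Q.Δ

/-- The unit object `k`, on which `H` acts through `ε`. -/
def unitAct : H →ₐ[k] Module.End k k := (Algebra.ofId k (Module.End k k)).comp Q.ε

/-- The left dual `M*`: `(h · m*)(m) = m*(S(h) · m)`. -/
def dualAct (ρ : H →ₐ[k] Module.End k M) : H →ₐ[k] Module.End k (Module.Dual k M) :=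
  AlgHom.ofLinearMap (Module.Dual.transpose ∘ₗ ρ.toLinearMap ∘ₗ Q.S)
    (by ext φ m; simp [Q.S_one, Module.Dual.transpose_apply])
    (by intro a b; ext φ m; simp [Q.S_mul, Module.Dual.transpose_apply])

/-- `H`-linear maps. -/
def IsHLinear (ρ : H →ₐ[k] Module.End k M) (σ : H →ₐ[k] Module.End k N) (φ : M →ₗ[k] N) : Prop :=
  ∀ (h : H) (m : M), φ (ρ h m) = σ h (φ m)

/-- The associativity constraint `(u ⊗ v) ⊗ w ↦ X¹ · u ⊗ (X² · v ⊗ X³ · w)`. -/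
def assocHom (ρ : H →ₐ[k] Module.End k M) (σ : H →ₐ[k] Module.End k N)
    (τ : H →ₐ[k] Module.End k P) : (M ⊗[k] N) ⊗[k] P →ₗ[k] M ⊗[k] (N ⊗[k] P) :=
  extAct ρ (extAct σ τ) Q.X ∘ₗ (TensorProduct.assoc k M N P).toLinearMap

/-- The inverse associativity constraint `u ⊗ (v ⊗ w) ↦ (x¹ · u ⊗ x² · v) ⊗ x³ · w`. -/
def assocInv (ρ : H →ₐ[k] Module.End k M) (σ : H →ₐ[k] Module.End k N)
    (τ : H →ₐ[k] Module.End k P) : M ⊗[k] (N ⊗[k] P) →ₗ[k] (M ⊗[k] N) ⊗[k] P :=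
  (TensorProduct.assoc k M N P).symm.toLinearMap ∘ₗ extAct ρ (extAct σ τ) Q.x

/-- `ev_M (m* ⊗ m) = m*(α · m)`. -/
def ev (ρ : H →ₐ[k] Module.End k M) : Module.Dual k M ⊗[k] M →ₗ[k] k :=
  contractLeft k M ∘ₗ TensorProduct.map LinearMap.id (ρ Q.α)

/-- `coev_M (1) = ∑ᵢ β · mᵢ ⊗ mⁱ`. -/
def coev [FiniteDimensional k M] (ρ : H →ₐ[k] Module.End k M) :
    k →ₗ[k] M ⊗[k] Module.Dual k M :=
  TensorProduct.map (ρ Q.β) LinearMap.id ∘ₗ coevaluation k M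

/-- The categorical transpose `ν* : N* → M*` of `ν : M → N`:
`N* ≅ N* ⊗ k → N* ⊗ (M ⊗ M*) → N* ⊗ (N ⊗ M*) → (N* ⊗ N) ⊗ M* → k ⊗ M* ≅ M*`. -/
def transpose [FiniteDimensional k M] (ρ : H →ₐ[k] Module.End k M)
    (σ : H →ₐ[k] Module.End k N) (ν : M →ₗ[k] N) : Module.Dual k N →ₗ[k] Module.Dual k M :=
  (TensorProduct.lid k (Module.Dual k M)).toLinearMap ∘ₗ
  TensorProduct.map (Q.ev σ) LinearMap.id ∘ₗ
  Q.assocInv (Q.dualAct σ) σ (Q.dualAct ρ) ∘ₗ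
  TensorProduct.map LinearMap.id (TensorProduct.map ν LinearMap.id) ∘ₗ
  TensorProduct.map LinearMap.id (Q.coev ρ) ∘ₗ
  (TensorProduct.rid k (Module.Dual k N)).symm.toLinearMap

/-- The canonical morphism `φ*_{N,M} : N* ⊗ M* → (M ⊗ N)*`, as the composition
`N* ⊗ M* ≅ (N* ⊗ M*) ⊗ k → (N* ⊗ M*) ⊗ ((M ⊗ N) ⊗ (M ⊗ N)*)`
`→ ((N* ⊗ M*) ⊗ (M ⊗ N)) ⊗ (M ⊗ N)* → (N* ⊗ (M* ⊗ (M ⊗ N))) ⊗ (M ⊗ N)*`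
`→ (N* ⊗ ((M* ⊗ M) ⊗ N)) ⊗ (M ⊗ N)* → (N* ⊗ (k ⊗ N)) ⊗ (M ⊗ N)*`
`→ (N* ⊗ N) ⊗ (M ⊗ N)* → k ⊗ (M ⊗ N)* ≅ (M ⊗ N)*`
of coevaluation, associativity constraints and evaluations. -/
def phiStar [FiniteDimensional k M] [FiniteDimensional k N] (ρ : H →ₐ[k] Module.End k M)
    (σ : H →ₐ[k] Module.End k N) :
    Module.Dual k N ⊗[k] Module.Dual k M →ₗ[k] Module.Dual k (M ⊗[k] N) :=
  (TensorProduct.lid k (Module.Dual k (M ⊗[k] N))).toLinearMap ∘ₗ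
  TensorProduct.map (Q.ev σ) LinearMap.id ∘ₗ
  TensorProduct.map
    (TensorProduct.map LinearMap.id (TensorProduct.lid k N).toLinearMap) LinearMap.id ∘ₗ
  TensorProduct.map
    (TensorProduct.map LinearMap.id (TensorProduct.map (Q.ev ρ) LinearMap.id)) LinearMap.id ∘ₗ
  TensorProduct.map
    (TensorProduct.map LinearMap.id (Q.assocInv (Q.dualAct ρ) ρ σ)) LinearMap.id ∘ₗ
  TensorProduct.map
    (Q.assocHom (Q.dualAct σ) (Q.dualAct ρ) (Q.tensAct ρ σ)) LinearMap.id ∘ₗ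
  Q.assocInv (Q.tensAct (Q.dualAct σ) (Q.dualAct ρ)) (Q.tensAct ρ σ)
    (Q.dualAct (Q.tensAct ρ σ)) ∘ₗ
  TensorProduct.map LinearMap.id (Q.coev (Q.tensAct ρ σ)) ∘ₗ
  (TensorProduct.rid k (Module.Dual k N ⊗[k] Module.Dual k M)).symm.toLinearMap

end Modules

/-! ### Sandwich maps -/

/-- `a ⊗ b ↦ (h ↦ a h S(b))`. -/
def sandR : H ⊗[k] H →ₗ[k] Module.End k H := mulMap (lm k H) (rm k H ∘ₗ Q.S)

/-- `a ⊗ b ↦ (h ↦ S(a) h b)`. -/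
def sandL : H ⊗[k] H →ₗ[k] Module.End k H := mulMap (lm k H ∘ₗ Q.S) (rm k H)

/-- `(a ⊗ b) ⊗ (c ⊗ d) ↦ (h ⊗ h' ↦ a h S(b) ⊗ c h' S(d))`. -/
def sandR₂ : H4 k H →ₗ[k] Module.End k (H ⊗[k] H) :=
  (Module.endTensorEndAlgHom (R := k) (S := k) (A := k) (M := H) (N := H)).toLinearMap ∘ₗ
     TensorProduct.map Q.sandR Q.sandR

/-- `(a ⊗ b) ⊗ (c ⊗ d) ↦ (h ⊗ h' ↦ S(a) h b ⊗ S(c) h' d)`. -/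
def sandL₂ : H4 k H →ₗ[k] Module.End k (H ⊗[k] H) :=
  (Module.endTensorEndAlgHom (R := k) (S := k) (A := k) (M := H) (N := H)).toLinearMap ∘ₗ
     TensorProduct.map Q.sandL Q.sandL

/-- `H` with the adjoint action `h ▷ h' = h₁ h' S(h₂)`. -/
def adAct : H →ₐ[k] Module.End k H :=
  AlgHom.ofLinearMap (Q.sandR ∘ₗ Q.Δ.toLinearMap)
    (by
      ext h
      simp [sandR, Algebra.TensorProduct.one_def, lm, rm, Q.S_one])
    (by
      have key : ∀ s t : H ⊗[k] H, Q.sandR (s * t) = Q.sandR s * Q.sandR t := by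
        intro s t
        induction s with
        | zero => simp
        | add s₁ s₂ h₁ h₂ => simp [add_mul, h₁, h₂]
        | tmul a b =>
          induction t with
          | zero => simp
          | add t₁ t₂ h₁ h₂ => simp [mul_add, h₁, h₂]
          | tmul c d =>
            ext h
            simp [sandR, lm, rm, Q.S_mul, mul_assoc]
      intro a b
      simp [key])

/-- `H*` with the action `h ▶ χ = h₂ ⇀ χ ↼ S(h₁)`, that is `(h ▶ χ)(h') = χ(S(h₁) h' h₂)`. -/
def coadAct : H →ₐ[k] Module.End k (Module.Dual k H) :=
  AlgHom.ofLinearMap (Module.Dual.transpose ∘ₗ Q.sandL ∘ₗ Q.Δ.toLinearMap)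
    (by
      ext χ h
      simp [sandL, Algebra.TensorProduct.one_def, lm, rm, Q.S_one, Module.Dual.transpose_apply])
    (by
      have key : ∀ s t : H ⊗[k] H, Q.sandL (s * t) = Q.sandL t * Q.sandL s := by
        intro s t
        induction s with
        | zero => simp
        | add s₁ s₂ h₁ h₂ => simp [add_mul, mul_add, h₁, h₂]
        | tmul a b =>
          induction t with
          | zero => simp
          | add t₁ t₂ h₁ h₂ => simp [mul_add, add_mul, h₁, h₂]
          | tmul c d =>
            ext h
            simp [sandL, lm, rm, Q.S_mul, mul_assoc]
      intro a b
      ext χ h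
      simp [key, Module.Dual.transpose_apply])

end QuasiHopfAlgebra

/-! ### Hopf algebras in the braided category of left `H`-modules -/

/-- The data of a Hopf algebra in the category of left `H`-modules: an `H`-module `B` with a
multiplication, a unit, a comultiplication, a counit and an antipode. The axioms are
`QTQuasiHopfAlgebra.IsBraidedHopf`. -/
structure BraidedHopfData (k H B : Type*) [Field k] [Ring H] [Algebra k H] [AddCommGroup B]
    [Module k B] where
  act : H →ₐ[k] Module.End k B
  mul : B ⊗[k] B →ₗ[k] B
  one : k →ₗ[k] B
  comul : B →ₗ[k] B ⊗[k] B
  counit : B →ₗ[k] k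
  antipode : B →ₗ[k] B

/-- `φ : D → E` is an isomorphism of braided Hopf algebras: a bijective `H`-linear map that
respects multiplication, unit, comultiplication, counit and antipode. -/
structure BraidedHopfData.IsIso {k H B C : Type*} [Field k] [Ring H] [Algebra k H]
    [AddCommGroup B] [Module k B] [AddCommGroup C] [Module k C]
    (D : BraidedHopfData k H B) (E : BraidedHopfData k H C) (φ : B →ₗ[k] C) : Prop where
  bijective : Function.Bijective φ
  linear : QuasiHopfAlgebra.IsHLinear D.act E.act φ
  map_mul : φ ∘ₗ D.mul = E.mul ∘ₗ TensorProduct.map φ φ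
  map_one : φ ∘ₗ D.one = E.one
  map_comul : TensorProduct.map φ φ ∘ₗ D.comul = E.comul ∘ₗ φ
  map_counit : E.counit ∘ₗ φ = D.counit
  map_antipode : φ ∘ₗ D.antipode = E.antipode ∘ₗ φ

namespace QuasiHopfAlgebra

open QuasiHopf

variable {k H : Type*} [Field k] [Ring H] [Algebra k H] (Q : QuasiHopfAlgebra k H)

/-- The categorical left dual `B*` of a Hopf algebra `B` in the category of left `H`-modules, with
multiplication `Δ_B* ∘ φ*_{B,B}`, comultiplication `φ*_{B,B}⁻¹ ∘ m_B*`, unit `ε_B*`, counit `η_B*`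
and antipode `S_B*` (the unit object `k` being identified with its dual `k*` as usual). -/
def leftDual {B : Type*} [AddCommGroup B] [Module k B] [FiniteDimensional k B]
    (D : BraidedHopfData k H B) : BraidedHopfData k H (Module.Dual k B) where
  act := Q.dualAct D.act
  mul := Q.transpose D.act (Q.tensAct D.act D.act) D.comul ∘ₗ Q.phiStar D.act D.act
  one := Q.transpose D.act Q.unitAct D.counit ∘ₗ
    (LinearMap.ringLmapEquivSelf k k k).symm.toLinearMap
  comul := linInv (Q.phiStar D.act D.act) ∘ₗ
    Q.transpose (Q.tensAct D.act D.act) D.act D.mul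
  counit := (LinearMap.ringLmapEquivSelf k k k).toLinearMap ∘ₗ
    Q.transpose Q.unitAct D.act D.one
  antipode := Q.transpose D.act D.act D.antipode

end QuasiHopfAlgebra

namespace QTQuasiHopfAlgebra

open QuasiHopf

variable {k H : Type*} [Field k] [Ring H] [Algebra k H] (Q : QTQuasiHopfAlgebra k H)

section Braided

variable {M N : Type*} [AddCommGroup M] [Module k M] [AddCommGroup N] [Module k N]

/-- The braiding `c_{M,N} (m ⊗ n) = R² · n ⊗ R¹ · m`. -/
def braiding (ρ : H →ₐ[k] Module.End k M) (σ : H →ₐ[k] Module.End k N) :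
    M ⊗[k] N →ₗ[k] N ⊗[k] M :=
  (TensorProduct.comm k M N).toLinearMap ∘ₗ QuasiHopfAlgebra.extAct ρ σ Q.R

variable {B : Type*} [AddCommGroup B] [Module k B]

/-- The multiplication of `B ⊗ B`:
`(B ⊗ B) ⊗ (B ⊗ B) → B ⊗ (B ⊗ (B ⊗ B)) → B ⊗ ((B ⊗ B) ⊗ B) → B ⊗ ((B ⊗ B) ⊗ B)`
`→ B ⊗ (B ⊗ (B ⊗ B)) → (B ⊗ B) ⊗ (B ⊗ B) → B ⊗ B`
through `a`, `id ⊗ a⁻¹`, `id ⊗ (c ⊗ id)`, `id ⊗ a`, `a⁻¹` and `m ⊗ m`. -/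
def mulTens (D : BraidedHopfData k H B) : (B ⊗[k] B) ⊗[k] (B ⊗[k] B) →ₗ[k] B ⊗[k] B :=
  TensorProduct.map D.mul D.mul ∘ₗ
  Q.assocInv D.act D.act (Q.tensAct D.act D.act) ∘ₗ
  TensorProduct.map LinearMap.id (Q.assocHom D.act D.act D.act) ∘ₗ
  TensorProduct.map LinearMap.id
    (TensorProduct.map (Q.braiding D.act D.act) LinearMap.id) ∘ₗ
  TensorProduct.map LinearMap.id (Q.assocInv D.act D.act D.act) ∘ₗ
  Q.assocHom D.act D.act (Q.tensAct D.act D.act)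

/-- The axioms of a Hopf algebra in the braided category of left `H`-modules. -/
structure IsBraidedHopf (D : BraidedHopfData k H B) : Prop where
  mul_linear : QuasiHopfAlgebra.IsHLinear (Q.tensAct D.act D.act) D.act D.mul
  one_linear : QuasiHopfAlgebra.IsHLinear Q.unitAct D.act D.one
  comul_linear : QuasiHopfAlgebra.IsHLinear D.act (Q.tensAct D.act D.act) D.comul
  counit_linear : QuasiHopfAlgebra.IsHLinear D.act Q.unitAct D.counit
  antipode_linear : QuasiHopfAlgebra.IsHLinear D.act D.act D.antipode
  mul_assoc : D.mul ∘ₗ TensorProduct.map D.mul LinearMap.id =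
    D.mul ∘ₗ TensorProduct.map LinearMap.id D.mul ∘ₗ Q.assocHom D.act D.act D.act
  one_mul : ∀ b, D.mul (D.one 1 ⊗ₜ[k] b) = b
  mul_one : ∀ b, D.mul (b ⊗ₜ[k] D.one 1) = b
  comul_coassoc : Q.assocHom D.act D.act D.act ∘ₗ TensorProduct.map D.comul LinearMap.id ∘ₗ
    D.comul = TensorProduct.map LinearMap.id D.comul ∘ₗ D.comul
  counit_comul : ∀ b, TensorProduct.map D.counit LinearMap.id (D.comul b) = 1 ⊗ₜ[k] b
  comul_counit : ∀ b, TensorProduct.map LinearMap.id D.counit (D.comul b) = b ⊗ₜ[k] 1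
  comul_mul : D.comul ∘ₗ D.mul = Q.mulTens D ∘ₗ TensorProduct.map D.comul D.comul
  comul_one : D.comul (D.one 1) = D.one 1 ⊗ₜ[k] D.one 1
  counit_mul : ∀ b c, D.counit (D.mul (b ⊗ₜ[k] c)) = D.counit b * D.counit c
  counit_one : D.counit (D.one 1) = 1
  antipode_left : D.mul ∘ₗ TensorProduct.map D.antipode LinearMap.id ∘ₗ D.comul =
    D.one ∘ₗ D.counit
  antipode_right : D.mul ∘ₗ TensorProduct.map LinearMap.id D.antipode ∘ₗ D.comul =
    D.one ∘ₗ D.counit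

end Braided

/-! ### The enveloping algebra braided group of `H` -/

/-- The enveloping algebra braided group of `H`: the space `H` with the adjoint action and
* `h • h' = X¹ h S(x¹ X²) α x² X³₁ h' S(x³ X³₂)`, unit `β`, counit `ε`;
* `Δ(h) = x¹ X¹ h₁ g¹ S(x² R² y³ X³₂) ⊗ x³ R¹ ▷ (y¹ X² h₂ g² S(y² X³₁))`, which is
  `x¹ X¹ h₁ g¹ S(x² R² y³ X³₂) ⊗ (x³₁ R¹₁ y¹ X²) h₂ g² S(x³₂ R¹₂ y² X³₁)`;
* `S(h) = X¹ R² p² S(q¹ (X² R¹ p¹ ▷ h) S(q²) X³)`. -/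
def envelopingBraidedGroup : BraidedHopfData k H H where
  act := Q.adAct
  mul := LinearMap.mul' k H ∘ₗ TensorProduct.map (LinearMap.mulRight k Q.α) LinearMap.id ∘ₗ
    Q.sandR₂
      (mulMap₃ (slot₂ k H) (slot₃ k H) (slot₄ k H) Q.x *
        mulMap₃ (slot₁ k H) (slot₂ k H) (Q.Δ₂ (slot₃ k H) (slot₄ k H)) Q.X)
  one := LinearMap.toSpanSingleton k H Q.β
  comul :=
    Q.sandR₂
      (mulMap₃ (slot₁ k H) (slot₂ k H) (Q.Δ₂ (slot₃ k H) (slot₄ k H)) Q.x *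
        mulMap (Q.Δ₂ (slot₃ k H) (slot₄ k H)) (slot₂ k H) Q.R *
        mulMap₃ (slot₃ k H) (slot₄ k H) (slot₂ k H) Q.x *
        mulMap₃ (slot₁ k H) (slot₃ k H) (Q.Δ₂ (slot₄ k H) (slot₂ k H)) Q.X) ∘ₗ
    LinearMap.mulRight k Q.g ∘ₗ Q.Δ.toLinearMap
  counit := Q.ε.toLinearMap
  antipode :=
    -- `a ⊗ (b ⊗ c) ↦ (h ↦ a S(q¹ (c ▷ h) S(q²) b))`
    mulMap₃ (LinearMap.mulRight k (Q.S : Module.End k H) ∘ₗ lm k H)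
      (LinearMap.mulRight k (Q.sandR Q.qR) ∘ₗ rm k H) Q.adAct.toLinearMap
      (mulMap₃ (leg₁ k H) (leg₃ k H) (leg₂ k H) Q.X *
        mulMap (leg₃ k H) (leg₁ k H) Q.R *
        mulMap (leg₃ k H) (leg₁ k H) Q.pR)

/-! ### The function algebra braided group of `H*` -/

/-- `R⁻¹`. -/
def Rinv : H ⊗[k] H := Ring.inverse Q.R

/-- The function algebra braided group of `H*`, viewed in the category of left `H`-modules: the
space `H*` with the action `h ▶ χ = h₂ ⇀ χ ↼ S(h₁)` and
* `χ · ψ = [x³₁ Y² r¹ y¹ X² ⇀ χ ↼ S(x¹ X¹) f² R¹] [x³₂ Y³ y³ X³₂ ⇀ ψ ↼ S(x² Y¹ r² y² X³₁) f¹ R²]`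
  (the outer product is `(χ ψ)(h) = χ(h₁) ψ(h₂)`), unit `ε`, counit `χ ↦ χ(α)`;
* `Δ(χ) = χ₁ ↼ S(x¹) ⊗ x³₂ X³ ⇀ χ₂ ↼ x² X¹ β S(x³₁ X²)`, which pairs with `a ⊗ b` to
  `χ(S(x¹) a x² X¹ β S(x³₁ X²) b x³₂ X³)`;
* `S(χ) = q¹₂ R̄¹₂ p̃² ⇀ χ ∘ S ↼ q² R̄² S(q¹₁ R̄¹₁ p̃¹)`, where `R⁻¹ = R̄¹ ⊗ R̄²`.
Here `(h ⇀ χ)(h') = χ(h' h)` and `(χ ↼ h)(h') = χ(h h')`. -/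
def functionBraidedGroup [FiniteDimensional k H] : BraidedHopfData k H (Module.Dual k H) where
  act := Q.coadAct
  mul := Module.Dual.transpose
      (Q.sandL₂
        (mulMap₃ (slot₁ k H) (slot₃ k H) (Q.Δ₂ (slot₂ k H) (slot₄ k H)) Q.x *
          mulMap₃ (slot₃ k H) (slot₂ k H) (slot₄ k H) Q.X *
          mulMap (slot₂ k H) (slot₃ k H) Q.R *
          mulMap₃ (slot₂ k H) (slot₃ k H) (slot₄ k H) Q.x *
          mulMap₃ (slot₁ k H) (slot₂ k H) (Q.Δ₂ (slot₃ k H) (slot₄ k H)) Q.X) ∘ₗ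
        LinearMap.mulLeft k (TensorProduct.comm k H H Q.f * Q.R) ∘ₗ Q.Δ.toLinearMap) ∘ₗ
    TensorProduct.dualDistrib k H H
  one := LinearMap.toSpanSingleton k (Module.Dual k H) Q.ε.toLinearMap
  comul := (TensorProduct.dualDistribEquiv k H H).symm.toLinearMap ∘ₗ
    Module.Dual.transpose
      (LinearMap.mul' k H ∘ₗ TensorProduct.map (LinearMap.mulRight k Q.β) LinearMap.id ∘ₗ
        Q.sandL₂
          (mulMap₃ (slot₁ k H) (slot₂ k H) (Q.Δ₂ (slot₃ k H) (slot₄ k H)) Q.x *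
            mulMap₃ (slot₂ k H) (slot₃ k H) (slot₄ k H) Q.X))
  counit := Module.Dual.eval k H Q.α
  antipode := Module.Dual.transpose
    -- `a ⊗ (b ⊗ c) ↦ (h ↦ a S(b) h c)`
    (Q.S ∘ₗ mulMap (lm k H) Q.sandL
      (mulMap (Q.Δ₂ (leg₂ k H) (leg₃ k H)) (leg₁ k H) Q.qR *
        mulMap (Q.Δ₂ (leg₂ k H) (leg₃ k H)) (leg₁ k H) Q.Rinv *
        mulMap (leg₂ k H) (leg₃ k H) Q.pL))

/-- `λ(χ) = S⁻¹(g¹) ⇀ χ ∘ S ↼ g²`, that is `λ(χ)(h) = χ(S(g² h S⁻¹(g¹)))`. -/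
def lam : Module.Dual k H →ₗ[k] Module.Dual k H :=
  Module.Dual.transpose (Q.S ∘ₗ mulMap (rm k H ∘ₗ Q.Sinv) (lm k H) Q.g)

end QTQuasiHopfAlgebra

end

/-!
The dual `H*`, with its matrix coefficients `V* ⊗ V → H*`, carries a natural coaction `V → V ⊗ H*`
on every `H`-module `V`. In any braided category, an object `F` with a natural coaction and with
operations that are compatible with it (`NatCoaction.Structure`) satisfies the axioms of a braided
Hopf algebra, as soon as the coefficients are jointly epimorphic: each axiom, tested on
coefficients, follows from naturality of the coaction and of the braiding and from the zigzag
identities (`ι_mul_assoc`, `ι_comul_mul`, `ι_antipode_left`, `ι_antipode_right`). For `F = H*` the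
coefficients of the regular representation suffice. The formulas of the function algebra braided
group are exactly what the abstract operations give on coefficients (`mul_coeff`, `comul_coeff`,
`antipode_coeff`), so it is a braided Hopf algebra.

The inverses in these formulas exist for categorical reasons. Before `R` is known to be invertible,
the finite-dimensional modules form a monoidal category with left duals and a lax braiding. Duals
make a lax braiding split epi (`lax_braiding_split`), and for the regular representation this says
that `R` has a right inverse, hence an inverse. In the resulting braided category every object is
isomorphic to its double dual, on which `h` acts through `S²`, so `S` is injective and therefore
bijective. Drinfeld's twist compares the two left duals `N* ⊗ M*` and `(M ⊗ N)*` of `M ⊗ N`: the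
comparison in one direction is the action of `f` (`phiStar_apply`), in the other direction that of
`g` (`nest_mate_apply`), and mutually inverse comparisons of duals give `f g = g f = 1` and the
bijectivity of `φ*`.

The enveloping algebra braided group is treated dually. The map `actElt : H → M ⊗ M*` sends `h` to
the tensor of its action on `M`. It turns the multiplication, comultiplication and antipode of the
enveloping algebra braided group into categorical maps between the objects `M ⊗ M*`: the
composition of internal endomorphisms, their regrouping by a braiding, and a braided transposition
(`actElt_mul`, `map_actElt_comul`, `actElt_antipode`). Transposing these maps gives the product,
coproduct and antipode of matrix coefficients (`bracket_elt_mul`, `bracket_elt_comul`,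
`bracket_elt_antipode`). The transpose of `actElt` followed by `λ` is the categorical map that
turns a functional on `M ⊗ M*` into a matrix coefficient of `M*` (`lamHom_lin`). For the regular
representation the transpose of `actElt` is surjective, so `λ` respects all operations, and it is
bijective because the coefficients of a faithful module exhaust `H*`. The axioms for the left dual
of the enveloping algebra braided group are then transported back along `λ`
(`IsBraidedHopf.of_isIso`).
-/

/-! ### Natural coactions and matrix coefficients -/

section

open CategoryTheory MonoidalCategory BraidedCategory ExactPairing
namespace BraidedReconstruction
universe v u
variable {C : Type u} [Category.{v} C] [MonoidalCategory C]

/-- A coaction `δ V : V ⟶ V ⊗ F` of an object `F` on every object `V`, natural in `V`. Such families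
correspond to dinatural families `V' ⊗ V ⟶ F` (see `ι`), so the coend of `V' ⊗ V` carries the
universal one. -/
structure NatCoaction (F : C) where
  δ : ∀ V : C, V ⟶ V ⊗ F
  naturality : ∀ {V W : C} (f : V ⟶ W), δ V ≫ f ▷ F = f ≫ δ W

namespace NatCoaction
variable {F : C} (c : NatCoaction F)

/-- The matrix coefficients `V' ⊗ V ⟶ F` of a natural coaction, for a left dual `V'` of `V`. The
pairing `V'` with `V` is arbitrary, so that tensor products and double duals can be used without
choosing duals. -/
def ι (V V' : C) [ExactPairing V V'] : V' ⊗ V ⟶ F :=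
  V' ◁ c.δ V ⊗≫ ε_ V V' ▷ F ⊗≫ 𝟙 F

variable (U U' V V' W W' : C) [ExactPairing U U'] [ExactPairing V V'] [ExactPairing W W']

theorem coev_ι : η_ V V' ▷ V ≫ (α_ V V' V).hom ≫ V ◁ c.ι V V' = (λ_ V).hom ≫ c.δ V := by
  calc _ = 𝟙 _ ⊗≫ (η_ V V' ▷ V ≫ (V ⊗ V') ◁ c.δ V) ⊗≫ V ◁ ε_ V V' ▷ F ⊗≫ 𝟙 _ := by
        dsimp only [ι]; monoidal
    _ = 𝟙 _ ⊗≫ (𝟙_ C) ◁ c.δ V ⊗≫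
          (η_ V V' ▷ V ≫ (α_ V V' V).hom ≫ V ◁ ε_ V V') ▷ F ⊗≫ 𝟙 _ := by
        rw [← whisker_exchange]; monoidal
    _ = _ := by rw [evaluation_coevaluation]; monoidal

theorem ι_comp {Z : C} (a : F ⟶ Z) :
    c.ι V V' ≫ a = V' ◁ (c.δ V ≫ V ◁ a) ⊗≫ ε_ V V' ▷ Z ⊗≫ 𝟙 Z := by
  calc _ = V' ◁ c.δ V ⊗≫ (ε_ V V' ▷ F ≫ (𝟙_ C) ◁ a) ⊗≫ 𝟙 Z := by dsimp only [ι]; monoidal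
    _ = _ := by rw [← whisker_exchange]; monoidal

theorem δ_eq : c.δ V = (λ_ V).inv ≫ η_ V V' ▷ V ≫ (α_ V V' V).hom ≫ V ◁ c.ι V V' := by
  rw [coev_ι]; simp

theorem ι_congr {Z : C} {a b : F ⟶ Z} (h : c.δ V ≫ V ◁ a = c.δ V ≫ V ◁ b) :
    c.ι V V' ≫ a = c.ι V V' ≫ b := by rw [ι_comp, h, ← ι_comp]

variable [BraidedCategory C]

/-- The mate of a braiding under the nested duality of a tensor product is again a braiding. -/
theorem braiding_mate : (V' ⊗ W') ◁ (β_ V W).hom ≫ ε_ (W ⊗ V) (V' ⊗ W') =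
    (β_ V' W').hom ▷ (V ⊗ W) ≫ ε_ (V ⊗ W) (W' ⊗ V') := by
  have h1 : W' ◁ (β_ V W).hom ⊗≫ ε_ W W' ▷ V =
     𝟙 _ ⊗≫ (β_ V W').inv ▷ W ⊗≫ V ◁ ε_ W W' ⊗≫ 𝟙 _ := by
    have := (braiding_naturality_right V (ε_ W W'))
    rw [braiding_tensor_right_hom] at this
    calc _ = 𝟙 _ ⊗≫ ((β_ V W').inv ≫ (β_ V W').hom) ▷ W ⊗≫ W' ◁ (β_ V W).hom ⊗≫ ε_ W W' ▷ V ⊗≫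
            𝟙 _ := by
            rw [Iso.inv_hom_id]; monoidal
      _ = 𝟙 _ ⊗≫ ((β_ V W').inv) ▷ W ⊗≫ (((α_ V W' W).inv ≫
        (β_ V W').hom ▷ W ≫ (α_ W' V W).hom ≫ W' ◁ (β_ V W).hom ≫ (α_ W' W V).inv) ≫
      ε_ W W' ▷ V) ⊗≫ 𝟙 _ := by monoidal
      _ = 𝟙 _ ⊗≫ ((β_ V W').inv) ▷ W ⊗≫ (V ◁ ε_ W W' ≫ (β_ V (𝟙_ C)).hom) ⊗≫ 𝟙 _ := by rw [← this]
      _ = _ := by rw [braiding_tensorUnit_right]; monoidal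
  have h2 : (β_ V' W').hom ▷ V ⊗≫ W' ◁ ε_ V V' =
     𝟙 _ ⊗≫ V' ◁ (β_ V W').inv ⊗≫ ε_ V V' ▷ W' ⊗≫ 𝟙 _ := by
    have := (braiding_naturality_left (ε_ V V') W')
    rw [braiding_tensor_left_hom] at this
    calc _ = 𝟙 _ ⊗≫ V' ◁ ((β_ V W').inv ≫ (β_ V W').hom) ⊗≫ (β_ V' W').hom ▷ V ⊗≫ W' ◁ ε_ V V' ⊗≫
            𝟙 _ := by
            rw [Iso.inv_hom_id]; monoidal
      _ = 𝟙 _ ⊗≫ V' ◁ ((β_ V W').inv) ⊗≫ (((α_ V' V W').hom ≫ V' ◁ (β_ V W').hom ≫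
            (α_ V' W' V).inv ≫
          (β_ V' W').hom ▷ V ≫ (α_ W' V' V).hom) ≫ W' ◁ ε_ V V') ⊗≫ 𝟙 _ := by monoidal
      _ = 𝟙 _ ⊗≫ V' ◁ ((β_ V W').inv) ⊗≫ (ε_ V V' ▷ W' ≫ (β_ (𝟙_ C) W').hom) ⊗≫ 𝟙 _ := by
          rw [← this]
      _ = _ := by rw [braiding_tensorUnit_left]; monoidal
  rw [tensor_evaluation, tensor_evaluation]
  calc _ = 𝟙 _ ⊗≫ V' ◁ (W' ◁ (β_ V W).hom ⊗≫ ε_ W W' ▷ V) ⊗≫ ε_ V V' := by monoidal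
    _ = 𝟙 _ ⊗≫ V' ◁ (β_ V W').inv ▷ W ⊗≫ ((V' ⊗ V) ◁ ε_ W W' ≫ ε_ V V' ▷ 𝟙_ C) ⊗≫ 𝟙 _ := by
        rw [h1]; monoidal
    _ = 𝟙 _ ⊗≫ (𝟙 ((V' ⊗ W') ⊗ V) ⊗≫ V' ◁ (β_ V W').inv ⊗≫ ε_ V V' ▷ W' ⊗≫
          𝟙 (W' ⊗ 𝟙_ C)) ▷ W ⊗≫ ε_ W W':= by
      rw [whisker_exchange]; monoidal
    _ = _ := by rw [← h2]; monoidal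

theorem ι_braiding : (V' ⊗ W') ◁ (β_ V W).hom ≫ c.ι (W ⊗ V) (V' ⊗ W') =
    (β_ V' W').hom ▷ (V ⊗ W) ≫ c.ι (V ⊗ W) (W' ⊗ V') := by
  calc _ = (V' ⊗ W') ◁ ((β_ V W).hom ≫ c.δ _) ⊗≫ ε_ (W ⊗ V) (V' ⊗ W') ▷ F ⊗≫ 𝟙 F := by
         dsimp only [ι]; monoidal
    _ = (V' ⊗ W') ◁ c.δ (V ⊗ W) ⊗≫ ((V' ⊗ W') ◁ (β_ V W).hom ≫ ε_ (W ⊗ V) (V' ⊗ W')) ▷ F ⊗≫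
          𝟙 F := by
         rw [← c.naturality]; monoidal
    _ = ((V' ⊗ W') ◁ c.δ (V ⊗ W) ≫ (β_ V' W').hom ▷ ((V ⊗ W) ⊗ F)) ⊗≫ (ε_ (V ⊗ W) (W' ⊗ V')) ▷ F ⊗≫
          𝟙 F := by
         rw [braiding_mate]; monoidal
    _ = _ := by
         rw [whisker_exchange]; dsimp only [ι]; monoidal

/-- An evaluation slides through the braiding with a third object. -/
theorem braiding_eval (Y : C) : (β_ Y V').inv ▷ V ≫ (α_ Y V' V).hom ≫ Y ◁ ε_ V V' =
    (α_ V' Y V).hom ≫ V' ◁ (β_ Y V).hom ≫ (α_ V' V Y).inv ≫ ε_ V V' ▷ Y ≫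
      (λ_ Y).hom ≫ (ρ_ Y).inv := by
  have := (braiding_naturality_right Y (ε_ V V'))
  rw [braiding_tensor_right_hom] at this
  calc _ = 𝟙 _ ⊗≫ (β_ Y V').inv ▷ V ⊗≫ (Y ◁ ε_ V V' ≫ (β_ Y (𝟙_ C)).hom) ⊗≫ 𝟙 _ := by
        rw [braiding_tensorUnit_right]; monoidal
    _ = 𝟙 _ ⊗≫ ((β_ Y V').inv ≫ (β_ Y V').hom) ▷ V ⊗≫ V' ◁ (β_ Y V).hom ⊗≫
          ε_ V V' ▷ Y ⊗≫ 𝟙 _ := by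
        rw [this]; monoidal
    _ = _ := by rw [Iso.inv_hom_id]; monoidal

/-- If `m` multiplies the coefficients of `V` and `W` to coefficients of `V ⊗ W`, then the coaction
on `V ⊗ W` is the product of the two coactions. -/
theorem δ_tensor_of_ι (m : F ⊗ F ⟶ F)
    (h2 : c.ι V V' ▷ (W' ⊗ W) ≫ F ◁ c.ι W W' ≫ m =
      (α_ (V' ⊗ V) W' W).inv ≫ (β_ (V' ⊗ V) W').hom ▷ W ≫ (α_ W' (V' ⊗ V) W).hom ≫
        W' ◁ (α_ V' V W).hom ≫ (α_ W' V' (V ⊗ W)).inv ≫ c.ι (V ⊗ W) (W' ⊗ V')) :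
    c.δ (V ⊗ W) = c.δ V ▷ W ≫ (α_ V F W).hom ≫ V ◁ F ◁ c.δ W ≫ V ◁ (α_ F W F).inv ≫
      V ◁ (β_ F W).hom ▷ F ≫ V ◁ (α_ W F F).hom ≫ V ◁ W ◁ m ≫ (α_ V W F).inv := by
  symm
  have h3 := braiding_naturality_right (V' ⊗ V) (η_ W W')
  rw [braiding_tensor_right_hom] at h3
  calc _ = 𝟙 _ ⊗≫ η_ V V' ▷ V ▷ W ⊗≫ V ◁ (c.ι V V' ▷ (𝟙_ C ⊗ W) ≫ F ◁ η_ W W' ▷ W) ⊗≫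
         V ◁ ((F ⊗ W) ◁ c.ι W W' ≫ (β_ F W).hom ▷ F) ⊗≫ (V ⊗ W) ◁ m := by
         rw [c.δ_eq V V', c.δ_eq W W']; monoidal
    _ = 𝟙 _ ⊗≫ η_ V V' ▷ V ▷ W ⊗≫ V ◁ ((V' ⊗ V) ◁ η_ W W' ▷ W ⊗≫ (c.ι V V' ▷ W ≫
          (β_ F W).hom) ▷ (W' ⊗ W)) ⊗≫
         V ◁ ((W ⊗ F) ◁ c.ι W W') ⊗≫ (V ⊗ W) ◁ m := by
         rw [← whisker_exchange (c.ι V V'), whisker_exchange (β_ F W).hom]; monoidal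
    _ = 𝟙 _ ⊗≫ η_ V V' ▷ V ▷ W ⊗≫ V ◁ ((V' ⊗ V) ◁ η_ W W' ▷ W ⊗≫ (β_ (V' ⊗ V) W).hom ▷ (W' ⊗ W)) ⊗≫
         V ◁ W ◁ (c.ι V V' ▷ (W' ⊗ W) ≫ F ◁ c.ι W W' ≫ m) ⊗≫ 𝟙 _ := by
         rw [braiding_naturality_left]; monoidal
    _ = 𝟙 _ ⊗≫ η_ V V' ▷ V ▷ W ⊗≫ V ◁ ((V' ⊗ V) ◁ η_ W W' ≫ (α_ (V' ⊗ V) W W').inv ≫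
       (β_ (V' ⊗ V) W).hom ▷ W' ≫ (α_ W (V' ⊗ V) W').hom ≫
         W ◁ (β_ (V' ⊗ V) W').hom ≫ (α_ W W' (V' ⊗ V)).inv) ▷ W
         ⊗≫ V ◁ W ◁ c.ι (V ⊗ W) (W' ⊗ V') ⊗≫ 𝟙 _ := by
         rw [h2]; monoidal
    _ = (λ_ (V ⊗ W)).inv ≫ η_ (V ⊗ W) (W' ⊗ V') ▷ (V ⊗ W) ≫ (α_ (V ⊗ W) (W' ⊗ V') (V ⊗ W)).hom ≫
          (V ⊗ W) ◁ c.ι (V ⊗ W) (W' ⊗ V') := by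
         rw [h3, tensor_coevaluation, braiding_tensorUnit_right]
         monoidal
    _ = _ := by rw [coev_ι]; simp

/-- The operations `m, u, Δ, e` on `F` turn the natural coaction `c` into a monoidal family of
comodule structures: `F` coacts on `V ⊗ W` through `m` and on the unit through `u`, and the coaction
on every `V` is coassociative for `Δ` and counital for `e`. -/
structure Structure (m : F ⊗ F ⟶ F) (u : 𝟙_ C ⟶ F) (Δ : F ⟶ F ⊗ F) (e : F ⟶ 𝟙_ C) : Prop where
  mul : ∀ V W, c.δ (V ⊗ W) =
    c.δ V ▷ W ≫ (α_ V F W).hom ≫ V ◁ F ◁ c.δ W ≫ V ◁ (α_ F W F).inv ≫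
      V ◁ (β_ F W).hom ▷ F ≫ V ◁ (α_ W F F).hom ≫ V ◁ W ◁ m ≫ (α_ V W F).inv
  one : c.δ (𝟙_ C) ≫ (λ_ F).hom = u
  comul : ∀ V, c.δ V ≫ V ◁ Δ = c.δ V ≫ c.δ V ▷ F ≫ (α_ V F F).hom
  counit : ∀ V, c.δ V ≫ V ◁ e = (ρ_ V).inv

variable {c} {m : F ⊗ F ⟶ F} {u : 𝟙_ C ⟶ F} {Δ : F ⟶ F ⊗ F} {e : F ⟶ 𝟙_ C}

namespace Structure
variable (D : c.Structure m u Δ e)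
include D

/-- The product of two matrix coefficients is a matrix coefficient of the tensor product. -/
theorem ι_mul : c.ι V V' ▷ (W' ⊗ W) ≫ F ◁ c.ι W W' ≫ m =
      (α_ (V' ⊗ V) W' W).inv ≫ (β_ (V' ⊗ V) W').hom ▷ W ≫ (α_ W' (V' ⊗ V) W).hom ≫
        W' ◁ (α_ V' V W).hom ≫ (α_ W' V' (V ⊗ W)).inv ≫ c.ι (V ⊗ W) (W' ⊗ V') := by
  symm
  calc _ = 𝟙 _ ⊗≫ (β_ (V' ⊗ V) W').hom ▷ W ⊗≫ W' ◁ V' ◁ (c.δ V ▷ W ≫ (α_ V F W).hom ≫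
          V ◁ F ◁ c.δ W ≫ V ◁ (α_ F W F).inv ≫
            V ◁ (β_ F W).hom ▷ F ≫ V ◁ (α_ W F F).hom ≫ V ◁ W ◁ m ≫ (α_ V W F).inv) ⊗≫
            ε_ (V ⊗ W) (W' ⊗ V') ▷ F ⊗≫ 𝟙 _ := by
          rw [← D.mul]; dsimp only [ι]; monoidal
    _ = 𝟙 _ ⊗≫ (β_ (V' ⊗ V) W').hom ▷ W ⊗≫ W' ◁ (V' ◁ c.δ V) ▷ W ⊗≫
           W' ◁ (((V' ⊗ V) ◁ F ◁ c.δ W ⊗≫ (V' ⊗ V) ◁ (β_ F W).hom ▷ F ⊗≫ (V' ⊗ V) ◁ (W ◁ m)) ≫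
            ε_ V V' ▷ (W ⊗ F)) ⊗≫
            ε_ W W' ▷ F ⊗≫ 𝟙 _ := by
          rw [tensor_evaluation]; monoidal
    _ = 𝟙 _ ⊗≫ (β_ (V' ⊗ V) W').hom ▷ W ⊗≫ W' ◁ (V' ◁ c.δ V) ▷ W ⊗≫
           W' ◁ ((V' ⊗ V) ◁ (F ◁ c.δ W ⊗≫ (β_ F W).hom ▷ F ⊗≫ (W ◁ m)) ≫
            ε_ V V' ▷ (W ⊗ F)) ⊗≫
            ε_ W W' ▷ F ⊗≫ 𝟙 _ := by
          monoidal
    _ = 𝟙 _ ⊗≫ ((β_ (V' ⊗ V) W').hom ≫ W' ◁ c.ι V V') ▷ W ⊗≫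
           W' ◁ (F ◁ c.δ W ⊗≫ (β_ F W).hom ▷ F) ⊗≫ ((W' ⊗ W) ◁ m ≫ ε_ W W' ▷ F) ⊗≫ 𝟙 _ := by
          rw [whisker_exchange]; dsimp only [ι]; monoidal
    _ = 𝟙 _ ⊗≫ (c.ι V V' ▷ W') ▷ W ⊗≫ ((β_ F W').hom ▷ W ≫ (W' ⊗ F) ◁ c.δ W) ⊗≫
          W' ◁ (β_ F W).hom ▷ F ⊗≫
            ε_ W W' ▷ (F ⊗ F) ⊗≫ m ⊗≫ 𝟙 _ := by
          rw [← braiding_naturality_left, whisker_exchange]; monoidal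
    _ = 𝟙 _ ⊗≫ (c.ι V V' ▷ W') ▷ W ⊗≫ (F ⊗ W') ◁ c.δ W ⊗≫
          ((α_ F W' W).inv ≫ (β_ F W').hom ▷ W ≫ (α_ W' F W).hom ≫ W' ◁ (β_ F W).hom ≫
          (α_ W' W F).inv ≫
            ε_ W W' ▷ F) ▷ F ⊗≫ m ⊗≫ 𝟙 _ := by
          rw [← whisker_exchange]; monoidal
    _ = _ := by
          have := (braiding_naturality_right F (ε_ W W'))
          rw [braiding_tensor_right_hom] at this
          simp only [Category.assoc] at this
          rw [← this, braiding_tensorUnit_right]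
          dsimp only [ι]; monoidal

end Structure

end NatCoaction
end BraidedReconstruction

end

/-! ### Algebra and coalgebra axioms on coefficients -/

section

open CategoryTheory MonoidalCategory BraidedCategory ExactPairing
namespace BraidedReconstruction
universe v u
variable {C : Type u} [Category.{v} C] [MonoidalCategory C]
namespace NatCoaction
variable {F : C}
variable (U U' V V' W W' : C) [ExactPairing U U'] [ExactPairing V V'] [ExactPairing W W']
variable [BraidedCategory C]
variable {c : NatCoaction F} {m : F ⊗ F ⟶ F} {u : 𝟙_ C ⟶ F} {Δ : F ⟶ F ⊗ F} {e : F ⟶ 𝟙_ C}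

namespace Structure
variable (D : c.Structure m u Δ e)
include D

theorem ι_comul : c.ι V V' ≫ Δ = V' ◁ c.δ V ≫ (α_ _ _ _).inv ≫ c.ι V V' ▷ F := by
  rw [ι_comp, D.comul]; dsimp only [ι]; monoidal

/-- The usual formula for the comultiplication of matrix coefficients: insert a pair of dual bases.
-/
theorem ι_comul' : c.ι V V' ≫ Δ = 𝟙 _ ⊗≫ V' ◁ η_ V V' ▷ V ⊗≫
    c.ι V V' ▷ (V' ⊗ V) ≫ F ◁ c.ι V V' := by
  rw [D.ι_comul V V', ← whisker_exchange, c.δ_eq V V']; monoidal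

theorem ι_counit : c.ι V V' ≫ e = ε_ V V' := by
  rw [ι_comp, D.counit]; monoidal

/-- Associativity of the product, tested on coefficients: both sides are coefficients of
`U ⊗ V ⊗ W`, and they agree by naturality of the braiding and of the coaction along the
associator. -/
theorem ι_mul_assoc : c.ι U U' ▷ ((V' ⊗ V) ⊗ (W' ⊗ W)) ≫ F ◁ c.ι V V' ▷ (W' ⊗ W) ≫
      F ◁ F ◁ c.ι W W' ≫ (α_ F F F).inv ≫ m ▷ F ≫ m =
    c.ι U U' ▷ ((V' ⊗ V) ⊗ (W' ⊗ W)) ≫ F ◁ c.ι V V' ▷ (W' ⊗ W) ≫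
      F ◁ F ◁ c.ι W W' ≫ F ◁ m ≫ m := by
  have hn := braiding_naturality_left ((α_ (U' ⊗ U) V' V).inv ≫ (β_ (U' ⊗ U) V').hom ▷ V ≫
    𝟙 _ ⊗≫ 𝟙 ((V' ⊗ U') ⊗ (U ⊗ V))) W'
  rw [braiding_tensor_left_hom (U' ⊗ U) (V' ⊗ V) W'] at hn
  have ha := c.naturality (α_ U V W).hom
  calc _ = 𝟙 _ ⊗≫ (c.ι U U' ▷ (V' ⊗ V) ≫ F ◁ c.ι V V' ≫ m) ▷ (W' ⊗ W) ⊗≫ F ◁ c.ι W W' ≫ m := by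
        rw [comp_whiskerRight, comp_whiskerRight]
        calc _ = 𝟙 _ ⊗≫ c.ι U U' ▷ ((V' ⊗ V) ⊗ (W' ⊗ W)) ⊗≫ F ◁ c.ι V V' ▷ (W' ⊗ W) ⊗≫
              ((F ⊗ F) ◁ c.ι W W' ≫ m ▷ F) ≫ m := by monoidal
          _ = _ := by rw [whisker_exchange]; monoidal
    _ = 𝟙 _ ⊗≫ (β_ (U' ⊗ U) V').hom ▷ (V ⊗ W' ⊗ W) ⊗≫
          (c.ι (U ⊗ V) (V' ⊗ U') ▷ (W' ⊗ W) ≫ F ◁ c.ι W W' ≫ m) := by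
        rw [D.ι_mul U U' V V']; monoidal
    _ = 𝟙 _ ⊗≫ (((α_ (U' ⊗ U) V' V).inv ≫ (β_ (U' ⊗ U) V').hom ▷ V ≫
    𝟙 _ ⊗≫ 𝟙 ((V' ⊗ U') ⊗ (U ⊗ V))) ▷ W' ≫ (β_ ((V' ⊗ U') ⊗ (U ⊗ V)) W').hom) ▷ W ⊗≫
          W' ◁ (V' ⊗ U') ◁ c.δ ((U ⊗ V) ⊗ W) ⊗≫
            ε_ ((U ⊗ V) ⊗ W) (W' ⊗ V' ⊗ U') ▷ F ⊗≫ 𝟙 _ := by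
        rw [D.ι_mul (U ⊗ V) (V' ⊗ U') W W']; dsimp only [ι]; monoidal
    _ = 𝟙 _ ⊗≫ ((U' ⊗ U) ◁ (β_ (V' ⊗ V) W').hom ⊗≫ (β_ (U' ⊗ U) W').hom ▷ (V' ⊗ V) ⊗≫
           W' ◁ (β_ (U' ⊗ U) V').hom ▷ V) ▷ W ⊗≫
          W' ◁ (V' ⊗ U') ◁ (c.δ ((U ⊗ V) ⊗ W) ≫ (α_ U V W).hom ▷ F) ⊗≫
            ε_ (U ⊗ (V ⊗ W)) ((W' ⊗ V') ⊗ U') ▷ F ⊗≫ 𝟙 _ := by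
        rw [hn, tensor_evaluation, tensor_evaluation, tensor_evaluation,
          tensor_evaluation]; monoidal
    _ = 𝟙 _ ⊗≫ (U' ⊗ U) ◁ (β_ (V' ⊗ V) W').hom ▷ W ⊗≫ (β_ (U' ⊗ U) (W' ⊗ V')).hom ▷ (V ⊗ W) ⊗≫
          c.ι (U ⊗ (V ⊗ W)) ((W' ⊗ V') ⊗ U') := by
        rw [ha, braiding_tensor_right_hom]; dsimp only [ι]; monoidal
    _ = 𝟙 _ ⊗≫ ((U' ⊗ U) ◁ ((β_ (V' ⊗ V) W').hom ▷ W ⊗≫ 𝟙 ((W' ⊗ V') ⊗ (V ⊗ W)))) ≫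
          c.ι U U' ▷ ((W' ⊗ V') ⊗ (V ⊗ W)) ≫
          F ◁ c.ι (V ⊗ W) (W' ⊗ V') ≫ m := by
        rw [D.ι_mul U U' (V ⊗ W) (W' ⊗ V')]; monoidal
    _ = 𝟙 _ ⊗≫ c.ι U U' ▷ ((V' ⊗ V) ⊗ (W' ⊗ W)) ⊗≫
          F ◁ ((α_ (V' ⊗ V) W' W).inv ≫ (β_ (V' ⊗ V) W').hom ▷ W ≫ (α_ W' (V' ⊗ V) W).hom ≫
        W' ◁ (α_ V' V W).hom ≫ (α_ W' V' (V ⊗ W)).inv ≫ c.ι (V ⊗ W) (W' ⊗ V')) ≫ m := by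
        rw [whisker_exchange_assoc]; monoidal
    _ = _ := by rw [← D.ι_mul V V' W W']; monoidal

theorem ι_one_mul : c.ι V V' ≫ (λ_ F).inv ≫ u ▷ F ≫ m = c.ι V V' := by
  have h : c.δ V ≫ V ◁ ((λ_ F).inv ≫ u ▷ F ≫ m) = c.δ V ≫ V ◁ 𝟙 F := by
    have h1 := c.naturality (λ_ V).hom
    rw [D.mul] at h1
    have h2 : c.δ (𝟙_ C) = u ≫ (λ_ F).inv := by rw [← D.one]; simp
    rw [h2] at h1
    have h3 := braiding_naturality_left u V
    rw [braiding_tensorUnit_left] at h3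
    calc _ = 𝟙 _ ⊗≫ c.δ V ⊗≫ ((λ_ V).hom ≫ (ρ_ V).inv ≫ V ◁ u) ▷ F ⊗≫ V ◁ m := by monoidal
      _ = (λ_ V).inv ≫ ((𝟙_ C) ◁ c.δ V ≫ u ▷ (V ⊗ F)) ⊗≫ (β_ F V).hom ▷ F ⊗≫ V ◁ m := by
          rw [Category.assoc] at h3; rw [← h3]; monoidal
      _ = (λ_ V).inv ≫ ((u ≫ (λ_ F).inv) ▷ V ≫ (α_ (𝟙_ C) F V).hom ≫ 𝟙_ C ◁ F ◁ c.δ V ≫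
          𝟙_ C ◁ (α_ F V F).inv ≫ 𝟙_ C ◁ (β_ F V).hom ▷ F ≫ 𝟙_ C ◁ (α_ V F F).hom ≫
          𝟙_ C ◁ V ◁ m ≫ (α_ (𝟙_ C) V F).inv) ≫ (λ_ V).hom ▷ F := by rw [whisker_exchange]; monoidal
      _ = _ := by rw [h1]; simp
  simpa using c.ι_congr V V' h

theorem ι_mul_one : c.ι V V' ≫ (ρ_ F).inv ≫ F ◁ u ≫ m = c.ι V V' := by
  have h : c.δ V ≫ V ◁ ((ρ_ F).inv ≫ F ◁ u ≫ m) = c.δ V ≫ V ◁ 𝟙 F := by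
    have h1 := c.naturality (ρ_ V).hom
    rw [D.mul] at h1
    have h2 : c.δ (𝟙_ C) = u ≫ (λ_ F).inv := by rw [← D.one]; simp
    rw [h2] at h1
    calc _ = (ρ_ V).inv ≫ (c.δ V ▷ 𝟙_ C ≫ (α_ V F (𝟙_ C)).hom ≫ V ◁ F ◁ (u ≫ (λ_ F).inv) ≫
          V ◁ (α_ F (𝟙_ C) F).inv ≫ V ◁ (β_ F (𝟙_ C)).hom ▷ F ≫ V ◁ (α_ (𝟙_ C) F F).hom ≫
          V ◁ 𝟙_ C ◁ m ≫ (α_ V (𝟙_ C) F).inv) ≫ (ρ_ V).hom ▷ F := by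
              rw [braiding_tensorUnit_right]; monoidal
      _ = _ := by rw [h1]; simp
  simpa using c.ι_congr V V' h

theorem ι_comul_coassoc : c.ι V V' ≫ Δ ≫ Δ ▷ F ≫ (α_ F F F).hom = c.ι V V' ≫ Δ ≫ F ◁ Δ := by
  apply c.ι_congr
  have h := D.comul V
  calc _ = (c.δ V ≫ V ◁ Δ) ≫ V ◁ (Δ ▷ F ≫ (α_ F F F).hom) := by monoidal
    _ = c.δ V ≫ (c.δ V ≫ V ◁ Δ) ▷ F ⊗≫ 𝟙 _ := by
      calc _ = (c.δ V ≫ c.δ V ▷ F ≫ (α_ V F F).hom) ≫ V ◁ (Δ ▷ F ≫ (α_ F F F).hom) := by rw [h]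
        _ = _ := by monoidal
    _ = c.δ V ≫ (c.δ V ▷ F) ≫ (c.δ V ▷ F) ▷ F ⊗≫ 𝟙 _ := by rw [h]; monoidal
    _ = c.δ V ≫ (c.δ V ▷ F ≫ (V ⊗ F) ◁ Δ) ⊗≫ 𝟙 _ := by
      calc _ = (c.δ V ≫ c.δ V ▷ F ≫ (α_ V F F).hom) ⊗≫ c.δ V ▷ (F ⊗ F) ⊗≫ 𝟙 _ := by monoidal
        _ = c.δ V ≫ (V ◁ Δ ≫ c.δ V ▷ (F ⊗ F)) ⊗≫ 𝟙 _ := by rw [← h]; monoidal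
        _ = _ := by rw [whisker_exchange]
    _ = (c.δ V ≫ c.δ V ▷ F ≫ (α_ V F F).hom) ≫ V ◁ F ◁ Δ := by monoidal
    _ = _ := by rw [← h]; monoidal

theorem ι_counit_comul : c.ι V V' ≫ Δ ≫ e ▷ F ≫ (λ_ F).hom = c.ι V V' := by
  have h : c.δ V ≫ V ◁ (Δ ≫ e ▷ F ≫ (λ_ F).hom) = c.δ V ≫ V ◁ 𝟙 F := by
    calc _ = (c.δ V ≫ V ◁ Δ) ≫ V ◁ (e ▷ F ≫ (λ_ F).hom) := by monoidal
      _ = c.δ V ≫ (c.δ V ≫ V ◁ e) ▷ F ⊗≫ 𝟙 _ := by rw [D.comul]; monoidal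
      _ = _ := by rw [D.counit]; monoidal
  simpa using c.ι_congr V V' h

theorem ι_comul_counit : c.ι V V' ≫ Δ ≫ F ◁ e ≫ (ρ_ F).hom = c.ι V V' := by
  have h : c.δ V ≫ V ◁ (Δ ≫ F ◁ e ≫ (ρ_ F).hom) = c.δ V ≫ V ◁ 𝟙 F := by
    calc _ = (c.δ V ≫ V ◁ Δ) ≫ V ◁ (F ◁ e ≫ (ρ_ F).hom) := by monoidal
      _ = c.δ V ≫ (c.δ V ▷ F ≫ (V ⊗ F) ◁ e) ⊗≫ 𝟙 _ := by rw [D.comul]; monoidal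
      _ = (c.δ V ≫ V ◁ e) ≫ c.δ V ▷ 𝟙_ C ⊗≫ 𝟙 _ := by rw [← whisker_exchange]; monoidal
      _ = _ := by rw [D.counit]; monoidal
  simpa using c.ι_congr V V' h

theorem counit_one : u ≫ e = 𝟙 _ := by
  have h := D.counit (𝟙_ C)
  rw [← D.one]
  calc _ = (c.δ (𝟙_ C) ≫ 𝟙_ C ◁ e) ⊗≫ 𝟙 _ := by monoidal
    _ = _ := by rw [h]; monoidal

theorem comul_one : u ≫ Δ = (λ_ _).inv ≫ u ▷ (𝟙_ C) ≫ F ◁ u := by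
  have h := D.comul (𝟙_ C)
  have h2 : c.δ (𝟙_ C) = u ≫ (λ_ F).inv := by rw [← D.one]; simp
  rw [h2] at h
  calc _ = 𝟙 _ ⊗≫ ((u ≫ (λ_ F).inv) ≫ 𝟙_ C ◁ Δ) ⊗≫ 𝟙 _ := by monoidal
    _ = u ⊗≫ u ▷ F ⊗≫ 𝟙 _ := by rw [h]; monoidal
    _ = 𝟙 _ ⊗≫ (𝟙_ C ◁ u ≫ u ▷ F) ⊗≫ 𝟙 _ := by monoidal
    _ = _ := by rw [whisker_exchange]; monoidal

theorem ι_counit_mul : c.ι V V' ▷ (W' ⊗ W) ≫ F ◁ c.ι W W' ≫ m ≫ e =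
    c.ι V V' ▷ (W' ⊗ W) ≫ F ◁ c.ι W W' ≫ e ▷ F ≫ (λ_ F).hom ≫ e := by
  have h1 : ε_ V V' ▷ W' ≫ (β_ (𝟙_ C) W').hom = _ := (braiding_naturality_left (ε_ V V') W')
  calc _ = (c.ι V V' ▷ (W' ⊗ W) ≫ F ◁ c.ι W W' ≫ m) ≫ e := by monoidal
    _ = 𝟙 _ ⊗≫ (β_ (V' ⊗ V) W').hom ▷ W ⊗≫ c.ι (V ⊗ W) (W' ⊗ V') ≫ e := by
        rw [D.ι_mul V V' W W']; monoidal
    _ = 𝟙 _ ⊗≫ ((β_ (V' ⊗ V) W').hom ≫ W' ◁ ε_ V V') ▷ W ⊗≫ ε_ W W' := by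
        rw [D.ι_counit (V ⊗ W) (W' ⊗ V'), tensor_evaluation]; monoidal
    _ = 𝟙 _ ⊗≫ ε_ V V' ▷ (W' ⊗ W) ⊗≫ ε_ W W' := by
        rw [← h1, braiding_tensorUnit_left]; monoidal
    _ = (c.ι V V' ≫ e) ▷ (W' ⊗ W) ⊗≫ (c.ι W W' ≫ e) := by
        rw [D.ι_counit V V', D.ι_counit W W']; monoidal
    _ = c.ι V V' ▷ (W' ⊗ W) ⊗≫ (e ▷ (W' ⊗ W) ≫ 𝟙_ C ◁ c.ι W W') ⊗≫ e := by monoidal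
    _ = _ := by rw [← whisker_exchange]; monoidal

end Structure
end NatCoaction
end BraidedReconstruction

end

/-! ### Compatibility of product and coproduct, and the antipode -/

section

open CategoryTheory MonoidalCategory BraidedCategory ExactPairing
namespace BraidedReconstruction
universe v u
variable {C : Type u} [Category.{v} C] [MonoidalCategory C]
namespace NatCoaction
variable {F : C}
variable (U U' V V' W W' : C) [ExactPairing U U'] [ExactPairing V V'] [ExactPairing W W']
variable [BraidedCategory C]
variable {c : NatCoaction F} {m : F ⊗ F ⟶ F} {u : 𝟙_ C ⟶ F} {Δ : F ⟶ F ⊗ F} {e : F ⟶ 𝟙_ C}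

theorem braiding_whisker {X Y X₂ Y₂ : C} (f : X ⟶ X₂) (g : Y ⟶ Y₂) :
    f ▷ Y ≫ X₂ ◁ g ≫ (β_ X₂ Y₂).hom = (β_ X Y).hom ≫ g ▷ X ≫ Y₂ ◁ f := by
  rw [braiding_naturality_right, braiding_naturality_left_assoc, whisker_exchange]

namespace Structure
variable (D : c.Structure m u Δ e)
include D

/-- Compatibility of product and coproduct, tested on coefficients. The coproduct inserts a
coevaluation; sliding the coevaluations of `V` and `W` through the braidings joins them to the
coevaluation of `V ⊗ W`. -/
theorem ι_comul_mul : c.ι V V' ▷ (W' ⊗ W) ≫ F ◁ c.ι W W' ≫ m ≫ Δ =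
    c.ι V V' ▷ (W' ⊗ W) ≫ F ◁ c.ι W W' ≫ Δ ▷ F ≫ (F ⊗ F) ◁ Δ ≫ (α_ F F (F ⊗ F)).hom ≫
      F ◁ (α_ F F F).inv ≫ F ◁ (β_ F F).hom ▷ F ≫ F ◁ (α_ F F F).hom ≫ (α_ F F (F ⊗ F)).inv ≫
      m ▷ (F ⊗ F) ≫ F ◁ m := by
  symm
  have hb1 : (β_ (V' ⊗ V) (W' ⊗ W)).hom ≫ c.ι W W' ▷ (V' ⊗ V) ≫ F ◁ c.ι V V' = _ :=
    (braiding_whisker (c.ι V V') (c.ι W W')).symm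
  have hb2 := braiding_naturality_right (V' ⊗ V) (η_ W W')
  rw [braiding_tensor_right_hom, braiding_tensorUnit_right] at hb2
  have hb3 := braiding_naturality_left ((ρ_ V').inv ▷ V ≫ (V' ◁ η_ V V') ▷ V ≫
    (α_ V' V V').inv ▷ V ≫ (α_ (V' ⊗ V) V' V).hom) W'
  rw [braiding_tensor_left_hom (V' ⊗ V) (V' ⊗ V) W'] at hb3
  calc _ = 𝟙 _ ⊗≫ c.ι V V' ▷ (W' ⊗ W) ⊗≫ (F ◁ c.ι W W' ≫ Δ ▷ F) ≫ (F ⊗ F) ◁ Δ ⊗≫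
        F ◁ (β_ F F).hom ▷ F ⊗≫ m ▷ (F ⊗ F) ⊗≫ F ◁ m := by monoidal
    _ = 𝟙 _ ⊗≫ (c.ι V V' ≫ Δ) ▷ (W' ⊗ W) ⊗≫ (F ⊗ F) ◁ (c.ι W W' ≫ Δ) ⊗≫
        F ◁ (β_ F F).hom ▷ F ⊗≫ m ▷ (F ⊗ F) ⊗≫ F ◁ m := by
        rw [whisker_exchange]; monoidal
    _ = 𝟙 _ ⊗≫ V' ◁ η_ V V' ▷ (V ⊗ W' ⊗ W) ⊗≫ c.ι V V' ▷ (V' ⊗ V ⊗ W' ⊗ W) ⊗≫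
        F ◁ (c.ι V V' ▷ (W' ⊗ (𝟙_ C) ⊗ W) ≫ F ◁ W' ◁ η_ W W' ▷ W) ⊗≫
        (F ⊗ F) ◁ (c.ι W W' ▷ (W' ⊗ W) ≫ F ◁ c.ι W W') ⊗≫
        F ◁ (β_ F F).hom ▷ F ⊗≫ m ▷ (F ⊗ F) ⊗≫ F ◁ m := by
        rw [D.ι_comul' V V', D.ι_comul' W W']; monoidal
    _ = 𝟙 _ ⊗≫ V' ◁ η_ V V' ▷ (V ⊗ W' ⊗ W) ⊗≫ (c.ι V V' ▷ ((V' ⊗ V) ⊗ W' ⊗ (𝟙_ C) ⊗ W) ≫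
        F ◁ (V' ⊗ V) ◁ W' ◁ η_ W W' ▷ W) ⊗≫ F ◁ c.ι V V' ▷ (W' ⊗ W ⊗ W' ⊗ W) ⊗≫
        F ◁ F ◁ c.ι W W' ▷ (W' ⊗ W) ⊗≫ (F ⊗ F) ◁ F ◁ c.ι W W' ⊗≫
        F ◁ (β_ F F).hom ▷ F ⊗≫ m ▷ (F ⊗ F) ⊗≫ F ◁ m := by
        rw [← whisker_exchange]; monoidal
    _ = 𝟙 _ ⊗≫ V' ◁ η_ V V' ▷ (V ⊗ W' ⊗ W) ⊗≫
        (V' ⊗ V) ◁ (V' ⊗ V) ◁ W' ◁ η_ W W' ▷ W ⊗≫ c.ι V V' ▷ (V' ⊗ V ⊗ W' ⊗ W ⊗ W' ⊗ W) ⊗≫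
        F ◁ c.ι V V' ▷ (W' ⊗ W ⊗ W' ⊗ W) ⊗≫
        F ◁ F ◁ c.ι W W' ▷ (W' ⊗ W) ⊗≫ F ◁ ((F ⊗ F) ◁ c.ι W W' ≫
        (β_ F F).hom ▷ F) ⊗≫ m ▷ (F ⊗ F) ⊗≫ F ◁ m := by
        rw [← whisker_exchange]; monoidal
    _ = 𝟙 _ ⊗≫ V' ◁ η_ V V' ▷ (V ⊗ W' ⊗ W) ⊗≫
        (V' ⊗ V) ◁ (V' ⊗ V) ◁ W' ◁ η_ W W' ▷ W ⊗≫ c.ι V V' ▷ (V' ⊗ V ⊗ W' ⊗ W ⊗ W' ⊗ W) ⊗≫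
        F ◁ (c.ι V V' ▷ (W' ⊗ W) ≫ F ◁ c.ι W W' ≫ (β_ F F).hom) ▷ (W' ⊗ W) ⊗≫
        F ◁ F ◁ F ◁ c.ι W W' ⊗≫ m ▷ (F ⊗ F) ⊗≫ F ◁ m := by
        rw [whisker_exchange]; monoidal
    _ = 𝟙 _ ⊗≫ V' ◁ η_ V V' ▷ (V ⊗ W' ⊗ W) ⊗≫
        (V' ⊗ V) ◁ (V' ⊗ V) ◁ W' ◁ η_ W W' ▷ W ⊗≫ (c.ι V V' ▷ ((V' ⊗ V) ⊗ (W' ⊗ W)) ≫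
        F ◁ (β_ (V' ⊗ V) (W' ⊗ W)).hom) ▷ (W' ⊗ W) ⊗≫ F ◁ c.ι W W' ▷ (V' ⊗ V) ▷ (W' ⊗ W) ⊗≫
          ((F ⊗ F) ◁ (c.ι V V' ▷ (W' ⊗ W) ≫ F ◁ c.ι W W') ≫ m ▷ (F ⊗ F)) ⊗≫ F ◁ m := by
        rw [← hb1]; monoidal
    _ = 𝟙 _ ⊗≫ V' ◁ η_ V V' ▷ (V ⊗ W' ⊗ W) ⊗≫
        (V' ⊗ V) ◁ (V' ⊗ V) ◁ W' ◁ η_ W W' ▷ W ⊗≫ ((V' ⊗ V) ◁ (β_ (V' ⊗ V) (W' ⊗ W)).hom) ▷ (W' ⊗ W)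
          ⊗≫ (c.ι V V' ▷ (W' ⊗ W) ≫ F ◁ c.ι W W') ▷ ((V' ⊗ V) ⊗ (W' ⊗ W)) ⊗≫
          ((F ⊗ F) ◁ (c.ι V V' ▷ (W' ⊗ W) ≫ F ◁ c.ι W W') ≫ m ▷ (F ⊗ F)) ⊗≫ F ◁ m := by
        rw [← whisker_exchange (c.ι V V') (β_ (V' ⊗ V) (W' ⊗ W)).hom]; monoidal
    _ = 𝟙 _ ⊗≫ V' ◁ η_ V V' ▷ (V ⊗ W' ⊗ W) ⊗≫
        (V' ⊗ V) ◁ (V' ⊗ V) ◁ W' ◁ η_ W W' ▷ W ⊗≫ ((V' ⊗ V) ◁ (β_ (V' ⊗ V) (W' ⊗ W)).hom) ▷ (W' ⊗ W)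
          ⊗≫ (c.ι V V' ▷ (W' ⊗ W) ≫ F ◁ c.ι W W' ≫ m) ▷ ((V' ⊗ V) ⊗ (W' ⊗ W)) ⊗≫
          F ◁ (c.ι V V' ▷ (W' ⊗ W) ≫ F ◁ c.ι W W' ≫ m) := by
        rw [whisker_exchange]; monoidal
    _ = 𝟙 _ ⊗≫ V' ◁ η_ V V' ▷ (V ⊗ W' ⊗ W) ⊗≫
        (V' ⊗ V) ◁ (V' ⊗ V) ◁ W' ◁ η_ W W' ▷ W ⊗≫ ((V' ⊗ V) ◁ (β_ (V' ⊗ V) (W' ⊗ W)).hom) ▷ (W' ⊗ W)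
          ⊗≫ (β_ (V' ⊗ V) W').hom ▷ W ▷ ((V' ⊗ V) ⊗ (W' ⊗ W)) ⊗≫
          (c.ι (V ⊗ W) (W' ⊗ V') ▷ ((V' ⊗ V) ⊗ W' ⊗ W) ≫
          F ◁ ((α_ (V' ⊗ V) W' W).inv ≫ (β_ (V' ⊗ V) W').hom ▷ W ≫ (α_ W' (V' ⊗ V) W).hom ≫
        W' ◁ (α_ V' V W).hom ≫ (α_ W' V' (V ⊗ W)).inv)) ≫ F ◁ c.ι (V ⊗ W) (W' ⊗ V') := by
        rw [D.ι_mul V V' W W']; monoidal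
    _ = 𝟙 _ ⊗≫ V' ◁ η_ V V' ▷ (V ⊗ W' ⊗ W) ⊗≫
        (V' ⊗ V) ◁ (V' ⊗ V) ◁ W' ◁ η_ W W' ▷ W ⊗≫
         ((V' ⊗ V) ◁ (β_ (V' ⊗ V) W').hom) ▷ (W ⊗ W' ⊗ W) ⊗≫
         ((V' ⊗ V) ⊗ W') ◁ (β_ (V' ⊗ V) W).hom ▷ (W' ⊗ W)
          ⊗≫ ((β_ (V' ⊗ V) W').hom ▷ (W ⊗ ((V' ⊗ V) ⊗ W')) ≫ (W' ⊗ (V' ⊗ V)) ◁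
            W ◁ (β_ (V' ⊗ V) W').hom) ▷ W ⊗≫
          c.ι (V ⊗ W) (W' ⊗ V') ▷ ((W' ⊗ V') ⊗ (V ⊗ W)) ≫ F ◁ c.ι (V ⊗ W) (W' ⊗ V') := by
        rw [← whisker_exchange, braiding_tensor_right_hom]; monoidal
    _ = 𝟙 _ ⊗≫ V' ◁ η_ V V' ▷ (V ⊗ W' ⊗ W) ⊗≫
         (V' ⊗ V) ◁ ((V' ⊗ V) ◁ W' ◁ η_ W W' ≫
          (V' ⊗ V) ◁ (α_ W' W W').inv ≫ (α_ (V' ⊗ V) (W' ⊗ W) W').inv ≫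
          (α_ (V' ⊗ V) W' W).inv ▷ W' ≫
         (β_ (V' ⊗ V) W').hom ▷ W ▷ W') ▷ W ⊗≫
         ((V' ⊗ V) ⊗ W') ◁ (β_ (V' ⊗ V) W).hom ▷ (W' ⊗ W)
          ⊗≫ ((V' ⊗ V) ⊗ W') ◁ W ◁ (β_ (V' ⊗ V) W').hom ▷ W ⊗≫
            (β_ (V' ⊗ V) W').hom ▷ (W ⊗ W' ⊗ (V' ⊗ V)) ▷ W ⊗≫
          c.ι (V ⊗ W) (W' ⊗ V') ▷ ((W' ⊗ V') ⊗ (V ⊗ W)) ≫ F ◁ c.ι (V ⊗ W) (W' ⊗ V') := by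
        rw [← whisker_exchange (β_ (V' ⊗ V) W').hom]; monoidal
    _ = 𝟙 _ ⊗≫ V' ◁ η_ V V' ▷ (V ⊗ W' ⊗ W) ⊗≫
         (V' ⊗ V) ◁ (((V' ⊗ V) ⊗ W') ◁ η_ W W' ≫
         (β_ (V' ⊗ V) W').hom ▷ (W ⊗ W')) ▷ W ⊗≫
         ((V' ⊗ V) ⊗ W') ◁ (β_ (V' ⊗ V) W).hom ▷ (W' ⊗ W)
          ⊗≫ ((V' ⊗ V) ⊗ W') ◁ W ◁ (β_ (V' ⊗ V) W').hom ▷ W ⊗≫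
            (β_ (V' ⊗ V) W').hom ▷ (W ⊗ W' ⊗ (V' ⊗ V)) ▷ W ⊗≫
          c.ι (V ⊗ W) (W' ⊗ V') ▷ ((W' ⊗ V') ⊗ (V ⊗ W)) ≫ F ◁ c.ι (V ⊗ W) (W' ⊗ V') := by
        monoidal
    _ = 𝟙 _ ⊗≫ V' ◁ η_ V V' ▷ (V ⊗ W' ⊗ W) ⊗≫
         (V' ⊗ V) ◁ (β_ (V' ⊗ V) W').hom ▷ W ⊗≫
         ((V' ⊗ V) ⊗ W') ◁ ((V' ⊗ V) ◁ η_ W W' ≫ (α_ (V' ⊗ V) W W').inv ≫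
       (β_ (V' ⊗ V) W).hom ▷ W' ≫ (α_ W (V' ⊗ V) W').hom ≫
         W ◁ (β_ (V' ⊗ V) W').hom ≫ (α_ W W' (V' ⊗ V)).inv) ▷ W ⊗≫
            (β_ (V' ⊗ V) W').hom ▷ (W ⊗ W' ⊗ (V' ⊗ V)) ▷ W ⊗≫
          c.ι (V ⊗ W) (W' ⊗ V') ▷ ((W' ⊗ V') ⊗ (V ⊗ W)) ≫ F ◁ c.ι (V ⊗ W) (W' ⊗ V') := by
        rw [whisker_exchange]; monoidal
    _ = 𝟙 _ ⊗≫ V' ◁ η_ V V' ▷ (V ⊗ W' ⊗ W) ⊗≫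
         (V' ⊗ V) ◁ (β_ (V' ⊗ V) W').hom ▷ W ⊗≫
         (((V' ⊗ V) ⊗ W') ◁ (η_ W W' ▷ (V' ⊗ V)) ≫
            (β_ (V' ⊗ V) W').hom ▷ ((W ⊗ W') ⊗ (V' ⊗ V))) ▷ W ⊗≫
          c.ι (V ⊗ W) (W' ⊗ V') ▷ ((W' ⊗ V') ⊗ (V ⊗ W)) ≫ F ◁ c.ι (V ⊗ W) (W' ⊗ V') := by
        rw [hb2]; monoidal
    _ = 𝟙 _ ⊗≫ (((ρ_ V').inv ▷ V ≫ (V' ◁ η_ V V') ▷ V ≫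
    (α_ V' V V').inv ▷ V ≫ (α_ (V' ⊗ V) V' V).hom) ▷ W' ≫ (α_ (V' ⊗ V) (V' ⊗ V) W').hom ≫
        (V' ⊗ V) ◁ (β_ (V' ⊗ V) W').hom ≫
          (α_ (V' ⊗ V) W' (V' ⊗ V)).inv ≫ (β_ (V' ⊗ V) W').hom ▷ (V' ⊗ V) ≫
            (α_ W' (V' ⊗ V) (V' ⊗ V)).hom) ▷ W ⊗≫
          (W' ⊗ (V' ⊗ V)) ◁ (η_ W W' ▷ (V' ⊗ V)) ▷ W ⊗≫
          c.ι (V ⊗ W) (W' ⊗ V') ▷ ((W' ⊗ V') ⊗ (V ⊗ W)) ≫ F ◁ c.ι (V ⊗ W) (W' ⊗ V') := by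
        rw [whisker_exchange]; monoidal
    _ = 𝟙 _ ⊗≫ (β_ (V' ⊗ V) W').hom ▷ W ⊗≫
          (𝟙 ((W' ⊗ V') ⊗ (V ⊗ W)) ⊗≫ (W' ⊗ V') ◁ η_ (V ⊗ W) (W' ⊗ V') ▷ (V ⊗ W) ⊗≫
          c.ι (V ⊗ W) (W' ⊗ V') ▷ ((W' ⊗ V') ⊗ (V ⊗ W)) ≫ F ◁ c.ι (V ⊗ W) (W' ⊗ V')) := by
        rw [hb3, tensor_coevaluation]; monoidal
    _ = 𝟙 _ ⊗≫ (β_ (V' ⊗ V) W').hom ▷ W ⊗≫ (c.ι (V ⊗ W) (W' ⊗ V') ≫ Δ) := by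
        rw [D.ι_comul' (V ⊗ W) (W' ⊗ V')]; monoidal
    _ = (c.ι V V' ▷ (W' ⊗ W) ≫ F ◁ c.ι W W' ≫ m) ≫ Δ := by
        rw [D.ι_mul V V' W W']; monoidal
    _ = _ := by monoidal

/-- The left antipode axiom, tested on coefficients. The antipode sends a coefficient of `V` to the
corresponding coefficient of the dual `V'`, and naturality of the coaction along the evaluation
`V' ⊗ V ⟶ 𝟙` collapses the product. -/
theorem ι_antipode_left (S : F ⟶ F)
    (hS : c.ι V V' ≫ S = c.δ V' ▷ V ≫ (β_ F V').inv ▷ V ≫ (α_ F V' V).hom ≫ F ◁ ε_ V V' ≫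
      (ρ_ F).hom) :
    c.ι V V' ≫ Δ ≫ S ▷ F ≫ m = c.ι V V' ≫ e ≫ u := by
  calc _ = (c.ι V V' ≫ Δ) ≫ S ▷ F ≫ m := by simp
    _ = V' ◁ c.δ V ⊗≫ (c.ι V V' ≫ S) ▷ F ⊗≫ m := by
        rw [D.ι_comul V V']; monoidal
    _ = (V' ◁ c.δ V ≫ c.δ V' ▷ (V ⊗ F)) ⊗≫
          ((β_ F V').inv ▷ V ≫ (α_ F V' V).hom ≫ F ◁ ε_ V V') ▷ F ⊗≫ m := by
        rw [hS]; monoidal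
    _ = c.δ V' ▷ V ⊗≫ (V' ⊗ F) ◁ c.δ V ⊗≫
          (V' ◁ (β_ F V).hom ⊗≫ ε_ V V' ▷ F) ▷ F ⊗≫ m := by
        rw [braiding_eval, whisker_exchange]; monoidal
    _ = c.δ V' ▷ V ⊗≫ (V' ⊗ F) ◁ c.δ V ⊗≫
          V' ◁ (β_ F V).hom ▷ F ⊗≫ (ε_ V V' ▷ (F ⊗ F) ≫ 𝟙_ C ◁ m) ⊗≫ 𝟙 _ := by
        monoidal
    _ = (c.δ V' ▷ V ≫ (α_ V' F V).hom ≫ V' ◁ F ◁ c.δ V ≫ V' ◁ (α_ F V F).inv ≫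
      V' ◁ (β_ F V).hom ▷ F ≫ V' ◁ (α_ V F F).hom ≫ V' ◁ V ◁ m ≫ (α_ V' V F).inv) ≫ ε_ V V' ▷ F ⊗≫
      𝟙 _ := by
        rw [← whisker_exchange]; monoidal
    _ = (c.δ (V' ⊗ V) ≫ ε_ V V' ▷ F) ⊗≫ 𝟙 _ := by rw [← D.mul]; monoidal
    _ = ε_ V V' ≫ c.δ (𝟙_ C) ≫ (λ_ F).hom := by rw [c.naturality]; monoidal
    _ = (c.ι V V' ≫ e) ≫ u := by rw [D.one, D.ι_counit V V']
    _ = _ := by simp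

/-- The right antipode axiom, tested on coefficients, by naturality along the coevaluation
`𝟙 ⟶ V ⊗ V'`. -/
theorem ι_antipode_right (S : F ⟶ F)
    (hS : c.ι V V' ≫ S = c.δ V' ▷ V ≫ (β_ F V').inv ▷ V ≫ (α_ F V' V).hom ≫ F ◁ ε_ V V' ≫
      (ρ_ F).hom) :
    c.ι V V' ≫ Δ ≫ F ◁ S ≫ m = c.ι V V' ≫ e ≫ u := by
  have hn1 := braiding_inv_naturality_right V' m
  rw [braiding_tensor_left_inv] at hn1
  have hn2 := braiding_inv_naturality_right V' u
  rw [braiding_inv_tensorUnit_left] at hn2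
  have hnat := c.naturality (η_ V V')
  have h2 : c.δ (𝟙_ C) = u ≫ (λ_ F).inv := by rw [← D.one]; simp
  rw [D.mul V V', h2] at hnat
  have e1 : V ◁ (β_ F V').hom ▷ F ⊗≫ V ◁ (β_ F V').inv ▷ F ⊗≫ 𝟙 (V ⊗ (F ⊗ V') ⊗ F) = 𝟙 _ := by
    calc _ = V ◁ ((β_ F V').hom ≫ (β_ F V').inv) ▷ F ⊗≫ 𝟙 (V ⊗ (F ⊗ V') ⊗ F) := by monoidal
      _ = _ := by rw [Iso.hom_inv_id]; monoidal
  calc _ = (c.ι V V' ≫ Δ) ≫ F ◁ S ≫ m := by simp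
    _ = 𝟙 _ ⊗≫ V' ◁ η_ V V' ▷ V ⊗≫ c.ι V V' ▷ (V' ⊗ V) ≫ F ◁ (c.ι V V' ≫ S) ≫ m := by
        rw [D.ι_comul' V V']; monoidal
    _ = 𝟙 _ ⊗≫ V' ◁ η_ V V' ▷ V ⊗≫ (c.ι V V' ▷ (V' ⊗ V) ≫ F ◁ (c.δ V' ▷ V ≫ (β_ F V').inv ▷ V)) ⊗≫
         F ◁ F ◁ ε_ V V' ⊗≫ m := by
        rw [hS]; monoidal
    _ = 𝟙 _ ⊗≫ V' ◁ η_ V V' ▷ V ⊗≫ V' ◁ (V ◁ c.δ V' ≫ c.δ V ▷ (V' ⊗ F)) ▷ V ⊗≫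
          (V' ◁ (V ⊗ F) ◁ (β_ F V').inv ▷ V ⊗≫ ε_ V V' ▷ ((F ⊗ F) ⊗ V' ⊗ V)) ⊗≫
         F ◁ F ◁ ε_ V V' ⊗≫ m := by
        rw [← whisker_exchange]
        calc _ = 𝟙 _ ⊗≫ V' ◁ η_ V V' ▷ V ⊗≫ V' ◁ (V ◁ c.δ V' ▷ V) ⊗≫
               ((V' ⊗ V) ◁ (β_ F V').inv ▷ V ≫ (V' ◁ c.δ V) ▷ ((F ⊗ V') ⊗ V)) ⊗≫
               ε_ V V' ▷ (F ⊗ (F ⊗ V') ⊗ V)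
                 ⊗≫ F ◁ F ◁ ε_ V V' ⊗≫ m := by dsimp only [ι]; monoidal
          _ = _ := by rw [whisker_exchange]; monoidal
    _ = 𝟙 _ ⊗≫ V' ◁ η_ V V' ▷ V ⊗≫ V' ◁ (c.δ V ▷ V' ⊗≫ (V ⊗ F) ◁ c.δ V') ▷ V ⊗≫
          (V' ◁ V ◁ (F ◁ (β_ F V').inv ▷ V) ≫ V' ◁ V ◁ (𝟙 _ ⊗≫ 𝟙 ((F ⊗ F) ⊗ V' ⊗ V))) ⊗≫
          (ε_ V V' ▷ ((F ⊗ F) ⊗ V' ⊗ V) ≫ 𝟙_ C ◁ (F ⊗ F) ◁ ε_ V V') ⊗≫ m ⊗≫ 𝟙 _ := by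
        rw [whisker_exchange]; monoidal
    _ = 𝟙 _ ⊗≫ V' ◁ η_ V V' ▷ V ⊗≫ V' ◁ (c.δ V ▷ V' ⊗≫ (V ⊗ F) ◁ c.δ V') ▷ V ⊗≫
          V' ◁ V ◁ (F ◁ (β_ F V').inv ▷ V) ⊗≫
          (ε_ V V' ▷ ((F ⊗ F) ⊗ V' ⊗ V) ≫ 𝟙_ C ◁ m ▷ (V' ⊗ V)) ⊗≫ F ◁ ε_ V V' ⊗≫ 𝟙 _ := by
        calc _ = 𝟙 _ ⊗≫ V' ◁ η_ V V' ▷ V ⊗≫ V' ◁ (c.δ V ▷ V' ⊗≫ (V ⊗ F) ◁ c.δ V') ▷ V ⊗≫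
               V' ◁ V ◁ (F ◁ (β_ F V').inv ▷ V) ⊗≫
               ε_ V V' ▷ ((F ⊗ F) ⊗ V' ⊗ V) ⊗≫ ((F ⊗ F) ◁ ε_ V V' ≫ m ▷ 𝟙_ C) ⊗≫ 𝟙 _ := by monoidal
          _ = _ := by rw [whisker_exchange]; monoidal
    _ = 𝟙 _ ⊗≫ V' ◁ η_ V V' ▷ V ⊗≫ V' ◁ (c.δ V ▷ V' ⊗≫ (V ⊗ F) ◁ c.δ V') ▷ V ⊗≫
          V' ◁ (𝟙 ((V ⊗ F) ⊗ V' ⊗ F) ⊗≫ (V ◁ (β_ F V').hom ▷ F ⊗≫ V ◁ (β_ F V').inv ▷ F ⊗≫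
          𝟙 (V ⊗ (F ⊗ V') ⊗ F)) ⊗≫
            V ◁ F ◁ (β_ F V').inv) ▷ V ⊗≫
          V' ◁ V ◁ m ▷ (V' ⊗ V) ⊗≫ ε_ V V' ▷ (F ⊗ V' ⊗ V) ⊗≫ F ◁ ε_ V V' ⊗≫ 𝟙 _ := by
        rw [← whisker_exchange, e1]; monoidal
    _ = 𝟙 _ ⊗≫ V' ◁ η_ V V' ▷ V ⊗≫ V' ◁ (c.δ V ▷ V' ⊗≫ (V ⊗ F) ◁ c.δ V') ▷ V ⊗≫
          V' ◁ V ◁ (β_ F V').hom ▷ F ▷ V ⊗≫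
          V' ◁ V ◁ (((α_ V' F F).inv ≫ (β_ F V').inv ▷ F ≫ (α_ F V' F).hom ≫ F ◁ (β_ F V').inv ≫
            (α_ F F V').inv) ≫ m ▷ V') ▷ V ⊗≫
          ε_ V V' ▷ (F ⊗ V' ⊗ V) ⊗≫ F ◁ ε_ V V' ⊗≫ 𝟙 _ := by
        monoidal
    _ = 𝟙 _ ⊗≫ V' ◁ (η_ V V' ≫ c.δ V ▷ V' ≫ (α_ V F V').hom ≫ V ◁ F ◁ c.δ V' ≫ V ◁ (α_ F V' F).inv ≫
      V ◁ (β_ F V').hom ▷ F ≫ V ◁ (α_ V' F F).hom ≫ V ◁ V' ◁ m ≫ (α_ V V' F).inv) ▷ V ⊗≫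
          V' ◁ V ◁ (β_ F V').inv ▷ V ⊗≫
          ε_ V V' ▷ (F ⊗ V' ⊗ V) ⊗≫ F ◁ ε_ V V' ⊗≫ 𝟙 _ := by
        rw [← hn1]; monoidal
    _ = 𝟙 _ ⊗≫ V' ◁ η_ V V' ▷ V ⊗≫
          V' ◁ V ◁ (V' ◁ u ≫ (β_ F V').inv) ▷ V ⊗≫
          ε_ V V' ▷ (F ⊗ V' ⊗ V) ⊗≫ F ◁ ε_ V V' ⊗≫ 𝟙 _ := by
        rw [← hnat]
        calc _ = 𝟙 _ ⊗≫ V' ◁ ((𝟙_ C) ◁ u ≫ η_ V V' ▷ F) ▷ V ⊗≫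
              V' ◁ V ◁ (β_ F V').inv ▷ V ⊗≫
              ε_ V V' ▷ (F ⊗ V' ⊗ V) ⊗≫ F ◁ ε_ V V' ⊗≫ 𝟙 _ := by monoidal
          _ = _ := by rw [whisker_exchange]; monoidal
    _ = 𝟙 _ ⊗≫ V' ◁ η_ V V' ▷ V ⊗≫
          ((V' ⊗ V) ◁ (u ▷ V') ≫ ε_ V V' ▷ (F ⊗ V')) ▷ V ⊗≫ F ◁ ε_ V V' ⊗≫ 𝟙 _ := by
        rw [hn2]; monoidal
    _ = 𝟙 _ ⊗≫ (V' ◁ η_ V V' ≫ (α_ V' V V').inv ≫ ε_ V V' ▷ V') ▷ V ⊗≫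
          (u ▷ (V' ⊗ V) ≫ F ◁ ε_ V V') ⊗≫ 𝟙 _ := by
        rw [whisker_exchange]; monoidal
    _ = ε_ V V' ≫ u := by
        rw [coevaluation_evaluation, ← whisker_exchange]; monoidal
    _ = (c.ι V V' ≫ e) ≫ u := by rw [D.ι_counit V V']
    _ = _ := by simp

end Structure
end NatCoaction
end BraidedReconstruction

end

/-! ### Transposes and internal endomorphisms -/

section

open CategoryTheory MonoidalCategory BraidedCategory ExactPairing
namespace BraidedReconstruction
universe v u
variable {C : Type u} [Category.{v} C] [MonoidalCategory C]

section Mate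
variable {F A B : C} (A' B' : C) [ExactPairing A A'] [ExactPairing B B']

/-- The transpose `B' ⟶ A'` of `t : A ⟶ B` with respect to arbitrary left duals. -/
def mate {A B : C} (t : A ⟶ B) (A' B' : C) [ExactPairing A A'] [ExactPairing B B'] : B' ⟶ A' :=
  (ρ_ B').inv ≫ B' ◁ η_ A A' ≫ B' ◁ (t ▷ A') ≫ (α_ B' B A').inv ≫ ε_ B B' ▷ A' ≫ (λ_ A').hom

theorem mate_eval (t : A ⟶ B) : mate t A' B' ▷ A ≫ ε_ A A' = B' ◁ t ≫ ε_ B B' := by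
  calc _ = 𝟙 _ ⊗≫ B' ◁ η_ A A' ▷ A ⊗≫ B' ◁ t ▷ (A' ⊗ A) ⊗≫ (ε_ B B' ▷ (A' ⊗ A) ≫ 𝟙_ C ◁ ε_ A A')
        ⊗≫ 𝟙 _ := by dsimp only [mate]; monoidal
    _ = 𝟙 _ ⊗≫ B' ◁ η_ A A' ▷ A ⊗≫ B' ◁ (t ▷ (A' ⊗ A) ≫ B ◁ ε_ A A') ⊗≫ ε_ B B' ⊗≫ 𝟙 _ := by
        rw [← whisker_exchange]; monoidal
    _ = 𝟙 _ ⊗≫ B' ◁ (η_ A A' ▷ A ≫ (α_ A A' A).hom ≫ A ◁ ε_ A A') ⊗≫ B' ◁ t ⊗≫ ε_ B B' ⊗≫ 𝟙 _ := by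
        rw [← whisker_exchange]; monoidal
    _ = _ := by rw [evaluation_coevaluation]; monoidal

theorem eq_mate {t : A ⟶ B} {x : B' ⟶ A'} (h : x ▷ A ≫ ε_ A A' = B' ◁ t ≫ ε_ B B') :
    x = mate t A' B' := by
  symm
  calc _ = 𝟙 _ ⊗≫ B' ◁ η_ A A' ⊗≫ (B' ◁ t ≫ ε_ B B') ▷ A' ⊗≫ 𝟙 _ := by dsimp only [mate]; monoidal
    _ = 𝟙 _ ⊗≫ (B' ◁ η_ A A' ≫ x ▷ (A ⊗ A')) ⊗≫ ε_ A A' ▷ A' ⊗≫ 𝟙 _ := by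
        rw [← h]; monoidal
    _ = 𝟙 _ ⊗≫ x ⊗≫ (A' ◁ η_ A A' ≫ (α_ A' A A').inv ≫ ε_ A A' ▷ A') ⊗≫ 𝟙 _ := by
        rw [whisker_exchange]; monoidal
    _ = _ := by rw [coevaluation_evaluation]; monoidal

theorem mate_comp {D : C} (D' : C) [ExactPairing D D'] (t : A ⟶ B) (s : B ⟶ D) :
    mate s B' D' ≫ mate t A' B' = mate (t ≫ s) A' D' := by
  apply eq_mate
  rw [comp_whiskerRight, Category.assoc, mate_eval, ← whisker_exchange_assoc, mate_eval]; simp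

/-- The morphism `A' ⟶ F` that corresponds by duality to an `F`-valued element `𝟙 ⟶ A ⊗ F`. -/
def bracket (A A' : C) [ExactPairing A A'] (s : 𝟙_ C ⟶ A ⊗ F) : A' ⟶ F :=
  (ρ_ A').inv ≫ A' ◁ s ≫ (α_ A' A F).inv ≫ ε_ A A' ▷ F ≫ (λ_ F).hom

theorem mate_bracket (t : A ⟶ B) (s : 𝟙_ C ⟶ A ⊗ F) :
    mate t A' B' ≫ bracket A A' s = bracket B B' (s ≫ t ▷ F) := by
  calc _ = 𝟙 _ ⊗≫ (mate t A' B' ▷ (𝟙_ C) ≫ A' ◁ s) ⊗≫ ε_ A A' ▷ F ⊗≫ 𝟙 _ := by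
        dsimp only [bracket]; monoidal
    _ = 𝟙 _ ⊗≫ B' ◁ s ⊗≫ (mate t A' B' ▷ A ≫ ε_ A A') ▷ F ⊗≫ 𝟙 _ := by
        rw [← whisker_exchange]; monoidal
    _ = _ := by rw [mate_eval]; dsimp only [bracket]; monoidal

theorem bracket_comp {Z : C} (s : 𝟙_ C ⟶ A ⊗ F) (f : F ⟶ Z) :
    bracket A A' s ≫ f = bracket A A' (s ≫ A ◁ f) := by
  calc _ = 𝟙 _ ⊗≫ A' ◁ s ⊗≫ (ε_ A A' ▷ F ≫ 𝟙_ C ◁ f) ⊗≫ 𝟙 _ := by dsimp only [bracket]; monoidal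
    _ = _ := by rw [← whisker_exchange]; dsimp only [bracket]; monoidal

/-- The transpose of the composition `(U ⊗ U') ⊗ (U ⊗ U') ⟶ U ⊗ U'` of internal endomorphisms
inserts a coevaluation. -/
theorem mate_inner (U U' U'' : C) [ExactPairing U U'] [ExactPairing U' U''] :
    (𝟙 (U'' ⊗ U') ⊗≫ U'' ◁ η_ U' U'' ▷ U' ⊗≫ 𝟙 ((U'' ⊗ U') ⊗ (U'' ⊗ U'))) =
    mate ((α_ U U' (U ⊗ U')).hom ≫ U ◁ (α_ U' U U').inv ≫ U ◁ ε_ U U' ▷ U' ≫ U ◁ (λ_ U').hom)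
      ((U'' ⊗ U') ⊗ (U'' ⊗ U')) (U'' ⊗ U') := by
  apply eq_mate
  rw [tensor_evaluation, tensor_evaluation]
  calc _ = 𝟙 _ ⊗≫ U'' ◁ η_ U' U'' ▷ (U' ⊗ U ⊗ U' ⊗ U ⊗ U') ⊗≫
        (U'' ⊗ U') ◁ U'' ◁ (ε_ U U' ▷ U') ▷ (U ⊗ U') ⊗≫
        (U'' ⊗ U') ◁ ε_ U' U'' ▷ (U ⊗ U') ⊗≫ U'' ◁ ε_ U U' ▷ U' ⊗≫ ε_ U' U'' := by monoidal
    _ = 𝟙 _ ⊗≫ U'' ◁ (η_ U' U'' ▷ ((U' ⊗ U) ⊗ U') ≫ (U' ⊗ U'') ◁ (ε_ U U' ▷ U')) ▷ (U ⊗ U') ⊗≫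
        (U'' ⊗ U') ◁ ε_ U' U'' ▷ (U ⊗ U') ⊗≫ U'' ◁ ε_ U U' ▷ U' ⊗≫ ε_ U' U'' := by monoidal
    _ = 𝟙 _ ⊗≫ U'' ◁ (ε_ U U' ▷ U') ▷ (U ⊗ U') ⊗≫ U'' ◁
        (η_ U' U'' ▷ U' ≫ (α_ U' U'' U').hom ≫ U' ◁ ε_ U' U'') ▷ (U ⊗ U') ⊗≫ U'' ◁ ε_ U U' ▷ U' ⊗≫
        ε_ U' U'' := by
        rw [← whisker_exchange]; monoidal
    _ = 𝟙 _ ⊗≫ U'' ◁ (ε_ U U' ▷ (U' ⊗ U) ≫ 𝟙_ C ◁ ε_ U U') ▷ U' ⊗≫ ε_ U' U'' := by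
        rw [evaluation_coevaluation]; monoidal
    _ = _ := by rw [← whisker_exchange]; monoidal

theorem coev_tensor_eval (U U' U'' : C) [ExactPairing U U'] [ExactPairing U' U''] :
    (U'' ⊗ U') ◁ η_ U U' ≫ ε_ (U ⊗ U') (U'' ⊗ U') = (ρ_ _).hom ≫ ε_ U' U'' := by
  rw [tensor_evaluation]
  calc _ = 𝟙 _ ⊗≫ U'' ◁ (U' ◁ η_ U U' ≫ (α_ U' U U').inv ≫ ε_ U U' ▷ U') ⊗≫ ε_ U' U'' := by monoidal
    _ = _ := by rw [coevaluation_evaluation]; monoidal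

end Mate

namespace NatCoaction
variable {F : C} (c : NatCoaction F)
variable (U U' U'' V V' V'' W W' W'' : C) [ExactPairing U U'] [ExactPairing V V']
  [ExactPairing W W']

/-- The coaction as an `F`-valued element of `U ⊗ U'`, the object of internal endomorphisms of
`U`. -/
def elt : 𝟙_ C ⟶ (U ⊗ U') ⊗ F := η_ U U' ≫ U ◁ c.δ U' ≫ (α_ U U' F).inv

/-- The functional attached to `elt` is the coefficient map of the dual object `U'`. -/
theorem bracket_elt [ExactPairing U' U''] :
    bracket (U ⊗ U') (U'' ⊗ U') (c.elt U U') = c.ι U' U'' := by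
  dsimp only [bracket, elt]
  rw [tensor_evaluation]
  calc _ = 𝟙 _ ⊗≫ U'' ◁ (U' ◁ η_ U U') ⊗≫ U'' ◁ ((U' ⊗ U) ◁ c.δ U' ≫ ε_ U U' ▷ (U' ⊗ F)) ⊗≫
        ε_ U' U'' ▷ F ⊗≫ 𝟙 _ := by monoidal
    _ = 𝟙 _ ⊗≫ U'' ◁ (U' ◁ η_ U U' ≫ (α_ U' U U').inv ≫ ε_ U U' ▷ U') ⊗≫ U'' ◁ c.δ U' ⊗≫
        ε_ U' U'' ▷ F ⊗≫ 𝟙 _ := by rw [whisker_exchange]; monoidal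
    _ = _ := by rw [coevaluation_evaluation]; dsimp only [ι]; monoidal

/-- The element `elt` does not depend on the choice of the dual. -/
theorem elt_mate (U₂ : C) [ExactPairing U U₂] :
    c.elt U U' ≫ (U ◁ mate (𝟙 U) U₂ U') ▷ F = c.elt U U₂ := by
  have h : η_ U U' ≫ U ◁ mate (𝟙 U) U₂ U' = η_ U U₂ := by
    calc _ = 𝟙 _ ⊗≫ (η_ U U' ▷ 𝟙_ C ≫ (U ⊗ U') ◁ η_ U U₂) ⊗≫ U ◁ ε_ U U' ▷ U₂ ⊗≫ 𝟙 _ := by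
          dsimp only [mate]; monoidal
      _ = 𝟙 _ ⊗≫ 𝟙_ C ◁ η_ U U₂ ⊗≫ (η_ U U' ▷ U ≫ (α_ U U' U).hom ≫ U ◁ ε_ U U') ▷ U₂ ⊗≫ 𝟙 _ := by
          rw [← whisker_exchange]; monoidal
      _ = _ := by rw [evaluation_coevaluation]; monoidal
  calc _ = η_ U U' ≫ U ◁ (c.δ U' ≫ mate (𝟙 U) U₂ U' ▷ F) ≫ (α_ U U₂ F).inv := by
        dsimp only [elt]; simp
    _ = (η_ U U' ≫ U ◁ mate (𝟙 U) U₂ U') ≫ U ◁ c.δ U₂ ≫ (α_ U U₂ F).inv := by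
        rw [c.naturality]; simp
    _ = _ := by rw [h]; rfl

variable [BraidedCategory C]
variable {c} {m : F ⊗ F ⟶ F} {u : 𝟙_ C ⟶ F} {Δ : F ⟶ F ⊗ F} {e : F ⟶ 𝟙_ C}

/-- The map from the internal endomorphisms of `W ⊗ V`, with `D` as dual, to the tensor product of
the internal endomorphisms of `W` and of `V`: regroup the four factors by a braiding. Its transpose
multiplies matrix coefficients. -/
def comulHom (D : C) [ExactPairing (W ⊗ V) D] : (W ⊗ V) ⊗ D ⟶ (W ⊗ W') ⊗ (V ⊗ V') :=
  (W ⊗ V) ◁ mate (𝟙 (W ⊗ V)) (V' ⊗ W') D ≫ (α_ W V (V' ⊗ W')).hom ≫ W ◁ (α_ V V' W').inv ≫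
    W ◁ (β_ (V ⊗ V') W').hom ≫ (α_ W W' (V ⊗ V')).inv

theorem Structure.elt_mul (D : c.Structure m u Δ e) (Z : C) [ExactPairing (W ⊗ V) Z] :
    c.elt (W ⊗ V) Z ≫ comulHom V V' W W' Z ▷ F =
      c.elt W W' ≫ ((ρ_ (W ⊗ W')).inv ≫ (W ⊗ W') ◁ c.elt V V' ≫
        (α_ (W ⊗ W') (V ⊗ V') F).inv) ▷ F ≫
        (α_ ((W ⊗ W') ⊗ (V ⊗ V')) F F).hom ≫ ((W ⊗ W') ⊗ (V ⊗ V')) ◁ m := by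
  have hb := braiding_naturality_left (c.elt V V') W'
  rw [braiding_tensor_left_hom, braiding_tensorUnit_left] at hb
  calc _ = (c.elt (W ⊗ V) Z ≫ ((W ⊗ V) ◁ mate (𝟙 (W ⊗ V)) (V' ⊗ W') Z) ▷ F) ≫
       ((α_ W V (V' ⊗ W')).hom ≫ W ◁ (α_ V V' W').inv ≫
        W ◁ (β_ (V ⊗ V') W').hom ≫ (α_ W W' (V ⊗ V')).inv) ▷ F := by
        dsimp only [comulHom]; simp
    _ = 𝟙 _ ⊗≫ η_ W W' ⊗≫ W ◁ (η_ V V' ▷ W') ⊗≫ (W ⊗ V) ◁ (c.δ V' ▷ W' ≫ (α_ V' F W').hom ≫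
          V' ◁ F ◁ c.δ W' ≫ V' ◁ (α_ F W' F).inv ≫
      V' ◁ (β_ F W').hom ▷ F ≫ V' ◁ (α_ W' F F).hom ≫ V' ◁ W' ◁ m ≫ (α_ V' W' F).inv) ⊗≫
        W ◁ (β_ (V ⊗ V') W').hom ▷ F ⊗≫ 𝟙 _ := by
        rw [elt_mate, ← D.mul]; dsimp only [elt]; rw [tensor_coevaluation]; monoidal
    _ = 𝟙 _ ⊗≫ η_ W W' ⊗≫ W ◁ ((c.elt V V' ▷ W' ≫ ((V ⊗ V') ⊗ F) ◁ c.δ W')) ⊗≫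
          W ◁ (V ⊗ V') ◁ (β_ F W').hom ▷ F ⊗≫
        W ◁ (((V ⊗ V') ⊗ W') ◁ m ≫ (β_ (V ⊗ V') W').hom ▷ F) ⊗≫ 𝟙 _ := by
        dsimp only [elt]; monoidal
    _ = 𝟙 _ ⊗≫ η_ W W' ⊗≫ W ◁ c.δ W' ⊗≫ W ◁ (c.elt V V' ▷ W' ≫ (α_ (V ⊗ V') F W').hom ≫
        (V ⊗ V') ◁ (β_ F W').hom ≫ (α_ (V ⊗ V') W' F).inv ≫ (β_ (V ⊗ V') W').hom ▷ F ≫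
          (α_ W' (V ⊗ V') F).hom) ▷ F ⊗≫ (W ⊗ W' ⊗ (V ⊗ V')) ◁ m ⊗≫ 𝟙 _ := by
        rw [← whisker_exchange, whisker_exchange (β_ (V ⊗ V') W').hom m]; monoidal
    _ = _ := by rw [hb]; dsimp only [elt]; monoidal

omit [BraidedCategory C] in
theorem bracket_insert [ExactPairing W' W''] [ExactPairing V' V''] (m : F ⊗ F ⟶ F) :
    bracket ((W ⊗ W') ⊗ (V ⊗ V')) ((V'' ⊗ V') ⊗ (W'' ⊗ W'))
      (c.elt W W' ≫ ((ρ_ (W ⊗ W')).inv ≫ (W ⊗ W') ◁ c.elt V V' ≫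
        (α_ (W ⊗ W') (V ⊗ V') F).inv) ▷ F ≫
        (α_ ((W ⊗ W') ⊗ (V ⊗ V')) F F).hom ≫ ((W ⊗ W') ⊗ (V ⊗ V')) ◁ m) =
    c.ι V' V'' ▷ (W'' ⊗ W') ≫ F ◁ c.ι W' W'' ≫ m := by
  rw [← c.bracket_elt V V' V'', ← c.bracket_elt W W' W'']
  generalize c.elt W W' = s
  generalize c.elt V V' = t
  dsimp only [bracket]
  rw [tensor_evaluation (X₁ := W ⊗ W') (X₂ := V ⊗ V')]
  calc _ = 𝟙 _ ⊗≫ (V'' ⊗ V') ◁ (W'' ⊗ W') ◁ s ⊗≫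
        (V'' ⊗ V') ◁ (((W'' ⊗ W') ⊗ (W ⊗ W')) ◁
          ((λ_ F).inv ≫ t ▷ F ≫ (α_ (V ⊗ V') F F).hom ≫ (V ⊗ V') ◁ m) ≫
            ε_ (W ⊗ W') (W'' ⊗ W') ▷ ((V ⊗ V') ⊗ F)) ⊗≫ ε_ (V ⊗ V') (V'' ⊗ V') ▷ F ⊗≫ 𝟙 _ := by
        monoidal
    _ = 𝟙 _ ⊗≫ (V'' ⊗ V') ◁ ((W'' ⊗ W') ◁ s ⊗≫ ε_ (W ⊗ W') (W'' ⊗ W') ▷ F) ⊗≫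
        (V'' ⊗ V') ◁ t ▷ F ⊗≫
        (((V'' ⊗ V') ⊗ (V ⊗ V')) ◁ m ≫ ε_ (V ⊗ V') (V'' ⊗ V') ▷ F) ⊗≫ 𝟙 _ := by
        rw [whisker_exchange]; monoidal
    _ = 𝟙 _ ⊗≫ (V'' ⊗ V') ◁ ((W'' ⊗ W') ◁ s ⊗≫ ε_ (W ⊗ W') (W'' ⊗ W') ▷ F) ⊗≫
        (((V'' ⊗ V') ◁ t) ▷ F ≫ (α_ (V'' ⊗ V') (V ⊗ V') F).inv ▷ F ≫
        ε_ (V ⊗ V') (V'' ⊗ V') ▷ F ▷ F) ⊗≫ m := by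
        rw [whisker_exchange]; monoidal
    _ = 𝟙 _ ⊗≫ ((V'' ⊗ V') ◁ ((W'' ⊗ W') ◁ s ⊗≫ ε_ (W ⊗ W') (W'' ⊗ W') ▷ F ⊗≫ 𝟙 F) ≫
        ((ρ_ (V'' ⊗ V')).inv ≫ (V'' ⊗ V') ◁ t ≫ (α_ (V'' ⊗ V') (V ⊗ V') F).inv ≫
        ε_ (V ⊗ V') (V'' ⊗ V') ▷ F ≫
          (λ_ F).hom) ▷ F) ≫ m := by monoidal
    _ = _ := by rw [whisker_exchange]; monoidal

/-- The product of coefficients is the transpose of `comulHom`. -/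
theorem ι_mul_eq_mate [ExactPairing W' W''] [ExactPairing V' V''] (D : c.Structure m u Δ e)
    (Z Z' : C) [ExactPairing (W ⊗ V) Z] [ExactPairing ((W ⊗ V) ⊗ Z) Z'] :
    c.ι V' V'' ▷ (W'' ⊗ W') ≫ F ◁ c.ι W' W'' ≫ m =
      mate (comulHom V V' W W' Z) Z' ((V'' ⊗ V') ⊗ (W'' ⊗ W')) ≫
        bracket ((W ⊗ V) ⊗ Z) Z' (c.elt (W ⊗ V) Z) := by
  rw [mate_bracket, D.elt_mul V V' W W', bracket_insert]

/-- The map from the internal endomorphisms of `U'` to those of `U` whose transpose is the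
antipode. -/
def antipodeHom [ExactPairing U' U''] : U' ⊗ U'' ⟶ U ⊗ U' :=
  (ρ_ (U' ⊗ U'')).inv ≫ (U' ⊗ U'') ◁ η_ U U' ≫ (α_ (U' ⊗ U'') U U').inv ≫
    (β_ (U' ⊗ U'') U).hom ▷ U' ≫ (α_ U (U' ⊗ U'') U').hom ≫
    U ◁ ((α_ U' U'' U').hom ≫ U' ◁ ε_ U' U'' ≫ (ρ_ U').hom)

theorem elt_antipode [ExactPairing U' U''] (S : F ⟶ F)
    (hS : c.ι U' U'' ≫ S = c.δ U'' ▷ U' ≫ (β_ F U'').inv ▷ U' ≫ (α_ F U'' U').hom ≫ F ◁ ε_ U' U'' ≫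
      (ρ_ F).hom) :
    c.elt U U' ≫ (U ⊗ U') ◁ S = c.elt U' U'' ≫ antipodeHom U U' U'' ▷ F := by
  have h1 := c.ι_comp
  have hb := braiding_naturality_left (c.elt U' U'') U
  rw [braiding_tensor_left_hom, braiding_tensorUnit_left] at hb
  have hb2 := braiding_naturality_right F (η_ U U')
  rw [braiding_tensor_right_hom, braiding_tensorUnit_right] at hb2
  calc _ = η_ U U' ⊗≫ U ◁ (η_ U' U'' ▷ U' ≫ (α_ U' U'' U').hom ≫ U' ◁ (c.ι U' U'' ≫ S)) ⊗≫ 𝟙 _ := by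
        dsimp only [elt]; rw [c.δ_eq U' U'']; monoidal
    _ = η_ U U' ⊗≫ U ◁ (η_ U' U'' ▷ U' ≫ (α_ U' U'' U').hom ≫ U' ◁ c.δ U'' ▷ U' ≫
          U' ◁ ((β_ F U'').inv ▷ U' ≫ (α_ F U'' U').hom ≫ F ◁ ε_ U' U'')) ⊗≫ 𝟙 _ := by
        rw [hS]; monoidal
    _ = η_ U U' ⊗≫ (((ρ_ U).inv ≫ U ◁ c.elt U' U'')) ▷ U' ⊗≫
          U ◁ U' ◁ (U'' ◁ (β_ F U').hom ⊗≫ ε_ U' U'' ▷ F) ⊗≫ 𝟙 _ := by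
        rw [braiding_eval]; dsimp only [elt]; monoidal
    _ = 𝟙 _ ⊗≫ (𝟙_ C ◁ η_ U U' ≫ c.elt U' U'' ▷ (U ⊗ U')) ⊗≫
          (U' ⊗ U'') ◁ (β_ F U).hom ▷ U' ⊗≫ ((β_ (U' ⊗ U'') U).hom ▷ (F ⊗ U') ≫
          (U ⊗ (U' ⊗ U'')) ◁ (β_ F U').hom)
            ⊗≫ U ◁ U' ◁ (ε_ U' U'' ▷ F) ⊗≫ 𝟙 _ := by
        have hb' : (ρ_ U).inv ≫ U ◁ c.elt U' U'' = (λ_ U).inv ≫ (c.elt U' U'') ▷ U ≫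
            (α_ (U' ⊗ U'') F U).hom ≫
        (U' ⊗ U'') ◁ (β_ F U).hom ≫
          (α_ (U' ⊗ U'') U F).inv ≫ (β_ (U' ⊗ U'') U).hom ▷ F ≫ (α_ U (U' ⊗ U'') F).hom := by
            rw [hb]; simp
        rw [hb']; monoidal
    _ = 𝟙 _ ⊗≫ c.elt U' U'' ⊗≫
          (U' ⊗ U'') ◁ (F ◁ η_ U U' ≫ (α_ F U U').inv ≫ (β_ F U).hom ▷ U' ≫ (α_ U F U').hom ≫
            U ◁ (β_ F U').hom ≫ (α_ U U' F).inv) ⊗≫ ((β_ (U' ⊗ U'') U).hom ▷ (U' ⊗ F))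
            ⊗≫ U ◁ U' ◁ (ε_ U' U'' ▷ F) ⊗≫ 𝟙 _ := by
        rw [whisker_exchange, ← whisker_exchange (β_ (U' ⊗ U'') U).hom]; monoidal
    _ = _ := by rw [hb2]; dsimp only [antipodeHom]; monoidal

end NatCoaction
end BraidedReconstruction

end

/-! ### Lax braidings and duals -/

section

open CategoryTheory MonoidalCategory BraidedCategory ExactPairing
namespace BraidedReconstruction
universe v u
variable {C : Type u} [Category.{v} C] [MonoidalCategory C]

/-- Let `c` satisfy all axioms of a braiding except one hexagon, one naturality and invertibility.
Then `c V W : V ⊗ W ⟶ W ⊗ V` is split epi as soon as `V` has a left dual `V'`: the section is the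
transpose of `c V' W`. -/
theorem lax_braiding_split (c : ∀ X Y : C, X ⊗ Y ⟶ Y ⊗ X)
    (naturality_left : ∀ {X Y : C} (f : X ⟶ Y) (Z : C), f ▷ Z ≫ c Y Z = c X Z ≫ Z ◁ f)
    (hexagon : ∀ X Y Z : C, (α_ X Y Z).inv ≫ c (X ⊗ Y) Z ≫ (α_ Z X Y).inv =
        X ◁ c Y Z ≫ (α_ X Z Y).inv ≫ c X Z ▷ Y)
    (unit : ∀ Z : C, c (𝟙_ C) Z = (λ_ Z).hom ≫ (ρ_ Z).inv)
    (V V' W : C) [ExactPairing V V'] :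
    (λ_ (W ⊗ V)).inv ≫ η_ V V' ▷ (W ⊗ V) ≫ (α_ V V' (W ⊗ V)).hom ≫ V ◁ (α_ V' W V).inv ≫
      V ◁ c V' W ▷ V ≫ V ◁ (α_ W V' V).hom ≫ V ◁ W ◁ ε_ V V' ≫ V ◁ (ρ_ W).hom ≫ c V W =
      𝟙 (W ⊗ V) := by
  calc _ = 𝟙 _ ⊗≫ η_ V V' ▷ (W ⊗ V) ⊗≫ V ◁ c V' W ▷ V ⊗≫ ((V ⊗ W) ◁ ε_ V V' ≫ c V W ▷ 𝟙_ C) ⊗≫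
          𝟙 _ := by
        monoidal
    _ = 𝟙 _ ⊗≫ η_ V V' ▷ (W ⊗ V) ⊗≫ (V ◁ c V' W ≫ (α_ V W V').inv ≫ c V W ▷ V') ▷ V ⊗≫
          W ◁ V ◁ ε_ V V' ⊗≫ 𝟙 _ := by
        rw [whisker_exchange]; monoidal
    _ = 𝟙 _ ⊗≫ (η_ V V' ▷ W ≫ c (V ⊗ V') W) ▷ V ⊗≫
          W ◁ V ◁ ε_ V V' ⊗≫ 𝟙 _ := by
        rw [← hexagon]; monoidal
    _ = 𝟙 _ ⊗≫ W ◁ (η_ V V' ▷ V ≫ (α_ V V' V).hom ≫ V ◁ ε_ V V') ⊗≫ 𝟙 _ := by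
        rw [naturality_left, unit]; monoidal
    _ = _ := by rw [evaluation_coevaluation]; monoidal

end BraidedReconstruction

end

/-! ### Natural coactions from dinatural families -/

section

open CategoryTheory MonoidalCategory BraidedCategory ExactPairing
namespace BraidedReconstruction
universe v u
variable {C : Type u} [Category.{v} C] [MonoidalCategory C]

/-- The comparison between the duals of a tensor product is the tensor product of the comparisons.
-/
theorem mate_tensor (A A' A₂ B B' B₂ : C) [ExactPairing A A'] [ExactPairing A A₂]
    [ExactPairing B B'] [ExactPairing B B₂] :
    mate (𝟙 (A ⊗ B)) (B₂ ⊗ A₂) (B' ⊗ A') = mate (𝟙 B) B₂ B' ▷ A' ≫ B₂ ◁ mate (𝟙 A) A₂ A' := by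
  symm
  apply eq_mate
  rw [tensor_evaluation, tensor_evaluation]
  calc _ = 𝟙 _ ⊗≫ mate (𝟙 B) B₂ B' ▷ (A' ⊗ A ⊗ B) ⊗≫
        B₂ ◁ (mate (𝟙 A) A₂ A' ▷ A ≫ ε_ A A₂) ▷ B ⊗≫ ε_ B B₂ := by monoidal
    _ = 𝟙 _ ⊗≫ (mate (𝟙 B) B₂ B' ▷ ((A' ⊗ A) ⊗ B) ≫ B₂ ◁ (ε_ A A' ▷ B)) ⊗≫ ε_ B B₂ := by
        rw [mate_eval, whiskerLeft_id, Category.id_comp]; monoidal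
    _ = 𝟙 _ ⊗≫ B' ◁ (ε_ A A' ▷ B) ⊗≫ (mate (𝟙 B) B₂ B' ▷ B ≫ ε_ B B₂) := by
        rw [← whisker_exchange]; monoidal
    _ = _ := by rw [mate_eval]; monoidal

namespace NatCoaction
variable {F : C} (c : NatCoaction F)

/-- Coefficients are dinatural. -/
theorem ι_mate {V W : C} (V' W' : C) [ExactPairing V V'] [ExactPairing W W'] (f : V ⟶ W) :
    mate f V' W' ▷ V ≫ c.ι V V' = W' ◁ f ≫ c.ι W W' := by
  calc _ = 𝟙 _ ⊗≫ (mate f V' W' ▷ V ≫ V' ◁ c.δ V) ⊗≫ ε_ V V' ▷ F ⊗≫ 𝟙 F := by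
        dsimp only [ι]; monoidal
    _ = 𝟙 _ ⊗≫ W' ◁ c.δ V ⊗≫ (mate f V' W' ▷ V ≫ ε_ V V') ▷ F ⊗≫ 𝟙 F := by
        rw [← whisker_exchange]; monoidal
    _ = 𝟙 _ ⊗≫ W' ◁ (c.δ V ≫ f ▷ F) ⊗≫ ε_ W W' ▷ F ⊗≫ 𝟙 F := by
        rw [mate_eval]; monoidal
    _ = _ := by rw [c.naturality]; dsimp only [ι]; monoidal

/-- The coaction `V ≅ 1 ⊗ V → V ⊗ V* ⊗ V → V ⊗ F` attached to a dinatural family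
`V* ⊗ V → F`. -/
def ofDinatural (dual : C → C) [∀ V, ExactPairing V (dual V)] (j : ∀ V, dual V ⊗ V ⟶ F)
    (hj : ∀ {V W : C} (f : V ⟶ W), mate f (dual V) (dual W) ▷ V ≫ j V = dual W ◁ f ≫ j W) :
    NatCoaction F where
  δ V := (λ_ V).inv ≫ η_ V (dual V) ▷ V ≫ (α_ V (dual V) V).hom ≫ V ◁ j V
  naturality {V W} f := by
    have h : η_ V (dual V) ≫ f ▷ dual V = η_ W (dual W) ≫ W ◁ mate f (dual V) (dual W) := by
      symm
      calc _ = 𝟙 _ ⊗≫ (η_ W (dual W) ▷ 𝟙_ C ≫ (W ⊗ dual W) ◁ (η_ V (dual V) ≫ f ▷ dual V)) ⊗≫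
            W ◁ ε_ W (dual W) ▷ dual V ⊗≫ 𝟙 _ := by
            dsimp only [mate]; monoidal
        _ = 𝟙 _ ⊗≫ (η_ V (dual V) ≫ f ▷ dual V) ⊗≫
            (η_ W (dual W) ▷ W ≫ (α_ W (dual W) W).hom ≫ W ◁ ε_ W (dual W)) ▷ dual V ⊗≫ 𝟙 _ := by
            rw [← whisker_exchange]; monoidal
        _ = _ := by rw [evaluation_coevaluation]; monoidal
    calc _ = 𝟙 _ ⊗≫ η_ V (dual V) ▷ V ⊗≫ (V ◁ j V ≫ f ▷ F) := by monoidal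
      _ = 𝟙 _ ⊗≫ (η_ V (dual V) ≫ f ▷ dual V) ▷ V ⊗≫ W ◁ j V := by
          rw [whisker_exchange]; monoidal
      _ = 𝟙 _ ⊗≫ η_ W (dual W) ▷ V ⊗≫ W ◁ (mate f (dual V) (dual W) ▷ V ≫ j V) := by
          rw [h]; monoidal
      _ = 𝟙 _ ⊗≫ (η_ W (dual W) ▷ V ≫ (W ⊗ dual W) ◁ f) ⊗≫ W ◁ j W := by
          rw [hj]; monoidal
      _ = _ := by rw [← whisker_exchange]; monoidal

theorem ofDinatural_ι (dual : C → C) [∀ V, ExactPairing V (dual V)] (j : ∀ V, dual V ⊗ V ⟶ F)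
    (hj : ∀ {V W : C} (f : V ⟶ W), mate f (dual V) (dual W) ▷ V ≫ j V = dual W ◁ f ≫ j W)
    (V : C) : (ofDinatural dual j hj).ι V (dual V) = j V := by
  calc _ = 𝟙 _ ⊗≫ dual V ◁ η_ V (dual V) ▷ V ⊗≫ ((dual V ⊗ V) ◁ j V ≫ ε_ V (dual V) ▷ F) ⊗≫
        𝟙 F := by
        dsimp only [ι, ofDinatural]; monoidal
    _ = 𝟙 _ ⊗≫ (dual V ◁ η_ V (dual V) ≫ (α_ (dual V) V (dual V)).inv ≫
          ε_ V (dual V) ▷ dual V) ▷ V ⊗≫ j V := by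
        rw [whisker_exchange]; monoidal
    _ = _ := by rw [coevaluation_evaluation]; monoidal

variable (V V' W W' : C) [ExactPairing V V'] [ExactPairing W W']

theorem δ_comul_of_ι {Δ : F ⟶ F ⊗ F}
    (h : c.ι V V' ≫ Δ = V' ◁ ((λ_ V).inv ≫ η_ V V' ▷ V ≫ (α_ V V' V).hom) ≫
      (α_ V' V (V' ⊗ V)).inv ≫ c.ι V V' ▷ (V' ⊗ V) ≫ F ◁ c.ι V V') :
    c.δ V ≫ V ◁ Δ = c.δ V ≫ c.δ V ▷ F ≫ (α_ V F F).hom := by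
  have h2 : c.ι V V' ≫ Δ = V' ◁ c.δ V ≫ (α_ V' V F).inv ≫ c.ι V V' ▷ F := by
    rw [h, ← whisker_exchange, c.δ_eq V V']; monoidal
  calc _ = (λ_ V).inv ≫ η_ V V' ▷ V ≫ (α_ V V' V).hom ≫ V ◁ (c.ι V V' ≫ Δ) := by
        rw [c.δ_eq V V']; monoidal
    _ = 𝟙 _ ⊗≫ (η_ V V' ▷ V ≫ (V ⊗ V') ◁ c.δ V) ⊗≫ V ◁ c.ι V V' ▷ F := by
        rw [h2]; monoidal
    _ = c.δ V ≫ ((λ_ V).inv ≫ η_ V V' ▷ V ≫ (α_ V V' V).hom ≫ V ◁ c.ι V V') ▷ F ⊗≫ 𝟙 _ := by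
        rw [← whisker_exchange]; monoidal
    _ = _ := by rw [← c.δ_eq V V']; monoidal

theorem δ_counit_of_ι {e : F ⟶ 𝟙_ C} (h : c.ι V V' ≫ e = ε_ V V') :
    c.δ V ≫ V ◁ e = (ρ_ V).inv := by
  calc _ = (λ_ V).inv ≫ η_ V V' ▷ V ≫ (α_ V V' V).hom ≫ V ◁ (c.ι V V' ≫ e) := by
        rw [c.δ_eq V V']; monoidal
    _ = _ := by rw [h, evaluation_coevaluation]; monoidal

theorem δ_unit : c.δ (𝟙_ C) ≫ (λ_ F).hom = (λ_ (𝟙_ C)).inv ≫ c.ι (𝟙_ C) (𝟙_ C) := by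
  have h : ε_ (𝟙_ C) (𝟙_ C) = (ρ_ (𝟙_ C)).hom := rfl
  dsimp only [ι]
  rw [h]
  monoidal

variable [BraidedCategory C]

/-- The product of coefficients, written with the braiding of `V` past `W'` and of `V` past `W`:
the form in which it is read off from the multiplication of `H*`. -/
theorem δ_tensor_of_ι_swap (m : F ⊗ F ⟶ F)
    (h : c.ι V V' ▷ (W' ⊗ W) ≫ F ◁ c.ι W W' ≫ m =
      (α_ V' V (W' ⊗ W)).hom ≫ V' ◁ (α_ V W' W).inv ≫ V' ◁ (β_ V W').hom ▷ W ≫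
        V' ◁ (α_ W' V W).hom ≫ (α_ V' W' (V ⊗ W)).inv ≫ (V' ⊗ W') ◁ (β_ V W).hom ≫
          c.ι (W ⊗ V) (V' ⊗ W')) :
    c.δ (V ⊗ W) = c.δ V ▷ W ≫ (α_ V F W).hom ≫ V ◁ F ◁ c.δ W ≫ V ◁ (α_ F W F).inv ≫
      V ◁ (β_ F W).hom ▷ F ≫ V ◁ (α_ W F F).hom ≫ V ◁ W ◁ m ≫ (α_ V W F).inv := by
  refine c.δ_tensor_of_ι V V' W W' m ?_
  rw [h, ι_braiding, braiding_tensor_left_hom]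
  monoidal

/-- The antipode formula through the coaction on `V'` follows from the formula through coefficients
of `V'`, which needs a second dual `V''`. -/
theorem antipode_of_double (V'' : C) [ExactPairing V' V''] (S : F ⟶ F)
    (h : c.ι V V' ≫ S = ((λ_ V').inv ≫ η_ V' V'' ▷ V' ≫ (α_ V' V'' V').hom ≫
      (β_ (V'' ⊗ V') V').inv) ▷ V ≫ (α_ (V'' ⊗ V') V' V).hom ≫
      (V'' ⊗ V') ◁ ε_ V V' ≫ (ρ_ (V'' ⊗ V')).hom ≫ c.ι V' V'') :
    c.ι V V' ≫ S = c.δ V' ▷ V ≫ (β_ F V').inv ▷ V ≫ (α_ F V' V).hom ≫ F ◁ ε_ V V' ≫ (ρ_ F).hom := by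
  rw [h, c.δ_eq V' V'']
  calc _ = 𝟙 _ ⊗≫ (η_ V' V'' ▷ V' ≫ (α_ V' V'' V').hom ≫ (β_ (V'' ⊗ V') V').inv) ▷ V ⊗≫
           ((V'' ⊗ V') ◁ ε_ V V' ≫ c.ι V' V'' ▷ 𝟙_ C) ⊗≫ 𝟙 _ := by monoidal
    _ = 𝟙 _ ⊗≫ (η_ V' V'' ▷ V' ≫ (α_ V' V'' V').hom ≫ (β_ (V'' ⊗ V') V').inv ≫
          c.ι V' V'' ▷ V') ▷ V ⊗≫ (F ◁ ε_ V V') ⊗≫ 𝟙 _ := by rw [whisker_exchange]; monoidal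
    _ = _ := by rw [← braiding_inv_naturality_right]; monoidal

end NatCoaction
end BraidedReconstruction

end

/-! ### Operations on coefficients as transposes -/

section

universe v u
open CategoryTheory MonoidalCategory ExactPairing
namespace BraidedReconstruction
variable {C : Type u} [Category.{v} C] [MonoidalCategory C]
variable {F : C} (c : NatCoaction F)
variable (U U' U'' V V' V'' W W' W'' : C) [ExactPairing U U'] [ExactPairing V V']
  [ExactPairing W W']
  [ExactPairing U' U''] [ExactPairing V' V''] [ExactPairing W' W'']
namespace NatCoaction

/-- As `bracket_elt`, for an arbitrary dual of `U ⊗ U'`. -/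
theorem bracket_elt_eq (Z : C) [ExactPairing (U ⊗ U') Z] : bracket (U ⊗ U') Z (c.elt U U') =
    mate (𝟙 (U ⊗ U')) (U'' ⊗ U') Z ≫ c.ι U' U'' := by
  rw [← c.bracket_elt U U' U'', mate_bracket]; simp

variable [BraidedCategory C]
variable {c} {m : F ⊗ F ⟶ F} {u : 𝟙_ C ⟶ F} {Δ : F ⟶ F ⊗ F} {e : F ⟶ 𝟙_ C}

include V'' W'' in
/-- The coefficient maps of `V'` and `W'` multiply through the transpose of `comulHom`. -/
theorem Structure.bracket_elt_mul (D : c.Structure m u Δ e) (Zv Zw Z Z' : C)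
    [ExactPairing (V ⊗ V') Zv] [ExactPairing (W ⊗ W') Zw] [ExactPairing (W ⊗ V) Z]
    [ExactPairing ((W ⊗ V) ⊗ Z) Z'] :
    bracket (V ⊗ V') Zv (c.elt V V') ▷ Zw ≫ F ◁ bracket (W ⊗ W') Zw (c.elt W W') ≫ m =
      mate (comulHom V V' W W' Z) Z' (Zv ⊗ Zw) ≫
        bracket ((W ⊗ V) ⊗ Z) Z' (c.elt (W ⊗ V) Z) := by
  have h : mate (comulHom V V' W W' Z) Z' (Zv ⊗ Zw) =
      mate (𝟙 ((W ⊗ W') ⊗ (V ⊗ V'))) ((V'' ⊗ V') ⊗ (W'' ⊗ W')) (Zv ⊗ Zw) ≫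
        mate (comulHom V V' W W' Z) Z' ((V'' ⊗ V') ⊗ (W'' ⊗ W')) := by
    rw [mate_comp, Category.comp_id]
  rw [h, Category.assoc, ← ι_mul_eq_mate V V' V'' W W' W'' D Z Z', mate_tensor,
    c.bracket_elt_eq V V' V'', c.bracket_elt_eq W W' W'']
  simp only [comp_whiskerRight, whiskerLeft_comp, Category.assoc]
  rw [whisker_exchange_assoc]

include U'' in
/-- The comultiplication of coefficients is the transpose of the composition of internal
endomorphisms. -/
theorem Structure.bracket_elt_comul (D : c.Structure m u Δ e) (Z : C) [ExactPairing (U ⊗ U') Z] :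
    bracket (U ⊗ U') Z (c.elt U U') ≫ Δ =
      mate ((α_ U U' (U ⊗ U')).hom ≫ U ◁ (α_ U' U U').inv ≫ U ◁ ε_ U U' ▷ U' ≫ U ◁ (λ_ U').hom)
        (Z ⊗ Z) Z ≫ bracket (U ⊗ U') Z (c.elt U U') ▷ Z ≫
          F ◁ bracket (U ⊗ U') Z (c.elt U U') := by
  set K := (α_ U U' (U ⊗ U')).hom ≫ U ◁ (α_ U' U U').inv ≫ U ◁ ε_ U U' ▷ U' ≫ U ◁ (λ_ U').hom
  have h1 : c.ι U' U'' ≫ Δ = mate K ((U'' ⊗ U') ⊗ (U'' ⊗ U')) (U'' ⊗ U') ≫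
      c.ι U' U'' ▷ (U'' ⊗ U') ≫ F ◁ c.ι U' U'' := by
    rw [← mate_inner U U' U'', D.ι_comul' U' U'']; monoidal
  have h2 : mate (𝟙 (U ⊗ U')) (U'' ⊗ U') Z ≫ mate K ((U'' ⊗ U') ⊗ (U'' ⊗ U')) (U'' ⊗ U') =
      mate K (Z ⊗ Z) Z ≫ mate (𝟙 ((U ⊗ U') ⊗ (U ⊗ U'))) ((U'' ⊗ U') ⊗ (U'' ⊗ U')) (Z ⊗ Z) := by
    rw [mate_comp, mate_comp, Category.comp_id, Category.id_comp]
  rw [c.bracket_elt_eq U U' U'', Category.assoc, h1, ← Category.assoc, h2, mate_tensor]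
  simp only [comp_whiskerRight, whiskerLeft_comp, Category.assoc]
  rw [whisker_exchange_assoc]

include U'' in
theorem Structure.bracket_elt_counit (D : c.Structure m u Δ e) (Z : C) [ExactPairing (U ⊗ U') Z] :
    bracket (U ⊗ U') Z (c.elt U U') ≫ e = (ρ_ Z).inv ≫ Z ◁ η_ U U' ≫ ε_ (U ⊗ U') Z := by
  have h := mate_eval (U'' ⊗ U') Z (𝟙 (U ⊗ U'))
  rw [whiskerLeft_id, Category.id_comp] at h
  rw [c.bracket_elt_eq U U' U'', Category.assoc, D.ι_counit U' U'', ← h, whisker_exchange_assoc,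
    coev_tensor_eval]
  simp

/-- The antipode of coefficients is the transpose of `antipodeHom`. -/
theorem bracket_elt_antipode (S : F ⟶ F)
    (hS : c.ι U' U'' ≫ S = c.δ U'' ▷ U' ≫ (β_ F U'').inv ▷ U' ≫ (α_ F U'' U').hom ≫
      F ◁ ε_ U' U'' ≫ (ρ_ F).hom) (Z Z' : C) [ExactPairing (U ⊗ U') Z]
    [ExactPairing (U' ⊗ U'') Z'] :
    bracket (U ⊗ U') Z (c.elt U U') ≫ S =
      mate (antipodeHom U U' U'') Z' Z ≫ bracket (U' ⊗ U'') Z' (c.elt U' U'') := by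
  rw [mate_bracket, ← elt_antipode U U' U'' S hS, ← bracket_comp]

end NatCoaction
end BraidedReconstruction

end

/-! ### Actions on tensor products and the pentagon -/

noncomputable section

open CategoryTheory MonoidalCategory
open QuasiHopf QuasiHopfAlgebra

namespace QuasiHopf
variable {k : Type*} [Field k]

theorem map_map_apply {M N M' N' M₂ N₂ : Type*} [AddCommMonoid M] [Module k M] [AddCommMonoid N]
    [Module k N] [AddCommMonoid M'] [Module k M'] [AddCommMonoid N'] [Module k N']
    [AddCommMonoid M₂] [Module k M₂] [AddCommMonoid N₂] [Module k N₂] (f : M' →ₗ[k] M₂)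
    (g : N' →ₗ[k] N₂) (f' : M →ₗ[k] M') (g' : N →ₗ[k] N') (y : M ⊗[k] N) :
    TensorProduct.map f g (TensorProduct.map f' g' y) =
      TensorProduct.map (f ∘ₗ f') (g ∘ₗ g') y := by
  rw [TensorProduct.map_comp]; rfl

section ext
variable {A B D A' B' : Type*} [Ring A] [Algebra k A] [Ring B] [Algebra k B] [Ring D] [Algebra k D]
variable {M N P K M' N' : Type*} [AddCommGroup M] [Module k M] [AddCommGroup N] [Module k N]
  [AddCommGroup P] [Module k P] [AddCommGroup K] [Module k K]
  [AddCommGroup M'] [Module k M'] [AddCommGroup N'] [Module k N']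
variable (ρ : A →ₐ[k] Module.End k M) (σ : B →ₐ[k] Module.End k N) (τ : D →ₐ[k] Module.End k P)

@[simp] theorem extAct_tmul (a : A) (b : B) (m : M) (n : N) :
    extAct ρ σ (a ⊗ₜ[k] b) (m ⊗ₜ[k] n) = ρ a m ⊗ₜ[k] σ b n := by
  simp [extAct, Module.endTensorEndAlgHom_apply]

theorem extAct_tmul_eq_map (a : A) (b : B) :
    extAct ρ σ (a ⊗ₜ[k] b) = TensorProduct.map (ρ a) (σ b) := by
  ext; simp

/-- Pairs of equivariant maps are equivariant for the external tensor product of two actions. -/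
theorem extAct_natural {ρ' : A →ₐ[k] Module.End k M'} {σ' : B →ₐ[k] Module.End k N'}
    (φ : M →ₗ[k] M') (ψ : N →ₗ[k] N') (hφ : ∀ a m, φ (ρ a m) = ρ' a (φ m))
    (hψ : ∀ a m, ψ (σ a m) = σ' a (ψ m)) (t : A ⊗[k] B) (y : M ⊗[k] N) :
    TensorProduct.map φ ψ (extAct ρ σ t y) = extAct ρ' σ' t (TensorProduct.map φ ψ y) := by
  induction t with
  | zero => simp
  | add s t hs ht => simp [hs, ht]
  | tmul a b =>
    induction y with
    | zero => simp
    | add s t hs ht => simp [hs, ht]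
    | tmul m n => simp [hφ, hψ]

theorem extAct_comp_right {B' : Type*} [Ring B'] [Algebra k B'] (f : B' →ₐ[k] B) (t : A ⊗[k] B') :
    extAct ρ (σ.comp f) t = extAct ρ σ (Algebra.TensorProduct.map (AlgHom.id k A) f t) := by
  induction t with
  | zero => simp
  | add s t hs ht => simp [hs, ht]
  | tmul a b => ext; simp

theorem extAct_comp_left {A' : Type*} [Ring A'] [Algebra k A'] (f : A' →ₐ[k] A) (t : A' ⊗[k] B) :
    extAct (ρ.comp f) σ t = extAct ρ σ (Algebra.TensorProduct.map f (AlgHom.id k B) t) := by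
  induction t with
  | zero => simp
  | add s t hs ht => simp [hs, ht]
  | tmul a b => ext; simp

theorem extAct_assoc (t : (A ⊗[k] B) ⊗[k] D) (y : (M ⊗[k] N) ⊗[k] P) :
    TensorProduct.assoc k M N P (extAct (extAct ρ σ) τ t y) =
      extAct ρ (extAct σ τ) (Algebra.TensorProduct.assoc k k k A B D t)
        (TensorProduct.assoc k M N P y) := by
  induction t with
  | zero => simp
  | add s t hs ht => simp [hs, ht]
  | tmul t d =>
    induction t with
    | zero => simp
    | add s t hs ht => simp [hs, ht, TensorProduct.add_tmul]
    | tmul a b =>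
      induction y with
      | zero => simp
      | add s t hs ht => simp [hs, ht]
      | tmul y p =>
        induction y with
        | zero => simp
        | add s t hs ht => simp only [TensorProduct.add_tmul, map_add, hs, ht]
        | tmul m n => simp
end ext

section slots
variable {H : Type*} [Ring H] [Algebra k H]
@[simp] theorem slot₁_apply (a : H) : slot₁ k H a = (a ⊗ₜ 1) ⊗ₜ (1 ⊗ₜ 1) := rfl
@[simp] theorem slot₂_apply (a : H) : slot₂ k H a = (1 ⊗ₜ a) ⊗ₜ (1 ⊗ₜ 1) := rfl
@[simp] theorem slot₃_apply (a : H) : slot₃ k H a = (1 ⊗ₜ 1) ⊗ₜ (a ⊗ₜ 1) := rfl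
@[simp] theorem slot₄_apply (a : H) : slot₄ k H a = (1 ⊗ₜ 1) ⊗ₜ (1 ⊗ₜ a) := rfl
@[simp] theorem leg₁_apply (a : H) : leg₁ k H a = a ⊗ₜ (1 ⊗ₜ 1) := rfl
@[simp] theorem leg₂_apply (a : H) : leg₂ k H a = 1 ⊗ₜ (a ⊗ₜ 1) := rfl
@[simp] theorem leg₃_apply (a : H) : leg₃ k H a = 1 ⊗ₜ (1 ⊗ₜ a) := rfl
end slots

end QuasiHopf

namespace QuasiHopfAlgebra
variable {k H : Type*} [Field k] [Ring H] [Algebra k H] (Q : QuasiHopfAlgebra k H)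

theorem X_mul_x : Q.X * Q.x = 1 := Q.Φ.mul_inv
theorem x_mul_X : Q.x * Q.X = 1 := Q.Φ.inv_mul

section Modules
variable {M N P K M' N' P' : Type*} [AddCommGroup M] [Module k M] [AddCommGroup N] [Module k N]
  [AddCommGroup P] [Module k P] [AddCommGroup K] [Module k K]
  [AddCommGroup M'] [Module k M'] [AddCommGroup N'] [Module k N'] [AddCommGroup P'] [Module k P']
variable (ρ : H →ₐ[k] Module.End k M) (σ : H →ₐ[k] Module.End k N) (τ : H →ₐ[k] Module.End k P)
  (π : H →ₐ[k] Module.End k K)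
variable {ρ' : H →ₐ[k] Module.End k M'} {σ' : H →ₐ[k] Module.End k N'}
  {τ' : H →ₐ[k] Module.End k P'}

theorem tensAct_apply (h : H) : Q.tensAct ρ σ h = extAct ρ σ (Q.Δ h) := rfl

theorem assocHom_apply (y : (M ⊗[k] N) ⊗[k] P) :
    Q.assocHom ρ σ τ y = extAct ρ (extAct σ τ) Q.X (TensorProduct.assoc k M N P y) := rfl

theorem assocInv_apply (y : M ⊗[k] (N ⊗[k] P)) :
    Q.assocInv ρ σ τ y =
      (TensorProduct.assoc k M N P).symm (extAct ρ (extAct σ τ) Q.x y) := rfl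

theorem assocInv_assocHom (y : (M ⊗[k] N) ⊗[k] P) :
    Q.assocInv ρ σ τ (Q.assocHom ρ σ τ y) = y := by
  rw [assocHom_apply, assocInv_apply, ← Module.End.mul_apply, ← map_mul, x_mul_X]
  simp

theorem assocHom_assocInv (y : M ⊗[k] (N ⊗[k] P)) :
    Q.assocHom ρ σ τ (Q.assocInv ρ σ τ y) = y := by
  rw [assocHom_apply, assocInv_apply, LinearEquiv.apply_symm_apply, ← Module.End.mul_apply,
    ← map_mul, X_mul_x]
  simp

variable {ρ σ τ} in
theorem IsHLinear.map {φ : M →ₗ[k] M'} {ψ : N →ₗ[k] N'} (hφ : IsHLinear ρ ρ' φ)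
    (hψ : IsHLinear σ σ' ψ) :
    IsHLinear (Q.tensAct ρ σ) (Q.tensAct ρ' σ') (TensorProduct.map φ ψ) :=
  fun h m => extAct_natural ρ σ φ ψ hφ hψ (Q.Δ h) m

theorem assocHom_linear : IsHLinear (Q.tensAct (Q.tensAct ρ σ) τ) (Q.tensAct ρ (Q.tensAct σ τ))
    (Q.assocHom ρ σ τ) := by
  intro h y
  rw [assocHom_apply, assocHom_apply, tensAct_apply, tensAct_apply, tensAct, tensAct,
    extAct_comp_left, extAct_comp_right, extAct_assoc, ← Module.End.mul_apply,
    ← Module.End.mul_apply, ← map_mul, ← map_mul, Q.coassoc]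
  congr 2
  change _ = _ * ↑Q.Φ⁻¹ * (Q.Φ : H ⊗[k] (H ⊗[k] H))
  rw [Units.inv_mul_cancel_right]
  rfl

theorem isHLinear_of_inverse {ρ : H →ₐ[k] Module.End k M} {σ : H →ₐ[k] Module.End k N}
    {φ : M →ₗ[k] N} {ψ : N →ₗ[k] M}
    (h : IsHLinear ρ σ φ) (h1 : ∀ y, φ (ψ y) = y) (h2 : ∀ y, ψ (φ y) = y) :
    IsHLinear σ ρ ψ := by
  intro a y
  rw [← h2 (ρ a (ψ y)), h, h1]

theorem assocInv_linear : IsHLinear (Q.tensAct ρ (Q.tensAct σ τ)) (Q.tensAct (Q.tensAct ρ σ) τ)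
    (Q.assocInv ρ σ τ) :=
  isHLinear_of_inverse (Q.assocHom_linear ρ σ τ) (Q.assocHom_assocInv ρ σ τ)
    (Q.assocInv_assocHom ρ σ τ)

/-- The action of `H ⊗ H ⊗ H ⊗ H` on a fourfold tensor product. -/
abbrev act4 : H4 k H →ₐ[k] Module.End k ((M ⊗[k] N) ⊗[k] (P ⊗[k] K)) :=
  extAct (extAct ρ σ) (extAct τ π)

/-- The element `Φ ⊗ 1` acts on a fourfold tensor product as the associator of the first three
factors; the next lemmas do the same for the other sides of the pentagon. -/
theorem act4_whiskerRight (t : H ⊗[k] (H ⊗[k] H)) :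
    act4 ρ σ τ π (mulMap₃ (slot₁ k H) (slot₂ k H) (slot₃ k H) t) ∘ₗ
        (TensorProduct.assoc k (M ⊗[k] N) P K).toLinearMap ∘ₗ
        TensorProduct.map (TensorProduct.assoc k M N P).symm.toLinearMap LinearMap.id =
      (TensorProduct.assoc k (M ⊗[k] N) P K).toLinearMap ∘ₗ
        TensorProduct.map (TensorProduct.assoc k M N P).symm.toLinearMap LinearMap.id ∘ₗ
        TensorProduct.map (extAct ρ (extAct σ τ) t) LinearMap.id := by
  induction t using TensorProduct.induction_on with
  | zero => simp
  | add s t hs ht => simp only [map_add, hs, ht, LinearMap.comp_add, LinearMap.add_comp,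
      TensorProduct.map_add_left]
  | tmul a t =>
    induction t with
    | zero => simp
    | add s t hs ht => simp only [map_add, hs, ht, LinearMap.comp_add, LinearMap.add_comp,
        TensorProduct.map_add_left, TensorProduct.tmul_add]
    | tmul b c => ext; simp

theorem act4_whiskerLeft (t : H ⊗[k] (H ⊗[k] H)) :
    act4 ρ σ τ π (mulMap₃ (slot₂ k H) (slot₃ k H) (slot₄ k H) t) ∘ₗ
        (TensorProduct.assoc k M N (P ⊗[k] K)).symm.toLinearMap =
      (TensorProduct.assoc k M N (P ⊗[k] K)).symm.toLinearMap ∘ₗ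
        TensorProduct.map LinearMap.id (extAct σ (extAct τ π) t) := by
  induction t using TensorProduct.induction_on with
  | zero => simp
  | add s t hs ht => simp only [map_add, hs, ht, LinearMap.comp_add, LinearMap.add_comp,
      TensorProduct.map_add_right]
  | tmul a t =>
    induction t with
    | zero => simp
    | add s t hs ht => simp only [map_add, hs, ht, LinearMap.comp_add, LinearMap.add_comp,
        TensorProduct.map_add_right, TensorProduct.tmul_add]
    | tmul b c => ext; simp

theorem act4_mid (t : H ⊗[k] (H ⊗[k] H)) :
    act4 ρ σ τ π (mulMap₃ (slot₁ k H) (Q.Δ₂ (slot₂ k H) (slot₃ k H)) (slot₄ k H) t) ∘ₗ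
        (TensorProduct.assoc k M N (P ⊗[k] K)).symm.toLinearMap ∘ₗ
        TensorProduct.map LinearMap.id (TensorProduct.assoc k N P K).toLinearMap =
      (TensorProduct.assoc k M N (P ⊗[k] K)).symm.toLinearMap ∘ₗ
        TensorProduct.map LinearMap.id (TensorProduct.assoc k N P K).toLinearMap ∘ₗ
        extAct ρ (extAct (Q.tensAct σ τ) π) t := by
  induction t using TensorProduct.induction_on with
  | zero => simp
  | add s t hs ht => simp only [map_add, hs, ht, LinearMap.comp_add, LinearMap.add_comp]
  | tmul a t =>
    induction t with
    | zero => simp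
    | add s t hs ht => simp only [map_add, hs, ht, LinearMap.comp_add, LinearMap.add_comp,
        TensorProduct.tmul_add]
    | tmul b c =>
      simp only [mulMap₃_tmul, Δ₂, LinearMap.comp_apply, AlgHom.toLinearMap_apply,
        extAct_tmul_eq_map, tensAct_apply]
      generalize Q.Δ b = d
      induction d with
      | zero => simp
      | add s t hs ht => simp only [map_add, hs, ht, LinearMap.comp_add, LinearMap.add_comp,
          TensorProduct.map_add_left, TensorProduct.map_add_right, mul_add, add_mul]
      | tmul d e => ext; simp

theorem act4_left (t : H ⊗[k] (H ⊗[k] H)) :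
    act4 ρ σ τ π (mulMap₃ (Q.Δ₂ (slot₁ k H) (slot₂ k H)) (slot₃ k H) (slot₄ k H) t) =
      extAct (Q.tensAct ρ σ) (extAct τ π) t := by
  induction t using TensorProduct.induction_on with
  | zero => simp
  | add s t hs ht => simp only [map_add, hs, ht]
  | tmul a t =>
    induction t with
    | zero => simp
    | add s t hs ht => simp only [map_add, hs, ht, TensorProduct.tmul_add]
    | tmul b c =>
      simp only [mulMap₃_tmul, Δ₂, LinearMap.comp_apply, AlgHom.toLinearMap_apply,
        extAct_tmul_eq_map, tensAct_apply]
      generalize Q.Δ a = d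
      induction d with
      | zero => simp
      | add s t hs ht => simp only [map_add, hs, ht, TensorProduct.map_add_left, add_mul]
      | tmul d e => ext; simp

theorem act4_right (t : H ⊗[k] (H ⊗[k] H)) :
    act4 ρ σ τ π (mulMap₃ (slot₁ k H) (slot₂ k H) (Q.Δ₂ (slot₃ k H) (slot₄ k H)) t) ∘ₗ
        (TensorProduct.assoc k M N (P ⊗[k] K)).symm.toLinearMap =
      (TensorProduct.assoc k M N (P ⊗[k] K)).symm.toLinearMap ∘ₗ
        extAct ρ (extAct σ (Q.tensAct τ π)) t := by
  induction t using TensorProduct.induction_on with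
  | zero => simp
  | add s t hs ht => simp only [map_add, hs, ht, LinearMap.comp_add, LinearMap.add_comp]
  | tmul a t =>
    induction t with
    | zero => simp
    | add s t hs ht => simp only [map_add, hs, ht, LinearMap.comp_add, LinearMap.add_comp,
        TensorProduct.tmul_add]
    | tmul b c =>
      simp only [mulMap₃_tmul, Δ₂, LinearMap.comp_apply, AlgHom.toLinearMap_apply,
        extAct_tmul_eq_map, tensAct_apply]
      generalize Q.Δ c = d
      induction d with
      | zero => simp
      | add s t hs ht => simp only [map_add, hs, ht, LinearMap.comp_add, LinearMap.add_comp,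
          TensorProduct.map_add_right, mul_add]
      | tmul d e => ext; simp

theorem assoc_coherence (z : (M ⊗[k] (N ⊗[k] P)) ⊗[k] K) :
    (TensorProduct.assoc k M N (P ⊗[k] K)).symm (TensorProduct.map LinearMap.id
        (TensorProduct.assoc k N P K).toLinearMap (TensorProduct.assoc k M (N ⊗[k] P) K z)) =
      TensorProduct.assoc k (M ⊗[k] N) P K
        (TensorProduct.map (TensorProduct.assoc k M N P).symm.toLinearMap LinearMap.id z) := by
  have : (TensorProduct.assoc k M N (P ⊗[k] K)).symm.toLinearMap ∘ₗ
      TensorProduct.map LinearMap.id (TensorProduct.assoc k N P K).toLinearMap ∘ₗ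
        (TensorProduct.assoc k M (N ⊗[k] P) K).toLinearMap =
      (TensorProduct.assoc k (M ⊗[k] N) P K).toLinearMap ∘ₗ
        TensorProduct.map (TensorProduct.assoc k M N P).symm.toLinearMap LinearMap.id := by
    ext; simp
  exact LinearMap.congr_fun this z

theorem pentagon (y : ((M ⊗[k] N) ⊗[k] P) ⊗[k] K) :
    TensorProduct.map LinearMap.id (Q.assocHom σ τ π)
        (Q.assocHom ρ (Q.tensAct σ τ) π
          (TensorProduct.map (Q.assocHom ρ σ τ) LinearMap.id y)) =
      Q.assocHom ρ σ (Q.tensAct τ π) (Q.assocHom (Q.tensAct ρ σ) τ π y) := by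
  have h1 := LinearMap.congr_fun (act4_whiskerRight ρ σ τ π Q.X)
    (TensorProduct.map (TensorProduct.assoc k M N P).toLinearMap LinearMap.id y)
  have h2 := LinearMap.congr_fun (Q.act4_mid ρ σ τ π Q.X) (TensorProduct.assoc k M (N ⊗[k] P) K
    (TensorProduct.map (Q.assocHom ρ σ τ) LinearMap.id y))
  have h3 := LinearMap.congr_fun (act4_whiskerLeft ρ σ τ π Q.X)
    (TensorProduct.map LinearMap.id (TensorProduct.assoc k N P K).toLinearMap
      (Q.assocHom ρ (Q.tensAct σ τ) π (TensorProduct.map (Q.assocHom ρ σ τ) LinearMap.id y)))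
  have h4 := Q.act4_left ρ σ τ π Q.X
  have h5 := LinearMap.congr_fun (Q.act4_right ρ σ τ π Q.X)
    (TensorProduct.assoc k M N (P ⊗[k] K) (Q.assocHom (Q.tensAct ρ σ) τ π y))
  have key := LinearMap.congr_fun (congrArg (act4 ρ σ τ π) Q.cocycle)
    (TensorProduct.assoc k (M ⊗[k] N) P K y)
  have e1 : TensorProduct.map (TensorProduct.assoc k M N P).symm.toLinearMap LinearMap.id
      (TensorProduct.map (TensorProduct.assoc k M N P).toLinearMap LinearMap.id y) = y := by
    rw [← LinearMap.comp_apply, ← TensorProduct.map_comp]; simp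
  have e2 : TensorProduct.map (extAct ρ (extAct σ τ) Q.X) LinearMap.id
      (TensorProduct.map (TensorProduct.assoc k M N P).toLinearMap LinearMap.id y) =
      TensorProduct.map (Q.assocHom ρ σ τ) LinearMap.id y := by
    rw [← LinearMap.comp_apply, ← TensorProduct.map_comp]; rfl
  have e3 : ∀ z, TensorProduct.map LinearMap.id (extAct σ (extAct τ π) Q.X)
      (TensorProduct.map LinearMap.id (TensorProduct.assoc k N P K).toLinearMap z) =
      TensorProduct.map (LinearMap.id : M →ₗ[k] M) (Q.assocHom σ τ π) z := by
    intro z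
    rw [← LinearMap.comp_apply, ← TensorProduct.map_comp]; rfl
  simp only [LinearMap.comp_apply, LinearEquiv.coe_coe, LinearEquiv.symm_apply_apply] at h1 h2 h3 h5
  rw [e1, e2] at h1
  rw [assoc_coherence, ← Q.assocHom_apply ρ (Q.tensAct σ τ) π] at h2
  rw [e3] at h3
  rw [← Q.assocHom_apply] at h5
  simp only [map_mul, Module.End.mul_apply] at key
  change act4 ρ σ τ π (mulMap₃ (slot₂ k H) (slot₃ k H) (slot₄ k H) Q.X)
    (act4 ρ σ τ π (mulMap₃ (slot₁ k H) (Q.Δ₂ (slot₂ k H) (slot₃ k H)) (slot₄ k H) Q.X)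
    (act4 ρ σ τ π (mulMap₃ (slot₁ k H) (slot₂ k H) (slot₃ k H) Q.X) _)) =
    act4 ρ σ τ π (mulMap₃ (slot₁ k H) (slot₂ k H) (Q.Δ₂ (slot₃ k H) (slot₄ k H)) Q.X)
    (act4 ρ σ τ π (mulMap₃ (Q.Δ₂ (slot₁ k H) (slot₂ k H)) (slot₃ k H) (slot₄ k H) Q.X) _) at key
  rw [h1, h2, h3, h4, ← Q.assocHom_apply, h5] at key
  exact (TensorProduct.assoc k M N (P ⊗[k] K)).symm.injective key

theorem triangle (y : (M ⊗[k] k) ⊗[k] N) :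
    TensorProduct.map LinearMap.id (TensorProduct.lid k N).toLinearMap
        (Q.assocHom ρ Q.unitAct σ y) =
      TensorProduct.map (TensorProduct.rid k M).toLinearMap LinearMap.id y := by
  have key : ∀ t : H ⊗[k] (H ⊗[k] H), TensorProduct.map LinearMap.id
      (TensorProduct.lid k N).toLinearMap ∘ₗ extAct ρ (extAct Q.unitAct σ) t =
      extAct ρ σ (TensorProduct.map LinearMap.id (TensorProduct.lid k H).toLinearMap
        (Algebra.TensorProduct.map (AlgHom.id k H)
        (Algebra.TensorProduct.map Q.ε (AlgHom.id k H)) t)) ∘ₗ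
      TensorProduct.map LinearMap.id (TensorProduct.lid k N).toLinearMap := by
    intro t
    induction t using TensorProduct.induction_on with
    | zero => simp
    | add s t hs ht => simp only [map_add, hs, ht, LinearMap.comp_add, LinearMap.add_comp]
    | tmul a t =>
      induction t with
      | zero => simp
      | add s t hs ht => simp only [map_add, hs, ht, LinearMap.comp_add, LinearMap.add_comp,
          TensorProduct.tmul_add]
      | tmul b c =>
        ext m n
        simp [unitAct, Algebra.ofId_apply]
  have := LinearMap.congr_fun (key Q.X) (TensorProduct.assoc k M k N y)
  rw [X, Q.cocycle_counit] at this
  rw [assocHom_apply, X]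
  simp only [LinearMap.comp_apply] at this
  rw [this]
  simp only [Algebra.TensorProduct.one_def, TensorProduct.map_tmul, LinearMap.id_apply,
    LinearEquiv.coe_coe, TensorProduct.lid_tmul, one_smul, extAct_tmul_eq_map, map_one,
    Module.End.one_eq_id, TensorProduct.map_id]
  have e : TensorProduct.map LinearMap.id (TensorProduct.lid k N).toLinearMap ∘ₗ
      (TensorProduct.assoc k M k N).toLinearMap =
      TensorProduct.map (TensorProduct.rid k M).toLinearMap LinearMap.id := by
    ext; simp
  exact LinearMap.congr_fun e y
end Modules
end QuasiHopfAlgebra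

end

/-! ### Duals, the braiding and the hexagons -/

noncomputable section

open CategoryTheory MonoidalCategory
open QuasiHopf QuasiHopfAlgebra

namespace QuasiHopf
variable {k : Type*} [Field k] {M N M' N' : Type*} [AddCommGroup M] [Module k M]
  [AddCommGroup N] [Module k N] [AddCommGroup M'] [Module k M'] [AddCommGroup N'] [Module k N']

/-- The linear map `M → N` attached to an element of `N ⊗ M*`. -/
def toHom : N ⊗[k] Module.Dual k M →ₗ[k] (M →ₗ[k] N) :=
  dualTensorHom k M N ∘ₗ (TensorProduct.comm k N (Module.Dual k M)).toLinearMap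

@[simp] theorem toHom_tmul (n : N) (φ : Module.Dual k M) (m : M) :
    toHom (n ⊗ₜ[k] φ) m = φ m • n := by simp [toHom]

theorem toHom_injective [FiniteDimensional k M] :
    Function.Injective (toHom : N ⊗[k] Module.Dual k M →ₗ[k] _) := by
  have : (toHom : N ⊗[k] Module.Dual k M →ₗ[k] (M →ₗ[k] N)) =
      (dualTensorHomEquiv k M N).toLinearMap ∘ₗ
        (TensorProduct.comm k N (Module.Dual k M)).toLinearMap := by
    ext; simp
  rw [this]
  exact (dualTensorHomEquiv k M N).injective.comp (TensorProduct.comm k N _).injective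

theorem toHom_map (a : N →ₗ[k] N') (b : M' →ₗ[k] M) (y : N ⊗[k] Module.Dual k M) :
    toHom (TensorProduct.map a (Module.Dual.transpose b) y) = a ∘ₗ toHom y ∘ₗ b := by
  induction y with
  | zero => simp
  | add s t hs ht => simp only [map_add, hs, ht, LinearMap.add_comp, LinearMap.comp_add]
  | tmul n φ => ext; simp [Module.Dual.transpose_apply]

theorem toHom_map_left (a : N →ₗ[k] N') (y : N ⊗[k] Module.Dual k M) :
    toHom (TensorProduct.map a LinearMap.id y) = a ∘ₗ toHom y := by
  have := toHom_map a LinearMap.id y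
  rwa [LinearMap.comp_id, show Module.Dual.transpose (LinearMap.id : M →ₗ[k] M) = LinearMap.id
    from rfl] at this

@[simp] theorem toHom_coevaluation [FiniteDimensional k M] :
    toHom (coevaluation k M 1) = LinearMap.id := by
  ext m
  rw [coevaluation_apply_one]
  simp only [map_sum, LinearMap.sum_apply, toHom_tmul, Module.Basis.coord_apply,
    LinearMap.id_apply]
  exact (Module.Basis.ofVectorSpace k M).sum_repr m

theorem contract_right (y : N ⊗[k] Module.Dual k M) (m : M) :
    TensorProduct.map LinearMap.id (contractLeft k M)
      (TensorProduct.assoc k N (Module.Dual k M) M (y ⊗ₜ m)) = toHom y m ⊗ₜ 1 := by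
  induction y with
  | zero => simp
  | add s t hs ht => simp only [TensorProduct.add_tmul, map_add, hs, ht, LinearMap.add_apply]
  | tmul n φ => simp [contractLeft_apply, TensorProduct.smul_tmul]

theorem contract_left (y : N ⊗[k] Module.Dual k M) (φ : Module.Dual k N) :
    TensorProduct.map (contractLeft k N) LinearMap.id
      ((TensorProduct.assoc k (Module.Dual k N) N (Module.Dual k M)).symm (φ ⊗ₜ y)) =
        1 ⊗ₜ (φ ∘ₗ toHom y) := by
  induction y with
  | zero => simp
  | add s t hs ht => simp only [TensorProduct.tmul_add, map_add, hs, ht, LinearMap.comp_add]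
  | tmul n ψ =>
    simp only [TensorProduct.assoc_symm_tmul, TensorProduct.map_tmul, contractLeft_apply,
      LinearMap.id_apply]
    rw [← mul_one (φ n), ← smul_eq_mul, TensorProduct.smul_tmul]
    congr 1
    ext; simp [mul_comm]

end QuasiHopf

namespace QuasiHopfAlgebra
variable {k H : Type*} [Field k] [Ring H] [Algebra k H] (Q : QuasiHopfAlgebra k H)

@[simp] theorem SαI_tmul (a b : H) : Q.SαI (a ⊗ₜ b) = Q.S a * Q.α * b := by simp [SαI]
@[simp] theorem IβS_tmul (a b : H) : Q.IβS (a ⊗ₜ b) = a * Q.β * Q.S b := by simp [IβS]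

theorem SαI_Δ (h : H) : Q.SαI (Q.Δ h) = Q.ε h • Q.α := Q.antipode_left h
theorem IβS_Δ (h : H) : Q.IβS (Q.Δ h) = Q.ε h • Q.β := Q.antipode_right h

section Modules
variable {M N P K : Type*} [AddCommGroup M] [Module k M] [AddCommGroup N] [Module k N]
  [AddCommGroup P] [Module k P] [AddCommGroup K] [Module k K]
variable (ρ : H →ₐ[k] Module.End k M) (σ : H →ₐ[k] Module.End k N) (τ : H →ₐ[k] Module.End k P)

@[simp] theorem dualAct_apply (h : H) (φ : Module.Dual k M) (m : M) :
    Q.dualAct ρ h φ m = φ (ρ (Q.S h) m) := rfl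

theorem dualAct_eq (h : H) : Q.dualAct ρ h = Module.Dual.transpose (ρ (Q.S h)) := rfl

@[simp] theorem unitAct_apply (h : H) (c : k) : Q.unitAct h c = Q.ε h * c := by
  simp [unitAct, Algebra.ofId_apply]

@[simp] theorem ev_tmul (φ : Module.Dual k M) (m : M) : Q.ev ρ (φ ⊗ₜ m) = φ (ρ Q.α m) := by
  simp [ev, contractLeft_apply]

theorem ev_extAct (d : H ⊗[k] H) (φ : Module.Dual k M) (m : M) :
    Q.ev ρ (extAct (Q.dualAct ρ) ρ d (φ ⊗ₜ m)) = φ (ρ (Q.SαI d) m) := by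
  induction d with
  | zero => simp
  | add s t hs ht => simp [hs, ht]
  | tmul a b => simp

theorem ev_linear : IsHLinear (Q.tensAct (Q.dualAct ρ) ρ) Q.unitAct (Q.ev ρ) := by
  intro h y
  induction y with
  | zero => simp
  | add s t hs ht => simp only [map_add, hs, ht]
  | tmul φ m => rw [tensAct_apply, ev_extAct, SαI_Δ]; simp

section coev
variable [FiniteDimensional k M]

theorem coev_one : Q.coev ρ 1 = TensorProduct.map (ρ Q.β) LinearMap.id (coevaluation k M 1) := rfl

theorem toHom_coev : toHom (Q.coev ρ 1) = ρ Q.β := by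
  rw [coev_one, toHom_map_left]; simp

theorem toHom_extAct_coev (d : H ⊗[k] H) :
    toHom (extAct ρ (Q.dualAct ρ) d (Q.coev ρ 1)) = ρ (Q.IβS d) := by
  induction d with
  | zero => simp
  | add s t hs ht => simp only [map_add, LinearMap.add_apply, hs, ht]
  | tmul a b =>
    rw [extAct_tmul_eq_map, dualAct_eq, toHom_map, toHom_coev]
    ext; simp

theorem coev_linear : IsHLinear Q.unitAct (Q.tensAct ρ (Q.dualAct ρ)) (Q.coev ρ) := by
  intro h c
  have : Q.coev ρ (Q.ε h) = Q.tensAct ρ (Q.dualAct ρ) h (Q.coev ρ 1) := by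
    apply toHom_injective
    rw [tensAct_apply, toHom_extAct_coev, IβS_Δ, map_smul, ← toHom_coev, ← map_smul, ← map_smul,
      smul_eq_mul, mul_one]
  rw [unitAct_apply, ← mul_one c, ← mul_assoc, mul_right_comm, mul_one, mul_comm, ← smul_eq_mul,
    map_smul, this]
  conv_rhs => rw [← smul_eq_mul, map_smul, map_smul]

theorem coev_ev (m : M) : TensorProduct.map LinearMap.id (Q.ev ρ)
    (Q.assocHom ρ (Q.dualAct ρ) ρ (Q.coev ρ 1 ⊗ₜ m)) = m ⊗ₜ 1 := by
  have key : ∀ (t : H ⊗[k] (H ⊗[k] H)), TensorProduct.map LinearMap.id (Q.ev ρ)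
      (extAct ρ (extAct (Q.dualAct ρ) ρ) t (TensorProduct.assoc k _ _ _ (Q.coev ρ 1 ⊗ₜ m))) =
      ρ (mulMap₃ (LinearMap.mulRight k Q.β) (LinearMap.mulRight k Q.α ∘ₗ Q.S) LinearMap.id t) m
        ⊗ₜ 1 := by
    intro t
    induction t using TensorProduct.induction_on with
    | zero => simp
    | add s t hs ht => simp only [map_add, LinearMap.add_apply, hs, ht, TensorProduct.add_tmul]
    | tmul a t =>
      induction t with
      | zero => simp
      | add s t hs ht => simp only [TensorProduct.tmul_add, map_add, LinearMap.add_apply, hs, ht,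
          TensorProduct.add_tmul]
      | tmul b c =>
        have e : TensorProduct.map LinearMap.id (Q.ev ρ) ∘ₗ
            extAct ρ (extAct (Q.dualAct ρ) ρ) (a ⊗ₜ (b ⊗ₜ c)) ∘ₗ
            (TensorProduct.assoc k _ _ _).toLinearMap =
          TensorProduct.map LinearMap.id (contractLeft k M) ∘ₗ
            (TensorProduct.assoc k _ _ _).toLinearMap ∘ₗ
            TensorProduct.map (TensorProduct.map (ρ a) (Module.Dual.transpose (ρ (Q.S b))))
              (ρ (Q.α * c)) := by
          ext; simp [contractLeft_apply, Module.Dual.transpose_apply]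
        refine (LinearMap.congr_fun e (Q.coev ρ 1 ⊗ₜ m)).trans ?_
        simp only [LinearMap.comp_apply, TensorProduct.map_tmul, LinearEquiv.coe_coe]
        rw [contract_right, toHom_map, toHom_coev]
        simp
  rw [assocHom_apply, key, X, Q.zigzag]
  simp

theorem ev_coev (φ : Module.Dual k M) : TensorProduct.map (Q.ev ρ) LinearMap.id
    (Q.assocInv (Q.dualAct ρ) ρ (Q.dualAct ρ) (φ ⊗ₜ Q.coev ρ 1)) = 1 ⊗ₜ φ := by
  have key : ∀ (t : H ⊗[k] (H ⊗[k] H)), TensorProduct.map (Q.ev ρ) LinearMap.id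
      ((TensorProduct.assoc k _ _ _).symm (extAct (Q.dualAct ρ) (extAct ρ (Q.dualAct ρ)) t
        (φ ⊗ₜ Q.coev ρ 1))) =
      1 ⊗ₜ (φ ∘ₗ ρ (mulMap₃ (LinearMap.mulRight k Q.α ∘ₗ Q.S) (LinearMap.mulRight k Q.β) Q.S
        t)) := by
    intro t
    induction t using TensorProduct.induction_on with
    | zero => simp
    | add s t hs ht => simp only [map_add, LinearMap.add_apply, hs, ht, TensorProduct.tmul_add,
        LinearMap.comp_add]
    | tmul a t =>
      induction t with
      | zero => simp
      | add s t hs ht => simp only [TensorProduct.tmul_add, map_add, LinearMap.add_apply, hs, ht,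
          LinearMap.comp_add]
      | tmul b c =>
        have e : TensorProduct.map (Q.ev ρ) LinearMap.id ∘ₗ
            (TensorProduct.assoc k _ _ _).symm.toLinearMap ∘ₗ
            extAct (Q.dualAct ρ) (extAct ρ (Q.dualAct ρ)) (a ⊗ₜ (b ⊗ₜ c)) =
          TensorProduct.map (contractLeft k M) LinearMap.id ∘ₗ
            (TensorProduct.assoc k _ _ _).symm.toLinearMap ∘ₗ
            TensorProduct.map (Module.Dual.transpose (ρ (Q.S a))) (TensorProduct.map (ρ (Q.α * b))
              (Module.Dual.transpose (ρ (Q.S c)))) := by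
          ext; simp [contractLeft_apply, Module.Dual.transpose_apply, dualAct_eq]
        refine (LinearMap.congr_fun e (φ ⊗ₜ Q.coev ρ 1)).trans ?_
        simp only [LinearMap.comp_apply, TensorProduct.map_tmul, LinearEquiv.coe_coe]
        rw [contract_left, toHom_map, toHom_coev]
        congr 1
        ext; simp [Module.Dual.transpose_apply]
  rw [assocInv_apply, key, x, Q.zigzag_inv]
  simp [Module.End.one_eq_id]
end coev
end Modules
end QuasiHopfAlgebra

namespace QTQuasiHopfAlgebra
variable {k H : Type*} [Field k] [Ring H] [Algebra k H] (Q : QTQuasiHopfAlgebra k H)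
variable {M N P K M' N' : Type*} [AddCommGroup M] [Module k M] [AddCommGroup N] [Module k N]
  [AddCommGroup P] [Module k P] [AddCommGroup K] [Module k K]
  [AddCommGroup M'] [Module k M'] [AddCommGroup N'] [Module k N']
variable (ρ : H →ₐ[k] Module.End k M) (σ : H →ₐ[k] Module.End k N) (τ : H →ₐ[k] Module.End k P)
  {ρ' : H →ₐ[k] Module.End k M'} {σ' : H →ₐ[k] Module.End k N'}

theorem braiding_apply (y : M ⊗[k] N) :
    Q.braiding ρ σ y = TensorProduct.comm k M N (extAct ρ σ Q.R y) := rfl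

theorem comm_extAct (t : H ⊗[k] H) (y : M ⊗[k] N) :
    TensorProduct.comm k M N (extAct ρ σ t y) =
      extAct σ ρ (TensorProduct.comm k H H t) (TensorProduct.comm k M N y) := by
  induction t with
  | zero => simp
  | add s t hs ht => simp [hs, ht]
  | tmul a b =>
    induction y with
    | zero => simp
    | add s t hs ht => simp only [map_add, hs, ht]
    | tmul m n => simp

theorem comm_mul (s t : H ⊗[k] H) : TensorProduct.comm k H H (s * t) =
    TensorProduct.comm k H H s * TensorProduct.comm k H H t :=
  map_mul (Algebra.TensorProduct.comm k H H) s t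

theorem braiding_linear : IsHLinear (Q.tensAct ρ σ) (Q.tensAct σ ρ) (Q.braiding ρ σ) := by
  intro h y
  rw [braiding_apply, braiding_apply, tensAct_apply, tensAct_apply, ← Module.End.mul_apply,
    ← map_mul, ← Q.almost_cocomm, map_mul, Module.End.mul_apply, comm_extAct]
  congr 2
  exact (TensorProduct.comm k H H).symm_apply_apply _

variable {ρ σ} in
theorem braiding_natural {φ : M →ₗ[k] M'} {ψ : N →ₗ[k] N'} (hφ : IsHLinear ρ ρ' φ)
    (hψ : IsHLinear σ σ' ψ) (y : M ⊗[k] N) :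
    TensorProduct.map ψ φ (Q.braiding ρ σ y) = Q.braiding ρ' σ' (TensorProduct.map φ ψ y) := by
  rw [braiding_apply, braiding_apply, TensorProduct.map_comm, extAct_natural ρ σ φ ψ hφ hψ]

/-- A permutation of the legs of an element of `H ⊗ H ⊗ H` acts as the conjugation by the
permutation of the tensor factors. This and the following lemmas translate the hexagon identities
for `R` into hexagons for the braiding. -/
theorem act3_cycle (t : H ⊗[k] (H ⊗[k] H)) :
    extAct τ (extAct ρ σ) t ∘ₗ (TensorProduct.comm k _ _).toLinearMap ∘ₗ
        (TensorProduct.assoc k M N P).symm.toLinearMap =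
      (TensorProduct.comm k _ _).toLinearMap ∘ₗ (TensorProduct.assoc k M N P).symm.toLinearMap ∘ₗ
        extAct ρ (extAct σ τ) (mulMap₃ (leg₃ k H) (leg₁ k H) (leg₂ k H) t) := by
  induction t using TensorProduct.induction_on with
  | zero => simp
  | add s t hs ht => simp only [map_add, hs, ht, LinearMap.comp_add, LinearMap.add_comp]
  | tmul a t =>
    induction t with
    | zero => simp
    | add s t hs ht => simp only [map_add, hs, ht, LinearMap.comp_add, LinearMap.add_comp,
        TensorProduct.tmul_add]
    | tmul b c => ext; simp

theorem act3_cycle' (t : H ⊗[k] (H ⊗[k] H)) :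
    extAct σ (extAct τ ρ) t ∘ₗ (TensorProduct.assoc k N P M).toLinearMap ∘ₗ
        (TensorProduct.comm k M (N ⊗[k] P)).toLinearMap =
      (TensorProduct.assoc k N P M).toLinearMap ∘ₗ
        (TensorProduct.comm k M (N ⊗[k] P)).toLinearMap ∘ₗ
        extAct ρ (extAct σ τ) (mulMap₃ (leg₂ k H) (leg₃ k H) (leg₁ k H) t) := by
  induction t using TensorProduct.induction_on with
  | zero => simp
  | add s t hs ht => simp only [map_add, hs, ht, LinearMap.comp_add, LinearMap.add_comp]
  | tmul a t =>
    induction t with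
    | zero => simp
    | add s t hs ht => simp only [map_add, hs, ht, LinearMap.comp_add, LinearMap.add_comp,
        TensorProduct.tmul_add]
    | tmul b c => ext; simp

theorem act3_swap_right (t : H ⊗[k] (H ⊗[k] H)) :
    extAct ρ (extAct τ σ) t ∘ₗ
        TensorProduct.map LinearMap.id (TensorProduct.comm k N P).toLinearMap =
      TensorProduct.map LinearMap.id (TensorProduct.comm k N P).toLinearMap ∘ₗ
        extAct ρ (extAct σ τ) (mulMap₃ (leg₁ k H) (leg₃ k H) (leg₂ k H) t) := by
  induction t using TensorProduct.induction_on with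
  | zero => simp
  | add s t hs ht => simp only [map_add, hs, ht, LinearMap.comp_add, LinearMap.add_comp]
  | tmul a t =>
    induction t with
    | zero => simp
    | add s t hs ht => simp only [map_add, hs, ht, LinearMap.comp_add, LinearMap.add_comp,
        TensorProduct.tmul_add]
    | tmul b c => ext; simp

theorem act3_swap_left (t : H ⊗[k] (H ⊗[k] H)) :
    extAct σ (extAct ρ τ) t ∘ₗ (TensorProduct.assoc k N M P).toLinearMap ∘ₗ
        TensorProduct.map (TensorProduct.comm k M N).toLinearMap LinearMap.id ∘ₗ
        (TensorProduct.assoc k M N P).symm.toLinearMap =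
      (TensorProduct.assoc k N M P).toLinearMap ∘ₗ
        TensorProduct.map (TensorProduct.comm k M N).toLinearMap LinearMap.id ∘ₗ
        (TensorProduct.assoc k M N P).symm.toLinearMap ∘ₗ
        extAct ρ (extAct σ τ) (mulMap₃ (leg₂ k H) (leg₁ k H) (leg₃ k H) t) := by
  induction t using TensorProduct.induction_on with
  | zero => simp
  | add s t hs ht => simp only [map_add, hs, ht, LinearMap.comp_add, LinearMap.add_comp]
  | tmul a t =>
    induction t with
    | zero => simp
    | add s t hs ht => simp only [map_add, hs, ht, LinearMap.comp_add, LinearMap.add_comp,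
        TensorProduct.tmul_add]
    | tmul b c => ext; simp

theorem act3_left (t : H ⊗[k] H) :
    extAct (Q.tensAct ρ σ) τ t ∘ₗ (TensorProduct.assoc k M N P).symm.toLinearMap =
      (TensorProduct.assoc k M N P).symm.toLinearMap ∘ₗ
        extAct ρ (extAct σ τ) (mulMap (Q.Δ₂ (leg₁ k H) (leg₂ k H)) (leg₃ k H) t) := by
  induction t with
  | zero => simp
  | add s t hs ht => simp only [map_add, hs, ht, LinearMap.comp_add, LinearMap.add_comp]
  | tmul a c =>
    simp only [mulMap_tmul, Δ₂, LinearMap.comp_apply, AlgHom.toLinearMap_apply,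
      extAct_tmul_eq_map, tensAct_apply]
    generalize Q.Δ a = d
    induction d with
    | zero => simp
    | add s t hs ht => simp only [map_add, hs, ht, LinearMap.comp_add, LinearMap.add_comp,
        TensorProduct.map_add_left, add_mul]
    | tmul d e => ext; simp

theorem act3_right (t : H ⊗[k] H) :
    extAct ρ (Q.tensAct σ τ) t =
      extAct ρ (extAct σ τ) (mulMap (leg₁ k H) (Q.Δ₂ (leg₂ k H) (leg₃ k H)) t) := by
  induction t with
  | zero => simp
  | add s t hs ht => simp only [map_add, hs, ht]
  | tmul a c =>
    simp only [mulMap_tmul, Δ₂, LinearMap.comp_apply, AlgHom.toLinearMap_apply,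
      extAct_tmul_eq_map, tensAct_apply]
    generalize Q.Δ c = d
    induction d with
    | zero => simp
    | add s t hs ht => simp only [map_add, hs, ht, TensorProduct.map_add_right, mul_add]
    | tmul d e => ext; simp

theorem act3_leg₂₃ (t : H ⊗[k] H) :
    TensorProduct.map LinearMap.id (extAct σ τ t) =
      extAct ρ (extAct σ τ) (mulMap (leg₂ k H) (leg₃ k H) t) := by
  induction t with
  | zero => simp
  | add s t hs ht => simp only [map_add, hs, ht, TensorProduct.map_add_right]
  | tmul a c => ext; simp

theorem act3_leg₁₂ (t : H ⊗[k] H) :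
    TensorProduct.map (extAct ρ σ t) LinearMap.id ∘ₗ
        (TensorProduct.assoc k M N P).symm.toLinearMap =
      (TensorProduct.assoc k M N P).symm.toLinearMap ∘ₗ
        extAct ρ (extAct σ τ) (mulMap (leg₁ k H) (leg₂ k H) t) := by
  induction t with
  | zero => simp
  | add s t hs ht => simp only [map_add, hs, ht, TensorProduct.map_add_left, LinearMap.comp_add,
      LinearMap.add_comp]
  | tmul a c => ext; simp

theorem act3_leg₁₃ (t : H ⊗[k] H) :
    TensorProduct.map (extAct ρ τ t) LinearMap.id ∘ₗ
        (TensorProduct.assoc k M P N).symm.toLinearMap ∘ₗ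
        TensorProduct.map LinearMap.id (TensorProduct.comm k N P).toLinearMap =
      (TensorProduct.assoc k M P N).symm.toLinearMap ∘ₗ
        TensorProduct.map LinearMap.id (TensorProduct.comm k N P).toLinearMap ∘ₗ
        extAct ρ (extAct σ τ) (mulMap (leg₁ k H) (leg₃ k H) t) := by
  induction t with
  | zero => simp
  | add s t hs ht => simp only [map_add, hs, ht, TensorProduct.map_add_left, LinearMap.comp_add,
      LinearMap.add_comp]
  | tmul a c => ext; simp

theorem act3_leg₁₃' (t : H ⊗[k] H) :
    TensorProduct.map LinearMap.id (extAct ρ τ t) ∘ₗ (TensorProduct.assoc k N M P).toLinearMap ∘ₗ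
        TensorProduct.map (TensorProduct.comm k M N).toLinearMap LinearMap.id ∘ₗ
        (TensorProduct.assoc k M N P).symm.toLinearMap =
      (TensorProduct.assoc k N M P).toLinearMap ∘ₗ
        TensorProduct.map (TensorProduct.comm k M N).toLinearMap LinearMap.id ∘ₗ
        (TensorProduct.assoc k M N P).symm.toLinearMap ∘ₗ
        extAct ρ (extAct σ τ) (mulMap (leg₁ k H) (leg₃ k H) t) := by
  induction t with
  | zero => simp
  | add s t hs ht => simp only [map_add, hs, ht, TensorProduct.map_add_right, LinearMap.comp_add,
      LinearMap.add_comp]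
  | tmul a c => ext; simp

theorem braiding_hexagon_reverse (y : M ⊗[k] (N ⊗[k] P)) :
    Q.assocInv τ ρ σ (Q.braiding (Q.tensAct ρ σ) τ (Q.assocInv ρ σ τ y)) =
      TensorProduct.map (Q.braiding ρ τ) LinearMap.id (Q.assocInv ρ τ σ
        (TensorProduct.map LinearMap.id (Q.braiding σ τ) y)) := by
  have e1 : TensorProduct.map LinearMap.id (Q.braiding σ τ) y =
      TensorProduct.map LinearMap.id (TensorProduct.comm k N P).toLinearMap
        (extAct ρ (extAct σ τ) (mulMap (leg₂ k H) (leg₃ k H) Q.R) y) := by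
    rw [← act3_leg₂₃, ← LinearMap.comp_apply, ← TensorProduct.map_comp]; rfl
  have e2 : ∀ z : (M ⊗[k] P) ⊗[k] N, TensorProduct.map (Q.braiding ρ τ) LinearMap.id z =
      TensorProduct.map (TensorProduct.comm k M P).toLinearMap LinearMap.id
        (TensorProduct.map (extAct ρ τ Q.R) LinearMap.id z) := by
    intro z
    rw [← LinearMap.comp_apply, ← TensorProduct.map_comp]; rfl
  have e3 : (TensorProduct.assoc k P M N).symm.toLinearMap ∘ₗ
      (TensorProduct.comm k (M ⊗[k] N) P).toLinearMap ∘ₗ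
        (TensorProduct.assoc k M N P).symm.toLinearMap =
      TensorProduct.map (TensorProduct.comm k M P).toLinearMap LinearMap.id ∘ₗ
        (TensorProduct.assoc k M P N).symm.toLinearMap ∘ₗ
        TensorProduct.map LinearMap.id (TensorProduct.comm k N P).toLinearMap := by
    ext; simp
  have h1 := LinearMap.congr_fun (act3_cycle ρ σ τ Q.X)
  have h2 := LinearMap.congr_fun (act3_swap_right ρ σ τ Q.x)
  have h3 := LinearMap.congr_fun (Q.act3_left ρ σ τ Q.R)
  have h5 := LinearMap.congr_fun (act3_leg₁₃ ρ σ τ Q.R)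
  have e4 := LinearMap.congr_fun e3
  have hR := congrArg (extAct ρ (extAct σ τ)) Q.hexagon_left
  change extAct ρ (extAct σ τ) (mulMap (Q.Δ₂ (leg₁ k H) (leg₂ k H)) (leg₃ k H) Q.R) =
    extAct ρ (extAct σ τ) (mulMap₃ (leg₃ k H) (leg₁ k H) (leg₂ k H) Q.X * _ *
      mulMap₃ (leg₁ k H) (leg₃ k H) (leg₂ k H) Q.x * _ * Q.X) at hR
  have hX : ∀ z, extAct ρ (extAct σ τ) Q.X (extAct ρ (extAct σ τ) Q.x z) = z := by
    intro z
    rw [← Module.End.mul_apply, ← map_mul, X_mul_x, map_one, Module.End.one_apply]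
  have hx : ∀ z, extAct τ (extAct ρ σ) Q.x (extAct τ (extAct ρ σ) Q.X z) = z := by
    intro z
    rw [← Module.End.mul_apply, ← map_mul, x_mul_X, map_one, Module.End.one_apply]
  simp only [LinearMap.comp_apply, LinearEquiv.coe_coe] at h1 h2 h3 h5 e4
  rw [assocInv_apply, assocInv_apply, assocInv_apply, braiding_apply, h3, hR]
  simp only [map_mul, Module.End.mul_apply]
  rw [hX, ← h1, hx, e4, e1, h2, e2, h5]

theorem braiding_hexagon_forward (y : (M ⊗[k] N) ⊗[k] P) :
    Q.assocHom σ τ ρ (Q.braiding ρ (Q.tensAct σ τ) (Q.assocHom ρ σ τ y)) =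
      TensorProduct.map LinearMap.id (Q.braiding ρ τ) (Q.assocHom σ ρ τ
        (TensorProduct.map (Q.braiding ρ σ) LinearMap.id y)) := by
  obtain ⟨y, rfl⟩ := (TensorProduct.assoc k M N P).symm.surjective y
  have e1 : TensorProduct.map (Q.braiding ρ σ) LinearMap.id
        ((TensorProduct.assoc k M N P).symm y) =
      TensorProduct.map (TensorProduct.comm k M N).toLinearMap LinearMap.id
        ((TensorProduct.assoc k M N P).symm
          (extAct ρ (extAct σ τ) (mulMap (leg₁ k H) (leg₂ k H) Q.R) y)) := by
    have := LinearMap.congr_fun (act3_leg₁₂ ρ σ τ Q.R) y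
    simp only [LinearMap.comp_apply, LinearEquiv.coe_coe] at this
    rw [← this, ← LinearMap.comp_apply, ← TensorProduct.map_comp]; rfl
  have e2 : ∀ z : N ⊗[k] (M ⊗[k] P), TensorProduct.map LinearMap.id (Q.braiding ρ τ) z =
      TensorProduct.map LinearMap.id (TensorProduct.comm k M P).toLinearMap
        (TensorProduct.map LinearMap.id (extAct ρ τ Q.R) z) := by
    intro z
    rw [← LinearMap.comp_apply, ← TensorProduct.map_comp]; rfl
  have e3 : (TensorProduct.assoc k N P M).toLinearMap ∘ₗ
      (TensorProduct.comm k M (N ⊗[k] P)).toLinearMap =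
      TensorProduct.map LinearMap.id (TensorProduct.comm k M P).toLinearMap ∘ₗ
        (TensorProduct.assoc k N M P).toLinearMap ∘ₗ
        TensorProduct.map (TensorProduct.comm k M N).toLinearMap LinearMap.id ∘ₗ
        (TensorProduct.assoc k M N P).symm.toLinearMap := by
    ext; simp
  have h1 := LinearMap.congr_fun (act3_cycle' ρ σ τ Q.x)
  have h2 := LinearMap.congr_fun (act3_swap_left ρ σ τ Q.X)
  have h5 := LinearMap.congr_fun (act3_leg₁₃' ρ σ τ Q.R)
  have e4 := LinearMap.congr_fun e3
  have hR := congrArg (extAct ρ (extAct σ τ)) Q.hexagon_right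
  change extAct ρ (extAct σ τ) (mulMap (leg₁ k H) (Q.Δ₂ (leg₂ k H) (leg₃ k H)) Q.R) =
    extAct ρ (extAct σ τ) (mulMap₃ (leg₂ k H) (leg₃ k H) (leg₁ k H) Q.x * _ *
      mulMap₃ (leg₂ k H) (leg₁ k H) (leg₃ k H) Q.X * _ * Q.x) at hR
  have hx : ∀ z, extAct ρ (extAct σ τ) Q.x (extAct ρ (extAct σ τ) Q.X z) = z := by
    intro z
    rw [← Module.End.mul_apply, ← map_mul, x_mul_X, map_one, Module.End.one_apply]
  have hX : ∀ z, extAct σ (extAct τ ρ) Q.X (extAct σ (extAct τ ρ) Q.x z) = z := by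
    intro z
    rw [← Module.End.mul_apply, ← map_mul, X_mul_x, map_one, Module.End.one_apply]
  simp only [LinearMap.comp_apply, LinearEquiv.coe_coe] at h1 h2 h5 e4
  rw [assocHom_apply, assocHom_apply, assocHom_apply, braiding_apply, act3_right, hR,
    LinearEquiv.apply_symm_apply]
  simp only [map_mul, Module.End.mul_apply]
  rw [hx, ← h1, hX, e4, e1, h2, e2, h5]

theorem braiding_unit (y : k ⊗[k] P) :
    Q.braiding Q.unitAct τ y = (TensorProduct.rid k P).symm (TensorProduct.lid k P y) := by
  have key : ∀ t : H ⊗[k] H, extAct Q.unitAct τ t =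
      extAct (Algebra.ofId k (Module.End k k)) τ
        (Algebra.TensorProduct.map Q.ε (AlgHom.id k H) t) := by
    intro t
    exact extAct_comp_left _ _ _ _
  rw [braiding_apply, key, Q.counit_R_left, map_one, Module.End.one_apply]
  induction y with
  | zero => simp
  | add s t hs ht => simp only [map_add, hs, ht]
  | tmul c p => simp [← TensorProduct.tmul_smul]

end QTQuasiHopfAlgebra

end

/-! ### The monoidal category of finite-dimensional modules -/

noncomputable section

open CategoryTheory MonoidalCategory
open QuasiHopf QuasiHopfAlgebra

universe r s

namespace QTQuasiHopfAlgebra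
variable {k : Type r} {H : Type s} [Field k] [Ring H] [Algebra k H] (Q : QTQuasiHopfAlgebra k H)

/-- Finite-dimensional left `H`-modules. The universe is that of the dual of `H`. -/
structure Rep (Q : QTQuasiHopfAlgebra k H) where
  carrier : Type (max r s)
  [addCommGroup : AddCommGroup carrier]
  [module : Module k carrier]
  [finite : FiniteDimensional k carrier]
  act : H →ₐ[k] Module.End k carrier

namespace Rep
variable {Q}
instance : CoeSort Q.Rep (Type (max r s)) := ⟨Rep.carrier⟩
instance (A : Q.Rep) : AddCommGroup A := A.addCommGroup
instance (A : Q.Rep) : Module k A := A.module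
instance (A : Q.Rep) : FiniteDimensional k A := A.finite

/-- Morphisms are the `H`-linear maps. -/
@[ext]
structure Hom (A B : Q.Rep) where
  lin : A →ₗ[k] B
  linear : IsHLinear A.act B.act lin

instance : Category Q.Rep where
  Hom := Hom
  id A := ⟨LinearMap.id, fun _ _ => rfl⟩
  comp f g := ⟨g.lin ∘ₗ f.lin, fun h m => by
    simp only [LinearMap.comp_apply]; rw [f.linear, g.linear]⟩

@[simp] theorem id_lin (A : Q.Rep) : Hom.lin (𝟙 A) = LinearMap.id := rfl
@[simp] theorem comp_lin {A B D : Q.Rep} (f : A ⟶ B) (g : B ⟶ D) :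
    (f ≫ g).lin = g.lin ∘ₗ f.lin := rfl
theorem hom_ext {A B : Q.Rep} {f g : A ⟶ B} (h : f.lin = g.lin) : f = g := Hom.ext h

/-- An isomorphism from a linear equivalence that is `H`-linear. -/
def mkIso {A B : Q.Rep} (e : A ≃ₗ[k] B) (h : IsHLinear A.act B.act e.toLinearMap) : A ≅ B where
  hom := ⟨e.toLinearMap, h⟩
  inv := ⟨e.symm.toLinearMap, isHLinear_of_inverse h e.apply_symm_apply e.symm_apply_apply⟩
  hom_inv_id := hom_ext (by ext; simp)
  inv_hom_id := hom_ext (by ext; simp)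

variable (Q) in
/-- The unit object, the base field lifted to the universe of `H`-modules. -/
@[reducible]
def unit : Q.Rep where
  carrier := ULift.{s} k
  act := (Algebra.ofId k (Module.End k (ULift.{s} k))).comp Q.ε

/-- The tensor product of modules. -/
@[reducible] def tensor (A B : Q.Rep) : Q.Rep where
  carrier := A ⊗[k] B
  act := Q.tensAct A.act B.act

/-- The linear isomorphism from the unit object to the base field. -/
def unitEquiv : (unit Q) ≃ₗ[k] k := ULift.moduleEquiv

theorem unitEquiv_linear : IsHLinear (unit Q).act Q.unitAct unitEquiv.toLinearMap := by
  intro h m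
  rw [unitAct_apply]
  change (unitEquiv (algebraMap k (Module.End k (ULift.{s} k)) (Q.ε h) m) : k) = _
  rw [Module.algebraMap_end_apply, map_smul]
  rfl

theorem lid_linear {M : Type*} [AddCommGroup M] [Module k M] (ρ : H →ₐ[k] Module.End k M) :
    IsHLinear (Q.tensAct Q.unitAct ρ) ρ (TensorProduct.lid k M).toLinearMap := by
  intro h y
  have key : ∀ t : H ⊗[k] H, extAct Q.unitAct ρ t =
      extAct (Algebra.ofId k (Module.End k k)) ρ
        (Algebra.TensorProduct.map Q.ε (AlgHom.id k H) t) := by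
    intro t
    exact extAct_comp_left _ _ _ _
  rw [tensAct_apply, key, Q.counit_left, extAct_tmul_eq_map]
  induction y with
  | zero => simp
  | add s t hs ht => simp only [map_add, hs, ht]
  | tmul c p => simp

theorem rid_linear {M : Type*} [AddCommGroup M] [Module k M] (ρ : H →ₐ[k] Module.End k M) :
    IsHLinear (Q.tensAct ρ Q.unitAct) ρ (TensorProduct.rid k M).toLinearMap := by
  intro h y
  have key : ∀ t : H ⊗[k] H, extAct ρ Q.unitAct t =
      extAct ρ (Algebra.ofId k (Module.End k k))
        (Algebra.TensorProduct.map (AlgHom.id k H) Q.ε t) := by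
    intro t
    exact extAct_comp_right _ _ _ _
  rw [tensAct_apply, key, Q.counit_right, extAct_tmul_eq_map]
  induction y with
  | zero => simp
  | add s t hs ht => simp only [map_add, hs, ht]
  | tmul c p => simp

theorem id_linear {M : Type*} [AddCommGroup M] [Module k M] (ρ : H →ₐ[k] Module.End k M) :
    IsHLinear ρ ρ LinearMap.id := fun _ _ => rfl

theorem isHLinear_comp {M N P : Type*} [AddCommGroup M] [Module k M] [AddCommGroup N] [Module k N]
    [AddCommGroup P] [Module k P] {ρ : H →ₐ[k] Module.End k M} {σ : H →ₐ[k] Module.End k N}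
    {τ : H →ₐ[k] Module.End k P} {f : M →ₗ[k] N} {g : N →ₗ[k] P} (hg : IsHLinear σ τ g)
    (hf : IsHLinear ρ σ f) : IsHLinear ρ τ (g ∘ₗ f) := fun h m => by
  simp only [LinearMap.comp_apply]; rw [hf, hg]

instance : MonoidalCategoryStruct Q.Rep where
  tensorObj := tensor
  tensorUnit := unit Q
  tensorHom f g := ⟨TensorProduct.map f.lin g.lin, IsHLinear.map _ f.linear g.linear⟩
  whiskerLeft _ _ _ f := ⟨TensorProduct.map LinearMap.id f.lin,
    IsHLinear.map _ (id_linear _) f.linear⟩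
  whiskerRight f _ := ⟨TensorProduct.map f.lin LinearMap.id,
    IsHLinear.map _ f.linear (id_linear _)⟩
  associator A B D :=
    { hom := ⟨Q.assocHom A.act B.act D.act, Q.assocHom_linear _ _ _⟩
      inv := ⟨Q.assocInv A.act B.act D.act, Q.assocInv_linear _ _ _⟩
      hom_inv_id := hom_ext (LinearMap.ext (Q.assocInv_assocHom _ _ _))
      inv_hom_id := hom_ext (LinearMap.ext (Q.assocHom_assocInv _ _ _)) }
  leftUnitor A := mkIso ((TensorProduct.congr unitEquiv (LinearEquiv.refl k A)).trans
      (TensorProduct.lid k A))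
    (isHLinear_comp (lid_linear A.act) (IsHLinear.map _ unitEquiv_linear (id_linear _)))
  rightUnitor A := mkIso ((TensorProduct.congr (LinearEquiv.refl k A) unitEquiv).trans
      (TensorProduct.rid k A))
    (isHLinear_comp (rid_linear A.act) (IsHLinear.map _ (id_linear _) unitEquiv_linear))

theorem assocHom_natural {M N P M' N' P' : Type*} [AddCommGroup M] [Module k M]
    [AddCommGroup N] [Module k N] [AddCommGroup P] [Module k P]
    [AddCommGroup M'] [Module k M'] [AddCommGroup N'] [Module k N'] [AddCommGroup P']
    [Module k P']
    {ρ : H →ₐ[k] Module.End k M} {σ : H →ₐ[k] Module.End k N} {τ : H →ₐ[k] Module.End k P}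
    {ρ' : H →ₐ[k] Module.End k M'} {σ' : H →ₐ[k] Module.End k N'} {τ' : H →ₐ[k] Module.End k P'}
    {f : M →ₗ[k] M'} {g : N →ₗ[k] N'} {h : P →ₗ[k] P'} (hf : IsHLinear ρ ρ' f)
    (hg : IsHLinear σ σ' g) (hh : IsHLinear τ τ' h) (y : (M ⊗[k] N) ⊗[k] P) :
    TensorProduct.map f (TensorProduct.map g h) (Q.assocHom ρ σ τ y) =
      Q.assocHom ρ' σ' τ' (TensorProduct.map (TensorProduct.map f g) h y) := by
  rw [assocHom_apply, assocHom_apply, extAct_natural ρ (extAct σ τ) f (TensorProduct.map g h) hf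
    (fun a m => extAct_natural σ τ g h hg hh a m)]
  congr 1
  have : TensorProduct.map f (TensorProduct.map g h) ∘ₗ (TensorProduct.assoc k M N P).toLinearMap =
      (TensorProduct.assoc k M' N' P').toLinearMap ∘ₗ
        TensorProduct.map (TensorProduct.map f g) h := by
    ext; simp
  exact LinearMap.congr_fun this y

theorem triangle_unit {M N : Type*} [AddCommGroup M] [Module k M] [AddCommGroup N] [Module k N]
    (ρ : H →ₐ[k] Module.End k M) (σ : H →ₐ[k] Module.End k N) (y : (M ⊗[k] unit Q) ⊗[k] N) :
    TensorProduct.map LinearMap.id ((TensorProduct.lid k N).toLinearMap ∘ₗ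
      TensorProduct.map unitEquiv.toLinearMap LinearMap.id) (Q.assocHom ρ (unit Q).act σ y) =
    TensorProduct.map ((TensorProduct.rid k M).toLinearMap ∘ₗ
      TensorProduct.map LinearMap.id unitEquiv.toLinearMap) LinearMap.id y := by
  have h1 := Q.triangle ρ σ
    (TensorProduct.map (TensorProduct.map LinearMap.id unitEquiv.toLinearMap) LinearMap.id y)
  rw [← assocHom_natural (id_linear ρ) unitEquiv_linear (id_linear σ)] at h1
  rw [map_map_apply, map_map_apply, LinearMap.id_comp, LinearMap.id_comp] at h1
  exact h1

instance : MonoidalCategory Q.Rep where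
  tensorHom_def _ _ := hom_ext (TensorProduct.ext' fun _ _ => rfl)
  id_tensorHom_id _ _ := hom_ext TensorProduct.map_id
  tensorHom_comp_tensorHom _ _ _ _ := hom_ext (TensorProduct.ext' fun _ _ => rfl)
  whiskerLeft_id _ _ := hom_ext TensorProduct.map_id
  id_whiskerRight _ _ := hom_ext TensorProduct.map_id
  associator_naturality f g h := hom_ext (LinearMap.ext fun y =>
    (assocHom_natural f.linear g.linear h.linear y).symm)
  leftUnitor_naturality f := hom_ext (TensorProduct.ext' fun c m =>
    (f.lin.map_smul (unitEquiv c) m).symm)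
  rightUnitor_naturality f := hom_ext (TensorProduct.ext' fun m c =>
    (f.lin.map_smul (unitEquiv c) m).symm)
  pentagon A B D E := hom_ext (LinearMap.ext fun y => Q.pentagon A.act B.act D.act E.act y)
  triangle A B := hom_ext (LinearMap.ext fun y => triangle_unit A.act B.act y)

theorem ev_coev_unit {M : Type*} [AddCommGroup M] [Module k M] [FiniteDimensional k M]
    (ρ : H →ₐ[k] Module.End k M) (φ : Module.Dual k M) (c : unit Q) :
    TensorProduct.map (unitEquiv.symm.toLinearMap ∘ₗ Q.ev ρ) LinearMap.id
      (Q.assocInv (Q.dualAct ρ) ρ (Q.dualAct ρ) (TensorProduct.map LinearMap.id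
        (Q.coev ρ ∘ₗ unitEquiv.toLinearMap) (φ ⊗ₜ[k] c))) =
      (unitEquiv.symm (1 : k) : unit Q) ⊗ₜ[k] (unitEquiv c • φ) := by
  have h := congrArg (TensorProduct.map (unitEquiv (Q := Q)).symm.toLinearMap LinearMap.id)
      (Q.ev_coev ρ φ)
  have e : Q.coev ρ (unitEquiv c) = unitEquiv c • Q.coev ρ 1 := by
    rw [← map_smul, smul_eq_mul, mul_one]
  rw [map_map_apply, LinearMap.id_comp, TensorProduct.map_tmul] at h
  rw [TensorProduct.map_tmul, LinearMap.comp_apply, LinearEquiv.coe_coe, e,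
    TensorProduct.tmul_smul, map_smul, map_smul, LinearMap.id_apply, h, TensorProduct.tmul_smul]
  rfl

theorem coev_ev_unit {M : Type*} [AddCommGroup M] [Module k M] [FiniteDimensional k M]
    (ρ : H →ₐ[k] Module.End k M) (m : M) (c : unit Q) :
    TensorProduct.map LinearMap.id (unitEquiv.symm.toLinearMap ∘ₗ Q.ev ρ)
      (Q.assocHom ρ (Q.dualAct ρ) ρ (TensorProduct.map
        (Q.coev ρ ∘ₗ unitEquiv.toLinearMap) LinearMap.id (c ⊗ₜ[k] m))) =
      (unitEquiv c • m) ⊗ₜ[k] (unitEquiv.symm (1 : k) : unit Q) := by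
  have h := congrArg (TensorProduct.map LinearMap.id (unitEquiv (Q := Q)).symm.toLinearMap)
      (Q.coev_ev ρ m)
  have e : Q.coev ρ (unitEquiv c) = unitEquiv c • Q.coev ρ 1 := by
    rw [← map_smul, smul_eq_mul, mul_one]
  rw [map_map_apply, LinearMap.id_comp, TensorProduct.map_tmul] at h
  rw [TensorProduct.map_tmul, LinearMap.comp_apply, LinearEquiv.coe_coe, e,
    ← TensorProduct.smul_tmul', map_smul, map_smul, LinearMap.id_apply, h, TensorProduct.smul_tmul']
  rfl

/-- The dual module. -/
def dual (A : Q.Rep) : Q.Rep where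
  carrier := Module.Dual k A
  act := Q.dualAct A.act

instance (A : Q.Rep) : ExactPairing A A.dual where
  coevaluation' := ⟨Q.coev A.act ∘ₗ unitEquiv.toLinearMap,
    isHLinear_comp (Q.coev_linear A.act) unitEquiv_linear⟩
  evaluation' := ⟨unitEquiv.symm.toLinearMap ∘ₗ Q.ev A.act,
    isHLinear_comp (isHLinear_of_inverse unitEquiv_linear unitEquiv.apply_symm_apply
      unitEquiv.symm_apply_apply) (Q.ev_linear A.act)⟩
  coevaluation_evaluation' :=
    hom_ext (TensorProduct.ext' fun φ c => ev_coev_unit A.act φ c)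
  evaluation_coevaluation' :=
    hom_ext (TensorProduct.ext' fun c m => coev_ev_unit A.act m c)

theorem evaluation_lin (A : Q.Rep) : (ε_ A A.dual).lin = unitEquiv.symm.toLinearMap ∘ₗ Q.ev A.act :=
  rfl

end Rep
end QTQuasiHopfAlgebra

end

/-! ### Invertibility of the R-matrix and of the antipode -/

noncomputable section

open CategoryTheory MonoidalCategory
open QuasiHopf QuasiHopfAlgebra BraidedReconstruction

universe r s

namespace QTQuasiHopfAlgebra
variable {k : Type r} {H : Type s} [Field k] [Ring H] [Algebra k H] (Q : QTQuasiHopfAlgebra k H)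

theorem extAct_lmul {A B : Type*} [Ring A] [Algebra k A] [Ring B] [Algebra k B] (t y : A ⊗[k] B) :
    extAct (Algebra.lmul k A) (Algebra.lmul k B) t y = t * y := by
  induction t with
  | zero => simp
  | add s t hs ht => simp only [map_add, LinearMap.add_apply, hs, ht, add_mul]
  | tmul a b =>
    induction y with
    | zero => simp
    | add s t hs ht => simp only [map_add, hs, ht, mul_add]
    | tmul c d => simp

theorem mul_eq_one_comm_of_finite (k : Type*) {A : Type*} [Field k] [Ring A] [Algebra k A]
    [FiniteDimensional k A] {a b : A} : a * b = 1 ↔ b * a = 1 := by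
  have h : ∀ {a b : A}, a * b = 1 → b * a = 1 := by
    intro a b h
    apply (Algebra.lmul_injective (R := k) (A := A))
    rw [map_mul, map_one, _root_.mul_eq_one_comm, ← map_mul, h, map_one]
  exact ⟨h, h⟩

namespace Rep

/-- The action of `R` followed by the flip, as a morphism. That it is invertible is only known once
`isUnit_R` is proved. -/
def laxBraiding (A B : Q.Rep) : A ⊗ B ⟶ B ⊗ A :=
  ⟨Q.braiding A.act B.act, Q.braiding_linear A.act B.act⟩

theorem lax_unit (Z : Q.Rep) : laxBraiding Q (𝟙_ Q.Rep) Z = (λ_ Z).hom ≫ (ρ_ Z).inv := by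
  refine hom_ext (LinearMap.ext fun y => ?_)
  have h1 := Q.braiding_unit Z.act (TensorProduct.map unitEquiv.toLinearMap LinearMap.id y)
  rw [← braiding_natural Q unitEquiv_linear (id_linear Z.act)] at h1
  have h2 := congrArg (TensorProduct.map LinearMap.id (unitEquiv (Q := Q)).symm.toLinearMap) h1
  rw [map_map_apply] at h2
  refine Eq.trans (Eq.trans ?_ h2) ?_
  · rw [LinearMap.id_comp, LinearEquiv.comp_coe, LinearEquiv.self_trans_symm]
    exact (LinearMap.congr_fun TensorProduct.map_id _).symm
  · rfl

section
variable [FiniteDimensional k H]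

/-- The regular representation. -/
@[reducible] def regular : Q.Rep where
  carrier := ULift.{r} H
  act := Algebra.lsmul k k (ULift.{r} H)

/-- The linear isomorphism from the regular representation to `H`. -/
def down : regular Q ≃ₗ[k] H := ULift.moduleEquiv

theorem down_linear : IsHLinear (regular Q).act (Algebra.lmul k H) (down Q).toLinearMap :=
  fun _ _ => rfl

/-- The braiding of the regular representation with itself is split epi because the regular
representation has a dual; evaluated at a preimage of `1 ⊗ 1` this gives a right inverse of `R`,
which is two-sided in a finite-dimensional algebra. -/
theorem isUnit_R : IsUnit Q.R := by
  have h := lax_braiding_split (laxBraiding Q)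
    (fun f Z => hom_ext (LinearMap.ext fun y => (braiding_natural Q f.linear (id_linear _) y).symm))
    (fun X Y Z => hom_ext (LinearMap.ext fun y => Q.braiding_hexagon_reverse X.act Y.act Z.act y))
    (lax_unit Q) (regular Q) (dual (regular Q)) (regular Q)
  have hs : Function.Surjective (laxBraiding Q (regular Q) (regular Q)).lin := by
    intro y
    simp only [← Category.assoc] at h
    exact ⟨_, LinearMap.congr_fun (congrArg Hom.lin h) y⟩
  obtain ⟨y, hy⟩ := hs (TensorProduct.map (down Q).symm.toLinearMap (down Q).symm.toLinearMap 1)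
  have h2 := Q.braiding_natural (down_linear Q) (down_linear Q) y
  have h3 := congrArg (TensorProduct.map (down Q).toLinearMap (down Q).toLinearMap) hy
  have h4 := h2.symm.trans h3
  rw [map_map_apply, braiding_apply, extAct_lmul] at h4
  have h5 := (LinearEquiv.eq_symm_apply _).2 h4
  have h6 : Q.R * TensorProduct.map (down Q).toLinearMap (down Q).toLinearMap y = 1 := by
    refine h5.trans ?_
    simp [Algebra.TensorProduct.one_def]
  exact ⟨⟨_, _, h6, (mul_eq_one_comm_of_finite k).1 h6⟩, rfl⟩

theorem R_mul_Rinv : Q.R * Q.Rinv = 1 := Ring.mul_inverse_cancel _ (isUnit_R Q)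
theorem Rinv_mul_R : Q.Rinv * Q.R = 1 := Ring.inverse_mul_cancel _ (isUnit_R Q)

variable {Q}
/-- The inverse braiding `n ⊗ m ↦ R̄¹ · m ⊗ R̄² · n`. -/
def braidingInv {M N : Type*} [AddCommGroup M] [Module k M] [AddCommGroup N] [Module k N]
    (Q : QTQuasiHopfAlgebra k H)
    (ρ : H →ₐ[k] Module.End k M) (σ : H →ₐ[k] Module.End k N) : N ⊗[k] M →ₗ[k] M ⊗[k] N :=
  extAct ρ σ Q.Rinv ∘ₗ (TensorProduct.comm k N M).toLinearMap

theorem braidingInv_braiding {M N : Type*} [AddCommGroup M] [Module k M] [AddCommGroup N]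
    [Module k N] (ρ : H →ₐ[k] Module.End k M) (σ : H →ₐ[k] Module.End k N) (y : M ⊗[k] N) :
    braidingInv Q ρ σ (Q.braiding ρ σ y) = y := by
  change extAct ρ σ Q.Rinv ((TensorProduct.comm k M N).symm (TensorProduct.comm k M N _)) = _
  rw [LinearEquiv.symm_apply_apply, ← Module.End.mul_apply, ← map_mul, Rinv_mul_R, map_one]
  rfl

theorem braiding_braidingInv {M N : Type*} [AddCommGroup M] [Module k M] [AddCommGroup N]
    [Module k N] (ρ : H →ₐ[k] Module.End k M) (σ : H →ₐ[k] Module.End k N) (y : N ⊗[k] M) :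
    Q.braiding ρ σ (braidingInv Q ρ σ y) = y := by
  change TensorProduct.comm k M N (extAct ρ σ Q.R (extAct ρ σ Q.Rinv
    ((TensorProduct.comm k M N).symm y))) = _
  rw [← Module.End.mul_apply, ← map_mul, R_mul_Rinv, map_one, Module.End.one_apply,
    LinearEquiv.apply_symm_apply]

instance : BraidedCategory Q.Rep where
  braiding A B :=
    { hom := laxBraiding Q A B
      inv := ⟨braidingInv Q A.act B.act, isHLinear_of_inverse (Q.braiding_linear A.act B.act)
        (braiding_braidingInv _ _) (braidingInv_braiding _ _)⟩
      hom_inv_id := hom_ext (LinearMap.ext (braidingInv_braiding A.act B.act))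
      inv_hom_id := hom_ext (LinearMap.ext (braiding_braidingInv A.act B.act)) }
  braiding_naturality_right X _ _ f :=
    hom_ext (LinearMap.ext fun y => (braiding_natural Q (id_linear X.act) f.linear y).symm)
  braiding_naturality_left f Z :=
    hom_ext (LinearMap.ext fun y => (braiding_natural Q f.linear (id_linear Z.act) y).symm)
  hexagon_forward X Y Z :=
    hom_ext (LinearMap.ext fun y => Q.braiding_hexagon_forward X.act Y.act Z.act y)
  hexagon_reverse X Y Z :=
    hom_ext (LinearMap.ext fun y => Q.braiding_hexagon_reverse X.act Y.act Z.act y)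

variable (Q) in
/-- In a braided category a left dual is also a right dual, so every module is isomorphic to its
double left dual, on which `h` acts through `S²`. Hence `S h = 0` makes `h` act by zero on the
regular representation. -/
theorem bijective_S : Function.Bijective Q.S := by
  have hinj : Function.Injective Q.S := by
    rw [injective_iff_map_eq_zero]
    intro h hh
    let P := regular Q
    let i : P ≅ dual (dual P) := rightDualIso (X := dual P)
      (BraidedCategory.exactPairing_swap P (dual P)) inferInstance
    have h1 : (dual (dual P)).act h = 0 := by
      refine LinearMap.ext fun (Ψ : Module.Dual k P.dual) => LinearMap.ext fun φ => ?_
      change Ψ ((dual P).act (Q.S h) φ) = 0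
      rw [hh, map_zero, LinearMap.zero_apply, map_zero]
    have h2 := i.hom.linear h ((down Q).symm 1)
    rw [h1, LinearMap.zero_apply] at h2
    have h3 : P.act h ((down Q).symm 1) = 0 := by
      have h4 := congrArg i.inv.lin h2
      rw [map_zero] at h4
      refine Eq.trans ?_ h4
      exact (LinearMap.congr_fun (congrArg Hom.lin i.hom_inv_id) _).symm
    have h5 := congrArg (down Q) h3
    rw [map_zero] at h5
    refine Eq.trans ?_ h5
    exact (mul_one h).symm
  exact ⟨hinj, LinearMap.surjective_of_injective hinj⟩

variable (Q) in
@[simp] theorem S_Sinv (h : H) : Q.S (Q.Sinv h) = h := by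
  rw [Sinv, linInv, dif_pos (bijective_S Q)]
  exact (LinearEquiv.ofBijective Q.S (bijective_S Q)).apply_symm_apply h

end
end Rep
end QTQuasiHopfAlgebra

end

/-! ### Two forms of the elements γ and δ -/

noncomputable section

open CategoryTheory MonoidalCategory
open QuasiHopf QuasiHopfAlgebra BraidedReconstruction

namespace QuasiHopf
variable {k : Type*} [Field k] {H A B : Type*} [Ring H] [Algebra k H] [Ring A] [Algebra k A]
  [Ring B] [Algebra k B]

/-- A linear map that is multiplicative and unital. -/
structure IsSlot (f : H →ₗ[k] A) : Prop where
  one : f 1 = 1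
  mul : ∀ a b, f (a * b) = f a * f b

/-- Linear maps with elementwise commuting values. -/
def Commutes (f g : H →ₗ[k] A) : Prop := ∀ a b, f a * g b = g b * f a

theorem Commutes.symm {f g : H →ₗ[k] A} (h : Commutes f g) : Commutes g f :=
  fun a b => (h b a).symm

theorem mulMap_mul {f g : H →ₗ[k] A} (hf : IsSlot f) (hg : IsSlot g) (h : Commutes f g)
    (s t : H ⊗[k] H) : mulMap f g (s * t) = mulMap f g s * mulMap f g t := by
  induction s with
  | zero => simp
  | add s₁ s₂ h₁ h₂ => simp [add_mul, h₁, h₂]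
  | tmul a b =>
    induction t with
    | zero => simp
    | add t₁ t₂ h₁ h₂ => simp [mul_add, h₁, h₂]
    | tmul c d =>
      rw [Algebra.TensorProduct.tmul_mul_tmul, mulMap_tmul, mulMap_tmul, mulMap_tmul, hf.mul,
        hg.mul, mul_assoc, mul_assoc, ← mul_assoc (f c), h c b, mul_assoc]

theorem mulMap_one {f g : H →ₗ[k] A} (hf : IsSlot f) (hg : IsSlot g) : mulMap f g 1 = 1 := by
  rw [Algebra.TensorProduct.one_def, mulMap_tmul, hf.one, hg.one, one_mul]

theorem mulMap₃_mul {f g h : H →ₗ[k] A} (hf : IsSlot f) (hg : IsSlot g) (hh : IsSlot h)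
    (hfg : Commutes f g) (hfh : Commutes f h) (hgh : Commutes g h) (s t : H ⊗[k] (H ⊗[k] H)) :
    mulMap₃ f g h (s * t) = mulMap₃ f g h s * mulMap₃ f g h t := by
  induction s with
  | zero => simp
  | add s₁ s₂ h₁ h₂ => simp [add_mul, h₁, h₂]
  | tmul a b =>
    induction t with
    | zero => simp
    | add t₁ t₂ h₁ h₂ => simp [mul_add, h₁, h₂]
    | tmul c d =>
      have key : ∀ b, f c * mulMap g h b = mulMap g h b * f c := by
        intro b
        induction b with
        | zero => simp
        | add s₁ s₂ h₁ h₂ => simp [add_mul, mul_add, h₁, h₂]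
        | tmul b b' => rw [mulMap_tmul, ← mul_assoc, hfg, mul_assoc, hfh, mul_assoc]
      rw [Algebra.TensorProduct.tmul_mul_tmul]
      simp only [mulMap₃]
      rw [mulMap_tmul, mulMap_tmul, mulMap_tmul, hf.mul, mulMap_mul hg hh hgh, mul_assoc,
        mul_assoc, ← mul_assoc (f c), key, mul_assoc]

theorem mulMap₃_one {f g h : H →ₗ[k] A} (hf : IsSlot f) (hg : IsSlot g) (hh : IsSlot h) :
    mulMap₃ f g h 1 = 1 := by
  rw [Algebra.TensorProduct.one_def, mulMap₃, mulMap_tmul, mulMap_one hg hh, hf.one, one_mul]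

theorem map_mulMap (p : A →ₐ[k] B) (f g : H →ₗ[k] A) (t : H ⊗[k] H) :
    p (mulMap f g t) = mulMap (p.toLinearMap ∘ₗ f) (p.toLinearMap ∘ₗ g) t := by
  induction t with
  | zero => simp
  | add s₁ s₂ h₁ h₂ => simp only [map_add, h₁, h₂]
  | tmul a b => simp

theorem map_mulMap₃ (p : A →ₐ[k] B) (f g h : H →ₗ[k] A) (t : H ⊗[k] (H ⊗[k] H)) :
    p (mulMap₃ f g h t) =
      mulMap₃ (p.toLinearMap ∘ₗ f) (p.toLinearMap ∘ₗ g) (p.toLinearMap ∘ₗ h) t := by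
  induction t with
  | zero => simp
  | add s₁ s₂ h₁ h₂ => simp only [map_add, h₁, h₂]
  | tmul a b =>
    rw [mulMap₃, mulMap₃, mulMap_tmul, mulMap_tmul, map_mul, map_mulMap]
    rfl

theorem isSlot_algHom (p : H →ₐ[k] A) : IsSlot p.toLinearMap := ⟨map_one p, map_mul p⟩

theorem isSlot_slot₁ : IsSlot (slot₁ k H) := ⟨rfl, by intros; simp⟩
theorem isSlot_slot₂ : IsSlot (slot₂ k H) := ⟨rfl, by intros; simp⟩
theorem isSlot_slot₃ : IsSlot (slot₃ k H) := ⟨rfl, by intros; simp⟩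
theorem isSlot_slot₄ : IsSlot (slot₄ k H) := ⟨rfl, by intros; simp⟩
theorem commutes₁₂ : Commutes (slot₁ k H) (slot₂ k H) := by intro a b; simp
theorem commutes₁₃ : Commutes (slot₁ k H) (slot₃ k H) := by intro a b; simp
theorem commutes₁₄ : Commutes (slot₁ k H) (slot₄ k H) := by intro a b; simp
theorem commutes₂₃ : Commutes (slot₂ k H) (slot₃ k H) := by intro a b; simp
theorem commutes₂₄ : Commutes (slot₂ k H) (slot₄ k H) := by intro a b; simp
theorem commutes₃₄ : Commutes (slot₃ k H) (slot₄ k H) := by intro a b; simp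

end QuasiHopf

namespace QuasiHopfAlgebra
variable {k H : Type*} [Field k] [Ring H] [Algebra k H] (Q : QuasiHopfAlgebra k H)

section slots
variable {A B : Type*} [Ring A] [Algebra k A] [Ring B] [Algebra k B]

theorem isSlot_Δ₂ {f g : H →ₗ[k] A} (hf : IsSlot f) (hg : IsSlot g) (h : Commutes f g) :
    IsSlot (Q.Δ₂ f g) where
  one := by simp [Δ₂, mulMap_one hf hg]
  mul a b := by simp [Δ₂, mulMap_mul hf hg h]

theorem commutes_Δ₂ {f g h : H →ₗ[k] A} (hf : Commutes f h) (hg : Commutes g h) :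
    Commutes (Q.Δ₂ f g) h := by
  intro a b
  simp only [Δ₂, LinearMap.comp_apply]
  generalize Q.Δ.toLinearMap a = d
  induction d with
  | zero => simp
  | add s t hs ht => simp only [map_add, add_mul, mul_add, hs, ht]
  | tmul c d => rw [mulMap_tmul, mul_assoc, hg, ← mul_assoc, hf, mul_assoc]

theorem mulMap₃_X_mul_x {f g h : H →ₗ[k] A} (hf : IsSlot f) (hg : IsSlot g) (hh : IsSlot h)
    (hfg : Commutes f g) (hfh : Commutes f h) (hgh : Commutes g h) :
    mulMap₃ f g h Q.X * mulMap₃ f g h Q.x = 1 := by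
  rw [← mulMap₃_mul hf hg hh hfg hfh hgh, X_mul_x, mulMap₃_one hf hg hh]

theorem mulMap₃_x_mul_X {f g h : H →ₗ[k] A} (hf : IsSlot f) (hg : IsSlot g) (hh : IsSlot h)
    (hfg : Commutes f g) (hfh : Commutes f h) (hgh : Commutes g h) :
    mulMap₃ f g h Q.x * mulMap₃ f g h Q.X = 1 := by
  rw [← mulMap₃_mul hf hg hh hfg hfh hgh, x_mul_X, mulMap₃_one hf hg hh]

theorem comp_Δ₂ (p : A →ₐ[k] B) (f g : H →ₗ[k] A) :
    p.toLinearMap ∘ₗ Q.Δ₂ f g = Q.Δ₂ (p.toLinearMap ∘ₗ f) (p.toLinearMap ∘ₗ g) := by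
  ext a
  simp only [Δ₂, LinearMap.comp_apply, AlgHom.toLinearMap_apply]
  rw [map_mulMap]

/-- `(1 ⊗ Φ⁻¹)(id ⊗ id ⊗ Δ)(Φ) = (id ⊗ Δ ⊗ id)(Φ)(Φ ⊗ 1)(Δ ⊗ id ⊗ id)(Φ⁻¹)`. -/
theorem cocycle_left :
    mulMap₃ (slot₂ k H) (slot₃ k H) (slot₄ k H) Q.x *
        mulMap₃ (slot₁ k H) (slot₂ k H) (Q.Δ₂ (slot₃ k H) (slot₄ k H)) Q.X =
      mulMap₃ (slot₁ k H) (Q.Δ₂ (slot₂ k H) (slot₃ k H)) (slot₄ k H) Q.X *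
        (mulMap₃ (slot₁ k H) (slot₂ k H) (slot₃ k H) Q.X *
        mulMap₃ (Q.Δ₂ (slot₁ k H) (slot₂ k H)) (slot₃ k H) (slot₄ k H) Q.x) := by
  have h : mulMap₃ (slot₂ k H) (slot₃ k H) (slot₄ k H) Q.X *
      mulMap₃ (slot₁ k H) (Q.Δ₂ (slot₂ k H) (slot₃ k H)) (slot₄ k H) Q.X *
      mulMap₃ (slot₁ k H) (slot₂ k H) (slot₃ k H) Q.X =
      mulMap₃ (slot₁ k H) (slot₂ k H) (Q.Δ₂ (slot₃ k H) (slot₄ k H)) Q.X *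
      mulMap₃ (Q.Δ₂ (slot₁ k H) (slot₂ k H)) (slot₃ k H) (slot₄ k H) Q.X := Q.cocycle
  have h1 := Q.mulMap₃_x_mul_X isSlot_slot₂ isSlot_slot₃ isSlot_slot₄ commutes₂₃ commutes₂₄
    commutes₃₄
  have h2 := Q.mulMap₃_X_mul_x (Q.isSlot_Δ₂ isSlot_slot₁ isSlot_slot₂ commutes₁₂) isSlot_slot₃
    isSlot_slot₄ (Q.commutes_Δ₂ commutes₁₃ commutes₂₃) (Q.commutes_Δ₂ commutes₁₄ commutes₂₄)
    commutes₃₄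
  rw [← mul_assoc, ← one_mul (mulMap₃ (slot₁ k H) (Q.Δ₂ (slot₂ k H) (slot₃ k H)) (slot₄ k H) Q.X),
    ← h1, mul_assoc (mulMap₃ (slot₂ k H) (slot₃ k H) (slot₄ k H) Q.x), mul_assoc, mul_assoc,
    ← mul_assoc (_ * _) (mulMap₃ (slot₁ k H) (slot₂ k H) (slot₃ k H) Q.X), h,
    mul_assoc _ _ (mulMap₃ (Q.Δ₂ _ _) _ _ Q.x), h2, mul_one]

/-- `(id ⊗ id ⊗ Δ)(Φ⁻¹)(1 ⊗ Φ) = (Δ ⊗ id ⊗ id)(Φ)(Φ⁻¹ ⊗ 1)(id ⊗ Δ ⊗ id)(Φ⁻¹)`. -/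
theorem cocycle_right :
    mulMap₃ (slot₁ k H) (slot₂ k H) (Q.Δ₂ (slot₃ k H) (slot₄ k H)) Q.x *
        mulMap₃ (slot₂ k H) (slot₃ k H) (slot₄ k H) Q.X =
      mulMap₃ (Q.Δ₂ (slot₁ k H) (slot₂ k H)) (slot₃ k H) (slot₄ k H) Q.X *
        mulMap₃ (slot₁ k H) (slot₂ k H) (slot₃ k H) Q.x *
        mulMap₃ (slot₁ k H) (Q.Δ₂ (slot₂ k H) (slot₃ k H)) (slot₄ k H) Q.x := by
  have h1 := Q.mulMap₃_X_mul_x isSlot_slot₂ isSlot_slot₃ isSlot_slot₄ commutes₂₃ commutes₂₄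
    commutes₃₄
  have h2 := Q.mulMap₃_x_mul_X (Q.isSlot_Δ₂ isSlot_slot₁ isSlot_slot₂ commutes₁₂) isSlot_slot₃
    isSlot_slot₄ (Q.commutes_Δ₂ commutes₁₃ commutes₂₃) (Q.commutes_Δ₂ commutes₁₄ commutes₂₄)
    commutes₃₄
  have h3 := Q.mulMap₃_X_mul_x isSlot_slot₁ isSlot_slot₂ isSlot_slot₃ commutes₁₂ commutes₁₃
    commutes₂₃
  have h4 := Q.mulMap₃_X_mul_x isSlot_slot₁ (Q.isSlot_Δ₂ isSlot_slot₂ isSlot_slot₃ commutes₂₃)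
    isSlot_slot₄ (Q.commutes_Δ₂ commutes₁₂.symm commutes₁₃.symm).symm commutes₁₄
    (Q.commutes_Δ₂ commutes₂₄ commutes₃₄)
  have h5 := Q.mulMap₃_x_mul_X isSlot_slot₁ isSlot_slot₂
    (Q.isSlot_Δ₂ isSlot_slot₃ isSlot_slot₄ commutes₃₄) commutes₁₂
    (Q.commutes_Δ₂ commutes₁₃.symm commutes₁₄.symm).symm
    (Q.commutes_Δ₂ commutes₂₃.symm commutes₂₄.symm).symm
  have h := Q.cocycle_left
  revert h h1 h2 h3 h4 h5
  generalize mulMap₃ (slot₂ k H) (slot₃ k H) (slot₄ k H) Q.x = x234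
  generalize mulMap₃ (slot₂ k H) (slot₃ k H) (slot₄ k H) Q.X = X234
  generalize mulMap₃ (slot₁ k H) (slot₂ k H) (slot₃ k H) Q.x = x123
  generalize mulMap₃ (slot₁ k H) (slot₂ k H) (slot₃ k H) Q.X = X123
  generalize mulMap₃ (slot₁ k H) (slot₂ k H) (Q.Δ₂ (slot₃ k H) (slot₄ k H)) Q.x = xr
  generalize mulMap₃ (slot₁ k H) (slot₂ k H) (Q.Δ₂ (slot₃ k H) (slot₄ k H)) Q.X = Xr
  generalize mulMap₃ (Q.Δ₂ (slot₁ k H) (slot₂ k H)) (slot₃ k H) (slot₄ k H) Q.x = xl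
  generalize mulMap₃ (Q.Δ₂ (slot₁ k H) (slot₂ k H)) (slot₃ k H) (slot₄ k H) Q.X = Xl
  generalize mulMap₃ (slot₁ k H) (Q.Δ₂ (slot₂ k H) (slot₃ k H)) (slot₄ k H) Q.x = xm
  generalize mulMap₃ (slot₁ k H) (Q.Δ₂ (slot₂ k H) (slot₃ k H)) (slot₄ k H) Q.X = Xm
  intro h1 h2 h3 h4 h5 h
  -- both sides are inverse to the two sides of `cocycle_left`
  have e1 : xr * X234 * (x234 * Xr) = 1 := by
    rw [mul_assoc, ← mul_assoc X234, h1, one_mul, h5]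
  have e2 : (Xm * (X123 * xl)) * (Xl * x123 * xm) = 1 := by
    rw [mul_assoc, mul_assoc, mul_assoc, ← mul_assoc xl, h2, one_mul, ← mul_assoc X123,
      h3, one_mul, h4]
  rw [h] at e1
  exact left_inv_eq_right_inv e1 e2

/-- The permutation `a₁ ⊗ a₂ ⊗ a₃ ⊗ a₄ ↦ (a₂ ⊗ a₃) ⊗ (a₁ ⊗ a₄)`. -/
def permγ : H4 k H →ₐ[k] H4 k H :=
  (Algebra.TensorProduct.tensorTensorTensorComm k k k k H H H H).toAlgHom.comp
    (Algebra.TensorProduct.map (Algebra.TensorProduct.comm k H H).toAlgHom (AlgHom.id k _))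

/-- The permutation `a₁ ⊗ a₂ ⊗ a₃ ⊗ a₄ ↦ (a₁ ⊗ a₄) ⊗ (a₂ ⊗ a₃)`. -/
def permδ : H4 k H →ₐ[k] H4 k H :=
  (Algebra.TensorProduct.tensorTensorTensorComm k k k k H H H H).toAlgHom.comp
    (Algebra.TensorProduct.map (AlgHom.id k _) (Algebra.TensorProduct.comm k H H).toAlgHom)

theorem permγ_slot₁ : (permγ (k := k) (H := H)).toLinearMap ∘ₗ slot₁ k H = slot₃ k H := by
  ext; simp [permγ]
theorem permγ_slot₂ : (permγ (k := k) (H := H)).toLinearMap ∘ₗ slot₂ k H = slot₁ k H := by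
  ext; simp [permγ]
theorem permγ_slot₃ : (permγ (k := k) (H := H)).toLinearMap ∘ₗ slot₃ k H = slot₂ k H := by
  ext; simp [permγ]
theorem permγ_slot₄ : (permγ (k := k) (H := H)).toLinearMap ∘ₗ slot₄ k H = slot₄ k H := by
  ext; simp [permγ]
theorem permδ_slot₁ : (permδ (k := k) (H := H)).toLinearMap ∘ₗ slot₁ k H = slot₁ k H := by
  ext; simp [permδ]
theorem permδ_slot₂ : (permδ (k := k) (H := H)).toLinearMap ∘ₗ slot₂ k H = slot₃ k H := by
  ext; simp [permδ]
theorem permδ_slot₃ : (permδ (k := k) (H := H)).toLinearMap ∘ₗ slot₃ k H = slot₄ k H := by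
  ext; simp [permδ]
theorem permδ_slot₄ : (permδ (k := k) (H := H)).toLinearMap ∘ₗ slot₄ k H = slot₂ k H := by
  ext; simp [permδ]

/-- Application of `ε` to the middle leg. -/
def εmid : H ⊗[k] (H ⊗[k] H) →ₗ[k] H ⊗[k] H :=
  TensorProduct.map LinearMap.id ((TensorProduct.lid k H).toLinearMap ∘ₗ
    TensorProduct.map Q.ε.toLinearMap LinearMap.id)

theorem εmid_tmul (a b c : H) : Q.εmid (a ⊗ₜ (b ⊗ₜ c)) = Q.ε b • (a ⊗ₜ c) := by
  simp [εmid]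

theorem εmid_X : Q.εmid Q.X = 1 := by
  have h := congrArg (TensorProduct.map LinearMap.id (TensorProduct.lid k H).toLinearMap)
    Q.cocycle_counit
  have : Q.εmid Q.X = TensorProduct.map LinearMap.id (TensorProduct.lid k H).toLinearMap
    (Algebra.TensorProduct.map (AlgHom.id k H) (Algebra.TensorProduct.map Q.ε (AlgHom.id k H))
      Q.X) := by
    generalize Q.X = t
    induction t using TensorProduct.induction_on with
    | zero => simp
    | add s t hs ht => simp only [map_add, hs, ht]
    | tmul a t =>
      induction t with
      | zero => simp
      | add s t hs ht => simp only [map_add, hs, ht, TensorProduct.tmul_add]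
      | tmul b c => simp [εmid]
  rw [this]
  refine h.trans ?_
  simp [Algebra.TensorProduct.one_def]

theorem εmid_mul (s t : H ⊗[k] (H ⊗[k] H)) : Q.εmid (s * t) = Q.εmid s * Q.εmid t := by
  have key : ∀ t, Q.εmid t = mulMap₃ (Algebra.TensorProduct.includeLeft (S := k)).toLinearMap
      ((Algebra.ofId k (H ⊗[k] H)).toLinearMap ∘ₗ Q.ε.toLinearMap)
      Algebra.TensorProduct.includeRight.toLinearMap t := by
    intro t
    induction t using TensorProduct.induction_on with
    | zero => simp
    | add s t hs ht => simp only [map_add, hs, ht]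
    | tmul a t =>
      induction t with
      | zero => simp
      | add s t hs ht => simp only [map_add, hs, ht, TensorProduct.tmul_add]
      | tmul b c =>
        simp [εmid_tmul, Algebra.ofId_apply, Algebra.algebraMap_eq_smul_one]
  rw [key, key, key]
  apply mulMap₃_mul
  · exact isSlot_algHom _
  · exact isSlot_algHom ((Algebra.ofId k (H ⊗[k] H)).comp Q.ε)
  · exact isSlot_algHom _
  · intro a b; simp [Algebra.ofId_apply, Algebra.commutes]
  · intro a b; simp
  · intro a b; simp [Algebra.ofId_apply]

theorem εmid_x : Q.εmid Q.x = 1 := by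
  have h := Q.εmid_mul Q.X Q.x
  rw [X_mul_x, εmid_X, one_mul] at h
  rw [← h]
  simp [Algebra.TensorProduct.one_def, εmid_tmul]

/-- `γ` through the other side of the pentagon. -/
theorem γ_eq : Q.γ = TensorProduct.map Q.SαI Q.SαI
    (mulMap₃ (slot₁ k H) (slot₂ k H) (slot₄ k H) Q.x *
      mulMap₃ (slot₃ k H) (slot₁ k H) (Q.Δ₂ (slot₂ k H) (slot₄ k H)) Q.X) := by
  have h := congrArg permγ Q.cocycle_left
  simp only [map_mul, map_mulMap₃, comp_Δ₂, permγ_slot₁, permγ_slot₂, permγ_slot₃,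
    permγ_slot₄] at h
  rw [h, γ]
  generalize (mulMap₃ (slot₃ k H) (slot₁ k H) (slot₂ k H)) Q.X *
    (mulMap₃ (Q.Δ₂ (slot₃ k H) (slot₁ k H)) (slot₂ k H) (slot₄ k H)) Q.x = s
  have key : ∀ (u : H ⊗[k] (H ⊗[k] H)) (s : H4 k H), TensorProduct.map Q.SαI Q.SαI
      (mulMap₃ (slot₃ k H) (Q.Δ₂ (slot₁ k H) (slot₂ k H)) (slot₄ k H) u * s) =
      TensorProduct.map Q.SαI Q.SαI (mulMap (slot₃ k H) (slot₄ k H) (Q.εmid u) * s) := by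
    intro u s
    induction u using TensorProduct.induction_on with
    | zero => simp
    | add s t hs ht => simp only [map_add, add_mul, hs, ht]
    | tmul a t =>
      induction t with
      | zero => simp
      | add s t hs ht => simp only [map_add, add_mul, hs, ht, TensorProduct.tmul_add]
      | tmul b c =>
        induction s using TensorProduct.induction_on with
        | zero => simp
        | add s t hs ht => simp only [map_add, mul_add, hs, ht]
        | tmul s t =>
          induction s with
          | zero => simp
          | add s t hs ht => simp only [map_add, mul_add, hs, ht, TensorProduct.add_tmul]
          | tmul s₁ s₂ =>
            induction t with
            | zero => simp
            | add s t hs ht => simp only [map_add, mul_add, hs, ht, TensorProduct.tmul_add]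
            | tmul s₃ s₄ =>
              have e : ∀ d : H ⊗[k] H, TensorProduct.map Q.SαI Q.SαI
                  (slot₃ k H a * (mulMap (slot₁ k H) (slot₂ k H) d * slot₄ k H c) *
                    (s₁ ⊗ₜ[k] s₂) ⊗ₜ[k] (s₃ ⊗ₜ[k] s₄)) =
                  (Q.S s₁ * Q.SαI d * s₂) ⊗ₜ (Q.S s₃ * Q.S a * Q.α * c * s₄) := by
                intro d
                induction d with
                | zero => simp
                | add s t hs ht => simp only [map_add, mul_add, add_mul, hs, ht,
                    TensorProduct.add_tmul]
                | tmul d e => simp [Q.S_mul, mul_assoc]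
              rw [mulMap₃_tmul, εmid_tmul, Δ₂, LinearMap.comp_apply, e, AlgHom.toLinearMap_apply,
                SαI_Δ]
              simp [Q.S_mul, mul_assoc, TensorProduct.smul_tmul']
  rw [key, εmid_X, show mulMap (slot₃ k H) (slot₄ k H) 1 = 1 from
    mulMap_one isSlot_slot₃ isSlot_slot₄, one_mul]

/-- `δ` through the other side of the pentagon. -/
theorem δ_eq : Q.δ = TensorProduct.map Q.IβS Q.IβS
    (mulMap₃ (slot₁ k H) (slot₃ k H) (Q.Δ₂ (slot₄ k H) (slot₂ k H)) Q.x *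
      mulMap₃ (slot₃ k H) (slot₄ k H) (slot₂ k H) Q.X) := by
  have h := congrArg permδ Q.cocycle_right
  simp only [map_mul, map_mulMap₃, comp_Δ₂, permδ_slot₁, permδ_slot₂, permδ_slot₃,
    permδ_slot₄] at h
  rw [h, δ]
  generalize (mulMap₃ (Q.Δ₂ (slot₁ k H) (slot₃ k H)) (slot₄ k H) (slot₂ k H)) Q.X *
    (mulMap₃ (slot₁ k H) (slot₃ k H) (slot₄ k H)) Q.x = s
  have key : ∀ (u : H ⊗[k] (H ⊗[k] H)) (s : H4 k H), TensorProduct.map Q.IβS Q.IβS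
      (s * mulMap₃ (slot₁ k H) (Q.Δ₂ (slot₃ k H) (slot₄ k H)) (slot₂ k H) u) =
      TensorProduct.map Q.IβS Q.IβS (s * mulMap (slot₁ k H) (slot₂ k H) (Q.εmid u)) := by
    intro u s
    induction u using TensorProduct.induction_on with
    | zero => simp
    | add s t hs ht => simp only [map_add, mul_add, hs, ht]
    | tmul a t =>
      induction t with
      | zero => simp
      | add s t hs ht => simp only [map_add, mul_add, hs, ht, TensorProduct.tmul_add]
      | tmul b c =>
        induction s using TensorProduct.induction_on with
        | zero => simp
        | add s t hs ht => simp only [map_add, add_mul, hs, ht]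
        | tmul s t =>
          induction s with
          | zero => simp
          | add s t hs ht => simp only [map_add, add_mul, hs, ht, TensorProduct.add_tmul]
          | tmul s₁ s₂ =>
            induction t with
            | zero => simp
            | add s t hs ht => simp only [map_add, add_mul, hs, ht, TensorProduct.tmul_add]
            | tmul s₃ s₄ =>
              have e : ∀ d : H ⊗[k] H, TensorProduct.map Q.IβS Q.IβS
                  ((s₁ ⊗ₜ[k] s₂) ⊗ₜ[k] (s₃ ⊗ₜ[k] s₄) *
                    (slot₁ k H a * (mulMap (slot₃ k H) (slot₄ k H) d * slot₂ k H c))) =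
                  (s₁ * a * Q.β * Q.S c * Q.S s₂) ⊗ₜ (s₃ * Q.IβS d * Q.S s₄) := by
                intro d
                induction d with
                | zero => simp
                | add s t hs ht => simp only [map_add, mul_add, add_mul, hs, ht,
                    TensorProduct.tmul_add]
                | tmul d e => simp [Q.S_mul, mul_assoc]
              rw [mulMap₃_tmul, εmid_tmul, Δ₂, LinearMap.comp_apply, e, AlgHom.toLinearMap_apply,
                IβS_Δ]
              simp [Q.S_mul, mul_assoc, TensorProduct.smul_tmul']
  rw [key, εmid_x, show mulMap (slot₁ k H) (slot₂ k H) 1 = 1 from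
    mulMap_one isSlot_slot₁ isSlot_slot₂, mul_one]
end slots
end QuasiHopfAlgebra

end

/-! ### Drinfeld's twist and duals of tensor products -/

noncomputable section

open CategoryTheory MonoidalCategory ExactPairing
open QuasiHopf QuasiHopfAlgebra BraidedReconstruction

namespace QuasiHopf
variable {k : Type*} [Field k] {M N D : Type*} [AddCommGroup M] [Module k M]
  [AddCommGroup N] [Module k N] [AddCommGroup D] [Module k D]

/-- The pairing `(φ ⊗ ψ)(m ⊗ n) = ψ(m) φ(n)` of `N* ⊗ M*` with `M ⊗ N`. -/
def nest : Module.Dual k N ⊗[k] Module.Dual k M →ₗ[k] Module.Dual k (M ⊗[k] N) :=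
  TensorProduct.dualDistrib k M N ∘ₗ (TensorProduct.comm k _ _).toLinearMap

@[simp] theorem nest_tmul (φ : Module.Dual k N) (ψ : Module.Dual k M) (m : M) (n : N) :
    nest (φ ⊗ₜ[k] ψ) (m ⊗ₜ[k] n) = ψ m * φ n := by simp [nest]

theorem nest_bijective [FiniteDimensional k M] [FiniteDimensional k N] :
    Function.Bijective (nest : Module.Dual k N ⊗[k] Module.Dual k M →ₗ[k] _) := by
  have : (nest : Module.Dual k N ⊗[k] Module.Dual k M →ₗ[k] _) =
      (TensorProduct.dualDistribEquiv k M N).toLinearMap ∘ₗ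
        (TensorProduct.comm k _ _).toLinearMap := rfl
  rw [this]
  exact (TensorProduct.dualDistribEquiv k M N).bijective.comp (TensorProduct.comm k _ _).bijective

theorem lid_contract (e : D ⊗[k] M →ₗ[k] k) (d : D) (w : M ⊗[k] Module.Dual k N) (z : N) :
    TensorProduct.lid k _ (TensorProduct.map e LinearMap.id
      ((TensorProduct.assoc k D M (Module.Dual k N)).symm (d ⊗ₜ w))) z = e (d ⊗ₜ toHom w z) := by
  induction w with
  | zero => simp
  | add s t hs ht => simp only [TensorProduct.tmul_add, map_add, LinearMap.add_apply, hs, ht]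
  | tmul m φ => simp [mul_comm]

end QuasiHopf

namespace QuasiHopfAlgebra
variable {k H : Type*} [Field k] [Ring H] [Algebra k H] (Q : QuasiHopfAlgebra k H)
variable {M N D : Type*} [AddCommGroup M] [Module k M] [AddCommGroup N] [Module k N]
  [AddCommGroup D] [Module k D]
variable (ρ : H →ₐ[k] Module.End k M) (σ : H →ₐ[k] Module.End k N) (κ : H →ₐ[k] Module.End k D)

theorem SSΔop_apply (h : H) : Q.SSΔop h =
    TensorProduct.map Q.S Q.S (TensorProduct.comm k H H (Q.Δ h)) := rfl

theorem nest_tensAct (h : H) (y : Module.Dual k N ⊗[k] Module.Dual k M) :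
    nest (Q.tensAct (Q.dualAct σ) (Q.dualAct ρ) h y) = nest y ∘ₗ extAct ρ σ (Q.SSΔop h) := by
  rw [tensAct_apply, SSΔop_apply]
  generalize Q.Δ h = d
  induction d with
  | zero => simp
  | add s t hs ht => simp only [map_add, LinearMap.add_apply, hs, ht, LinearMap.comp_add]
  | tmul a b =>
    induction y with
    | zero => simp
    | add s t hs ht => simp only [map_add, hs, ht, LinearMap.add_comp]
    | tmul φ ψ => ext; simp

/-- The mate of an evaluation `e : D ⊗ M → k` against the dual of `M`. -/
theorem mate_apply [FiniteDimensional k M] (e : D ⊗[k] M →ₗ[k] k) (d : D) (z : M) :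
    TensorProduct.lid k _ (TensorProduct.map e LinearMap.id
      (Q.assocInv κ ρ (Q.dualAct ρ) (d ⊗ₜ Q.coev ρ 1))) z = e (extAct κ ρ Q.pR (d ⊗ₜ z)) := by
  have key : ∀ t : H ⊗[k] (H ⊗[k] H), TensorProduct.lid k _ (TensorProduct.map e LinearMap.id
      ((TensorProduct.assoc k _ _ _).symm (extAct κ (extAct ρ (Q.dualAct ρ)) t
        (d ⊗ₜ Q.coev ρ 1)))) z =
      e (extAct κ ρ (TensorProduct.map LinearMap.id Q.IβS t) (d ⊗ₜ z)) := by
    intro t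
    induction t with
    | zero => simp
    | add s t hs ht => simp only [map_add, LinearMap.add_apply, hs, ht]
    | tmul a t => rw [extAct_tmul, lid_contract, toHom_extAct_coev]; simp
  exact key Q.x

/-- The evaluation of `N* ⊗ M*` on `M ⊗ N`. -/
def evTens : (Module.Dual k N ⊗[k] Module.Dual k M) ⊗[k] (M ⊗[k] N) →ₗ[k] k :=
  Q.ev σ ∘ₗ TensorProduct.map LinearMap.id (TensorProduct.lid k N).toLinearMap ∘ₗ
  TensorProduct.map LinearMap.id (TensorProduct.map (Q.ev ρ) LinearMap.id) ∘ₗ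
  TensorProduct.map LinearMap.id (Q.assocInv (Q.dualAct ρ) ρ σ) ∘ₗ
  Q.assocHom (Q.dualAct σ) (Q.dualAct ρ) (Q.tensAct ρ σ)

/-- The nested evaluation is the nested pairing precomposed with the action of `γ`. -/
theorem evTens_tmul (y : Module.Dual k N ⊗[k] Module.Dual k M) (z : M ⊗[k] N) :
    Q.evTens ρ σ (y ⊗ₜ z) = nest y (extAct ρ σ Q.γ z) := by
  have key : ∀ (t u : H ⊗[k] (H ⊗[k] H)) (φ : Module.Dual k N) (ψ : Module.Dual k M) (m : M)
      (n : N), Q.ev σ (TensorProduct.map LinearMap.id (TensorProduct.lid k N).toLinearMap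
      (TensorProduct.map LinearMap.id (TensorProduct.map (Q.ev ρ) LinearMap.id)
      (TensorProduct.map LinearMap.id ((TensorProduct.assoc k _ _ _).symm.toLinearMap ∘ₗ
          extAct (Q.dualAct ρ) (extAct ρ σ) t)
        (extAct (Q.dualAct σ) (extAct (Q.dualAct ρ) (Q.tensAct ρ σ)) u
          (φ ⊗ₜ (ψ ⊗ₜ (m ⊗ₜ n))))))) =
      nest (φ ⊗ₜ ψ) (extAct ρ σ (TensorProduct.map Q.SαI Q.SαI
        (mulMap₃ (slot₁ k H) (slot₂ k H) (slot₄ k H) t *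
          mulMap₃ (slot₃ k H) (slot₁ k H) (Q.Δ₂ (slot₂ k H) (slot₄ k H)) u)) (m ⊗ₜ n)) := by
    intro t u φ ψ m n
    induction u using TensorProduct.induction_on with
    | zero => simp
    | add s t hs ht => simp only [map_add, LinearMap.add_apply, hs, ht, mul_add]
    | tmul a u =>
    induction u with
    | zero => simp
    | add s t hs ht => simp only [map_add, LinearMap.add_apply, hs, ht, mul_add,
        TensorProduct.tmul_add]
    | tmul b c =>
    simp only [extAct_tmul, tensAct_apply, mulMap₃_tmul, Δ₂, LinearMap.comp_apply,
      AlgHom.toLinearMap_apply]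
    generalize Q.Δ c = d
    induction d with
    | zero => simp
    | add s t hs ht => simp only [map_add, LinearMap.add_apply, hs, ht, mul_add,
        TensorProduct.tmul_add]
    | tmul d₁ d₂ =>
    induction t using TensorProduct.induction_on with
    | zero => simp
    | add s t hs ht => simp only [map_add, LinearMap.add_apply, hs, ht, add_mul,
        LinearMap.comp_add, TensorProduct.map_add_right]
    | tmul a' u =>
    induction u with
    | zero => simp
    | add s t hs ht => simp only [map_add, LinearMap.add_apply, hs, ht, add_mul,
        TensorProduct.tmul_add, LinearMap.comp_add, TensorProduct.map_add_right]
    | tmul b' c' => simp [Q.S_mul]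
  rw [γ_eq]
  induction y with
  | zero => simp
  | add s t hs ht => simp only [TensorProduct.add_tmul, map_add, LinearMap.add_apply, hs, ht]
  | tmul φ ψ =>
    induction z with
    | zero => simp
    | add s t hs ht => simp only [TensorProduct.tmul_add, map_add, hs, ht]
    | tmul m n => exact key Q.x Q.X φ ψ m n

/-- The map `φ*` is the mate of the identity for the nested evaluation. -/
theorem phiStar_eq_mate [FiniteDimensional k M] [FiniteDimensional k N]
    (y : Module.Dual k N ⊗[k] Module.Dual k M) :
    Q.phiStar ρ σ y = TensorProduct.lid k _ (TensorProduct.map (Q.evTens ρ σ) LinearMap.id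
      (Q.assocInv (Q.tensAct (Q.dualAct σ) (Q.dualAct ρ)) (Q.tensAct ρ σ)
        (Q.dualAct (Q.tensAct ρ σ)) (y ⊗ₜ Q.coev (Q.tensAct ρ σ) 1))) := by
  rw [phiStar]
  simp only [LinearMap.comp_apply, map_map_apply, LinearMap.id_comp]
  rfl

/-- Drinfeld's twist compares the two duals of a tensor product: the canonical map
`N* ⊗ M* → (M ⊗ N)*` is the nested pairing precomposed with the action of `f`. -/
theorem phiStar_apply [FiniteDimensional k M] [FiniteDimensional k N]
    (y : Module.Dual k N ⊗[k] Module.Dual k M) (z : M ⊗[k] N) :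
    Q.phiStar ρ σ y z = nest y (extAct ρ σ Q.f z) := by
  rw [phiStar_eq_mate]
  refine (Q.mate_apply (Q.tensAct ρ σ) (Q.tensAct (Q.dualAct σ) (Q.dualAct ρ)) (Q.evTens ρ σ) y
    z).trans ?_
  rw [pR, f]
  generalize Q.x = t
  induction t with
  | zero => simp
  | add s t hs ht => simp only [map_add, LinearMap.add_apply, hs, ht]
  | tmul a s =>
    rw [TensorProduct.map_tmul, extAct_tmul, evTens_tmul, LinearMap.id_apply, nest_tensAct,
      mulMap_tmul]
    simp [tensAct_apply]

/-- `a ⊗ b ↦ ρ(a) ∘ T ∘ ρ(S(b))`. -/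
def sandEnd (T : Module.End k M) : H ⊗[k] H →ₗ[k] Module.End k M :=
  mulMap (LinearMap.mulRight k T ∘ₗ ρ.toLinearMap) (ρ.toLinearMap ∘ₗ Q.S)

theorem sandEnd_tmul (T : Module.End k M) (a b : H) (m : M) :
    Q.sandEnd ρ T (a ⊗ₜ b) m = ρ a (T (ρ (Q.S b) m)) := by
  simp [sandEnd]

theorem sandEnd_β (t : H ⊗[k] H) : Q.sandEnd ρ (ρ Q.β) t = ρ (Q.IβS t) := by
  induction t with
  | zero => simp
  | add s t hs ht => simp only [map_add, hs, ht]
  | tmul a b => ext; simp [sandEnd_tmul]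

/-- The coevaluation of `M ⊗ N` in `(M ⊗ N) ⊗ (N* ⊗ M*)`. -/
def coevTens [FiniteDimensional k M] [FiniteDimensional k N] :
    (M ⊗[k] N) ⊗[k] (Module.Dual k N ⊗[k] Module.Dual k M) :=
  Q.assocInv ρ σ (Q.tensAct (Q.dualAct σ) (Q.dualAct ρ))
    (TensorProduct.map LinearMap.id (Q.assocHom σ (Q.dualAct σ) (Q.dualAct ρ))
      (TensorProduct.map LinearMap.id (TensorProduct.mk k _ _ (Q.coev σ 1)) (Q.coev ρ 1)))

/-- The nested coevaluation represents the action of `δ`. -/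
theorem toHom_coevTens [FiniteDimensional k M] [FiniteDimensional k N] :
    toHom (TensorProduct.map LinearMap.id nest (Q.coevTens ρ σ)) = extAct ρ σ Q.δ := by
  have key : ∀ (t u : H ⊗[k] (H ⊗[k] H)) (w : M ⊗[k] Module.Dual k M)
      (v : N ⊗[k] Module.Dual k N), toHom (TensorProduct.map LinearMap.id nest
        ((TensorProduct.assoc k _ _ _).symm
          (extAct ρ (extAct σ (Q.tensAct (Q.dualAct σ) (Q.dualAct ρ))) t
        (TensorProduct.map LinearMap.id (extAct σ (extAct (Q.dualAct σ) (Q.dualAct ρ)) u ∘ₗ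
          (TensorProduct.assoc k _ _ _).toLinearMap)
        (TensorProduct.map LinearMap.id (TensorProduct.mk k _ _ v) w))))) =
      (Module.endTensorEndAlgHom (R := k) (S := k) (A := k) (M := M) (N := N))
        (TensorProduct.map (Q.sandEnd ρ (toHom w)) (Q.sandEnd σ (toHom v))
        (mulMap₃ (slot₁ k H) (slot₃ k H) (Q.Δ₂ (slot₄ k H) (slot₂ k H)) t *
          mulMap₃ (slot₃ k H) (slot₄ k H) (slot₂ k H) u)) := by
    intro t u w v
    induction t using TensorProduct.induction_on with
    | zero => simp
    | add s t hs ht => simp only [map_add, LinearMap.add_apply, hs, ht, add_mul]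
    | tmul a t =>
    induction t with
    | zero => simp
    | add s t hs ht => simp only [map_add, LinearMap.add_apply, hs, ht, add_mul,
        TensorProduct.tmul_add]
    | tmul b c =>
    simp only [extAct_tmul_eq_map, tensAct_apply, mulMap₃_tmul, Δ₂, LinearMap.comp_apply,
      AlgHom.toLinearMap_apply]
    generalize Q.Δ c = d
    induction d with
    | zero => simp
    | add s t hs ht => simp only [map_add, LinearMap.add_apply, hs, ht, mul_add, add_mul,
        TensorProduct.map_add_right]
    | tmul d₁ d₂ =>
    induction u using TensorProduct.induction_on with
    | zero => simp
    | add s t hs ht => simp only [map_add, LinearMap.add_apply, hs, ht, mul_add,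
        LinearMap.add_comp, TensorProduct.map_add_right]
    | tmul a' u =>
    induction u with
    | zero => simp
    | add s t hs ht => simp only [map_add, LinearMap.add_apply, hs, ht, mul_add,
        TensorProduct.tmul_add, LinearMap.add_comp, TensorProduct.map_add_right]
    | tmul b' c' =>
    have e : ∀ (T : Module.End k M) (T' : Module.End k N) (z : M ⊗[k] N),
        (Module.endTensorEndAlgHom (R := k) (S := k) (A := k) (M := M) (N := N))
        (TensorProduct.map (Q.sandEnd ρ T) (Q.sandEnd σ T')
        (slot₁ k H a * (slot₃ k H b * mulMap (slot₄ k H) (slot₂ k H) (d₁ ⊗ₜ[k] d₂)) *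
          mulMap₃ (slot₃ k H) (slot₄ k H) (slot₂ k H) (a' ⊗ₜ[k] (b' ⊗ₜ[k] c')))) z =
        TensorProduct.map (ρ a ∘ₗ T ∘ₗ ρ (Q.S (d₂ * c')))
          (σ (b * a') ∘ₗ T' ∘ₗ σ (Q.S (d₁ * b'))) z := by
      intro T T' z
      induction z with
      | zero => simp
      | add s t hs ht => simp only [map_add, hs, ht]
      | tmul m n => simp [sandEnd_tmul, Module.endTensorEndAlgHom_apply]
    ext m n
    simp only [TensorProduct.AlgebraTensorModule.curry_apply, LinearMap.restrictScalars_self,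
      TensorProduct.curry_apply, e]
    induction w with
    | zero => simp
    | add s t hs ht => simp only [map_add, LinearMap.add_apply, hs, ht, LinearMap.add_comp,
        LinearMap.comp_add, TensorProduct.map_add_left]
    | tmul w ψ =>
    induction v with
    | zero => simp
    | add s t hs ht => simp only [map_add, LinearMap.add_apply, hs, ht, LinearMap.add_comp,
        LinearMap.comp_add, TensorProduct.map_add_right]
    | tmul v φ =>
      simp [Q.S_mul, TensorProduct.smul_tmul', TensorProduct.tmul_smul, smul_smul, mul_comm]
  have h := key Q.x Q.X (Q.coev ρ 1) (Q.coev σ 1)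
  rw [toHom_coev, toHom_coev] at h
  refine h.trans ?_
  rw [δ_eq]
  generalize (mulMap₃ (slot₁ k H) (slot₃ k H) (Q.Δ₂ (slot₄ k H) (slot₂ k H))) Q.x *
    (mulMap₃ (slot₃ k H) (slot₄ k H) (slot₂ k H)) Q.X = s
  induction s using TensorProduct.induction_on with
  | zero => simp
  | add s t hs ht => simp only [map_add, hs, ht]
  | tmul s t =>
    rw [TensorProduct.map_tmul, TensorProduct.map_tmul, sandEnd_β, sandEnd_β, extAct_tmul_eq_map]
    ext; simp [Module.endTensorEndAlgHom_apply]

/-- The mate of the identity from `(M ⊗ N)*` to `N* ⊗ M*` is given by the inverse twist. -/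
theorem nest_mate_apply [FiniteDimensional k M] [FiniteDimensional k N]
    (ω : Module.Dual k (M ⊗[k] N)) :
    nest (TensorProduct.lid k _ (TensorProduct.map (Q.ev (Q.tensAct ρ σ)) LinearMap.id
      (Q.assocInv (Q.dualAct (Q.tensAct ρ σ)) (Q.tensAct ρ σ)
        (Q.tensAct (Q.dualAct σ) (Q.dualAct ρ)) (ω ⊗ₜ Q.coevTens ρ σ)))) =
      ω ∘ₗ extAct ρ σ Q.g := by
  have key : ∀ (t : H ⊗[k] (H ⊗[k] H)) (y : (M ⊗[k] N) ⊗[k] (Module.Dual k N ⊗[k] Module.Dual k M)),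
      nest (TensorProduct.lid k _ (TensorProduct.map (Q.ev (Q.tensAct ρ σ)) LinearMap.id
        ((TensorProduct.assoc k _ _ _).symm (extAct (Q.dualAct (Q.tensAct ρ σ))
          (extAct (Q.tensAct ρ σ) (Q.tensAct (Q.dualAct σ) (Q.dualAct ρ))) t (ω ⊗ₜ y))))) =
      ω ∘ₗ mulMap (k := k) (LinearMap.mulRight k (toHom (TensorProduct.map LinearMap.id nest y)) ∘ₗ
        (Q.tensAct ρ σ).toLinearMap ∘ₗ Q.SαI) ((extAct ρ σ).toLinearMap ∘ₗ Q.SSΔop)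
          ((TensorProduct.assoc k H H H).symm t) := by
    intro t y
    induction t using TensorProduct.induction_on with
    | zero => simp
    | add s t hs ht => simp only [map_add, LinearMap.add_apply, hs, ht, LinearMap.comp_add]
    | tmul a t =>
    induction t with
    | zero => simp
    | add s t hs ht => simp only [map_add, LinearMap.add_apply, hs, ht, LinearMap.comp_add,
        TensorProduct.tmul_add]
    | tmul b c =>
    induction y with
    | zero => simp
    | add s t hs ht =>
      rw [TensorProduct.tmul_add, map_add, map_add, map_add, map_add, map_add, hs, ht, map_add,
        map_add]
      ext; simp [mul_add, add_mul]
    | tmul z d =>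
    ext m n
    simp [nest_tensAct, mul_comm]
  refine (key Q.x _).trans ?_
  rw [toHom_coevTens, g]
  congr 1
  generalize (TensorProduct.assoc k H H H).symm Q.x = t
  induction t with
  | zero => simp
  | add s t hs ht => simp only [map_add, hs, ht]
  | tmul a b => simp [tensAct_apply]

variable {ρ σ} in
/-- The categorical transpose of an `H`-linear map is its linear transpose. -/
theorem transpose_eq [FiniteDimensional k M] {ν : M →ₗ[k] N}
    (hν : IsHLinear ρ σ ν) : Q.transpose ρ σ ν = Module.Dual.transpose ν := by
  have key : ∀ (t : H ⊗[k] (H ⊗[k] H)) (φ : Module.Dual k N) (z : M),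
      TensorProduct.lid k _ (TensorProduct.map (Q.ev σ) LinearMap.id
      ((TensorProduct.assoc k _ _ _).symm (extAct (Q.dualAct σ) (extAct σ (Q.dualAct ρ)) t
        (φ ⊗ₜ TensorProduct.map ν LinearMap.id (Q.coev ρ 1))))) z =
      φ (ν (ρ (Q.SαI (TensorProduct.map LinearMap.id Q.IβS t)) z)) := by
    intro t φ z
    induction t with
    | zero => simp
    | add s t hs ht => simp only [map_add, LinearMap.add_apply, hs, ht]
    | tmul a t =>
      rw [extAct_tmul, ← extAct_natural ρ (Q.dualAct ρ) ν LinearMap.id hν (fun _ _ => rfl),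
        lid_contract, toHom_map_left, toHom_extAct_coev]
      simp [hν _ _]
  have h1 : Q.SαI (TensorProduct.map LinearMap.id Q.IβS Q.x) = 1 := by
    rw [← Q.zigzag_inv, ← x]
    generalize Q.x = t
    induction t using TensorProduct.induction_on with
    | zero => simp
    | add s t hs ht => simp only [map_add, hs, ht]
    | tmul a t =>
      induction t with
      | zero => simp
      | add s t hs ht => simp only [TensorProduct.tmul_add, map_add, hs, ht]
      | tmul b c => simp
  refine LinearMap.ext fun φ => LinearMap.ext fun z => ?_
  refine (key Q.x φ z).trans ?_
  rw [h1]
  simp [Module.Dual.transpose_apply]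

end QuasiHopfAlgebra

end

/-! ### Invertibility of the twist -/

noncomputable section

open CategoryTheory MonoidalCategory ExactPairing
open QuasiHopf QuasiHopfAlgebra BraidedReconstruction

universe r s

namespace QTQuasiHopfAlgebra
variable {k : Type r} {H : Type s} [Field k] [Ring H] [Algebra k H] {Q : QTQuasiHopfAlgebra k H}

namespace Rep

/-- The evaluation of an exact pairing as a bilinear form. -/
def evForm (A A' : Q.Rep) [ExactPairing A A'] : A' ⊗[k] A →ₗ[k] k :=
  unitEquiv.toLinearMap ∘ₗ (ε_ A A').lin

/-- The coevaluation of an exact pairing as a tensor. -/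
def coevElt (A A' : Q.Rep) [ExactPairing A A'] : A ⊗[k] A' :=
  (η_ A A').lin ((unitEquiv (Q := Q)).symm (1 : k))

theorem evForm_dual (A : Q.Rep) : evForm A A.dual = Q.ev A.act := by
  ext; rfl

theorem coevElt_dual (A : Q.Rep) : coevElt A A.dual = Q.coev A.act 1 := rfl

theorem mate_lin {A B : Q.Rep} (t : A ⟶ B) (A' B' : Q.Rep) [ExactPairing A A']
    [ExactPairing B B'] (y : B') :
    (mate t A' B').lin y = TensorProduct.lid k A' (TensorProduct.map (evForm B B') LinearMap.id
      (Q.assocInv B'.act B.act A'.act (y ⊗ₜ TensorProduct.map t.lin LinearMap.id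
        (coevElt A A')))) := by
  rw [evForm, ← LinearMap.id_comp (LinearMap.id : A' →ₗ[k] A'), ← map_map_apply]
  rfl

theorem tensor_evaluation_eq {C : Type*} [Category* C] [MonoidalCategory C] (A A' B B' : C)
    [ExactPairing A A'] [ExactPairing B B'] : ε_ (A ⊗ B) (B' ⊗ A') =
      (α_ B' A' (A ⊗ B)).hom ≫ B' ◁ (α_ A' A B).inv ≫ B' ◁ (ε_ A A' ▷ B ≫ (λ_ B).hom) ≫
        ε_ B B' := by
  rw [tensor_evaluation]; monoidal

theorem tensor_coevaluation_eq {C : Type*} [Category* C] [MonoidalCategory C] (A A' B B' : C)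
    [ExactPairing A A'] [ExactPairing B B'] : η_ (A ⊗ B) (B' ⊗ A') =
      η_ A A' ≫ A ◁ ((λ_ A').inv ≫ η_ B B' ▷ A') ≫ A ◁ (α_ B B' A').hom ≫
        (α_ A B (B' ⊗ A')).inv := by
  rw [tensor_coevaluation]; monoidal

theorem evTens_eq {M N : Type*} [AddCommGroup M] [Module k M] [AddCommGroup N] [Module k N]
    (ρ : H →ₐ[k] Module.End k M) (σ : H →ₐ[k] Module.End k N) : Q.evTens ρ σ = Q.ev σ ∘ₗ
    TensorProduct.map LinearMap.id ((TensorProduct.lid k N).toLinearMap ∘ₗ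
      TensorProduct.map (Q.ev ρ) LinearMap.id) ∘ₗ
    TensorProduct.map LinearMap.id (Q.assocInv (Q.dualAct ρ) ρ σ) ∘ₗ
    Q.assocHom (Q.dualAct σ) (Q.dualAct ρ) (Q.tensAct ρ σ) := by
  refine LinearMap.ext fun y => ?_
  rw [evTens]
  simp only [LinearMap.comp_apply, map_map_apply, LinearMap.id_comp]
  rfl

theorem evForm_tensor (A B : Q.Rep) :
    evForm (A ⊗ B) (B.dual ⊗ A.dual) = Q.evTens A.act B.act := by
  rw [evForm, tensor_evaluation_eq]
  have e : (ε_ A A.dual ▷ B ≫ (λ_ B).hom).lin =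
      (TensorProduct.lid k B).toLinearMap ∘ₗ TensorProduct.map (Q.ev A.act) LinearMap.id := by
    refine TensorProduct.ext' fun y b => ?_
    rfl
  refine Eq.trans ?_ (evTens_eq A.act B.act).symm
  exact congrArg (fun L : (Module.Dual k A ⊗[k] A) ⊗[k] B →ₗ[k] B => Q.ev B.act ∘ₗ
    TensorProduct.map LinearMap.id L ∘ₗ
      TensorProduct.map LinearMap.id (Q.assocInv (Q.dualAct A.act) A.act B.act) ∘ₗ
      Q.assocHom (Q.dualAct B.act) (Q.dualAct A.act) (Q.tensAct A.act B.act)) e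

theorem coevElt_tensor (A B : Q.Rep) :
    coevElt (A ⊗ B) (B.dual ⊗ A.dual) = Q.coevTens A.act B.act := by
  rw [coevElt, tensor_coevaluation_eq]
  have e : ((λ_ A.dual).inv ≫ η_ B B.dual ▷ A.dual).lin =
      TensorProduct.mk k _ _ (Q.coev B.act 1) := by
    refine LinearMap.ext fun y => ?_
    rfl
  exact congrArg (fun L : Module.Dual k A →ₗ[k] (B ⊗[k] Module.Dual k B) ⊗[k] Module.Dual k A =>
    Q.assocInv A.act B.act (Q.tensAct (Q.dualAct B.act) (Q.dualAct A.act))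
    (TensorProduct.map LinearMap.id (Q.assocHom B.act (Q.dualAct B.act) (Q.dualAct A.act))
      (TensorProduct.map LinearMap.id L (Q.coev A.act 1)))) e

theorem map_id_lin {M : Type*} [AddCommGroup M] [Module k M] (A : Q.Rep) (y : A ⊗[k] M) :
    TensorProduct.map (Hom.lin (𝟙 A)) LinearMap.id y = y :=
  LinearMap.congr_fun TensorProduct.map_id y

theorem phi_lin (A B : Q.Rep) :
    (mate (𝟙 (A ⊗ B)) (dual (A ⊗ B)) (B.dual ⊗ A.dual)).lin = Q.phiStar A.act B.act := by
  refine LinearMap.ext fun y => ?_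
  rw [mate_lin, map_id_lin, evForm_tensor, coevElt_dual]
  exact (Q.phiStar_eq_mate A.act B.act y).symm

theorem psi_lin (A B : Q.Rep) (ω : dual (A ⊗ B)) :
    nest ((mate (𝟙 (A ⊗ B)) (B.dual ⊗ A.dual) (dual (A ⊗ B))).lin ω) =
      LinearMap.comp (ω : Module.Dual k (A ⊗[k] B)) (extAct A.act B.act Q.g) := by
  rw [mate_lin, map_id_lin, evForm_dual, coevElt_tensor]
  exact Q.nest_mate_apply A.act B.act ω

/-- The comparison maps between `(A ⊗ B)*` and `B* ⊗ A*` are given by `f` and `g` and compose to the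
identity. -/
theorem comp_extAct_g_mul_f (A B : Q.Rep) (ω : Module.Dual k (A ⊗[k] B)) (z : A ⊗[k] B) :
    ω (extAct A.act B.act (Q.g * Q.f) z) = ω z := by
  have h : mate (𝟙 (A ⊗ B)) (B.dual ⊗ A.dual) (dual (A ⊗ B)) ≫
      mate (𝟙 (A ⊗ B)) (dual (A ⊗ B)) (B.dual ⊗ A.dual) = 𝟙 _ := by
    rw [mate_comp]; symm; apply eq_mate; simp
  have h1 := LinearMap.congr_fun (congrArg Hom.lin h) ω
  rw [comp_lin, phi_lin] at h1
  have h2 := LinearMap.congr_fun h1 z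
  rw [map_mul]
  refine Eq.trans ?_ h2
  refine Eq.trans ?_ (Q.phiStar_apply A.act B.act _ z).symm
  exact (LinearMap.congr_fun (psi_lin A B ω) _).symm

variable [FiniteDimensional k H]

variable (Q) in
theorem g_mul_f : Q.g * Q.f = 1 := by
  have h : ∀ z : regular Q ⊗[k] regular Q,
      extAct (regular Q).act (regular Q).act (Q.g * Q.f) z = z := by
    intro z
    rw [← sub_eq_zero, ← Module.forall_dual_apply_eq_zero_iff k]
    intro ω
    rw [map_sub, comp_extAct_g_mul_f, sub_self]
  have h1 := congrArg (TensorProduct.map (down Q).toLinearMap (down Q).toLinearMap)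
    (h (TensorProduct.map (down Q).symm.toLinearMap (down Q).symm.toLinearMap 1))
  rw [extAct_natural _ _ _ _ (down_linear Q) (down_linear Q), map_map_apply, extAct_lmul] at h1
  rw [LinearEquiv.comp_coe, LinearEquiv.symm_trans_self] at h1
  have h2 : TensorProduct.map (LinearEquiv.refl k H).toLinearMap (LinearEquiv.refl k H).toLinearMap
      (1 : H ⊗[k] H) = 1 := LinearMap.congr_fun TensorProduct.map_id _
  rwa [h2, mul_one] at h1

variable (Q) in
theorem f_mul_g : Q.f * Q.g = 1 := (mul_eq_one_comm_of_finite k).1 (g_mul_f Q)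

variable (Q) in
theorem bijective_phiStar {M N : Type*} [AddCommGroup M] [Module k M] [AddCommGroup N] [Module k N]
    [FiniteDimensional k M] [FiniteDimensional k N] (ρ : H →ₐ[k] Module.End k M)
    (σ : H →ₐ[k] Module.End k N) : Function.Bijective (Q.phiStar ρ σ) := by
  have e : Q.phiStar ρ σ = Module.Dual.transpose (extAct ρ σ Q.f) ∘ₗ nest :=
    LinearMap.ext fun y => LinearMap.ext fun z => Q.phiStar_apply ρ σ y z
  rw [e, LinearMap.coe_comp]
  refine Function.Bijective.comp ?_ nest_bijective
  refine Function.bijective_iff_has_inverse.2 ⟨Module.Dual.transpose (extAct ρ σ Q.g), ?_, ?_⟩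
  · intro ω
    refine LinearMap.ext fun z => ?_
    simp only [Module.Dual.transpose_apply, LinearMap.comp_apply]
    rw [← Module.End.mul_apply, ← map_mul, f_mul_g, map_one, Module.End.one_apply]
  · intro ω
    refine LinearMap.ext fun z => ?_
    simp only [Module.Dual.transpose_apply, LinearMap.comp_apply]
    rw [← Module.End.mul_apply, ← map_mul, g_mul_f, map_one, Module.End.one_apply]

end Rep
end QTQuasiHopfAlgebra

end

/-! ### Matrix coefficients of modules -/

noncomputable section

open CategoryTheory MonoidalCategory ExactPairing
open QuasiHopf QuasiHopfAlgebra BraidedReconstruction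

namespace QuasiHopfAlgebra
variable {k H : Type*} [Field k] [Ring H] [Algebra k H] (Q : QuasiHopfAlgebra k H)
variable {M N P K : Type*} [AddCommGroup M] [Module k M] [AddCommGroup N] [Module k N]
  [AddCommGroup P] [Module k P] [AddCommGroup K] [Module k K]
variable (ρ : H →ₐ[k] Module.End k M) (σ : H →ₐ[k] Module.End k N) (τ : H →ₐ[k] Module.End k P)
  (π : H →ₐ[k] Module.End k K)

/-- The matrix coefficients `φ ⊗ m ↦ (h ↦ φ(h · m))` of a module. -/
def coeff : Module.Dual k M ⊗[k] M →ₗ[k] Module.Dual k H :=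
  TensorProduct.lift (LinearMap.mk₂ k (fun φ m => φ ∘ₗ ρ.toLinearMap.flip m)
    (fun φ ψ m => by ext; simp) (fun c φ m => by ext; simp) (fun φ m n => by ext; simp)
    (fun c φ m => by ext; simp))

@[simp] theorem coeff_tmul (φ : Module.Dual k M) (m : M) (h : H) :
    coeff ρ (φ ⊗ₜ m) h = φ (ρ h m) := rfl

@[simp] theorem sandL_tmul (a b h : H) : Q.sandL (a ⊗ₜ b) h = Q.S a * h * b := by
  simp [sandL, lm, rm, mul_assoc]

@[simp] theorem sandR_tmul (a b h : H) : Q.sandR (a ⊗ₜ b) h = a * h * Q.S b := by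
  simp [sandR, lm, rm, mul_assoc]

theorem sandL_mul (s t : H ⊗[k] H) : Q.sandL (s * t) = Q.sandL t * Q.sandL s := by
  induction s with
  | zero => simp
  | add s₁ s₂ h₁ h₂ => simp [add_mul, mul_add, h₁, h₂]
  | tmul a b =>
    induction t with
    | zero => simp
    | add t₁ t₂ h₁ h₂ => simp [mul_add, add_mul, h₁, h₂]
    | tmul c d => ext h; simp [Q.S_mul, mul_assoc]

theorem Δ₂_leg₂₃ (a : H) : Q.Δ₂ (leg₂ k H) (leg₃ k H) a = 1 ⊗ₜ Q.Δ a := by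
  rw [Δ₂, LinearMap.comp_apply, AlgHom.toLinearMap_apply]
  generalize Q.Δ a = d
  induction d with
  | zero => simp
  | add s t hs ht => simp only [map_add, TensorProduct.tmul_add, hs, ht]
  | tmul a b => simp

theorem coeff_extAct (t : H ⊗[k] H) (y : Module.Dual k M ⊗[k] M) :
    coeff ρ (extAct (Q.dualAct ρ) ρ t y) = Module.Dual.transpose (Q.sandL t) (coeff ρ y) := by
  induction t with
  | zero => simp
  | add s t hs ht => simp only [map_add, LinearMap.add_apply, hs, ht]
  | tmul a b =>
    induction y with
    | zero => simp
    | add s t hs ht => simp only [map_add, hs, ht]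
    | tmul φ m => ext h; simp [Module.Dual.transpose_apply]

/-- The action on `H*` is the one for which matrix coefficients are equivariant. -/
theorem coeff_linear : IsHLinear (Q.tensAct (Q.dualAct ρ) ρ) Q.coadAct (coeff ρ) :=
  fun h y => Q.coeff_extAct ρ (Q.Δ h) y

variable {ρ σ} in
theorem coeff_natural {f : M →ₗ[k] N} (hf : IsHLinear ρ σ f) (φ : Module.Dual k N) (m : M) :
    coeff ρ (Module.Dual.transpose f φ ⊗ₜ m) = coeff σ (φ ⊗ₜ f m) := by
  ext h; simp [Module.Dual.transpose_apply, hf h m]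

variable {ρ} in
/-- The coefficients of a faithful module exhaust `H*`. -/
theorem coeff_surjective [FiniteDimensional k H] (hρ : Function.Injective ρ) :
    Function.Surjective (coeff ρ) := by
  refine (LinearMap.dualMap_injective_iff (V₁ := Module.Dual k M ⊗[k] M)
    (V₂ := Module.Dual k H) (f := coeff ρ)).1 ?_
  rw [injective_iff_map_eq_zero]
  intro Ψ hΨ
  obtain ⟨h, rfl⟩ := (Module.evalEquiv k H).surjective Ψ
  have h0 : ρ h = ρ 0 := by
    refine LinearMap.ext fun m => ?_
    rw [← sub_eq_zero, ← Module.forall_dual_apply_eq_zero_iff k]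
    intro φ
    simpa using LinearMap.congr_fun hΨ (φ ⊗ₜ m)
  rw [hρ h0, map_zero]

/-- Pairs of matrix coefficients as functionals on `H ⊗ H`. -/
def coeff₂ : (Module.Dual k M ⊗[k] M) ⊗[k] (Module.Dual k N ⊗[k] N) →ₗ[k]
    Module.Dual k (H ⊗[k] H) :=
  TensorProduct.dualDistrib k H H ∘ₗ TensorProduct.map (coeff ρ) (coeff σ)

theorem coeff₂_act4 (t : H4 k H) (y : (Module.Dual k M ⊗[k] M) ⊗[k] (Module.Dual k N ⊗[k] N)) :
    coeff₂ ρ σ (act4 (Q.dualAct ρ) ρ (Q.dualAct σ) σ t y) =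
      Module.Dual.transpose (Q.sandL₂ t) (coeff₂ ρ σ y) := by
  induction t using TensorProduct.induction_on with
  | zero => simp
  | add s t hs ht => simp only [map_add, LinearMap.add_apply, hs, ht]
  | tmul s t =>
    induction y with
    | zero => simp
    | add s t hs ht => simp only [map_add, hs, ht]
    | tmul y z =>
      rw [extAct_tmul]
      ext u v
      simp [coeff₂, coeff_extAct, sandL₂, Module.Dual.transpose_apply,
        Module.endTensorEndAlgHom_apply]

/-- The reshuffling `m ⊗ (p ⊗ (n ⊗ q)) ↦ (m ⊗ n) ⊗ (p ⊗ q)`. -/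
def shuffle : M ⊗[k] (P ⊗[k] (N ⊗[k] K)) →ₗ[k] (M ⊗[k] N) ⊗[k] (P ⊗[k] K) :=
  (TensorProduct.assoc k M N (P ⊗[k] K)).symm.toLinearMap ∘ₗ
    TensorProduct.map LinearMap.id ((TensorProduct.assoc k N P K).toLinearMap ∘ₗ
      TensorProduct.map (TensorProduct.comm k P N).toLinearMap LinearMap.id ∘ₗ
        (TensorProduct.assoc k P N K).symm.toLinearMap)

@[simp] theorem shuffle_tmul (m : M) (n : N) (p : P) (q : K) :
    shuffle (k := k) (m ⊗ₜ (p ⊗ₜ (n ⊗ₜ q))) = (m ⊗ₜ n) ⊗ₜ (p ⊗ₜ q) := by simp [shuffle]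

theorem shuffle_braid (y : M ⊗[k] (N ⊗[k] (P ⊗[k] K))) :
    shuffle (TensorProduct.map LinearMap.id ((TensorProduct.assoc k P N K).toLinearMap ∘ₗ
      TensorProduct.map (TensorProduct.comm k N P).toLinearMap LinearMap.id ∘ₗ
        (TensorProduct.assoc k N P K).symm.toLinearMap) y) =
      (TensorProduct.assoc k M N (P ⊗[k] K)).symm y := by
  have : shuffle ∘ₗ TensorProduct.map LinearMap.id ((TensorProduct.assoc k P N K).toLinearMap ∘ₗ
      TensorProduct.map (TensorProduct.comm k N P).toLinearMap LinearMap.id ∘ₗ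
        (TensorProduct.assoc k N P K).symm.toLinearMap) =
      (TensorProduct.assoc k M N (P ⊗[k] K)).symm.toLinearMap := by
    ext; simp
  exact LinearMap.congr_fun this y

theorem act4_leg₂₃ (t : H ⊗[k] H) :
    act4 ρ σ τ π (mulMap (slot₂ k H) (slot₃ k H) t) ∘ₗ shuffle ∘ₗ
        TensorProduct.map LinearMap.id ((TensorProduct.assoc k P N K).toLinearMap ∘ₗ
          TensorProduct.map (TensorProduct.comm k N P).toLinearMap LinearMap.id) =
      shuffle ∘ₗ TensorProduct.map LinearMap.id ((TensorProduct.assoc k P N K).toLinearMap ∘ₗ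
          TensorProduct.map ((TensorProduct.comm k N P).toLinearMap ∘ₗ extAct σ τ t)
            LinearMap.id) := by
  induction t with
  | zero => simp
  | add s t hs ht => simp only [map_add, hs, ht, LinearMap.comp_add, LinearMap.add_comp,
      TensorProduct.map_add_right, TensorProduct.map_add_left]
  | tmul a b => ext; simp

/-- The lemmas `act4_shuffle_left` and `act4_shuffle_right` move the action of `Φ^{±1}` on permuted
legs through the reshuffling of the factors. -/
theorem act4_shuffle_left (t : H ⊗[k] (H ⊗[k] H)) :
    act4 ρ σ τ π (mulMap₃ (slot₃ k H) (slot₂ k H) (slot₄ k H) t) ∘ₗ shuffle =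
      shuffle ∘ₗ TensorProduct.map LinearMap.id (extAct τ (extAct σ π) t) := by
  induction t using TensorProduct.induction_on with
  | zero => simp
  | add s t hs ht => simp only [map_add, hs, ht, LinearMap.comp_add, LinearMap.add_comp,
      TensorProduct.map_add_right]
  | tmul a t =>
    induction t with
    | zero => simp
    | add s t hs ht => simp only [map_add, hs, ht, LinearMap.comp_add, LinearMap.add_comp,
        TensorProduct.map_add_right, TensorProduct.tmul_add]
    | tmul b c => ext; simp

theorem act4_shuffle_right (t : H ⊗[k] (H ⊗[k] H)) :
    act4 ρ σ τ π (mulMap₃ (slot₁ k H) (slot₃ k H) (Q.Δ₂ (slot₂ k H) (slot₄ k H)) t) ∘ₗ shuffle =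
      shuffle ∘ₗ extAct ρ (extAct τ (Q.tensAct σ π)) t := by
  induction t using TensorProduct.induction_on with
  | zero => simp
  | add s t hs ht => simp only [map_add, hs, ht, LinearMap.comp_add, LinearMap.add_comp]
  | tmul a t =>
    induction t with
    | zero => simp
    | add s t hs ht => simp only [map_add, hs, ht, LinearMap.comp_add, LinearMap.add_comp,
        TensorProduct.tmul_add]
    | tmul b c =>
      simp only [mulMap₃_tmul, Δ₂, LinearMap.comp_apply, AlgHom.toLinearMap_apply,
        extAct_tmul_eq_map, tensAct_apply]
      generalize Q.Δ c = d
      induction d with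
      | zero => simp
      | add s t hs ht => simp only [map_add, hs, ht, LinearMap.comp_add, LinearMap.add_comp,
          TensorProduct.map_add_right, mul_add]
      | tmul d e => ext; simp

theorem coeff₂_shuffle (y : Module.Dual k M ⊗[k] Module.Dual k N) (z : M ⊗[k] N) (u : H ⊗[k] H) :
    coeff₂ ρ σ (shuffle (TensorProduct.assoc k _ _ _ (y ⊗ₜ z))) u =
      nest y (TensorProduct.comm k M N (extAct ρ σ u z)) := by
  induction y with
  | zero => simp
  | add s t hs ht => simp only [map_add, TensorProduct.add_tmul, LinearMap.add_apply, hs, ht]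
  | tmul φ ψ =>
    induction z with
    | zero => simp
    | add s t hs ht => simp only [map_add, TensorProduct.tmul_add, LinearMap.add_apply, hs, ht]
    | tmul m n =>
      induction u with
      | zero => simp
      | add s t hs ht => simp only [map_add, LinearMap.add_apply, hs, ht]
      | tmul a b => simp [coeff₂, mul_comm]

end QuasiHopfAlgebra

end

/-! ### Operations of the function algebra on matrix coefficients -/

noncomputable section

open CategoryTheory MonoidalCategory ExactPairing
open QuasiHopf QuasiHopfAlgebra BraidedReconstruction

namespace QTQuasiHopfAlgebra
variable {k H : Type*} [Field k] [Ring H] [Algebra k H] (Q : QTQuasiHopfAlgebra k H)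
variable {M N : Type*} [AddCommGroup M] [Module k M] [AddCommGroup N] [Module k N]
variable (ρ : H →ₐ[k] Module.End k M) (σ : H →ₐ[k] Module.End k N)

/-- Where the twist enters the product: a nested pair of coefficients becomes a coefficient of the
tensor product after applying `φ*`. -/
theorem coeff₂_braiding [FiniteDimensional k M] [FiniteDimensional k N]
    (y : (Module.Dual k M ⊗[k] Module.Dual k N) ⊗[k] (M ⊗[k] N)) (h : H) :
    coeff₂ ρ σ (shuffle (TensorProduct.assoc k _ _ _ y))
      (TensorProduct.comm k H H Q.f * Q.R * Q.Δ h) =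
    coeff (Q.tensAct σ ρ) (TensorProduct.map (Q.phiStar σ ρ) (Q.braiding ρ σ) y) h := by
  induction y with
  | zero => simp
  | add s t hs ht => simp only [map_add, LinearMap.add_apply, hs, ht]
  | tmul y z =>
    rw [coeff₂_shuffle, comm_extAct, comm_mul, comm_mul, TensorProduct.map_tmul, coeff_tmul,
      phiStar_apply, ← braiding_linear, braiding_apply, tensAct_apply, comm_extAct, comm_extAct,
      mul_assoc, map_mul, map_mul]
    have hf : TensorProduct.comm k H H (TensorProduct.comm k H H Q.f) = Q.f :=
      (TensorProduct.comm k H H).symm_apply_apply Q.f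
    rw [hf]
    rfl

variable [FiniteDimensional k H]

/-- The multiplication of `H*` is the product of matrix coefficients: `φ ⊗ m` and `ψ ⊗ n` multiply
to a coefficient of `N ⊗ M` after braiding `M` past `N*` and past `N`. -/
theorem mul_coeff [FiniteDimensional k M] [FiniteDimensional k N]
    (y : (Module.Dual k M ⊗[k] M) ⊗[k] (Module.Dual k N ⊗[k] N)) :
    Q.functionBraidedGroup.mul (TensorProduct.map (coeff ρ) (coeff σ) y) =
      coeff (Q.tensAct σ ρ) (TensorProduct.map (Q.phiStar σ ρ) (Q.braiding ρ σ)
        (Q.assocInv (Q.dualAct ρ) (Q.dualAct σ) (Q.tensAct ρ σ)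
        (TensorProduct.map LinearMap.id (Q.assocHom (Q.dualAct σ) ρ σ)
        (TensorProduct.map LinearMap.id (TensorProduct.map (Q.braiding ρ (Q.dualAct σ))
          LinearMap.id)
        (TensorProduct.map LinearMap.id (Q.assocInv ρ (Q.dualAct σ) σ)
        (Q.assocHom (Q.dualAct ρ) ρ (Q.tensAct (Q.dualAct σ) σ) y)))))) := by
  set y₁ := Q.assocHom (Q.dualAct ρ) ρ (Q.tensAct (Q.dualAct σ) σ) y with h₁
  set y₂ := TensorProduct.map LinearMap.id (Q.assocInv ρ (Q.dualAct σ) σ) y₁ with h₂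
  set y₃ := TensorProduct.map LinearMap.id (TensorProduct.map (Q.braiding ρ (Q.dualAct σ))
          LinearMap.id) y₂ with h₃
  set y₄ := TensorProduct.map LinearMap.id (Q.assocHom (Q.dualAct σ) ρ σ) y₃ with h₄
  set y₅ := Q.assocInv (Q.dualAct ρ) (Q.dualAct σ) (Q.tensAct ρ σ) y₄ with h₅
  have e₁ : act4 (Q.dualAct ρ) ρ (Q.dualAct σ) σ
      (mulMap₃ (slot₁ k H) (slot₂ k H) (Q.Δ₂ (slot₃ k H) (slot₄ k H)) Q.X) y =
      (TensorProduct.assoc k _ _ _).symm y₁ := by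
    have := LinearMap.congr_fun (Q.act4_right (Q.dualAct ρ) ρ (Q.dualAct σ) σ Q.X)
      (TensorProduct.assoc k _ _ _ y)
    rw [h₁, assocHom_apply]
    simpa using this
  have e₂ : act4 (Q.dualAct ρ) ρ (Q.dualAct σ) σ
      (mulMap₃ (slot₂ k H) (slot₃ k H) (slot₄ k H) Q.x) ((TensorProduct.assoc k _ _ _).symm y₁) =
      shuffle (TensorProduct.map LinearMap.id ((TensorProduct.assoc k _ _ _).toLinearMap ∘ₗ
        TensorProduct.map (TensorProduct.comm k _ _).toLinearMap LinearMap.id) y₂) := by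
    have := LinearMap.congr_fun (act4_whiskerLeft (Q.dualAct ρ) ρ (Q.dualAct σ) σ Q.x) y₁
    refine this.trans ?_
    rw [h₂, map_map_apply, LinearMap.comp_apply, LinearEquiv.coe_coe, ← shuffle_braid,
      map_map_apply]
    rfl
  have e₃ : act4 (Q.dualAct ρ) ρ (Q.dualAct σ) σ (mulMap (slot₂ k H) (slot₃ k H) Q.R)
      (shuffle (TensorProduct.map LinearMap.id ((TensorProduct.assoc k _ _ _).toLinearMap ∘ₗ
        TensorProduct.map (TensorProduct.comm k _ _).toLinearMap LinearMap.id) y₂)) =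
      shuffle (TensorProduct.map LinearMap.id (TensorProduct.assoc k _ _ _).toLinearMap y₃) := by
    refine (LinearMap.congr_fun (act4_leg₂₃ (Q.dualAct ρ) ρ (Q.dualAct σ) σ Q.R) y₂).trans ?_
    rw [h₃, map_map_apply]
    rfl
  have e₄ : act4 (Q.dualAct ρ) ρ (Q.dualAct σ) σ
      (mulMap₃ (slot₃ k H) (slot₂ k H) (slot₄ k H) Q.X)
      (shuffle (TensorProduct.map LinearMap.id (TensorProduct.assoc k _ _ _).toLinearMap y₃)) =
      shuffle y₄ := by
    refine (LinearMap.congr_fun (act4_shuffle_left (Q.dualAct ρ) ρ (Q.dualAct σ) σ Q.X)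
      _).trans ?_
    rw [h₄, LinearMap.comp_apply, map_map_apply]
    rfl
  have e₅ : act4 (Q.dualAct ρ) ρ (Q.dualAct σ) σ
      (mulMap₃ (slot₁ k H) (slot₃ k H) (Q.Δ₂ (slot₂ k H) (slot₄ k H)) Q.x) (shuffle y₄) =
      shuffle (TensorProduct.assoc k _ _ _ y₅) := by
    refine (LinearMap.congr_fun (Q.act4_shuffle_right (Q.dualAct ρ) ρ (Q.dualAct σ) σ Q.x)
      _).trans ?_
    rw [h₅, assocInv_apply, LinearEquiv.apply_symm_apply]
    rfl
  refine LinearMap.ext fun h => ?_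
  rw [← coeff₂_braiding, ← e₅, ← e₄, ← e₃, ← e₂, ← e₁, ← Module.End.mul_apply,
    ← Module.End.mul_apply, ← Module.End.mul_apply, ← Module.End.mul_apply, ← map_mul, ← map_mul,
    ← map_mul, ← map_mul, coeff₂_act4]
  rfl

omit [FiniteDimensional k H] in
theorem coeff₂_insert (φ : Module.Dual k M) (v : M) (y : M ⊗[k] Module.Dual k M) (a b : H) :
    coeff₂ ρ ρ ((TensorProduct.assoc k _ _ _).symm (φ ⊗ₜ TensorProduct.assoc k _ _ _ (y ⊗ₜ v)))
      (a ⊗ₜ b) = φ (ρ a (toHom y (ρ b v))) := by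
  induction y with
  | zero => simp
  | add s t hs ht => simp only [TensorProduct.add_tmul, TensorProduct.tmul_add, map_add,
      LinearMap.add_apply, hs, ht]
  | tmul m ψ => simp [coeff₂, mul_comm]

/-- The comultiplication of `H*` inserts a coevaluation into a matrix coefficient. -/
theorem comul_coeff [FiniteDimensional k M] (y : Module.Dual k M ⊗[k] M) :
    Q.functionBraidedGroup.comul (coeff ρ y) = TensorProduct.map (coeff ρ) (coeff ρ)
      (Q.assocInv (Q.dualAct ρ) ρ (Q.tensAct (Q.dualAct ρ) ρ) (TensorProduct.map LinearMap.id
        (Q.assocHom ρ (Q.dualAct ρ) ρ ∘ₗ TensorProduct.mk k _ _ (Q.coev ρ 1)) y)) := by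
  induction y with
  | zero => simp
  | add s t hs ht => simp only [map_add, hs, ht]
  | tmul φ v =>
    apply (TensorProduct.dualDistribEquiv k H H).injective
    refine ((TensorProduct.dualDistribEquiv k H H).apply_symm_apply _).trans ?_
    set w := (TensorProduct.assoc k (Module.Dual k M) M (Module.Dual k M ⊗[k] M)).symm
      (φ ⊗ₜ TensorProduct.assoc k _ _ _ (Q.coev ρ 1 ⊗ₜ v)) with hw
    have e₁ := LinearMap.congr_fun (act4_whiskerLeft (Q.dualAct ρ) ρ (Q.dualAct ρ) ρ Q.X)
      (φ ⊗ₜ TensorProduct.assoc k _ _ _ (Q.coev ρ 1 ⊗ₜ v))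
    have e₂ := LinearMap.congr_fun (Q.act4_right (Q.dualAct ρ) ρ (Q.dualAct ρ) ρ Q.x)
      (φ ⊗ₜ extAct ρ (extAct (Q.dualAct ρ) ρ) Q.X (TensorProduct.assoc k _ _ _ (Q.coev ρ 1 ⊗ₜ v)))
    have e₃ : Q.assocInv (Q.dualAct ρ) ρ (Q.tensAct (Q.dualAct ρ) ρ) (TensorProduct.map
        LinearMap.id (Q.assocHom ρ (Q.dualAct ρ) ρ ∘ₗ TensorProduct.mk k _ _ (Q.coev ρ 1))
          (φ ⊗ₜ v)) =
        act4 (Q.dualAct ρ) ρ (Q.dualAct ρ) ρ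
          (mulMap₃ (slot₁ k H) (slot₂ k H) (Q.Δ₂ (slot₃ k H) (slot₄ k H)) Q.x *
            mulMap₃ (slot₂ k H) (slot₃ k H) (slot₄ k H) Q.X) w := by
      rw [map_mul, Module.End.mul_apply]
      exact e₂.symm.trans (congrArg _ e₁.symm)
    rw [e₃]
    refine Eq.trans ?_ (Q.coeff₂_act4 ρ ρ _ w).symm
    have hβ : coeff₂ ρ ρ w = Module.Dual.transpose (LinearMap.mul' k H ∘ₗ
        TensorProduct.map (LinearMap.mulRight k Q.β) LinearMap.id) (coeff ρ (φ ⊗ₜ v)) := by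
      ext a b
      refine (coeff₂_insert ρ φ v _ a b).trans ?_
      rw [toHom_coev]
      simp [Module.Dual.transpose_apply]
    rw [hβ]
    rfl

omit [FiniteDimensional k H] in
theorem double_dual_coeff (φ : Module.Dual k M) (v : M) (a₁ a₂ a₃ b₁ b₂ c₁ c₂ c₃ h : H)
    (y : Module.Dual k M ⊗[k] Module.Dual k (Module.Dual k M)) :
    coeff (Q.dualAct ρ) (TensorProduct.rid k _ (TensorProduct.map LinearMap.id (Q.ev ρ)
        (extAct (Q.tensAct (Q.dualAct (Q.dualAct ρ)) (Q.dualAct ρ)) (extAct (Q.dualAct ρ) ρ)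
          (c₁ ⊗ₜ (c₂ ⊗ₜ c₃)) (TensorProduct.assoc k _ _ _
          (extAct (Q.tensAct (Q.dualAct (Q.dualAct ρ)) (Q.dualAct ρ)) (Q.dualAct ρ) (b₁ ⊗ₜ b₂)
            (TensorProduct.comm k _ _
            (extAct (Q.dualAct ρ) (extAct (Q.dualAct (Q.dualAct ρ)) (Q.dualAct ρ))
              (a₁ ⊗ₜ (a₂ ⊗ₜ a₃)) (TensorProduct.assoc k _ _ _ (y ⊗ₜ φ)))) ⊗ₜ v))))) h =
        toHom y (Q.dualAct ρ (Q.S a₂ * Q.sandL (Q.Δ c₁ * Q.Δ b₁) h * a₃) φ)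
          (ρ (Q.S (c₂ * b₂ * a₁) * Q.α * c₃) v) := by
  induction y with
  | zero => simp
  | add s t hs ht => simp only [map_add, LinearMap.add_apply, TensorProduct.add_tmul, hs, ht]
  | tmul p Ψ =>
    have e₁ : ∀ z, Q.tensAct (Q.dualAct (Q.dualAct ρ)) (Q.dualAct ρ) c₁
        (Q.tensAct (Q.dualAct (Q.dualAct ρ)) (Q.dualAct ρ) b₁ z) =
        extAct (Q.dualAct (Q.dualAct ρ)) (Q.dualAct ρ) (Q.Δ c₁ * Q.Δ b₁) z := by
      intro z; rw [map_mul]; rfl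
    simp only [TensorProduct.assoc_tmul, extAct_tmul, TensorProduct.comm_tmul,
      TensorProduct.map_tmul, TensorProduct.rid_tmul, LinearMap.id_apply, e₁, map_smul,
      LinearMap.smul_apply, coeff_extAct, toHom_tmul, ev_tmul]
    simp [Module.Dual.transpose_apply, Q.S_mul, mul_comm]

theorem sandL_antipode (a₁ a₂ a₃ b₁ b₂ c₁ c₂ c₃ h : H) :
    mulMap (lm k H) Q.sandL
        (mulMap (Q.Δ₂ (leg₂ k H) (leg₃ k H)) (leg₁ k H) (TensorProduct.map LinearMap.id
            (mulMap (Q.Sinv ∘ₗ LinearMap.mulLeft k Q.α) LinearMap.id ∘ₗ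
              (TensorProduct.comm k H H).toLinearMap) (c₁ ⊗ₜ (c₂ ⊗ₜ c₃))) *
          mulMap (Q.Δ₂ (leg₂ k H) (leg₃ k H)) (leg₁ k H) (b₁ ⊗ₜ b₂) *
          mulMap (leg₂ k H) (leg₃ k H) (TensorProduct.map
            (mulMap LinearMap.id (Q.Sinv ∘ₗ LinearMap.mulRight k Q.β) ∘ₗ
              (TensorProduct.comm k H H).toLinearMap) LinearMap.id
              ((TensorProduct.assoc k H H H).symm (a₁ ⊗ₜ (a₂ ⊗ₜ a₃))))) h =
      Q.Sinv (Q.α * c₃) * c₂ * b₂ * (a₁ * Q.β) * (Q.S a₂ * Q.sandL (Q.Δ c₁ * Q.Δ b₁) h * a₃) := by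
  simp only [TensorProduct.map_tmul, LinearMap.id_apply, LinearMap.comp_apply,
      LinearEquiv.coe_coe, TensorProduct.comm_tmul, mulMap_tmul, TensorProduct.assoc_symm_tmul,
      Δ₂_leg₂₃, leg₁_apply, leg₂_apply, leg₃_apply, Algebra.TensorProduct.tmul_mul_tmul, one_mul,
      mul_one, LinearMap.mulLeft_apply, LinearMap.mulRight_apply,
      ← Algebra.TensorProduct.one_def]
  generalize Q.Δ c₁ * Q.Δ b₁ = d
  rw [sandL_mul, Module.End.mul_apply, Module.End.mul_apply, sandL_tmul, Q.S_mul, Rep.S_Sinv, lm,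
    LinearMap.mul_apply_apply]
  simp only [mul_assoc]

/-- The antipode of `H*` sends a coefficient of `M` to a coefficient of `M*`, through the
coevaluation of `M*` and the inverse braiding. -/
theorem antipode_coeff [FiniteDimensional k M] (φ : Module.Dual k M) (v : M) :
    Q.functionBraidedGroup.antipode (coeff ρ (φ ⊗ₜ v)) = coeff (Q.dualAct ρ)
      (TensorProduct.rid k _ (TensorProduct.map LinearMap.id (Q.ev ρ)
        (Q.assocHom (Q.tensAct (Q.dualAct (Q.dualAct ρ)) (Q.dualAct ρ)) (Q.dualAct ρ) ρ
          (Rep.braidingInv Q (Q.tensAct (Q.dualAct (Q.dualAct ρ)) (Q.dualAct ρ)) (Q.dualAct ρ)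
            (Q.assocHom (Q.dualAct ρ) (Q.dualAct (Q.dualAct ρ)) (Q.dualAct ρ)
              (Q.coev (Q.dualAct ρ) 1 ⊗ₜ φ)) ⊗ₜ v)))) := by
  have key : ∀ (t₁ t₃ : H ⊗[k] (H ⊗[k] H)) (t₂ : H ⊗[k] H) (h : H),
      coeff (Q.dualAct ρ) (TensorProduct.rid k _ (TensorProduct.map LinearMap.id (Q.ev ρ)
        (extAct (Q.tensAct (Q.dualAct (Q.dualAct ρ)) (Q.dualAct ρ)) (extAct (Q.dualAct ρ) ρ) t₃
          (TensorProduct.assoc k _ _ _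
          (extAct (Q.tensAct (Q.dualAct (Q.dualAct ρ)) (Q.dualAct ρ)) (Q.dualAct ρ) t₂
            (TensorProduct.comm k _ _
            (extAct (Q.dualAct ρ) (extAct (Q.dualAct (Q.dualAct ρ)) (Q.dualAct ρ)) t₁
              (TensorProduct.assoc k _ _ _ (Q.coev (Q.dualAct ρ) 1 ⊗ₜ φ)))) ⊗ₜ v))))) h =
      φ (ρ (Q.S (mulMap (lm k H) Q.sandL
        (mulMap (Q.Δ₂ (leg₂ k H) (leg₃ k H)) (leg₁ k H) (TensorProduct.map LinearMap.id
            (mulMap (Q.Sinv ∘ₗ LinearMap.mulLeft k Q.α) LinearMap.id ∘ₗ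
              (TensorProduct.comm k H H).toLinearMap) t₃) *
          mulMap (Q.Δ₂ (leg₂ k H) (leg₃ k H)) (leg₁ k H) t₂ *
          mulMap (leg₂ k H) (leg₃ k H) (TensorProduct.map
            (mulMap LinearMap.id (Q.Sinv ∘ₗ LinearMap.mulRight k Q.β) ∘ₗ
              (TensorProduct.comm k H H).toLinearMap) LinearMap.id
              ((TensorProduct.assoc k H H H).symm t₁))) h)) v) := by
    intro t₁ t₃ t₂ h
    induction t₁ using TensorProduct.induction_on with
    | zero => simp
    | add s t hs ht => simp only [map_add, LinearMap.add_apply, TensorProduct.add_tmul, mul_add,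
        hs, ht]
    | tmul a₁ t₁ =>
    induction t₁ with
    | zero => simp
    | add s t hs ht => simp only [map_add, LinearMap.add_apply, TensorProduct.add_tmul,
        TensorProduct.tmul_add, mul_add, hs, ht]
    | tmul a₂ a₃ =>
    induction t₂ with
    | zero => simp
    | add s t hs ht => simp only [map_add, LinearMap.add_apply, TensorProduct.add_tmul,
        mul_add, add_mul, hs, ht]
    | tmul b₁ b₂ =>
    induction t₃ using TensorProduct.induction_on with
    | zero => simp
    | add s t hs ht => simp only [map_add, LinearMap.add_apply, add_mul, hs, ht]
    | tmul c₁ t₃ =>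
    induction t₃ with
    | zero => simp
    | add s t hs ht => simp only [map_add, LinearMap.add_apply, TensorProduct.tmul_add,
        add_mul, hs, ht]
    | tmul c₂ c₃ =>
    rw [double_dual_coeff, toHom_coev, sandL_antipode]
    generalize Q.S a₂ * Q.sandL (Q.Δ c₁ * Q.Δ b₁) h * a₃ = u
    rw [← Module.End.mul_apply, ← map_mul, dualAct_apply, ← Module.End.mul_apply, ← map_mul]
    simp only [Q.S_mul, Rep.S_Sinv, mul_assoc]
  exact LinearMap.ext fun h => (key Q.X Q.X Q.Rinv h).symm

end QTQuasiHopfAlgebra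

end

/-! ### The natural coaction of the dual of `H` -/

noncomputable section

open CategoryTheory MonoidalCategory ExactPairing
open QuasiHopf QuasiHopfAlgebra BraidedReconstruction

universe r s

namespace QTQuasiHopfAlgebra
variable {k : Type r} {H : Type s} [Field k] [Ring H] [Algebra k H] {Q : QTQuasiHopfAlgebra k H}

/-- Equivariance can be tested after composition with an equivariant surjection. -/
theorem isHLinear_of_surjective {M N P : Type*} [AddCommGroup M] [Module k M] [AddCommGroup N]
    [Module k N] [AddCommGroup P] [Module k P] {ρ : H →ₐ[k] Module.End k M}
    {σ : H →ₐ[k] Module.End k N} {τ : H →ₐ[k] Module.End k P} {f : M →ₗ[k] N} {g : N →ₗ[k] P}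
    (hf : IsHLinear ρ σ f) (hs : Function.Surjective f) (hgf : IsHLinear ρ τ (g ∘ₗ f)) :
    IsHLinear σ τ g := by
  intro h n
  obtain ⟨m, rfl⟩ := hs n
  rw [← hf]
  exact hgf h m

theorem isHLinear_of_injective {M N P : Type*} [AddCommGroup M] [Module k M] [AddCommGroup N]
    [Module k N] [AddCommGroup P] [Module k P] {ρ : H →ₐ[k] Module.End k M}
    {σ : H →ₐ[k] Module.End k N} {τ : H →ₐ[k] Module.End k P} {f : M →ₗ[k] N} {g : N →ₗ[k] P}
    (hg : IsHLinear σ τ g) (hi : Function.Injective g) (hgf : IsHLinear ρ τ (g ∘ₗ f)) :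
    IsHLinear ρ σ f := by
  intro h m
  apply hi
  rw [hg]
  exact hgf h m

namespace Rep

theorem mate_dual_lin {A B : Q.Rep} (f : A ⟶ B) :
    (mate f A.dual B.dual).lin = Module.Dual.transpose f.lin := by
  rw [← transpose_eq Q.toQuasiHopfAlgebra f.linear]
  refine LinearMap.ext fun y => ?_
  rw [mate_lin, evForm_dual]
  rfl

variable [FiniteDimensional k H]

theorem injective_regular : Function.Injective (regular Q).act := by
  rw [injective_iff_map_eq_zero]
  intro h hh
  have h2 := congrArg (down Q) (LinearMap.congr_fun hh ((down Q).symm 1))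
  rw [LinearMap.zero_apply, map_zero] at h2
  refine Eq.trans ?_ h2
  exact (mul_one h).symm

variable (Q) in
/-- The module `H*` underlying the function algebra braided group. -/
def fn : Q.Rep where
  carrier := Module.Dual k H
  act := Q.coadAct

/-- The matrix coefficients as a morphism. -/
def coeffHom (A : Q.Rep) : A.dual ⊗ A ⟶ fn Q := ⟨coeff A.act, Q.coeff_linear A.act⟩

theorem coeffHom_dinatural {A B : Q.Rep} (f : A ⟶ B) :
    mate f A.dual B.dual ▷ A ≫ coeffHom A = B.dual ◁ f ≫ coeffHom B := by
  refine hom_ext (TensorProduct.ext' fun φ m => ?_)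
  refine Eq.trans ?_ (coeff_natural f.linear φ m)
  exact congrArg (fun L => coeff A.act ((L : B.dual →ₗ[k] A.dual) φ ⊗ₜ m)) (mate_dual_lin f)

variable (Q) in
/-- The natural coaction of `H*` on `H`-modules by matrix coefficients. -/
def coaction : NatCoaction (fn Q) := NatCoaction.ofDinatural dual coeffHom coeffHom_dinatural

theorem coaction_ι (A : Q.Rep) : (coaction Q).ι A A.dual = coeffHom A :=
  NatCoaction.ofDinatural_ι dual coeffHom coeffHom_dinatural A

theorem coaction_ι_tensor (A B : Q.Rep) : ((coaction Q).ι (A ⊗ B) (B.dual ⊗ A.dual)).lin =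
    coeff (Q.tensAct A.act B.act) ∘ₗ TensorProduct.map (Q.phiStar A.act B.act) LinearMap.id := by
  have h := (coaction Q).ι_mate (dual (A ⊗ B)) (B.dual ⊗ A.dual) (𝟙 (A ⊗ B))
  rw [coaction_ι, whiskerLeft_id, Category.id_comp] at h
  rw [← h, ← phi_lin]
  rfl

theorem coeffHom_surjective {A : Q.Rep} (h : Function.Injective A.act) :
    Function.Surjective (coeffHom A).lin := coeff_surjective h

/-- The product of coefficients of `A` and `B` as a coefficient of `B ⊗ A`. -/
def mulCoeff (A B : Q.Rep) : (A.dual ⊗ A) ⊗ (B.dual ⊗ B) ⟶ fn Q :=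
  (α_ A.dual A (B.dual ⊗ B)).hom ≫ A.dual ◁ (α_ A B.dual B).inv ≫ A.dual ◁ (β_ A B.dual).hom ▷ B ≫
    A.dual ◁ (α_ B.dual A B).hom ≫ (α_ A.dual B.dual (A ⊗ B)).inv ≫
      (A.dual ⊗ B.dual) ◁ (β_ A B).hom ≫ (coaction Q).ι (B ⊗ A) (A.dual ⊗ B.dual)

theorem mulCoeff_lin (A B : Q.Rep) : (mulCoeff A B).lin =
    Q.functionBraidedGroup.mul ∘ₗ TensorProduct.map (coeff A.act) (coeff B.act) := by
  refine LinearMap.ext fun y => ?_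
  refine Eq.trans ?_ (Q.mul_coeff A.act B.act y).symm
  have e : ∀ z : (Module.Dual k A ⊗[k] Module.Dual k B) ⊗[k] (A ⊗[k] B),
      ((coaction Q).ι (B ⊗ A) (A.dual ⊗ B.dual)).lin
        (TensorProduct.map LinearMap.id (Q.braiding A.act B.act) z) =
      coeff (Q.tensAct B.act A.act) (TensorProduct.map (Q.phiStar B.act A.act)
        (Q.braiding A.act B.act) z) := by
    intro z
    rw [coaction_ι_tensor]
    refine congrArg (coeff (Q.tensAct B.act A.act)) ?_
    refine (map_map_apply _ _ _ _ _).trans ?_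
    rfl
  exact e _

/-- The multiplication of `H*` as a morphism. -/
def mulHom : fn Q ⊗ fn Q ⟶ fn Q where
  lin := Q.functionBraidedGroup.mul
  linear := isHLinear_of_surjective (coeffHom (regular Q) ⊗ₘ coeffHom (regular Q)).linear
    (TensorProduct.map_surjective (coeffHom_surjective injective_regular)
      (coeffHom_surjective injective_regular))
    (fun h y => by
      have h1 := (mulCoeff (regular Q) (regular Q)).linear h y
      rw [mulCoeff_lin] at h1
      exact h1)

theorem ι_mulHom (A B : Q.Rep) : (coaction Q).ι A A.dual ▷ (B.dual ⊗ B) ≫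
    fn Q ◁ (coaction Q).ι B B.dual ≫ mulHom = mulCoeff A B := by
  refine hom_ext (Eq.trans ?_ (mulCoeff_lin A B).symm)
  rw [coaction_ι, coaction_ι]
  exact TensorProduct.ext' fun _ _ => rfl

/-- The comultiplication of coefficients. -/
def comulCoeff (A : Q.Rep) : A.dual ⊗ A ⟶ fn Q ⊗ fn Q :=
  A.dual ◁ ((λ_ A).inv ≫ η_ A A.dual ▷ A ≫ (α_ A A.dual A).hom) ≫
      (α_ A.dual A (A.dual ⊗ A)).inv ≫ (coaction Q).ι A A.dual ▷ (A.dual ⊗ A) ≫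
      fn Q ◁ (coaction Q).ι A A.dual

theorem comulCoeff_lin (A : Q.Rep) :
    (comulCoeff A).lin = Q.functionBraidedGroup.comul ∘ₗ coeff A.act := by
  refine LinearMap.ext fun y => ?_
  refine Eq.trans ?_ (Q.comul_coeff A.act y).symm
  rw [comulCoeff, coaction_ι]
  have e : ((λ_ A).inv ≫ η_ A A.dual ▷ A ≫ (α_ A A.dual A).hom).lin =
      Q.assocHom A.act (Q.dualAct A.act) A.act ∘ₗ TensorProduct.mk k _ _ (Q.coev A.act 1) := rfl
  refine Eq.trans (map_map_apply _ _ _ _ _) ?_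
  exact congrArg (fun L => TensorProduct.map (coeff A.act) (coeff A.act)
    (Q.assocInv (Q.dualAct A.act) A.act (Q.tensAct (Q.dualAct A.act) A.act)
      (TensorProduct.map LinearMap.id L y))) e

/-- The comultiplication of `H*` as a morphism. -/
def comulHom : fn Q ⟶ fn Q ⊗ fn Q where
  lin := Q.functionBraidedGroup.comul
  linear := isHLinear_of_surjective (coeffHom (regular Q)).linear
    (coeffHom_surjective injective_regular)
    (fun h y => by
      have h1 := (comulCoeff (regular Q)).linear h y
      rw [comulCoeff_lin] at h1
      exact h1)

theorem ι_comulHom (A : Q.Rep) : (coaction Q).ι A A.dual ≫ comulHom = comulCoeff A := by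
  refine hom_ext (Eq.trans ?_ (comulCoeff_lin A).symm)
  rw [coaction_ι]
  rfl

theorem counit_coeff (A : Q.Rep) :
    Q.functionBraidedGroup.counit ∘ₗ coeff A.act = Q.ev A.act := by
  refine TensorProduct.ext' fun φ m => ?_
  rw [ev_tmul]
  rfl

/-- The counit of `H*` as a morphism. -/
def counitHom : fn Q ⟶ 𝟙_ Q.Rep where
  lin := (unitEquiv (Q := Q)).symm.toLinearMap ∘ₗ Q.functionBraidedGroup.counit
  linear := isHLinear_of_surjective (coeffHom (regular Q)).linear
    (coeffHom_surjective injective_regular)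
    (fun h y => by
      have h1 := (ε_ (regular Q) (regular Q).dual).linear h y
      rw [evaluation_lin, ← counit_coeff] at h1
      exact h1)

theorem ι_counitHom (A : Q.Rep) : (coaction Q).ι A A.dual ≫ counitHom = ε_ A A.dual := by
  refine hom_ext ?_
  rw [coaction_ι, evaluation_lin, ← counit_coeff]
  rfl

omit [FiniteDimensional k H] in
theorem unit_act_apply (h : H) (c : k) :
    (𝟙_ Q.Rep).act h ((unitEquiv (Q := Q)).symm c) = (unitEquiv (Q := Q)).symm (Q.ε h * c) := by
  apply (unitEquiv (Q := Q)).injective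
  refine (unitEquiv_linear h _).trans ?_
  rw [unitAct_apply, LinearEquiv.apply_symm_apply]
  rw [LinearEquiv.coe_coe, LinearEquiv.apply_symm_apply]

theorem one_coeff (c d : k) : ((coaction Q).ι (𝟙_ Q.Rep) (𝟙_ Q.Rep)).lin
    ((unitEquiv (Q := Q)).symm c ⊗ₜ (unitEquiv (Q := Q)).symm d) =
      (c * d) • Q.ε.toLinearMap := by
  have h := (coaction Q).ι_mate (dual (𝟙_ Q.Rep)) (𝟙_ Q.Rep) (𝟙 (𝟙_ Q.Rep))
  have h2 := mate_eval (dual (𝟙_ Q.Rep)) (𝟙_ Q.Rep) (𝟙 (𝟙_ Q.Rep))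
  rw [whiskerLeft_id, Category.id_comp] at h h2
  rw [← h, coaction_ι]
  generalize mate (𝟙 (𝟙_ Q.Rep)) (dual (𝟙_ Q.Rep)) (𝟙_ Q.Rep) = m at h2
  refine LinearMap.ext fun x => ?_
  have h3 := congrArg (unitEquiv (Q := Q)) (LinearMap.congr_fun (congrArg Hom.lin h2)
    ((unitEquiv (Q := Q)).symm c ⊗ₜ (unitEquiv (Q := Q)).symm (Q.ε x * d)))
  have h4 : (show Module.Dual k (𝟙_ Q.Rep) from m.lin ((unitEquiv (Q := Q)).symm c))
      ((𝟙_ Q.Rep).act Q.α ((unitEquiv (Q := Q)).symm (Q.ε x * d))) = (Q.ε x * d) * c := h3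
  rw [unit_act_apply, Q.counit_α, one_mul, ← unit_act_apply] at h4
  refine h4.trans ?_
  change (Q.ε x * d) * c = (c * d) * Q.ε x
  ring

variable (Q) in
/-- The unit of `H*` as a morphism. -/
def oneHom : 𝟙_ Q.Rep ⟶ fn Q :=
  (λ_ (𝟙_ Q.Rep)).inv ≫ (coaction Q).ι (𝟙_ Q.Rep) (𝟙_ Q.Rep)

theorem oneHom_lin :
    (oneHom Q).lin = Q.functionBraidedGroup.one ∘ₗ (unitEquiv (Q := Q)).toLinearMap := by
  refine LinearMap.ext fun c => ?_
  obtain ⟨c, rfl⟩ := (unitEquiv (Q := Q)).symm.surjective c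
  refine (one_coeff (Q := Q) 1 c).trans ?_
  rw [one_mul]
  rfl

/-- The operations of the function algebra braided group are those of the coefficients of the
natural coaction. -/
theorem coaction_structure : (coaction Q).Structure mulHom (oneHom Q) comulHom counitHom where
  mul A B := (coaction Q).δ_tensor_of_ι_swap A A.dual B B.dual mulHom (ι_mulHom A B)
  one := (coaction Q).δ_unit
  comul A := (coaction Q).δ_comul_of_ι A A.dual (ι_comulHom A)
  counit A := (coaction Q).δ_counit_of_ι A A.dual (ι_counitHom A)

/-- The antipode of coefficients, through the double dual. -/
def antipodeCoeff (A : Q.Rep) : A.dual ⊗ A ⟶ fn Q :=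
  ((λ_ A.dual).inv ≫ η_ A.dual A.dual.dual ▷ A.dual ≫ (α_ A.dual A.dual.dual A.dual).hom ≫
      (β_ (A.dual.dual ⊗ A.dual) A.dual).inv) ▷ A ≫ (α_ (A.dual.dual ⊗ A.dual) A.dual A).hom ≫
      (A.dual.dual ⊗ A.dual) ◁ ε_ A A.dual ≫ (ρ_ (A.dual.dual ⊗ A.dual)).hom ≫
        (coaction Q).ι A.dual A.dual.dual

theorem antipodeCoeff_lin (A : Q.Rep) :
    (antipodeCoeff A).lin = Q.functionBraidedGroup.antipode ∘ₗ coeff A.act := by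
  refine TensorProduct.ext' fun φ v => ?_
  refine Eq.trans ?_ (Q.antipode_coeff A.act φ v).symm
  rw [antipodeCoeff, coaction_ι]
  have e : ((A.dual.dual ⊗ A.dual) ◁ ε_ A A.dual ≫ (ρ_ (A.dual.dual ⊗ A.dual)).hom).lin =
      (TensorProduct.rid k _).toLinearMap ∘ₗ TensorProduct.map LinearMap.id (Q.ev A.act) := by
    exact TensorProduct.ext' fun _ _ => rfl
  exact congrArg (fun L : (A.dual.dual ⊗[k] A.dual) ⊗[k] (A.dual ⊗[k] A) →ₗ[k] _ =>
    coeff (Q.dualAct A.act) (L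
        (Q.assocHom (Q.tensAct (Q.dualAct (Q.dualAct A.act)) (Q.dualAct A.act)) (Q.dualAct A.act)
          A.act (Rep.braidingInv Q (Q.tensAct (Q.dualAct (Q.dualAct A.act)) (Q.dualAct A.act))
            (Q.dualAct A.act) (Q.assocHom (Q.dualAct A.act) (Q.dualAct (Q.dualAct A.act))
              (Q.dualAct A.act) (Q.coev (Q.dualAct A.act) 1 ⊗ₜ φ)) ⊗ₜ v)))) e

/-- The antipode of `H*` as a morphism. -/
def antipodeHom : fn Q ⟶ fn Q where
  lin := Q.functionBraidedGroup.antipode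
  linear := isHLinear_of_surjective (coeffHom (regular Q)).linear
    (coeffHom_surjective injective_regular)
    (fun h y => by
      have h1 := (antipodeCoeff (regular Q)).linear h y
      rw [antipodeCoeff_lin] at h1
      exact h1)

theorem ι_antipodeHom (A : Q.Rep) : (coaction Q).ι A A.dual ≫ antipodeHom =
    (coaction Q).δ A.dual ▷ A ≫ (β_ (fn Q) A.dual).inv ▷ A ≫ (α_ (fn Q) A.dual A).hom ≫
      fn Q ◁ ε_ A A.dual ≫ (ρ_ (fn Q)).hom := by
  refine (coaction Q).antipode_of_double A A.dual A.dual.dual antipodeHom ?_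
  refine hom_ext (Eq.trans ?_ (antipodeCoeff_lin A).symm)
  rw [coaction_ι]
  rfl

omit [FiniteDimensional k H] in
theorem epi_of_surjective {A B : Q.Rep} (f : A ⟶ B) (hf : Function.Surjective f.lin) : Epi f where
  left_cancellation g h e := hom_ext (by
    have e2 : g.lin ∘ₗ f.lin = h.lin ∘ₗ f.lin := congrArg Hom.lin e
    refine LinearMap.ext fun b => ?_
    obtain ⟨a, rfl⟩ := hf b
    exact LinearMap.congr_fun e2 a)

theorem coaction_ι_surjective :
    Function.Surjective ((coaction Q).ι (regular Q) (regular Q).dual).lin := by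
  rw [coaction_ι]
  exact coeffHom_surjective injective_regular

end Rep
end QTQuasiHopfAlgebra

end

/-! ### The function algebra braided group is a braided Hopf algebra -/

noncomputable section

open CategoryTheory MonoidalCategory ExactPairing
open QuasiHopf QuasiHopfAlgebra BraidedReconstruction

universe r s

namespace QTQuasiHopfAlgebra
variable {k : Type r} {H : Type s} [Field k] [Ring H] [Algebra k H] {Q : QTQuasiHopfAlgebra k H}
namespace Rep
variable [FiniteDimensional k H]

variable (Q) in
/-- The coefficients of the regular representation, which exhaust `H*`. -/
abbrev regCoeff : (regular Q).dual ⊗ regular Q ⟶ fn Q :=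
  (coaction Q).ι (regular Q) (regular Q).dual

instance : Epi (regCoeff Q) := epi_of_surjective _ coaction_ι_surjective

theorem surjective_regCoeff₂ : Function.Surjective
    (regCoeff Q ▷ ((regular Q).dual ⊗ regular Q) ≫ fn Q ◁ regCoeff Q).lin := by
  have h1 : Function.Surjective (regCoeff Q ▷ ((regular Q).dual ⊗ regular Q)).lin :=
    TensorProduct.map_surjective coaction_ι_surjective Function.surjective_id
  have h2 : Function.Surjective (fn Q ◁ regCoeff Q).lin :=
    TensorProduct.map_surjective Function.surjective_id coaction_ι_surjective
  exact h2.comp h1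

theorem mul_assoc_hom : mulHom ▷ fn Q ≫ mulHom =
    (α_ (fn Q) (fn Q) (fn Q)).hom ≫ fn Q ◁ mulHom ≫ mulHom := by
  rw [← Iso.inv_comp_eq]
  let P := regular Q
  have h := (coaction_structure (Q := Q)).ι_mul_assoc P P.dual P P.dual P P.dual
  have : Epi (regCoeff Q ▷ ((P.dual ⊗ P) ⊗ (P.dual ⊗ P)) ≫
      fn Q ◁ (regCoeff Q ▷ (P.dual ⊗ P) ≫ fn Q ◁ regCoeff Q)) := by
    apply epi_of_surjective
    have h1 : Function.Surjective (regCoeff Q ▷ ((P.dual ⊗ P) ⊗ (P.dual ⊗ P))).lin :=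
      TensorProduct.map_surjective coaction_ι_surjective Function.surjective_id
    have h2 : Function.Surjective
        (fn Q ◁ (regCoeff Q ▷ (P.dual ⊗ P) ≫ fn Q ◁ regCoeff Q)).lin :=
      TensorProduct.map_surjective Function.surjective_id surjective_regCoeff₂
    exact h2.comp h1
  rw [← cancel_epi (regCoeff Q ▷ ((P.dual ⊗ P) ⊗ (P.dual ⊗ P)) ≫
      fn Q ◁ (regCoeff Q ▷ (P.dual ⊗ P) ≫ fn Q ◁ regCoeff Q))]
  simpa only [whiskerLeft_comp, Category.assoc] using h

theorem comul_mul_hom : mulHom (Q := Q) ≫ comulHom =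
    comulHom ▷ fn Q ≫ (fn Q ⊗ fn Q) ◁ comulHom ≫ (α_ (fn Q) (fn Q) (fn Q ⊗ fn Q)).hom ≫
      fn Q ◁ (α_ (fn Q) (fn Q) (fn Q)).inv ≫ fn Q ◁ (β_ (fn Q) (fn Q)).hom ▷ fn Q ≫
      fn Q ◁ (α_ (fn Q) (fn Q) (fn Q)).hom ≫ (α_ (fn Q) (fn Q) (fn Q ⊗ fn Q)).inv ≫
      mulHom ▷ (fn Q ⊗ fn Q) ≫ fn Q ◁ mulHom := by
  let P := regular Q
  have := epi_of_surjective _ (surjective_regCoeff₂ (Q := Q))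
  rw [← cancel_epi (regCoeff Q ▷ (P.dual ⊗ P) ≫ fn Q ◁ regCoeff Q)]
  simpa using (coaction_structure (Q := Q)).ι_comul_mul P P.dual P P.dual

theorem counit_mul_hom : mulHom (Q := Q) ≫ counitHom =
    counitHom ▷ fn Q ≫ (λ_ (fn Q)).hom ≫ counitHom := by
  let P := regular Q
  have := epi_of_surjective _ (surjective_regCoeff₂ (Q := Q))
  rw [← cancel_epi (regCoeff Q ▷ (P.dual ⊗ P) ≫ fn Q ◁ regCoeff Q)]
  simpa using (coaction_structure (Q := Q)).ι_counit_mul P P.dual P P.dual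

theorem oneHom_lin_one : (oneHom Q).lin ((unitEquiv (Q := Q)).symm 1) =
    Q.functionBraidedGroup.one 1 := by
  rw [oneHom_lin]
  rfl

theorem lid_counitHom (z : fn Q ⊗[k] fn Q) : TensorProduct.lid k (fn Q)
    (TensorProduct.map Q.functionBraidedGroup.counit LinearMap.id z) =
      (counitHom ▷ fn Q ≫ (λ_ (fn Q)).hom).lin z := by
  refine congrArg (TensorProduct.lid k (fn Q)) ?_
  refine Eq.trans ?_ (map_map_apply _ _ _ _ _).symm
  rfl

theorem rid_counitHom (z : fn Q ⊗[k] fn Q) : TensorProduct.rid k (fn Q)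
    (TensorProduct.map LinearMap.id Q.functionBraidedGroup.counit z) =
      (fn Q ◁ counitHom ≫ (ρ_ (fn Q)).hom).lin z := by
  refine congrArg (TensorProduct.rid k (fn Q)) ?_
  refine Eq.trans ?_ (map_map_apply _ _ _ _ _).symm
  rfl

theorem isBraidedHopf_functionBraidedGroup : Q.IsBraidedHopf Q.functionBraidedGroup where
  mul_linear := (mulHom (Q := Q)).linear
  one_linear := isHLinear_of_surjective unitEquiv_linear (unitEquiv (Q := Q)).surjective
    (oneHom_lin (Q := Q) ▸ (oneHom Q).linear)
  comul_linear := (comulHom (Q := Q)).linear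
  counit_linear := isHLinear_of_injective (isHLinear_of_inverse unitEquiv_linear
    unitEquiv.apply_symm_apply unitEquiv.symm_apply_apply) (unitEquiv (Q := Q)).symm.injective
    (counitHom (Q := Q)).linear
  antipode_linear := (antipodeHom (Q := Q)).linear
  mul_assoc := congrArg Hom.lin (mul_assoc_hom (Q := Q))
  one_mul b := by
    have h := (cancel_epi (regCoeff Q)).1 (((coaction_structure (Q := Q)).ι_one_mul (regular Q)
      (regular Q).dual).trans (Category.comp_id _).symm)
    have h2 := LinearMap.congr_fun (congrArg Hom.lin h) b
    rw [← oneHom_lin_one]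
    exact h2
  mul_one b := by
    have h := (cancel_epi (regCoeff Q)).1 (((coaction_structure (Q := Q)).ι_mul_one (regular Q)
      (regular Q).dual).trans (Category.comp_id _).symm)
    have h2 := LinearMap.congr_fun (congrArg Hom.lin h) b
    rw [← oneHom_lin_one]
    exact h2
  comul_coassoc := by
    have h := (cancel_epi (regCoeff Q)).1 ((coaction_structure (Q := Q)).ι_comul_coassoc
      (regular Q) (regular Q).dual)
    exact congrArg Hom.lin h
  counit_comul b := by
    have h := (cancel_epi (regCoeff Q)).1 (((coaction_structure (Q := Q)).ι_counit_comul
      (regular Q) (regular Q).dual).trans (Category.comp_id _).symm)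
    apply (TensorProduct.lid k (Module.Dual k H)).injective
    refine ((lid_counitHom (Q := Q) _).trans (LinearMap.congr_fun (congrArg Hom.lin h) b)).trans ?_
    exact (one_smul k b).symm
  comul_counit b := by
    have h := (cancel_epi (regCoeff Q)).1 (((coaction_structure (Q := Q)).ι_comul_counit
      (regular Q) (regular Q).dual).trans (Category.comp_id _).symm)
    apply (TensorProduct.rid k (Module.Dual k H)).injective
    refine ((rid_counitHom (Q := Q) _).trans (LinearMap.congr_fun (congrArg Hom.lin h) b)).trans ?_
    exact (one_smul k b).symm
  comul_mul := by
    have h := comul_mul_hom (Q := Q)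
    rw [← MonoidalCategory.tensorHom_def, ← MonoidalCategory.tensorHom_def_assoc] at h
    exact congrArg Hom.lin h
  comul_one := by
    have h2 := LinearMap.congr_fun (congrArg Hom.lin (coaction_structure (Q := Q)).comul_one)
      ((unitEquiv (Q := Q)).symm 1)
    rw [← oneHom_lin_one]
    exact h2
  counit_mul b c := by
    have h2 := LinearMap.congr_fun (congrArg Hom.lin (counit_mul_hom (Q := Q))) (b ⊗ₜ c)
    refine (congrArg (unitEquiv (Q := Q)) h2).trans ?_
    exact Q.functionBraidedGroup.counit.map_smul (Q.functionBraidedGroup.counit b) c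
  counit_one := by
    have h2 := LinearMap.congr_fun (congrArg Hom.lin (coaction_structure (Q := Q)).counit_one)
      ((unitEquiv (Q := Q)).symm 1)
    rw [← oneHom_lin_one]
    exact congrArg (unitEquiv (Q := Q)) h2
  antipode_left := by
    have h := (cancel_epi (regCoeff Q)).1 ((coaction_structure (Q := Q)).ι_antipode_left
      (regular Q) (regular Q).dual antipodeHom (ι_antipodeHom (regular Q)))
    refine (congrArg Hom.lin h).trans ?_
    rw [comp_lin, oneHom_lin]
    rfl
  antipode_right := by
    have h := (cancel_epi (regCoeff Q)).1 ((coaction_structure (Q := Q)).ι_antipode_right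
      (regular Q) (regular Q).dual antipodeHom (ι_antipodeHom (regular Q)))
    refine (congrArg Hom.lin h).trans ?_
    rw [comp_lin, oneHom_lin]
    rfl

end Rep
end QTQuasiHopfAlgebra

end

/-! ### Elements of the enveloping algebra as internal endomorphisms -/

noncomputable section

open CategoryTheory MonoidalCategory ExactPairing
open QuasiHopf QuasiHopfAlgebra BraidedReconstruction

namespace QuasiHopfAlgebra
variable {k H : Type*} [Field k] [Ring H] [Algebra k H] (Q : QuasiHopfAlgebra k H)
variable {M N : Type*} [AddCommGroup M] [Module k M] [AddCommGroup N] [Module k N]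
  [FiniteDimensional k M] [FiniteDimensional k N]
variable (ρ : H →ₐ[k] Module.End k M) (σ : H →ₐ[k] Module.End k N)

/-- The element `∑ᵢ h · mᵢ ⊗ mⁱ` of `M ⊗ M*` that represents the action of `h` on `M`. -/
def actElt : H →ₗ[k] M ⊗[k] Module.Dual k M where
  toFun h := TensorProduct.map (ρ h) LinearMap.id (coevaluation k M 1)
  map_add' a b := by rw [map_add, TensorProduct.map_add_left, LinearMap.add_apply]
  map_smul' c a := by rw [map_smul, TensorProduct.map_smul_left]; rfl

@[simp] theorem toHom_actElt (h : H) : toHom (actElt ρ h) = ρ h := by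
  refine (toHom_map_left _ _).trans ?_
  rw [toHom_coevaluation, LinearMap.comp_id]

variable {ρ} in
theorem actElt_injective (hρ : Function.Injective ρ) : Function.Injective (actElt ρ) := by
  intro a b h
  apply hρ
  rw [← toHom_actElt, h, toHom_actElt]

theorem actElt_sandR (t : H ⊗[k] H) (h : H) :
    actElt ρ (Q.sandR t h) = extAct ρ (Q.dualAct ρ) t (actElt ρ h) := by
  apply toHom_injective
  rw [toHom_actElt]
  induction t with
  | zero => simp
  | add s t hs ht => simp only [map_add, LinearMap.add_apply, hs, ht]
  | tmul a b =>
    rw [extAct_tmul_eq_map, dualAct_eq, toHom_map, toHom_actElt, sandR_tmul, map_mul, map_mul]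
    rfl

theorem actElt_linear : IsHLinear Q.adAct (Q.tensAct ρ (Q.dualAct ρ)) (actElt ρ) :=
  fun h x => Q.actElt_sandR ρ (Q.Δ h) x

theorem actElt_sandR₂ (t : H4 k H) (u : H ⊗[k] H) :
    TensorProduct.map (actElt ρ) (actElt σ) (Q.sandR₂ t u) =
      act4 ρ (Q.dualAct ρ) σ (Q.dualAct σ) t (TensorProduct.map (actElt ρ) (actElt σ) u) := by
  induction t using TensorProduct.induction_on with
  | zero => simp
  | add s t hs ht => simp only [map_add, LinearMap.add_apply, hs, ht]
  | tmul s t =>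
    induction u with
    | zero => simp
    | add s t hs ht => simp only [map_add, hs, ht]
    | tmul a b =>
      simp [sandR₂, Module.endTensorEndAlgHom_apply, actElt_sandR]

omit [FiniteDimensional k M] in
theorem toHom_contract (y z : M ⊗[k] Module.Dual k M) :
    toHom (TensorProduct.map LinearMap.id (TensorProduct.lid k (Module.Dual k M)).toLinearMap
      (TensorProduct.map LinearMap.id (TensorProduct.map (Q.ev ρ) LinearMap.id)
        (TensorProduct.map LinearMap.id (TensorProduct.assoc k _ _ _).symm.toLinearMap
          (TensorProduct.assoc k _ _ _ (y ⊗ₜ z))))) = toHom y ∘ₗ ρ Q.α ∘ₗ toHom z := by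
  induction y with
  | zero => simp
  | add s t hs ht => simp only [TensorProduct.add_tmul, map_add, hs, ht, LinearMap.add_comp]
  | tmul m φ =>
    induction z with
    | zero => simp
    | add s t hs ht => simp only [TensorProduct.tmul_add, map_add, hs, ht, LinearMap.comp_add]
    | tmul n ψ => ext v; simp [smul_smul, mul_comm]

/-- The four tensor factors of `(M ⊗ N) ⊗ (N* ⊗ M*)` regrouped as `(M ⊗ M*) ⊗ (N ⊗ N*)`. -/
def regroup {M N N' M' : Type*} [AddCommGroup M] [Module k M] [AddCommGroup N] [Module k N]
    [AddCommGroup M'] [Module k M'] [AddCommGroup N'] [Module k N'] :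
    M ⊗[k] (N ⊗[k] (N' ⊗[k] M')) →ₗ[k] (M ⊗[k] M') ⊗[k] (N ⊗[k] N') :=
  (TensorProduct.assoc k M M' (N ⊗[k] N')).symm.toLinearMap ∘ₗ
    TensorProduct.map LinearMap.id ((TensorProduct.comm k (N ⊗[k] N') M').toLinearMap ∘ₗ
      (TensorProduct.assoc k N N' M').symm.toLinearMap)

theorem regroup_surjective {M N N' M' : Type*} [AddCommGroup M] [Module k M] [AddCommGroup N]
    [Module k N] [AddCommGroup M'] [Module k M'] [AddCommGroup N'] [Module k N'] :
    Function.Surjective (regroup (k := k) (M := M) (N := N) (N' := N') (M' := M')) := by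
  have h : Function.Surjective (TensorProduct.map (LinearMap.id : M →ₗ[k] M)
      ((TensorProduct.comm k (N ⊗[k] N') M').toLinearMap ∘ₗ
        (TensorProduct.assoc k N N' M').symm.toLinearMap)) :=
    TensorProduct.map_surjective Function.surjective_id
      ((TensorProduct.comm k (N ⊗[k] N') M').surjective.comp
        (TensorProduct.assoc k N N' M').symm.surjective)
  exact (TensorProduct.assoc k M M' (N ⊗[k] N')).symm.surjective.comp h

@[simp] theorem regroup_tmul {M N N' M' : Type*} [AddCommGroup M] [Module k M] [AddCommGroup N]
    [Module k N] [AddCommGroup M'] [Module k M'] [AddCommGroup N'] [Module k N']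
    (m : M) (n : N) (n' : N') (m' : M') :
    regroup (k := k) (m ⊗ₜ (n ⊗ₜ (n' ⊗ₜ m'))) = (m ⊗ₜ m') ⊗ₜ (n ⊗ₜ n') := by simp [regroup]

omit [FiniteDimensional k M] [FiniteDimensional k N] in
/-- The endomorphism of `M ⊗ N` represented by a nested tensor is the tensor product of the
endomorphisms represented by the regrouped tensor. -/
theorem toHom_regroup (z : (M ⊗[k] N) ⊗[k] (Module.Dual k N ⊗[k] Module.Dual k M)) :
    toHom (TensorProduct.map LinearMap.id nest z) =
      Module.endTensorEndAlgHom (R := k) (S := k) (A := k) (M := M) (N := N)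
        (TensorProduct.map toHom toHom (regroup (TensorProduct.assoc k _ _ _ z))) := by
  have : ∀ (m : M) (n : N) (φ : Module.Dual k N) (ψ : Module.Dual k M),
      toHom (TensorProduct.map LinearMap.id nest ((m ⊗ₜ[k] n) ⊗ₜ[k] (φ ⊗ₜ[k] ψ))) =
      Module.endTensorEndAlgHom (R := k) (S := k) (A := k) (M := M) (N := N)
        (TensorProduct.map toHom toHom (regroup (TensorProduct.assoc k _ _ _
          ((m ⊗ₜ[k] n) ⊗ₜ[k] (φ ⊗ₜ[k] ψ))))) := by
    intro m n φ ψ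
    refine TensorProduct.ext' fun a b => ?_
    simp [Module.endTensorEndAlgHom_apply, TensorProduct.smul_tmul', TensorProduct.tmul_smul,
      smul_smul, mul_comm]
  induction z using TensorProduct.induction_on with
  | zero => simp
  | add s t hs ht => simp only [map_add, hs, ht]
  | tmul y w =>
    induction y with
    | zero => simp
    | add s t hs ht => simp only [TensorProduct.add_tmul, map_add, hs, ht]
    | tmul m n =>
      induction w with
      | zero => simp
      | add s t hs ht => simp only [TensorProduct.tmul_add, map_add, hs, ht]
      | tmul φ ψ => exact this m n φ ψ

/-- The comultiplication of `H` under `actElt`: the element of `Δ(h) t` on `M ⊗ N`, regrouped. -/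
theorem map_actElt_regroup (t : H ⊗[k] H) (h : H)
    (z : (M ⊗[k] N) ⊗[k] (Module.Dual k N ⊗[k] Module.Dual k M))
    (hz : TensorProduct.map LinearMap.id nest z = TensorProduct.map LinearMap.id
      (Module.Dual.transpose (extAct ρ σ t)) (actElt (Q.tensAct ρ σ) h)) :
    TensorProduct.map (actElt ρ) (actElt σ) (Q.Δ h * t) =
      regroup (TensorProduct.assoc k _ _ _ z) := by
  obtain ⟨w, hw⟩ := regroup_surjective (TensorProduct.map (actElt ρ) (actElt σ) (Q.Δ h * t))
  obtain ⟨z', rfl⟩ := (TensorProduct.assoc k _ _ _).surjective w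
  suffices h1 : z' = z by rw [← hw, h1]
  have hinj : Function.Injective (TensorProduct.map (LinearMap.id : M ⊗[k] N →ₗ[k] M ⊗[k] N)
      (nest : Module.Dual k N ⊗[k] Module.Dual k M →ₗ[k] Module.Dual k (M ⊗[k] N))) :=
    Module.Flat.lTensor_preserves_injective_linearMap _ nest_bijective.1
  apply hinj
  apply toHom_injective
  rw [hz, toHom_map, toHom_actElt, toHom_regroup, hw, map_map_apply]
  have e : ∀ u : H ⊗[k] H, Module.endTensorEndAlgHom (R := k) (S := k) (A := k) (M := M) (N := N)
      (TensorProduct.map (toHom ∘ₗ actElt ρ) (toHom ∘ₗ actElt σ) u) = extAct ρ σ u := by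
    intro u
    induction u with
    | zero => simp
    | add s t hs ht => simp only [map_add, hs, ht]
    | tmul a b => simp [extAct]
  rw [e, map_mul]
  rfl

variable {N' M' : Type*} [AddCommGroup M'] [Module k M'] [AddCommGroup N'] [Module k N']
  (ρ' : H →ₐ[k] Module.End k M') (σ' : H →ₐ[k] Module.End k N')

omit [FiniteDimensional k M] [FiniteDimensional k N] in
theorem act4_regroup (t : H ⊗[k] (H ⊗[k] H)) :
    act4 ρ ρ' σ σ' (mulMap₃ (slot₁ k H) (slot₃ k H) (Q.Δ₂ (slot₄ k H) (slot₂ k H)) t) ∘ₗ regroup =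
      regroup ∘ₗ extAct ρ (extAct σ (Q.tensAct σ' ρ')) t := by
  induction t using TensorProduct.induction_on with
  | zero => simp
  | add s t hs ht => simp only [map_add, hs, ht, LinearMap.comp_add, LinearMap.add_comp]
  | tmul a t =>
    induction t with
    | zero => simp
    | add s t hs ht => simp only [map_add, hs, ht, LinearMap.comp_add, LinearMap.add_comp,
        TensorProduct.tmul_add]
    | tmul b c =>
      simp only [mulMap₃_tmul, Δ₂, LinearMap.comp_apply, AlgHom.toLinearMap_apply,
        extAct_tmul_eq_map, tensAct_apply]
      generalize Q.Δ c = d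
      induction d with
      | zero => simp
      | add s t hs ht => simp only [map_add, hs, ht, LinearMap.comp_add, LinearMap.add_comp,
          TensorProduct.map_add_right, mul_add]
      | tmul d e => ext; simp

omit [FiniteDimensional k M] [FiniteDimensional k N] in
theorem act4_regroup_whiskerLeft (t : H ⊗[k] (H ⊗[k] H)) :
    act4 ρ ρ' σ σ' (mulMap₃ (slot₃ k H) (slot₄ k H) (slot₂ k H) t) ∘ₗ regroup =
      regroup ∘ₗ TensorProduct.map LinearMap.id (extAct σ (extAct σ' ρ') t) := by
  induction t using TensorProduct.induction_on with
  | zero => simp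
  | add s t hs ht => simp only [map_add, hs, ht, LinearMap.comp_add, LinearMap.add_comp,
      TensorProduct.map_add_right]
  | tmul a t =>
    induction t with
    | zero => simp
    | add s t hs ht => simp only [map_add, hs, ht, LinearMap.comp_add, LinearMap.add_comp,
        TensorProduct.map_add_right, TensorProduct.tmul_add]
    | tmul b c => ext; simp

omit [FiniteDimensional k M] [FiniteDimensional k N] in
theorem act4_regroup_braid (t : H ⊗[k] H) :
    act4 ρ ρ' σ σ' (mulMap (Q.Δ₂ (slot₃ k H) (slot₄ k H)) (slot₂ k H) t) ∘ₗ
        (TensorProduct.assoc k M M' (N ⊗[k] N')).symm.toLinearMap ∘ₗ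
          TensorProduct.map LinearMap.id (TensorProduct.comm k (N ⊗[k] N') M').toLinearMap =
      (TensorProduct.assoc k M M' (N ⊗[k] N')).symm.toLinearMap ∘ₗ
        TensorProduct.map LinearMap.id ((TensorProduct.comm k (N ⊗[k] N') M').toLinearMap ∘ₗ
          extAct (Q.tensAct σ σ') ρ' t) := by
  induction t with
  | zero => simp
  | add s t hs ht => simp only [map_add, hs, ht, LinearMap.comp_add, LinearMap.add_comp,
      TensorProduct.map_add_right]
  | tmul a b =>
      simp only [mulMap_tmul, Δ₂, LinearMap.comp_apply, AlgHom.toLinearMap_apply,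
        extAct_tmul_eq_map, tensAct_apply]
      generalize Q.Δ a = d
      induction d with
      | zero => simp
      | add s t hs ht => simp only [map_add, hs, ht, LinearMap.comp_add, LinearMap.add_comp,
          TensorProduct.map_add_right, TensorProduct.map_add_left, add_mul]
      | tmul d e => ext; simp

end QuasiHopfAlgebra

namespace QTQuasiHopfAlgebra
variable {k H : Type*} [Field k] [Ring H] [Algebra k H] (Q : QTQuasiHopfAlgebra k H)
variable {M N : Type*} [AddCommGroup M] [Module k M] [AddCommGroup N] [Module k N]
  [FiniteDimensional k M] [FiniteDimensional k N]
variable (ρ : H →ₐ[k] Module.End k M) (σ : H →ₐ[k] Module.End k N)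

/-- The multiplication of the enveloping algebra braided group is the composition
`(M ⊗ M*) ⊗ (M ⊗ M*) → M ⊗ M*` of internal endomorphisms. -/
theorem actElt_mul (y : H ⊗[k] H) : actElt ρ (Q.envelopingBraidedGroup.mul y) =
    TensorProduct.map LinearMap.id ((TensorProduct.lid k (Module.Dual k M)).toLinearMap ∘ₗ
        TensorProduct.map (Q.ev ρ) LinearMap.id)
      (TensorProduct.map LinearMap.id (Q.assocInv (Q.dualAct ρ) ρ (Q.dualAct ρ))
        (Q.assocHom ρ (Q.dualAct ρ) (Q.tensAct ρ (Q.dualAct ρ))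
          (TensorProduct.map (actElt ρ) (actElt ρ) y))) := by
  set p := TensorProduct.map (actElt ρ) (actElt ρ) y with hp
  set y₁ := Q.assocHom ρ (Q.dualAct ρ) (Q.tensAct ρ (Q.dualAct ρ)) p with h₁
  have e₁ : act4 ρ (Q.dualAct ρ) ρ (Q.dualAct ρ)
      (mulMap₃ (slot₁ k H) (slot₂ k H) (Q.Δ₂ (slot₃ k H) (slot₄ k H)) Q.X) p =
      (TensorProduct.assoc k _ _ _).symm y₁ := by
    have := LinearMap.congr_fun (Q.act4_right ρ (Q.dualAct ρ) ρ (Q.dualAct ρ) Q.X)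
      (TensorProduct.assoc k _ _ _ p)
    rw [h₁, assocHom_apply]
    simpa using this
  have e₂ : act4 ρ (Q.dualAct ρ) ρ (Q.dualAct ρ)
      (mulMap₃ (slot₂ k H) (slot₃ k H) (slot₄ k H) Q.x) ((TensorProduct.assoc k _ _ _).symm y₁) =
      (TensorProduct.assoc k _ _ _).symm (TensorProduct.map LinearMap.id
        (extAct (Q.dualAct ρ) (extAct ρ (Q.dualAct ρ)) Q.x) y₁) :=
    LinearMap.congr_fun (act4_whiskerLeft ρ (Q.dualAct ρ) ρ (Q.dualAct ρ) Q.x) y₁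
  have e₃ : ∀ u : H ⊗[k] H, actElt ρ (LinearMap.mul' k H
      (TensorProduct.map (LinearMap.mulRight k Q.α) LinearMap.id u)) =
      TensorProduct.map LinearMap.id (TensorProduct.lid k (Module.Dual k M)).toLinearMap
        (TensorProduct.map LinearMap.id (TensorProduct.map (Q.ev ρ) LinearMap.id)
          (TensorProduct.map LinearMap.id (TensorProduct.assoc k _ _ _).symm.toLinearMap
            (TensorProduct.assoc k _ _ _ (TensorProduct.map (actElt ρ) (actElt ρ) u)))) := by
    intro u
    induction u with
    | zero => simp
    | add s t hs ht => simp only [map_add, hs, ht]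
    | tmul a b =>
      apply toHom_injective
      rw [TensorProduct.map_tmul (actElt ρ) (actElt ρ), toHom_contract, toHom_actElt, toHom_actElt,
        toHom_actElt]
      simp only [TensorProduct.map_tmul, LinearMap.mul'_apply, LinearMap.mulRight_apply,
        LinearMap.id_apply, map_mul, mul_assoc]
      rfl
  refine (e₃ _).trans ?_
  rw [actElt_sandR₂, map_mul, Module.End.mul_apply, ← hp, e₁, e₂, LinearEquiv.apply_symm_apply]
  simp only [map_map_apply, LinearMap.id_comp]
  rfl

/-- The comultiplication of the enveloping algebra braided group is the categorical map from the
internal endomorphisms of `M ⊗ N` to those of `M` and `N`. The tensor `z` is the element of `h` on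
`M ⊗ N`, with `(M ⊗ N)*` replaced by `N* ⊗ M*` through the inverse twist. -/
theorem map_actElt_comul (h : H)
    (z : (M ⊗[k] N) ⊗[k] (Module.Dual k N ⊗[k] Module.Dual k M))
    (hz : TensorProduct.map LinearMap.id nest z = TensorProduct.map LinearMap.id
      (Module.Dual.transpose (extAct ρ σ Q.g)) (actElt (Q.tensAct ρ σ) h)) :
    TensorProduct.map (actElt ρ) (actElt σ) (Q.envelopingBraidedGroup.comul h) =
      Q.assocInv ρ (Q.dualAct ρ) (Q.tensAct σ (Q.dualAct σ))
        (TensorProduct.map LinearMap.id (Q.braiding (Q.tensAct σ (Q.dualAct σ)) (Q.dualAct ρ))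
          (TensorProduct.map LinearMap.id (Q.assocInv σ (Q.dualAct σ) (Q.dualAct ρ))
            (Q.assocHom ρ σ (Q.tensAct (Q.dualAct σ) (Q.dualAct ρ)) z))) := by
  set y₁ := Q.assocHom ρ σ (Q.tensAct (Q.dualAct σ) (Q.dualAct ρ)) z with h₁
  set y₂ := TensorProduct.map LinearMap.id (Q.assocInv σ (Q.dualAct σ) (Q.dualAct ρ)) y₁ with h₂
  set y₃ := TensorProduct.map LinearMap.id
    (Q.braiding (Q.tensAct σ (Q.dualAct σ)) (Q.dualAct ρ)) y₂ with h₃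
  have e₁ := LinearMap.congr_fun (Q.act4_regroup ρ σ (Q.dualAct ρ) (Q.dualAct σ) Q.X)
    (TensorProduct.assoc k _ _ _ z)
  have e₂ : act4 ρ (Q.dualAct ρ) σ (Q.dualAct σ)
      (mulMap₃ (slot₃ k H) (slot₄ k H) (slot₂ k H) Q.x) (regroup y₁) =
      (TensorProduct.assoc k M (Module.Dual k M) (N ⊗[k] Module.Dual k N)).symm
        (TensorProduct.map LinearMap.id (TensorProduct.comm k _ _).toLinearMap y₂) := by
    refine (LinearMap.congr_fun (act4_regroup_whiskerLeft ρ σ (Q.dualAct ρ) (Q.dualAct σ) Q.x)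
      y₁).trans ?_
    rw [h₂, map_map_apply, LinearMap.comp_apply, regroup, LinearMap.comp_apply, map_map_apply]
    rfl
  have e₃ : act4 ρ (Q.dualAct ρ) σ (Q.dualAct σ)
      (mulMap (Q.Δ₂ (slot₃ k H) (slot₄ k H)) (slot₂ k H) Q.R)
        ((TensorProduct.assoc k M (Module.Dual k M) (N ⊗[k] Module.Dual k N)).symm
        (TensorProduct.map LinearMap.id (TensorProduct.comm k _ _).toLinearMap y₂)) =
      (TensorProduct.assoc k _ _ _).symm y₃ :=
    LinearMap.congr_fun (Q.act4_regroup_braid ρ σ (Q.dualAct ρ) (Q.dualAct σ) Q.R) y₂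
  have e₄ := LinearMap.congr_fun (Q.act4_right ρ (Q.dualAct ρ) σ (Q.dualAct σ) Q.x) y₃
  refine (Q.actElt_sandR₂ ρ σ _ (Q.Δ h * Q.g)).trans ?_
  rw [Q.map_actElt_regroup ρ σ Q.g h z hz, map_mul, map_mul, map_mul, Module.End.mul_apply,
    Module.End.mul_apply, Module.End.mul_apply]
  refine (congrArg (fun t => act4 ρ (Q.dualAct ρ) σ (Q.dualAct σ) _ (act4 ρ (Q.dualAct ρ) σ
    (Q.dualAct σ) _ (act4 ρ (Q.dualAct ρ) σ (Q.dualAct σ) _ t))) e₁).trans ?_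
  refine (congrArg (fun t => act4 ρ (Q.dualAct ρ) σ (Q.dualAct σ) _ (act4 ρ (Q.dualAct ρ) σ
    (Q.dualAct σ) _ t)) e₂).trans ?_
  refine (congrArg (fun t => act4 ρ (Q.dualAct ρ) σ (Q.dualAct σ) _ t) e₃).trans ?_
  exact e₄

end QTQuasiHopfAlgebra

end

/-! ### The antipode of the enveloping algebra braided group -/

noncomputable section

open CategoryTheory MonoidalCategory ExactPairing
open QuasiHopf QuasiHopfAlgebra BraidedReconstruction

namespace QTQuasiHopfAlgebra
variable {k H : Type*} [Field k] [Ring H] [Algebra k H] (Q : QTQuasiHopfAlgebra k H)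
variable {M : Type*} [AddCommGroup M] [Module k M]
variable (ρ : H →ₐ[k] Module.End k M)

/-- Evaluating the element of `h` in `M ⊗ M*` against `M` through the associator is the action of
`q¹ h S(q²)`. -/
theorem sandR_qR [FiniteDimensional k H] [FiniteDimensional k M] (h : H) (χ : M) :
    TensorProduct.rid k M (TensorProduct.map LinearMap.id (Q.ev ρ)
      (Q.assocHom ρ (Q.dualAct ρ) ρ (actElt ρ h ⊗ₜ χ))) = ρ (Q.sandR Q.qR h) χ := by
  have key : ∀ (t : H ⊗[k] (H ⊗[k] H)) (y : M ⊗[k] Module.Dual k M) (u : H), toHom y = ρ u →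
      TensorProduct.rid k M (TensorProduct.map LinearMap.id (Q.ev ρ)
        (extAct ρ (extAct (Q.dualAct ρ) ρ) t (TensorProduct.assoc k _ _ _ (y ⊗ₜ χ)))) =
      ρ (Q.sandR (TensorProduct.map LinearMap.id
        (mulMap (Q.Sinv ∘ₗ LinearMap.mulLeft k Q.α) LinearMap.id ∘ₗ
          (TensorProduct.comm k H H).toLinearMap) t) u) χ := by
    intro t y u hu
    induction t using TensorProduct.induction_on with
    | zero => simp
    | add s t hs ht => simp only [map_add, LinearMap.add_apply, hs, ht]
    | tmul a t =>
    induction t with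
    | zero => simp
    | add s t hs ht => simp only [map_add, LinearMap.add_apply, TensorProduct.tmul_add, hs, ht]
    | tmul b c =>
    have e : ∀ y : M ⊗[k] Module.Dual k M,
        TensorProduct.rid k M (TensorProduct.map LinearMap.id (Q.ev ρ)
        (extAct ρ (extAct (Q.dualAct ρ) ρ) (a ⊗ₜ (b ⊗ₜ c))
          (TensorProduct.assoc k _ _ _ (y ⊗ₜ χ)))) =
        ρ a (toHom y (ρ (Q.S b * Q.α * c) χ)) := by
      intro y
      induction y with
      | zero => simp
      | add s t hs ht => simp only [map_add, LinearMap.add_apply, TensorProduct.add_tmul, hs, ht]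
      | tmul m φ => simp [dualAct_apply]
    rw [e, hu]
    simp only [TensorProduct.map_tmul, LinearMap.comp_apply, LinearMap.id_apply,
      LinearEquiv.coe_coe, TensorProduct.comm_tmul, mulMap_tmul, LinearMap.mulLeft_apply,
      sandR_tmul, Q.S_mul, Rep.S_Sinv, map_mul, Module.End.mul_apply]
  exact key Q.X _ h (toHom_actElt ρ h)

/-- The antipode of the enveloping algebra braided group, for simple tensors in place of `Φ^{-1}`,
`R` and `Φ`. -/
theorem antipode_apply (a₁ a₂ a₃ b₁ b₂ c₁ c₂ c₃ h : H) :
    mulMap₃ (LinearMap.mulRight k (Q.S : Module.End k H) ∘ₗ lm k H)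
      (LinearMap.mulRight k (Q.sandR Q.qR) ∘ₗ rm k H) Q.adAct.toLinearMap
      (mulMap₃ (leg₁ k H) (leg₃ k H) (leg₂ k H) (c₁ ⊗ₜ (c₂ ⊗ₜ c₃)) *
        mulMap (leg₃ k H) (leg₁ k H) (b₁ ⊗ₜ b₂) *
        mulMap (leg₃ k H) (leg₁ k H)
          (TensorProduct.map LinearMap.id Q.IβS (a₁ ⊗ₜ (a₂ ⊗ₜ a₃)))) h =
      c₁ * b₂ * a₂ * Q.β *
        Q.S (Q.sandR Q.qR (Q.adAct (c₂ * b₁ * a₁) h) * (c₃ * a₃)) := by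
  simp only [TensorProduct.map_tmul, LinearMap.id_apply, IβS, mulMap_tmul, mulMap₃_tmul,
    leg₁_apply, leg₂_apply, leg₃_apply, Algebra.TensorProduct.tmul_mul_tmul, one_mul, mul_one,
    LinearMap.mulRight_apply, LinearMap.comp_apply, Module.End.mul_apply, Q.S_mul,
    AlgHom.toLinearMap_apply, lm, rm, LinearMap.mul_apply_apply, LinearMap.flip_apply]
  simp only [mul_assoc]

theorem toHom_antipode {D : Type*} [AddCommGroup D] [Module k D] (τ : H →ₐ[k] Module.End k D)
    (g : H →ₗ[k] D) (hg : IsHLinear Q.adAct τ g)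
    (L : D ⊗[k] Module.Dual k M →ₗ[k] Module.Dual k M)
    (hL : ∀ u χ, L (g u ⊗ₜ χ) = Q.dualAct ρ (Q.sandR Q.qR u) χ) (h : H)
    (w : M ⊗[k] Module.Dual k M) (hw : toHom w = ρ Q.β) :
    toHom (TensorProduct.map LinearMap.id L (Q.assocHom ρ τ (Q.dualAct ρ)
      (TensorProduct.map (Q.braiding τ ρ) LinearMap.id
        (Q.assocInv τ ρ (Q.dualAct ρ) (g h ⊗ₜ w))))) =
      ρ (Q.envelopingBraidedGroup.antipode h) := by
  have key : ∀ (t₁ t₃ : H ⊗[k] (H ⊗[k] H)) (t₂ : H ⊗[k] H),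
      toHom (TensorProduct.map LinearMap.id L (extAct ρ (extAct τ (Q.dualAct ρ)) t₃
          (TensorProduct.assoc k _ _ _ (TensorProduct.map
            ((TensorProduct.comm k _ _).toLinearMap ∘ₗ extAct τ ρ t₂) LinearMap.id
            ((TensorProduct.assoc k _ _ _).symm (extAct τ (extAct ρ (Q.dualAct ρ)) t₁
              (g h ⊗ₜ w))))))) =
      ρ (mulMap₃ (LinearMap.mulRight k (Q.S : Module.End k H) ∘ₗ lm k H)
        (LinearMap.mulRight k (Q.sandR Q.qR) ∘ₗ rm k H) Q.adAct.toLinearMap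
        (mulMap₃ (leg₁ k H) (leg₃ k H) (leg₂ k H) t₃ *
          mulMap (leg₃ k H) (leg₁ k H) t₂ *
          mulMap (leg₃ k H) (leg₁ k H) (TensorProduct.map LinearMap.id Q.IβS t₁)) h) := by
    intro t₁ t₃ t₂
    induction t₁ using TensorProduct.induction_on with
    | zero => simp
    | add s t hs ht => simp only [map_add, LinearMap.add_apply, mul_add, hs, ht]
    | tmul a₁ t₁ =>
    induction t₁ with
    | zero => simp
    | add s t hs ht => simp only [map_add, LinearMap.add_apply,
        TensorProduct.tmul_add, mul_add, hs, ht]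
    | tmul a₂ a₃ =>
    induction t₂ with
    | zero => simp
    | add s t hs ht => simp only [map_add, LinearMap.add_apply, LinearMap.comp_add,
        TensorProduct.map_add_left, mul_add, add_mul, hs, ht]
    | tmul b₁ b₂ =>
    induction t₃ using TensorProduct.induction_on with
    | zero => simp
    | add s t hs ht => simp only [map_add, LinearMap.add_apply, add_mul, hs, ht]
    | tmul c₁ t₃ =>
    induction t₃ with
    | zero => simp
    | add s t hs ht => simp only [map_add, LinearMap.add_apply, TensorProduct.tmul_add,
        add_mul, hs, ht]
    | tmul c₂ c₃ =>
    rw [antipode_apply]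
    set v := Q.sandR Q.qR (Q.adAct (c₂ * b₁ * a₁) h) with hv
    have e : ∀ w : M ⊗[k] Module.Dual k M, toHom (TensorProduct.map LinearMap.id L
        (extAct ρ (extAct τ (Q.dualAct ρ)) (c₁ ⊗ₜ (c₂ ⊗ₜ c₃))
          (TensorProduct.assoc k _ _ _ (TensorProduct.map
            ((TensorProduct.comm k _ _).toLinearMap ∘ₗ extAct τ ρ (b₁ ⊗ₜ b₂)) LinearMap.id
            ((TensorProduct.assoc k _ _ _).symm (extAct τ (extAct ρ (Q.dualAct ρ))
              (a₁ ⊗ₜ (a₂ ⊗ₜ a₃)) (g h ⊗ₜ w))))))) =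
        ρ (c₁ * b₂ * a₂) ∘ₗ toHom w ∘ₗ ρ (Q.S (v * (c₃ * a₃))) := by
      intro w
      induction w with
      | zero => simp
      | add s t hs ht => simp only [map_add, LinearMap.add_comp, LinearMap.comp_add,
          TensorProduct.tmul_add, hs, ht]
      | tmul m φ =>
        simp only [extAct_tmul, TensorProduct.assoc_symm_tmul, TensorProduct.map_tmul,
          LinearMap.comp_apply, LinearEquiv.coe_coe, TensorProduct.comm_tmul,
          TensorProduct.assoc_tmul, LinearMap.id_apply, ← hg _ h, ← hg _ (Q.adAct _ h),
          ← hg _ (Q.adAct _ (Q.adAct _ h)), hL]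
        have hv' : Q.sandR Q.qR (Q.adAct c₂ (Q.adAct b₁ (Q.adAct a₁ h))) = v := by
          rw [hv, map_mul, map_mul]
          rfl
        rw [hv']
        ext x
        simp [dualAct_apply, Q.S_mul]
    rw [e, hw, ← Module.End.mul_eq_comp, ← Module.End.mul_eq_comp, ← map_mul, ← map_mul]
    simp only [mul_assoc]
  exact key Q.x Q.X Q.R

/-- The antipode of the enveloping algebra braided group is the categorical map from the internal
endomorphisms of `M*` to those of `M`. -/
theorem actElt_antipode [FiniteDimensional k H] [FiniteDimensional k M] (h : H) :
    actElt ρ (Q.envelopingBraidedGroup.antipode h) =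
      TensorProduct.map LinearMap.id ((TensorProduct.rid k (Module.Dual k M)).toLinearMap ∘ₗ
        TensorProduct.map LinearMap.id (Q.ev (Q.dualAct ρ)) ∘ₗ
          Q.assocHom (Q.dualAct ρ) (Q.dualAct (Q.dualAct ρ)) (Q.dualAct ρ))
        (Q.assocHom ρ (Q.tensAct (Q.dualAct ρ) (Q.dualAct (Q.dualAct ρ))) (Q.dualAct ρ)
          (TensorProduct.map (Q.braiding (Q.tensAct (Q.dualAct ρ) (Q.dualAct (Q.dualAct ρ))) ρ)
            LinearMap.id
            (Q.assocInv (Q.tensAct (Q.dualAct ρ) (Q.dualAct (Q.dualAct ρ))) ρ (Q.dualAct ρ)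
              (actElt (Q.dualAct ρ) h ⊗ₜ Q.coev ρ 1)))) := by
  apply toHom_injective
  rw [toHom_actElt]
  exact (Q.toHom_antipode ρ _ (actElt (Q.dualAct ρ)) (Q.actElt_linear (Q.dualAct ρ)) _
    (fun u χ => Q.sandR_qR (Q.dualAct ρ) u χ) h _ (toHom_coev Q.toQuasiHopfAlgebra ρ)).symm

end QTQuasiHopfAlgebra

end

/-! ### The map λ on functionals on internal endomorphisms -/

noncomputable section

open CategoryTheory MonoidalCategory ExactPairing
open QuasiHopf QuasiHopfAlgebra BraidedReconstruction

universe r s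

namespace QuasiHopfAlgebra
variable {k H : Type*} [Field k] [Ring H] [Algebra k H] (Q : QuasiHopfAlgebra k H)
variable {M N : Type*} [AddCommGroup M] [Module k M] [AddCommGroup N] [Module k N]
  [FiniteDimensional k M] [FiniteDimensional k N]
variable (ρ : H →ₐ[k] Module.End k M) (σ : H →ₐ[k] Module.End k N)

/-- Coefficients of the dual module in terms of the elements `actElt ρ (S h)`; this is where `χ ∘ S`
in the formula for `λ` comes from. -/
theorem coeff_dual (y : Module.Dual k (Module.Dual k M) ⊗[k] Module.Dual k M) (h : H) :
    coeff (Q.dualAct ρ) y h = nest y (actElt ρ (Q.S h)) := by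
  induction y with
  | zero => simp
  | add s t hs ht => simp only [map_add, LinearMap.add_apply, hs, ht]
  | tmul φ χ =>
    have e : ∀ z : M ⊗[k] Module.Dual k M, nest (φ ⊗ₜ χ) z = φ
      (Module.Dual.transpose (toHom z) χ) := by
      intro z
      induction z with
      | zero => simp
      | add s t hs ht => simp only [map_add, LinearMap.add_apply, hs, ht]
      | tmul m ψ =>
        have : Module.Dual.transpose (toHom (m ⊗ₜ[k] ψ)) χ = χ m • ψ := by
          ext x; simp [Module.Dual.transpose_apply, mul_comm]
        rw [this, nest_tmul, map_smul, smul_eq_mul]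
    rw [e, toHom_actElt]
    rfl

omit [FiniteDimensional k M] [FiniteDimensional k N] in
theorem transpose_linear {ρ σ} {f : M →ₗ[k] N} (hf : IsHLinear ρ σ f) :
    IsHLinear (Q.dualAct σ) (Q.dualAct ρ) (Module.Dual.transpose (R := k) f) := by
  intro h φ
  refine LinearMap.ext fun m => ?_
  exact congrArg φ (hf (Q.S h) m).symm

theorem ε_S (h : H) : Q.ε (Q.S h) = Q.ε h := by
  have key : ∀ d : H ⊗[k] H,
      Q.ε (mulMap (LinearMap.mulRight k Q.α ∘ₗ Q.S) LinearMap.id d) =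
        Q.ε (Q.S (TensorProduct.rid k H (TensorProduct.map LinearMap.id Q.ε.toLinearMap d))) := by
    intro d
    induction d with
    | zero => simp
    | add s t hs ht => simp only [map_add, hs, ht]
    | tmul a b => simp [Q.counit_α, mul_comm]
  have h1 := key (Q.Δ h)
  rw [Q.antipode_left] at h1
  have h2 : TensorProduct.map LinearMap.id Q.ε.toLinearMap (Q.Δ h) = h ⊗ₜ[k] (1 : k) :=
    Q.counit_right h
  rw [h2] at h1
  simpa [Q.counit_α] using h1.symm

omit [FiniteDimensional k M] [FiniteDimensional k N] in
theorem phiStar_natural {M' N' : Type*} [AddCommGroup M'] [Module k M'] [AddCommGroup N']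
    [Module k N'] [FiniteDimensional k M] [FiniteDimensional k N] [FiniteDimensional k M']
    [FiniteDimensional k N'] {ρ : H →ₐ[k] Module.End k M} {σ : H →ₐ[k] Module.End k N}
    {ρ' : H →ₐ[k] Module.End k M'} {σ' : H →ₐ[k] Module.End k N'} {f : M →ₗ[k] M'}
    {g : N →ₗ[k] N'} (hf : IsHLinear ρ ρ' f) (hg : IsHLinear σ σ' g)
    (y : Module.Dual k N' ⊗[k] Module.Dual k M') :
    Q.phiStar ρ σ (TensorProduct.map (Module.Dual.transpose (R := k) g)
        (Module.Dual.transpose (R := k) f) y) =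
      Q.phiStar ρ' σ' y ∘ₗ TensorProduct.map f g := by
  refine LinearMap.ext fun z => ?_
  rw [phiStar_apply, LinearMap.comp_apply, phiStar_apply, ← extAct_natural _ _ _ _ hf hg]
  generalize extAct ρ σ Q.f z = w
  induction y with
  | zero => simp
  | add s t hs ht => simp only [map_add, LinearMap.add_apply, hs, ht]
  | tmul φ ψ =>
    induction w with
    | zero => simp
    | add s t hs ht => simp only [map_add, hs, ht]
    | tmul m n => simp [Module.Dual.transpose_apply]

end QuasiHopfAlgebra

namespace QTQuasiHopfAlgebra

/-- The element `g` in the formula for `λ` comes from the comparison of `(M ⊗ M*)*` with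
`M** ⊗ M*`. -/
theorem actElt_lam {k H : Type*} [Field k] [Ring H] [Algebra k H] [FiniteDimensional k H]
    (Q : QTQuasiHopfAlgebra k H) {M : Type*} [AddCommGroup M] [Module k M] [FiniteDimensional k M]
    (ρ : H →ₐ[k] Module.End k M) (h : H) :
    extAct ρ (Q.dualAct ρ) Q.g (actElt ρ (Q.S h)) =
      actElt ρ (Q.S (mulMap (rm k H ∘ₗ Q.Sinv) (lm k H) Q.g h)) := by
  rw [← actElt_sandR]
  congr 1
  generalize Q.g = t
  induction t with
  | zero => simp
  | add s t hs ht => simp only [map_add, LinearMap.add_apply, hs, ht]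
  | tmul a b => simp [rm, lm, Q.S_mul, mul_assoc]

variable {k : Type r} {H : Type s} [Field k] [Ring H] [Algebra k H] {Q : QTQuasiHopfAlgebra k H}

namespace Rep
variable [FiniteDimensional k H]

/-- Functionals on `A ⊗ A*` as elements of `H*`. -/
def lamHom (A : Q.Rep) : dual (A ⊗ A.dual) ⟶ fn Q :=
  bracket (A ⊗ A.dual) (dual (A ⊗ A.dual)) ((coaction Q).elt A A.dual)

variable (A B : Q.Rep)

/-- The transpose of `h ↦ ∑ᵢ h · aᵢ ⊗ aⁱ`. -/
def pull : dual (A ⊗ A.dual) →ₗ[k] Module.Dual k H :=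
  Module.Dual.transpose (R := k) (M' := A ⊗[k] Module.Dual k A) (actElt A.act)

/-- The map `λ` after the transpose of `actElt` is the categorical map that turns functionals on
`A ⊗ A*` into matrix coefficients of `A*`. -/
theorem lamHom_lin : (lamHom A).lin = Q.lam ∘ₗ pull A := by
  rw [lamHom, (coaction Q).bracket_elt_eq A A.dual A.dual.dual, coaction_ι]
  refine LinearMap.ext fun Ψ => LinearMap.ext fun h => ?_
  refine (Q.coeff_dual A.act _ h).trans ?_
  have h1 := LinearMap.congr_fun (psi_lin A A.dual Ψ) (actElt A.act (Q.S h))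
  exact h1.trans (congrArg (fun z : A ⊗[k] Module.Dual k A =>
    (show Module.Dual k (A ⊗[k] Module.Dual k A) from Ψ) z) (Q.actElt_lam A.act h))

omit [FiniteDimensional k H] in
theorem pull_linear : IsHLinear (dual (A ⊗ A.dual)).act (Q.dualAct Q.adAct) (pull A) :=
  Q.transpose_linear (Q.actElt_linear A.act)

omit [FiniteDimensional k H] in
variable {A} in
theorem pull_surjective (hA : Function.Injective A.act) : Function.Surjective (pull A) :=
  LinearMap.dualMap_surjective_of_injective (actElt_injective hA)

/-- The contraction `(A ⊗ A*) ⊗ (A ⊗ A*) → A ⊗ A*`, the categorical form of the composition of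
endomorphisms. -/
def innerMul : (A ⊗ A.dual) ⊗ (A ⊗ A.dual) ⟶ A ⊗ A.dual :=
  (α_ A A.dual (A ⊗ A.dual)).hom ≫ A ◁ (α_ A.dual A A.dual).inv ≫ A ◁ ε_ A A.dual ▷ A.dual ≫
    A ◁ (λ_ A.dual).hom

omit [FiniteDimensional k H] in
theorem innerMul_lin : (innerMul A).lin ∘ₗ TensorProduct.map (actElt A.act) (actElt A.act) =
    actElt A.act ∘ₗ Q.envelopingBraidedGroup.mul := by
  refine LinearMap.ext fun y => ?_
  refine Eq.trans ?_ (Q.actElt_mul A.act y).symm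
  have e : (ε_ A A.dual ▷ A.dual ≫ (λ_ A.dual).hom).lin =
      (TensorProduct.lid k _).toLinearMap ∘ₗ TensorProduct.map (Q.ev A.act) LinearMap.id := by
    refine TensorProduct.ext' fun y b => ?_
    rfl
  rw [innerMul, ← MonoidalCategory.whiskerLeft_comp]
  exact congrArg (fun L : (Module.Dual k A ⊗[k] A) ⊗[k] Module.Dual k A →ₗ[k] Module.Dual k A =>
    TensorProduct.map LinearMap.id L (TensorProduct.map LinearMap.id
      (Q.assocInv (Q.dualAct A.act) A.act (Q.dualAct A.act))
          (Q.assocHom A.act (Q.dualAct A.act) (Q.tensAct A.act (Q.dualAct A.act))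
            (TensorProduct.map (actElt A.act) (actElt A.act) y)))) e

theorem comulHom_lin :
    (NatCoaction.comulHom B B.dual A A.dual (dual (A ⊗ B))).lin ∘ₗ actElt (A ⊗ B).act =
      TensorProduct.map (actElt A.act) (actElt B.act) ∘ₗ Q.envelopingBraidedGroup.comul := by
  refine LinearMap.ext fun h => ?_
  refine Eq.trans ?_ (Q.map_actElt_comul A.act B.act h (TensorProduct.map LinearMap.id
    (mate (𝟙 (A ⊗ B)) (B.dual ⊗ A.dual) (dual (A ⊗ B))).lin (actElt (A ⊗ B).act h)) ?_).symm
  · rfl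
  · refine (map_map_apply _ _ _ _ _).trans ?_
    refine congrArg (fun L => TensorProduct.map LinearMap.id L (actElt (A ⊗ B).act h)) ?_
    exact LinearMap.ext fun ω => psi_lin A B ω

theorem antipodeHom_lin :
    (NatCoaction.antipodeHom A A.dual A.dual.dual).lin ∘ₗ actElt A.dual.act =
      actElt A.act ∘ₗ Q.envelopingBraidedGroup.antipode := by
  refine LinearMap.ext fun h => ?_
  refine Eq.trans ?_ (Q.actElt_antipode A.act h).symm
  rw [NatCoaction.antipodeHom]
  have e : ((α_ A.dual A.dual.dual A.dual).hom ≫ A.dual ◁ ε_ A.dual A.dual.dual ≫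
      (ρ_ A.dual).hom).lin = (TensorProduct.rid k (Module.Dual k A)).toLinearMap ∘ₗ
        TensorProduct.map LinearMap.id (Q.ev (Q.dualAct A.act)) ∘ₗ
          Q.assocHom (Q.dualAct A.act) (Q.dualAct (Q.dualAct A.act)) (Q.dualAct A.act) := by
    have e1 : (A.dual ◁ ε_ A.dual A.dual.dual ≫
      (ρ_ A.dual).hom).lin = (TensorProduct.rid k (Module.Dual k A)).toLinearMap ∘ₗ
        TensorProduct.map LinearMap.id (Q.ev (Q.dualAct A.act)) :=
      TensorProduct.ext' fun _ _ => rfl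
    exact congrArg (fun L : Module.Dual k A ⊗[k] (Module.Dual k (Module.Dual k A) ⊗[k]
      Module.Dual k A) →ₗ[k] Module.Dual k A => L ∘ₗ Q.assocHom (Q.dualAct A.act)
        (Q.dualAct (Q.dualAct A.act)) (Q.dualAct A.act)) e1
  exact congrArg (fun L : (Module.Dual k A ⊗[k] Module.Dual k (Module.Dual k A)) ⊗[k]
      Module.Dual k A →ₗ[k] Module.Dual k A => TensorProduct.map LinearMap.id L
        (Q.assocHom A.act (Q.tensAct (Q.dualAct A.act) (Q.dualAct (Q.dualAct A.act)))
          (Q.dualAct A.act) (TensorProduct.map (Q.braiding (Q.tensAct (Q.dualAct A.act)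
            (Q.dualAct (Q.dualAct A.act))) A.act) LinearMap.id
            (Q.assocInv (Q.tensAct (Q.dualAct A.act) (Q.dualAct (Q.dualAct A.act))) A.act
              (Q.dualAct A.act) (actElt (Q.dualAct A.act) h ⊗ₜ Q.coev A.act 1))))) e

variable (Q) in
theorem enveloping_mul_linear : IsHLinear (Q.tensAct Q.adAct Q.adAct) Q.adAct
    Q.envelopingBraidedGroup.mul := by
  refine isHLinear_of_injective (Q.actElt_linear (regular Q).act)
    (actElt_injective injective_regular) ?_
  rw [← innerMul_lin]
  exact isHLinear_comp (innerMul (regular Q)).linear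
    (IsHLinear.map _ (Q.actElt_linear _) (Q.actElt_linear _))

variable (Q) in
theorem enveloping_comul_linear : IsHLinear Q.adAct (Q.tensAct Q.adAct Q.adAct)
    Q.envelopingBraidedGroup.comul := by
  refine isHLinear_of_injective (IsHLinear.map _ (Q.actElt_linear (regular Q).act)
    (Q.actElt_linear (regular Q).act)) (TensorProduct.map_injective_of_flat_flat _ _
      (actElt_injective injective_regular) (actElt_injective injective_regular)) ?_
  rw [← comulHom_lin]
  exact isHLinear_comp (NatCoaction.comulHom (regular Q) (regular Q).dual (regular Q)
    (regular Q).dual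
    (dual (regular Q ⊗ regular Q)) : _ ⟶ _).linear (Q.actElt_linear _)

variable (Q) in
theorem enveloping_antipode_linear : IsHLinear Q.adAct Q.adAct
    Q.envelopingBraidedGroup.antipode := by
  refine isHLinear_of_injective (Q.actElt_linear (regular Q).act)
    (actElt_injective injective_regular) ?_
  rw [← antipodeHom_lin]
  exact isHLinear_comp (NatCoaction.antipodeHom (regular Q) (regular Q).dual (regular Q).dual.dual :
    _ ⟶ _).linear (Q.actElt_linear _)

omit [FiniteDimensional k H] in
variable (Q) in
theorem enveloping_one_linear : IsHLinear Q.unitAct Q.adAct Q.envelopingBraidedGroup.one := by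
  intro h c
  have e : ∀ d : H ⊗[k] H, Q.sandR d Q.β = mulMap (LinearMap.mulRight k Q.β) Q.S d := by
    intro d
    induction d with
    | zero => simp
    | add s t hs ht => simp only [map_add, LinearMap.add_apply, hs, ht]
    | tmul a b => simp
  have h2 : Q.adAct h Q.β = Q.ε h • Q.β := (e (Q.Δ h)).trans (Q.antipode_right h)
  change (Q.unitAct h c) • Q.β = Q.adAct h (c • Q.β)
  rw [map_smul, h2, unitAct_apply, smul_smul, mul_comm]

omit [FiniteDimensional k H] in
variable (Q) in
theorem enveloping_counit_linear :
    IsHLinear Q.adAct Q.unitAct Q.envelopingBraidedGroup.counit := by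
  intro h x
  have e : ∀ d : H ⊗[k] H, Q.ε (Q.sandR d x) =
      Q.ε (TensorProduct.rid k H (TensorProduct.map LinearMap.id Q.ε.toLinearMap d)) * Q.ε x := by
    intro d
    induction d with
    | zero => simp
    | add s t hs ht => simp only [map_add, LinearMap.add_apply, hs, ht, add_mul]
    | tmul a b => simp [ε_S]; ring
  have h2 : TensorProduct.map LinearMap.id Q.ε.toLinearMap (Q.Δ h) = h ⊗ₜ[k] (1 : k) :=
    Q.counit_right h
  rw [unitAct_apply]
  refine (e (Q.Δ h)).trans ?_
  rw [h2, TensorProduct.rid_tmul, one_smul]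
  rfl

theorem leftDual_mul (y : Module.Dual k H ⊗[k] Module.Dual k H) :
    (Q.leftDual Q.envelopingBraidedGroup).mul y =
      Q.phiStar Q.adAct Q.adAct y ∘ₗ Q.envelopingBraidedGroup.comul :=
  LinearMap.congr_fun (transpose_eq Q.toQuasiHopfAlgebra (enveloping_comul_linear Q)) _

/-- To compute the comultiplication of the left dual it is enough to solve for its image under `φ*`.
-/
theorem leftDual_comul_eq {y : Module.Dual k H ⊗[k] Module.Dual k H} {χ : Module.Dual k H}
    (h : Q.phiStar Q.adAct Q.adAct y = χ ∘ₗ Q.envelopingBraidedGroup.mul) :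
    (Q.leftDual Q.envelopingBraidedGroup).comul χ = y := by
  have h1 : linInv (Q.phiStar Q.adAct Q.adAct) (Q.phiStar Q.adAct Q.adAct y) = y := by
    rw [linInv, dif_pos (bijective_phiStar Q _ _)]
    exact LinearEquiv.symm_apply_apply (LinearEquiv.ofBijective _ (bijective_phiStar Q _ _)) y
  rw [← h1, h]
  exact congrArg _ (LinearMap.congr_fun (transpose_eq Q.toQuasiHopfAlgebra
    (enveloping_mul_linear Q)) χ)

theorem leftDual_one : (Q.leftDual Q.envelopingBraidedGroup).one =
    LinearMap.toSpanSingleton k (Module.Dual k H) Q.ε.toLinearMap := by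
  refine LinearMap.ext fun c => ?_
  refine (LinearMap.congr_fun (transpose_eq Q.toQuasiHopfAlgebra
    (enveloping_counit_linear Q)) _).trans ?_
  refine LinearMap.ext fun h => ?_
  exact mul_comm (Q.ε h) c

theorem leftDual_counit (χ : Module.Dual k H) :
    (Q.leftDual Q.envelopingBraidedGroup).counit χ = χ Q.β := by
  have h := LinearMap.congr_fun (transpose_eq Q.toQuasiHopfAlgebra (enveloping_one_linear Q)) χ
  refine (congrArg (LinearMap.ringLmapEquivSelf k k k) h).trans ?_
  exact congrArg χ (one_smul k Q.β)

theorem leftDual_antipode (χ : Module.Dual k H) :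
    (Q.leftDual Q.envelopingBraidedGroup).antipode χ = χ ∘ₗ Q.envelopingBraidedGroup.antipode :=
  LinearMap.congr_fun (transpose_eq Q.toQuasiHopfAlgebra (enveloping_antipode_linear Q)) χ

end Rep
end QTQuasiHopfAlgebra

end

/-! ### The map λ is an isomorphism -/

noncomputable section

open CategoryTheory MonoidalCategory ExactPairing
open QuasiHopf QuasiHopfAlgebra BraidedReconstruction

universe r s

namespace QTQuasiHopfAlgebra
variable {k : Type r} {H : Type s} [Field k] [Ring H] [Algebra k H] {Q : QTQuasiHopfAlgebra k H}

namespace Rep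
variable [FiniteDimensional k H]
variable (A B : Q.Rep)

theorem lam_pull (Ψ : dual (A ⊗ A.dual)) : Q.lam (pull A Ψ) = (lamHom A).lin Ψ :=
  (LinearMap.congr_fun (lamHom_lin A) Ψ).symm

/-- The multiplication of the left dual is the transpose of `comulHom`. -/
theorem leftDual_mul_pull (y : (dual (B ⊗ B.dual) ⊗ dual (A ⊗ A.dual) : Q.Rep)) :
    (Q.leftDual Q.envelopingBraidedGroup).mul (TensorProduct.map (pull B) (pull A) y) =
      pull (A ⊗ B) ((mate (NatCoaction.comulHom B B.dual A A.dual (dual (A ⊗ B)))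
        (dual ((A ⊗ B) ⊗ dual (A ⊗ B))) (dual (B ⊗ B.dual) ⊗ dual (A ⊗ A.dual))).lin y) := by
  rw [leftDual_mul]
  refine (congrArg (fun L => L ∘ₗ Q.envelopingBraidedGroup.comul)
    (Q.phiStar_natural (Q.actElt_linear A.act) (Q.actElt_linear B.act) y)).trans ?_
  have h1 : mate (NatCoaction.comulHom B B.dual A A.dual (dual (A ⊗ B)))
        (dual ((A ⊗ B) ⊗ dual (A ⊗ B))) (dual (B ⊗ B.dual) ⊗ dual (A ⊗ A.dual)) =
      mate (𝟙 ((A ⊗ A.dual) ⊗ (B ⊗ B.dual))) (dual ((A ⊗ A.dual) ⊗ (B ⊗ B.dual)))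
        (dual (B ⊗ B.dual) ⊗ dual (A ⊗ A.dual)) ≫
      mate (NatCoaction.comulHom B B.dual A A.dual (dual (A ⊗ B)))
        (dual ((A ⊗ B) ⊗ dual (A ⊗ B))) (dual ((A ⊗ A.dual) ⊗ (B ⊗ B.dual))) := by
    rw [mate_comp, Category.comp_id]
  rw [h1, comp_lin, phi_lin, mate_dual_lin]
  refine LinearMap.ext fun h => ?_
  exact congrArg (Q.phiStar (Q.tensAct A.act (Q.dualAct A.act))
    (Q.tensAct B.act (Q.dualAct B.act)) y) (LinearMap.congr_fun (comulHom_lin A B) h).symm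

theorem lam_mul : Q.lam ∘ₗ (Q.leftDual Q.envelopingBraidedGroup).mul =
    Q.functionBraidedGroup.mul ∘ₗ TensorProduct.map Q.lam Q.lam := by
  let P := regular Q
  have hs : Function.Surjective (TensorProduct.map (pull P) (pull P)) :=
    TensorProduct.map_surjective (pull_surjective injective_regular)
      (pull_surjective injective_regular)
  refine LinearMap.ext fun z => ?_
  obtain ⟨y, rfl⟩ := hs z
  rw [LinearMap.comp_apply, leftDual_mul_pull, lam_pull, LinearMap.comp_apply, map_map_apply,
    ← lamHom_lin]
  have h := (coaction_structure (Q := Q)).bracket_elt_mul P P.dual P.dual.dual P P.dual P.dual.dual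
    (dual (P ⊗ P.dual)) (dual (P ⊗ P.dual)) (dual (P ⊗ P)) (dual ((P ⊗ P) ⊗ dual (P ⊗ P)))
  refine (LinearMap.congr_fun (congrArg Hom.lin h) y).symm.trans ?_
  refine congrArg Q.functionBraidedGroup.mul ?_
  refine (map_map_apply _ _ _ _ _).trans ?_
  rfl

theorem lam_comul : TensorProduct.map Q.lam Q.lam ∘ₗ
      (Q.leftDual Q.envelopingBraidedGroup).comul = Q.functionBraidedGroup.comul ∘ₗ Q.lam := by
  let P := regular Q
  refine LinearMap.ext fun χ => ?_
  obtain ⟨Ψ, rfl⟩ := pull_surjective (A := P) injective_regular χ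
  have h := (coaction_structure (Q := Q)).bracket_elt_comul P P.dual P.dual.dual
    (dual (P ⊗ P.dual))
  have h1 : mate (innerMul P) (dual (P ⊗ P.dual) ⊗ dual (P ⊗ P.dual)) (dual (P ⊗ P.dual)) ≫
      mate (𝟙 ((P ⊗ P.dual) ⊗ (P ⊗ P.dual))) (dual ((P ⊗ P.dual) ⊗ (P ⊗ P.dual)))
        (dual (P ⊗ P.dual) ⊗ dual (P ⊗ P.dual)) =
      mate (innerMul P) (dual ((P ⊗ P.dual) ⊗ (P ⊗ P.dual))) (dual (P ⊗ P.dual)) := by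
    rw [mate_comp, Category.id_comp]
  set b := (mate (innerMul P) (dual (P ⊗ P.dual) ⊗ dual (P ⊗ P.dual)) (dual (P ⊗ P.dual))).lin Ψ
    with hb
  have h2 : (Q.leftDual Q.envelopingBraidedGroup).comul (pull P Ψ) =
      TensorProduct.map (pull P) (pull P) b := by
    refine leftDual_comul_eq ?_
    refine (Q.phiStar_natural (Q.actElt_linear P.act) (Q.actElt_linear P.act) b).trans ?_
    have h3 := LinearMap.congr_fun (congrArg Hom.lin h1) Ψ
    rw [comp_lin, phi_lin, mate_dual_lin] at h3
    refine LinearMap.ext fun z => ?_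
    refine (LinearMap.congr_fun h3 _).trans ?_
    exact congrArg (show Module.Dual k (P ⊗[k] Module.Dual k P) from Ψ)
      (LinearMap.congr_fun (innerMul_lin P) z)
  rw [LinearMap.comp_apply, h2, map_map_apply, LinearMap.comp_apply, lam_pull, ← lamHom_lin]
  refine Eq.trans ?_ (LinearMap.congr_fun (congrArg Hom.lin h) Ψ).symm
  refine Eq.trans ?_ (map_map_apply _ _ _ _ b).symm
  rfl

theorem lam_counit : Q.functionBraidedGroup.counit ∘ₗ Q.lam =
    (Q.leftDual Q.envelopingBraidedGroup).counit := by
  let P := regular Q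
  refine LinearMap.ext fun χ => ?_
  obtain ⟨Ψ, rfl⟩ := pull_surjective (A := P) injective_regular χ
  rw [leftDual_counit, LinearMap.comp_apply, lam_pull]
  have h := (coaction_structure (Q := Q)).bracket_elt_counit P P.dual P.dual.dual
    (dual (P ⊗ P.dual))
  refine (congrArg unitEquiv (LinearMap.congr_fun (congrArg Hom.lin h) Ψ)).trans ?_
  have h2 : Q.tensAct P.act (Q.dualAct P.act) Q.α (Q.coev P.act 1) = Q.coev P.act 1 := by
    rw [← Q.coev_linear, unitAct_apply, Q.counit_α, one_mul]
  exact congrArg (show Module.Dual k (P ⊗[k] Module.Dual k P) from Ψ) h2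

theorem lam_one : Q.lam ∘ₗ (Q.leftDual Q.envelopingBraidedGroup).one =
    Q.functionBraidedGroup.one := by
  -- `λ(ε)` is a multiple `c ε` of the counit, and `λ` respects counits, so `c = c ε(α) = ε(β) = 1`
  obtain ⟨c, hc⟩ : ∃ c : k, Q.lam Q.ε.toLinearMap = c • Q.ε.toLinearMap := by
    have key : ∀ t : H ⊗[k] H, ∃ c : k, Module.Dual.transpose (R := k)
        (Q.S ∘ₗ mulMap (rm k H ∘ₗ Q.Sinv) (lm k H) t) Q.ε.toLinearMap = c • Q.ε.toLinearMap := by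
      intro t
      induction t with
      | zero => exact ⟨0, by simp⟩
      | add s t hs ht =>
        obtain ⟨c, hc⟩ := hs
        obtain ⟨d, hd⟩ := ht
        refine ⟨c + d, ?_⟩
        rw [map_add, LinearMap.comp_add, map_add, LinearMap.add_apply, hc, hd, add_smul]
      | tmul a b =>
        refine ⟨Q.ε a * Q.ε b, LinearMap.ext fun h => ?_⟩
        simp [Module.Dual.transpose_apply, rm, lm, Q.S_mul, ε_S]
        ring
    exact key Q.g
  have h1 : Q.functionBraidedGroup.counit (Q.lam Q.ε.toLinearMap) = 1 := by
    rw [← LinearMap.comp_apply, lam_counit, leftDual_counit]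
    exact Q.counit_β
  have h2 : Q.functionBraidedGroup.counit (c • Q.ε.toLinearMap) = c := by
    rw [map_smul]
    refine (congrArg (c • ·) (Q.counit_α : Q.ε Q.α = 1)).trans ?_
    simp
  rw [hc, h2] at h1
  rw [leftDual_one]
  refine LinearMap.ext_ring ?_
  rw [LinearMap.comp_apply, LinearMap.toSpanSingleton_apply_one, hc, h1, one_smul]
  exact (LinearMap.toSpanSingleton_apply_one k _ _).symm

theorem lam_antipode : Q.lam ∘ₗ (Q.leftDual Q.envelopingBraidedGroup).antipode =
    Q.functionBraidedGroup.antipode ∘ₗ Q.lam := by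
  let P := regular Q
  refine LinearMap.ext fun χ => ?_
  obtain ⟨Ψ, rfl⟩ := pull_surjective (A := P) injective_regular χ
  have h := NatCoaction.bracket_elt_antipode P P.dual P.dual.dual antipodeHom
    (ι_antipodeHom P.dual) (dual (P ⊗ P.dual)) (dual (P.dual ⊗ P.dual.dual))
  have h2 : (Q.leftDual Q.envelopingBraidedGroup).antipode (pull P Ψ) =
      pull P.dual ((mate (NatCoaction.antipodeHom P P.dual P.dual.dual)
        (dual (P.dual ⊗ P.dual.dual)) (dual (P ⊗ P.dual))).lin Ψ) := by
    rw [leftDual_antipode, mate_dual_lin]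
    refine LinearMap.ext fun z => ?_
    exact congrArg (show Module.Dual k (P ⊗[k] Module.Dual k P) from Ψ)
      (LinearMap.congr_fun (antipodeHom_lin P) z).symm
  rw [LinearMap.comp_apply, h2, lam_pull, LinearMap.comp_apply, lam_pull]
  exact (LinearMap.congr_fun (congrArg Hom.lin h) Ψ).symm

theorem lam_linear : IsHLinear (Q.leftDual Q.envelopingBraidedGroup).act
    Q.functionBraidedGroup.act Q.lam := by
  refine isHLinear_of_surjective (pull_linear (regular Q)) (pull_surjective injective_regular) ?_
  rw [← lamHom_lin]
  exact (lamHom (regular Q)).linear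

/-- The coefficients of the faithful module `P*`, for the regular representation `P`, exhaust `H*`
and factor through `λ`. -/
theorem lam_bijective : Function.Bijective Q.lam := by
  suffices h : Function.Surjective Q.lam from
    ⟨LinearMap.injective_iff_surjective.2 h, h⟩
  let P := regular Q
  have h1 := (coaction Q).bracket_elt_eq P P.dual P.dual.dual (dual (P ⊗ P.dual))
  have h2 : mate (𝟙 (P ⊗ P.dual)) (dual (P ⊗ P.dual)) (P.dual.dual ⊗ P.dual) ≫ lamHom P =
      coeffHom P.dual := by
    rw [lamHom, h1, ← Category.assoc, mate_comp, Category.comp_id, coaction_ι]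
    have : mate (𝟙 (P ⊗ P.dual)) (P.dual.dual ⊗ P.dual) (P.dual.dual ⊗ P.dual) = 𝟙 _ := by
      symm; apply eq_mate; simp
    rw [this, Category.id_comp]
  have h3 : Function.Injective (P.dual).act := by
    intro a b hab
    apply (bijective_S Q).1
    apply injective_regular (Q := Q)
    refine LinearMap.ext fun m => ?_
    rw [← sub_eq_zero, ← Module.forall_dual_apply_eq_zero_iff k]
    intro φ
    rw [map_sub, sub_eq_zero]
    exact LinearMap.congr_fun (LinearMap.congr_fun hab φ) m
  intro χ
  obtain ⟨y, rfl⟩ := coeffHom_surjective h3 χ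
  refine ⟨pull P ((mate (𝟙 (P ⊗ P.dual)) (dual (P ⊗ P.dual)) (P.dual.dual ⊗ P.dual)).lin y), ?_⟩
  rw [lam_pull]
  exact LinearMap.congr_fun (congrArg Hom.lin h2) y

theorem lam_isIso :
    (Q.leftDual Q.envelopingBraidedGroup).IsIso Q.functionBraidedGroup Q.lam where
  bijective := lam_bijective
  linear := lam_linear
  map_mul := lam_mul
  map_one := lam_one
  map_comul := lam_comul
  map_counit := lam_counit
  map_antipode := lam_antipode

end Rep
end QTQuasiHopfAlgebra

end

/-! ### Transport along isomorphisms -/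

noncomputable section

open QuasiHopf QuasiHopfAlgebra

namespace QTQuasiHopfAlgebra
variable {k H : Type*} [Field k] [Ring H] [Algebra k H] (Q : QTQuasiHopfAlgebra k H)

theorem assocInv_natural {M N P M' N' P' : Type*} [AddCommGroup M] [Module k M]
    [AddCommGroup N] [Module k N] [AddCommGroup P] [Module k P]
    [AddCommGroup M'] [Module k M'] [AddCommGroup N'] [Module k N'] [AddCommGroup P']
    [Module k P']
    {ρ : H →ₐ[k] Module.End k M} {σ : H →ₐ[k] Module.End k N} {τ : H →ₐ[k] Module.End k P}
    {ρ' : H →ₐ[k] Module.End k M'} {σ' : H →ₐ[k] Module.End k N'} {τ' : H →ₐ[k] Module.End k P'}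
    {f : M →ₗ[k] M'} {g : N →ₗ[k] N'} {h : P →ₗ[k] P'} (hf : IsHLinear ρ ρ' f)
    (hg : IsHLinear σ σ' g) (hh : IsHLinear τ τ' h) (y : M ⊗[k] (N ⊗[k] P)) :
    TensorProduct.map (TensorProduct.map f g) h (Q.assocInv ρ σ τ y) =
      Q.assocInv ρ' σ' τ' (TensorProduct.map f (TensorProduct.map g h) y) := by
  have h1 := Rep.assocHom_natural (Q := Q) hf hg hh (Q.assocInv ρ σ τ y)
  rw [assocHom_assocInv] at h1
  rw [h1, assocInv_assocHom]

/-- A commuting square tensored with a map on the left. -/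
theorem map_map_id {X Y X' Y' M M' : Type*} [AddCommGroup X] [Module k X] [AddCommGroup Y]
    [Module k Y] [AddCommGroup X'] [Module k X'] [AddCommGroup Y'] [Module k Y']
    [AddCommGroup M] [Module k M] [AddCommGroup M'] [Module k M'] (φ : M →ₗ[k] M')
    {f : X →ₗ[k] Y} {f' : X' →ₗ[k] Y'} {g : X →ₗ[k] X'} {g' : Y →ₗ[k] Y'}
    (h : ∀ x, g' (f x) = f' (g x)) (z : M ⊗[k] X) :
    TensorProduct.map φ g' (TensorProduct.map LinearMap.id f z) =
      TensorProduct.map LinearMap.id f' (TensorProduct.map φ g z) := by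
  rw [map_map_apply, map_map_apply, LinearMap.comp_id, LinearMap.id_comp]
  congr 2
  exact LinearMap.ext h

/-- A commuting square tensored with a map on the right. -/
theorem map_map_id_right {X Y X' Y' M M' : Type*} [AddCommGroup X] [Module k X] [AddCommGroup Y]
    [Module k Y] [AddCommGroup X'] [Module k X'] [AddCommGroup Y'] [Module k Y']
    [AddCommGroup M] [Module k M] [AddCommGroup M'] [Module k M'] (φ : M →ₗ[k] M')
    {f : X →ₗ[k] Y} {f' : X' →ₗ[k] Y'} {g : X →ₗ[k] X'} {g' : Y →ₗ[k] Y'}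
    (h : ∀ x, g' (f x) = f' (g x)) (z : X ⊗[k] M) :
    TensorProduct.map g' φ (TensorProduct.map f LinearMap.id z) =
      TensorProduct.map f' LinearMap.id (TensorProduct.map g φ z) := by
  rw [map_map_apply, map_map_apply, LinearMap.comp_id, LinearMap.id_comp]
  congr 2
  exact LinearMap.ext h

variable {B C : Type*} [AddCommGroup B] [Module k B] [AddCommGroup C] [Module k C]
  {D : BraidedHopfData k H B} {E : BraidedHopfData k H C} {φ : B →ₗ[k] C}

/-- The axioms of a braided Hopf algebra are transported backwards along isomorphisms. -/
theorem IsBraidedHopf.of_isIso (hφ : D.IsIso E φ) (hE : Q.IsBraidedHopf E) : Q.IsBraidedHopf D := by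
  have hi := hφ.bijective.1
  have hl := hφ.linear
  have i2 : Function.Injective (TensorProduct.map φ φ) :=
    TensorProduct.map_injective_of_flat_flat _ _ hi hi
  have i3 : Function.Injective (TensorProduct.map φ (TensorProduct.map φ φ)) :=
    TensorProduct.map_injective_of_flat_flat _ _ hi i2
  have i1 : Function.Injective (TensorProduct.map (LinearMap.id : k →ₗ[k] k) φ) :=
    TensorProduct.map_injective_of_flat_flat _ _ Function.injective_id hi
  have i1' : Function.Injective (TensorProduct.map φ (LinearMap.id : k →ₗ[k] k)) :=
    TensorProduct.map_injective_of_flat_flat _ _ hi Function.injective_id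
  have hm : ∀ y, φ (D.mul y) = E.mul (TensorProduct.map φ φ y) := LinearMap.congr_fun hφ.map_mul
  have ho : ∀ c, φ (D.one c) = E.one c := LinearMap.congr_fun hφ.map_one
  have hc : ∀ b, TensorProduct.map φ φ (D.comul b) = E.comul (φ b) :=
    LinearMap.congr_fun hφ.map_comul
  have he : ∀ b, E.counit (φ b) = D.counit b := LinearMap.congr_fun hφ.map_counit
  have ha : ∀ b, φ (D.antipode b) = E.antipode (φ b) := LinearMap.congr_fun hφ.map_antipode
  have l2 : IsHLinear (Q.tensAct D.act D.act) (Q.tensAct E.act E.act) (TensorProduct.map φ φ) :=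
    IsHLinear.map _ hl hl
  have mm : ∀ y, TensorProduct.map φ φ (TensorProduct.map D.mul D.mul y) =
      TensorProduct.map E.mul E.mul (TensorProduct.map (TensorProduct.map φ φ)
        (TensorProduct.map φ φ) y) := by
    intro y; rw [map_map_apply, map_map_apply, hφ.map_mul]
  have hmt : ∀ y, TensorProduct.map φ φ (Q.mulTens D y) = Q.mulTens E
      (TensorProduct.map (TensorProduct.map φ φ) (TensorProduct.map φ φ) y) := by
    intro y
    simp only [mulTens, LinearMap.comp_apply]
    rw [mm, Q.assocInv_natural hl hl l2,
      map_map_id φ (Rep.assocHom_natural hl hl hl),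
      map_map_id φ (map_map_id_right φ (braiding_natural Q hl hl)),
      map_map_id φ (Q.assocInv_natural hl hl hl),
      Rep.assocHom_natural hl hl l2]
  constructor
  · intro h m
    apply hi
    rw [hm, l2, hE.mul_linear, ← hm, hl]
  · intro h m
    apply hi
    rw [ho, hE.one_linear, hl, ho]
  · intro h m
    apply i2
    rw [hc, hl, hE.comul_linear, ← hc, l2]
  · intro h m
    rw [← he, hl, hE.counit_linear, he]
  · intro h m
    apply hi
    rw [ha, hl, hE.antipode_linear, ← ha, hl]
  · refine LinearMap.ext fun y => hi ?_
    simp only [LinearMap.comp_apply]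
    rw [hm, hm, map_map_id_right φ hm, map_map_id φ hm, Rep.assocHom_natural hl hl hl]
    exact LinearMap.congr_fun hE.mul_assoc _
  · intro b
    apply hi
    rw [hm, TensorProduct.map_tmul, ho, hE.one_mul]
  · intro b
    apply hi
    rw [hm, TensorProduct.map_tmul, ho, hE.mul_one]
  · refine LinearMap.ext fun y => i3 ?_
    simp only [LinearMap.comp_apply]
    rw [Rep.assocHom_natural hl hl hl, map_map_id_right φ hc, map_map_id φ hc, hc]
    exact LinearMap.congr_fun hE.comul_coassoc _
  · intro b
    apply i1
    rw [map_map_id_right (g := φ) (g' := LinearMap.id) φ (fun b => (he b).symm), hc,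
      hE.counit_comul]
    rfl
  · intro b
    apply i1'
    rw [map_map_id (g := φ) (g' := LinearMap.id) φ (fun b => (he b).symm), hc, hE.comul_counit]
    rfl
  · refine LinearMap.ext fun y => i2 ?_
    rw [LinearMap.comp_apply, hc, hm, LinearMap.comp_apply, hmt, map_map_apply, hφ.map_comul,
      ← map_map_apply]
    exact LinearMap.congr_fun hE.comul_mul _
  · apply i2
    rw [hc, ho, hE.comul_one, TensorProduct.map_tmul, ho]
  · intro b c
    rw [← he, hm, TensorProduct.map_tmul, hE.counit_mul, he, he]
  · rw [← he, ho, hE.counit_one]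
  · refine LinearMap.ext fun b => hi ?_
    simp only [LinearMap.comp_apply]
    rw [hm, map_map_apply, hφ.map_antipode, LinearMap.comp_id, ho, ← he, ← LinearMap.id_comp φ,
      ← map_map_apply, LinearMap.id_comp, hc]
    exact LinearMap.congr_fun hE.antipode_left (φ b)
  · refine LinearMap.ext fun b => hi ?_
    simp only [LinearMap.comp_apply]
    rw [hm, map_map_apply, hφ.map_antipode, LinearMap.comp_id, ho, ← he, ← LinearMap.id_comp φ,
      ← map_map_apply, LinearMap.id_comp, hc]
    exact LinearMap.congr_fun hE.antipode_right (φ b)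

end QTQuasiHopfAlgebra

end

theorem mainTheorem7 {k H : Type*} [Field k] [Ring H] [Algebra k H] [FiniteDimensional k H]
    (Q : QTQuasiHopfAlgebra k H) :
    -- the inverses that enter the definitions exist
    Function.Bijective Q.S ∧ IsUnit Q.R ∧ Q.f * Q.g = 1 ∧ Q.g * Q.f = 1 ∧
    Function.Bijective
      (Q.phiStar Q.envelopingBraidedGroup.act Q.envelopingBraidedGroup.act) ∧
    -- both objects are Hopf algebras in the braided category of left `H`-modules
    Q.IsBraidedHopf (Q.leftDual Q.envelopingBraidedGroup) ∧
    Q.IsBraidedHopf Q.functionBraidedGroup ∧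
    -- `λ` is an isomorphism between them
    (Q.leftDual Q.envelopingBraidedGroup).IsIso Q.functionBraidedGroup Q.lam :=
  ⟨QTQuasiHopfAlgebra.Rep.bijective_S Q, QTQuasiHopfAlgebra.Rep.isUnit_R Q,
    QTQuasiHopfAlgebra.Rep.f_mul_g Q, QTQuasiHopfAlgebra.Rep.g_mul_f Q,
    QTQuasiHopfAlgebra.Rep.bijective_phiStar Q _ _,
    QTQuasiHopfAlgebra.IsBraidedHopf.of_isIso Q QTQuasiHopfAlgebra.Rep.lam_isIso
      QTQuasiHopfAlgebra.Rep.isBraidedHopf_functionBraidedGroup,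
    QTQuasiHopfAlgebra.Rep.isBraidedHopf_functionBraidedGroup, QTQuasiHopfAlgebra.Rep.lam_isIso⟩
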